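/- **Setting.** Units $c=1$, metric $g=\mathrm{diag}(-1,1,1,1)$, a fixed inertial frame, $t_1<t_2$. There are $N$ point particles with real masses $m_n$, charges $q_n$ and trajectories $\mathbf z_n(t)$, $t_1\le t\le t_2$, with $\mathbf v_n=\dot{\mathbf z}_n$, $\gamma_n=(1-\mathbf v_n^2)^{-1/2}$, $u_n^\mu=\gamma_n(1,\mathbf v_n)$. The field of a potential $A^\mu(\mathbf x,t)$ is $F^{\mu\nu}=\partial^\mu A^\nu-\partial^\nu A^\mu$, with $E_i=F^{0i}$ and $\mathbf B=\nabla\wedge\mathbf A$. If $f(r)=a/r+b+O(r)$ as $r\to0^+$, put $\mathcal R\lim_{r\to0}f(r)=b$. For a function $G$ on $\mathbb R^3$ with singular points $\mathbf z_1,\dots,\mathbf z_N$ put $\mathcal R\!\int d^3\mathbf x\,G=\mathcal R\lim_{r\to0}\int_{|\mathbf x-\mathbf z_n|>r\ \forall n}d^3\mathbf x\,G$. For a quantity $X$ (a component of $A$ or of $F$) let $$\widetilde X(z_n)=\mathcal R\lim_{r\to0}\int_{|\mathbf x|=r}\frac{d\Omega_{\mathbf x}}{4\pi}X(\mathbf z_n+\mathbf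 x,t).$$ The Lagrangian is $L=L_{\rm em}+L_{\rm part}+L_{\rm int}$ with $$L_{\rm em}=-\tfrac14\,\mathcal R\!\int d^3\mathbf x\,F_{\mu\nu}F^{\mu\nu},\qquad L_{\rm part}=-\sum_n\frac{m_n}{\gamma_n},\qquad L_{\rm int}=\sum_n\frac{q_n}{\gamma_n}u_n^\nu\widetilde A_\nu(z_n),$$ and the action is $I=\int_{t_1}^{t_2}L\,dt$. **Definition domain of $I$.** It consists of the configurations $\{\mathbf z_n,A^\mu\}$ on $t_1\le t\le t_2$ such that: the $\mathbf z_n$ are smooth, pairwise distinct at each time, and $|\mathbf v_n|<1$; $A^\mu$ is smooth outside the world-lines; near each particle $A^\mu$ behaves like the potential of a point charge, i.e. for $|\boldsymbol\omega|=1$ and small $\rho>0$, uniformly in $t$, $$A^\mu(\mathbf z_n(t)+\rho\boldsymbol\omega,t)=\rho^{-1}h_n^\mu(t,\rho,\boldsymbol\omega)+s_n^\mu(t,\rho\boldsymbol\omega),\qquad h_n^\mu(t,-\rho,-\boldsymbol\omega)=h_n^\mu(t,\rho,\boldsymbol\omega),$$ with $s_n^\mu$ smooth and $h_n^\mu$ smooth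 also across $\rho=0$ (so the singular part has an expansion in homogeneous terms of degree $j\ge-1$ and parity $(-1)^{j+1}$, like half the sum of the advanced and retarded potentials); $F^{\mu\nu}=O(|\mathbf x|^{-2})$ at infinity, uniformly in $t$; for $t_1<t<t_2$ the $\mathcal R$-integral and the $\mathcal R$-limits of the averages of $A^\nu$ exist; and $L$ is integrable over $(t_1,t_2)$. **Admissible variations** of $\{\mathbf z_n,A^\mu\}$ are families $\{\mathbf z_n^\varepsilon,A_\varepsilon^\mu\}$, $|\varepsilon|<\eta$, of configurations in this domain, equal to $\{\mathbf z_n,A^\mu\}$ at $\varepsilon=0$, coinciding with it at $t=t_1$ and $t=t_2$ for every $\varepsilon$, depending smoothly on $\varepsilon$ (trajectories, potential outside the world-lines, and $h_n,s_n$ are jointly smooth in $\varepsilon$ and the other variables), and with $\partial_\varepsilon\partial_\mu A_\varepsilon^\nu=O(|\mathbf x|^{-2})$ at infinity, uniformly in $\varepsilon$ and $t$. The condition $\delta I=0$ means that for every such family $\varepsilon\mapsto I[\mathbf z^\varepsilon,A_\varepsilon]$ is differentiable at $\varepsilon=0$ with derivative $0$. **Theorem 3.** Let $\{\mathbf z_n,A^\mu\}$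 be in the definition domain of $I$. Then $\delta I=0$ for all admissible variations if and only if the equations of motion hold for $t_1<t<t_2$, namely the Maxwell equations, in the sense of distributions, $$\frac{\partial\mathbf B}{\partial t}+\nabla\wedge\mathbf E=0,\qquad \frac{\partial\mathbf E}{\partial t}-\nabla\wedge\mathbf B=-\sum_nq_n\mathbf v_n\,\delta(\mathbf x-\mathbf z_n),\qquad \nabla\cdot\mathbf E=\sum_nq_n\,\delta(\mathbf x-\mathbf z_n),\qquad \nabla\cdot\mathbf B=0,$$ and the Lorentz–Dirac equation, for every $n$ and $\mu$, $$m_n\gamma_n\frac{du_n^\mu}{dt}=q_n\,u_{n,\nu}\,\widetilde F^{\mu\nu}(z_n),$$ where the $\mathcal R$-limits defining $\widetilde F^{\mu\nu}(z_n)$ exist. -/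

import Mathlib

open scoped ContDiff Topology

namespace PointCharges

noncomputable section

/-! ### The renormalized limit and integral -/

/-- `f(r) = a/r + b + O(r)` as `r → 0⁺`; then `b` is the renormalized limit of `f`. -/
def HasRLim (f : ℝ → ℝ) (b : ℝ) : Prop :=
  ∃ a : ℝ, (fun r => f r - (a / r + b)) =O[𝓝[>] (0 : ℝ)] (fun r => r)

theorem HasRLim.unique {f : ℝ → ℝ} {b b' : ℝ} (h : HasRLim f b) (h' : HasRLim f b') :
    b = b' := by
  obtain ⟨a, ha⟩ := h
  obtain ⟨a', ha'⟩ := h'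
  have hid : Filter.Tendsto (fun r : ℝ => r) (𝓝[>] (0 : ℝ)) (𝓝 0) :=
    Filter.tendsto_id.mono_left nhdsWithin_le_nhds
  have hsub : Filter.Tendsto (fun r : ℝ => (f r - (a' / r + b')) - (f r - (a / r + b)))
      (𝓝[>] (0 : ℝ)) (𝓝 0) := (ha'.sub ha).trans_tendsto hid
  have hmul : Filter.Tendsto
      (fun r : ℝ => r * ((f r - (a' / r + b')) - (f r - (a / r + b))) - r * (b - b'))
      (𝓝[>] (0 : ℝ)) (𝓝 (0 * 0 - 0 * (b - b'))) :=
    (hid.mul hsub).sub (hid.mul_const _)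
  have hpos : ∀ᶠ r : ℝ in 𝓝[>] (0 : ℝ), 0 < r := self_mem_nhdsWithin
  have haa : a - a' = 0 := by
    refine tendsto_nhds_unique (tendsto_const_nhds (f := 𝓝[>] (0 : ℝ)) (x := a - a')) ?_
    refine Filter.Tendsto.congr' ?_ (by simpa using hmul)
    filter_upwards [hpos] with r hr
    field_simp
    ring
  have hbb : b - b' = 0 := by
    refine tendsto_nhds_unique (tendsto_const_nhds (f := 𝓝[>] (0 : ℝ)) (x := b - b')) ?_
    refine Filter.Tendsto.congr' ?_ hsub
    have : a = a' := by linarith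
    subst this
    filter_upwards with r
    ring
  linarith

open Classical in
/-- The renormalized limit `ℛlim_{r → 0} f(r)` (`0` if it does not exist). -/
def rLim (f : ℝ → ℝ) : ℝ :=
  if h : ∃ b, HasRLim f b then h.choose else 0

/-- Three-dimensional Euclidean space. -/
abbrev Space : Type := EuclideanSpace ℝ (Fin 3)

/-- Space-time in a fixed inertial frame, `c = 1`; a point is `(t, x)`. -/
abbrev Spacetime : Type := ℝ × Space

/-- Space with the balls of radius `r` around the points `w n` removed. -/
def cutoffRegion {N : ℕ} (w : Fin N → Space) (r : ℝ) : Set Space :=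
  {x | ∀ n, r < ‖x - w n‖}

/-- The renormalized integral of `G`, with singular points `w n`, over the whole space is properly
defined. -/
def RIntegrable {N : ℕ} (w : Fin N → Space) (G : Space → ℝ) : Prop :=
  (∀ᶠ r in 𝓝[>] (0 : ℝ), MeasureTheory.IntegrableOn G (cutoffRegion w r)) ∧
    ∃ b, HasRLim (fun r => ∫ x in cutoffRegion w r, G x) b

/-- The renormalized integral of `G`, with singular points `w n`, over the whole space. -/
def rIntegral {N : ℕ} (w : Fin N → Space) (G : Space → ℝ) : ℝ :=
  rLim (fun r => ∫ x in cutoffRegion w r, G x)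

/-- The average of `f` over the sphere with centre `c` and radius `r`. -/
def sphereAverage (f : Space → ℝ) (c : Space) (r : ℝ) : ℝ :=
  ⨍ θ : Metric.sphere (0 : Space) 1, f (c + r • (θ : Space))
    ∂(MeasureTheory.volume : MeasureTheory.Measure Space).toSphere

/-! ### Potentials and fields -/

/-- The diagonal of the metric `diag(-1, 1, 1, 1)`. -/
def metric : Fin 4 → ℝ := ![-1, 1, 1, 1]

/-- The coordinate directions of space-time; direction `0` is time. -/
def direction : Fin 4 → Spacetime :=
  Fin.cons (1, 0) (fun i => (0, EuclideanSpace.single i 1))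

/-- The partial derivative `∂_μ f`. -/
def partialD (μ : Fin 4) (f : Spacetime → ℝ) (p : Spacetime) : ℝ :=
  fderiv ℝ f p (direction μ)

/-- The field `F^{μν} = ∂^μ A^ν - ∂^ν A^μ` of the potential `A^μ` (upper indices). -/
def field (A : Spacetime → Fin 4 → ℝ) (μ ν : Fin 4) (p : Spacetime) : ℝ :=
  metric μ * partialD μ (fun x => A x ν) p - metric ν * partialD ν (fun x => A x μ) p

/-- `F_{μν} F^{μν}`. -/
def fieldSquare (A : Spacetime → Fin 4 → ℝ) (p : Spacetime) : ℝ :=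
  ∑ μ, ∑ ν, metric μ * metric ν * field A μ ν p ^ 2

/-- The electric field, `E_i = F^{0i}`. -/
def electric (A : Spacetime → Fin 4 → ℝ) (i : Fin 3) (p : Spacetime) : ℝ :=
  field A 0 i.succ p

/-- The magnetic field `B = curl A`, that is `B_1 = F^{23}` and cyclic permutations. -/
def magnetic (A : Spacetime → Fin 4 → ℝ) (i : Fin 3) (p : Spacetime) : ℝ :=
  field A (i + 1).succ (i + 2).succ p

/-! ### Kinematics -/

/-- `γ = (1 - v²)^{-1/2}` at time `t` for the trajectory `z`. -/
def gamma (z : ℝ → Space) (t : ℝ) : ℝ := 1 / √(1 - ‖deriv z t‖ ^ 2)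

/-- The four-velocity `u^μ = γ (1, v)`. -/
def fourVelocity (z : ℝ → Space) (t : ℝ) : Fin 4 → ℝ :=
  Fin.cons (gamma z t) (fun i => gamma z t * deriv z t i)

/-! ### The renormalized Lagrangian and the action -/

/-- The potential at the position of a particle, `Ã^ν(z)`. -/
def potentialAt (A : Spacetime → Fin 4 → ℝ) (z : ℝ → Space) (t : ℝ) (ν : Fin 4) : ℝ :=
  rLim (sphereAverage (fun x => A (t, x) ν) (z t))

/-- `L_em = -1/4 ℛ∫ F_{μν} F^{μν} d³x`. -/
def lagrangianEM {N : ℕ} (z : Fin N → ℝ → Space) (A : Spacetime → Fin 4 → ℝ) (t : ℝ) : ℝ :=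
  -(1 / 4) * rIntegral (fun n => z n t) (fun x => fieldSquare A (t, x))

/-- `L_part = -∑ m_n / γ_n`. -/
def lagrangianPart {N : ℕ} (m : Fin N → ℝ) (z : Fin N → ℝ → Space) (t : ℝ) : ℝ :=
  -∑ n, m n / gamma (z n) t

/-- `L_int = ∑ (q_n / γ_n) u_n^ν Ã_ν(z_n)`. -/
def lagrangianInt {N : ℕ} (q : Fin N → ℝ) (z : Fin N → ℝ → Space)
    (A : Spacetime → Fin 4 → ℝ) (t : ℝ) : ℝ :=
  ∑ n, q n / gamma (z n) t *
    ∑ ν, fourVelocity (z n) t ν * (metric ν * potentialAt A (z n) t ν)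

/-- The total Lagrangian. -/
def lagrangian {N : ℕ} (m q : Fin N → ℝ) (z : Fin N → ℝ → Space)
    (A : Spacetime → Fin 4 → ℝ) (t : ℝ) : ℝ :=
  lagrangianEM z A t + lagrangianPart m z t + lagrangianInt q z A t

/-- The action `∫_{t₁}^{t₂} L dt`. -/
def action {N : ℕ} (m q : Fin N → ℝ) (t₁ t₂ : ℝ) (z : Fin N → ℝ → Space)
    (A : Spacetime → Fin 4 → ℝ) : ℝ :=
  ∫ t in t₁..t₂, lagrangian m q z A t

/-! ### The definition domain of the action -/

/-- The points `z n p`, for parameters `p ∈ U`, are distinct and move smoothly; `A` is smooth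
outside of them, and near each of them it has the behaviour of the potential of a point charge:
`A(p, z n p + ρ θ) = h(p, ρ, θ) / ρ + s(p, ρ θ)` for `‖θ‖ = 1` and small `ρ > 0`, where `s` is
smooth, `h` is smooth up to and beyond `ρ = 0`, and `h(p, -ρ, -θ) = h(p, ρ, θ)`.
Thus the singular part has an asymptotic expansion `∑_{j ≥ -1} (A)_j(x)` in which `(A)_j` is
homogeneous of degree `j` in `x = ρ θ` and of parity `(-1)^(j+1)`, as half the sum of the advanced
and retarded Liénard-Wiechert potentials has.
The parameter is the time for a single configuration, and a pair `(ε, t)` for a family. -/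
structure PointSingular {N : ℕ} {P : Type} [NormedAddCommGroup P] [NormedSpace ℝ P]
    (U : Set P) (z : Fin N → P → Space) (A : P × Space → Fin 4 → ℝ) : Prop where
  smooth_trajectory : ∀ n, ContDiffOn ℝ ∞ (z n) U
  distinct : ∀ p ∈ U, Function.Injective (fun n => z n p)
  smooth_off : ContDiffOn ℝ ∞ A {x | x.1 ∈ U ∧ ∀ n, x.2 ≠ z n x.1}
  near : ∀ n, ∃ δ > 0, ∃ (h : P × ℝ × Space → Fin 4 → ℝ) (s : P × Space → Fin 4 → ℝ),
    ContDiffOn ℝ ∞ h (U ×ˢ (Set.Ioo (-δ) δ ×ˢ {0}ᶜ)) ∧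
    ContDiffOn ℝ ∞ s (U ×ˢ Metric.ball 0 δ) ∧
    (∀ p ∈ U, ∀ ρ ∈ Set.Ioo (-δ) δ, ∀ θ : Space, ‖θ‖ = 1 → h (p, -ρ, -θ) = h (p, ρ, θ)) ∧
    ∀ p ∈ U, ∀ ρ ∈ Set.Ioo 0 δ, ∀ θ : Space, ‖θ‖ = 1 →
      A (p, z n p + ρ • θ) = ρ⁻¹ • h (p, ρ, θ) + s (p, ρ • θ)

/-- The configurations on `[t₁, t₂]` on which the action is defined: trajectories slower than
light, potentials singular only at the particles, with the behaviour described above, fields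
vanishing like `|x|⁻²` at infinity, and a properly defined and integrable Lagrangian. -/
structure InDomain {N : ℕ} (m q : Fin N → ℝ) (t₁ t₂ : ℝ) (z : Fin N → ℝ → Space)
    (A : Spacetime → Fin 4 → ℝ) : Prop where
  singular : PointSingular (Set.Icc t₁ t₂) z A
  subluminal : ∀ n, ∀ t ∈ Set.Icc t₁ t₂, ‖derivWithin (z n) (Set.Icc t₁ t₂) t‖ < 1
  decay : ∃ C R : ℝ, 0 < R ∧ ∀ t ∈ Set.Ioo t₁ t₂, ∀ x : Space, R ≤ ‖x‖ →
    ∀ μ ν, |field A μ ν (t, x)| ≤ C / ‖x‖ ^ 2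
  rIntegrable : ∀ t ∈ Set.Ioo t₁ t₂,
    RIntegrable (fun n => z n t) (fun x => fieldSquare A (t, x))
  hasRLim : ∀ t ∈ Set.Ioo t₁ t₂, ∀ n ν,
    ∃ b, HasRLim (sphereAverage (fun x => A (t, x) ν) (z n t)) b
  integrable : IntervalIntegrable (lagrangian m q z A) MeasureTheory.volume t₁ t₂

/-! ### The equations of motion -/

/-- Test functions on the open slab `t₁ < t < t₂`. -/
structure IsTest (t₁ t₂ : ℝ) (φ : Spacetime → ℝ) : Prop where
  smooth : ContDiff ℝ ∞ φ
  compact : HasCompactSupport φ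
  support : tsupport φ ⊆ Set.Ioo t₁ t₂ ×ˢ Set.univ

/-- The distributional derivative `∂_μ f` applied to the test function `φ`. -/
def distD (μ : Fin 4) (f φ : Spacetime → ℝ) : ℝ := -∫ p, f p * partialD μ φ p

/-- The Maxwell equations with point sources, in the sense of distributions on `t₁ < t < t₂`. -/
structure Maxwell {N : ℕ} (q : Fin N → ℝ) (t₁ t₂ : ℝ) (z : Fin N → ℝ → Space)
    (A : Spacetime → Fin 4 → ℝ) : Prop where
  /-- `∂B/∂t + curl E = 0` -/
  faraday : ∀ φ, IsTest t₁ t₂ φ → ∀ i : Fin 3,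
    distD 0 (magnetic A i) φ + (distD (i + 1).succ (electric A (i + 2)) φ
      - distD (i + 2).succ (electric A (i + 1)) φ) = 0
  /-- `∂E/∂t - curl B = -∑ q_n v_n δ(x - z_n)` -/
  ampere : ∀ φ, IsTest t₁ t₂ φ → ∀ i : Fin 3,
    distD 0 (electric A i) φ - (distD (i + 1).succ (magnetic A (i + 2)) φ
      - distD (i + 2).succ (magnetic A (i + 1)) φ)
      = -∑ n, q n * ∫ t in t₁..t₂, deriv (z n) t i * φ (t, z n t)
  /-- `div E = ∑ q_n δ(x - z_n)` -/
  gauss : ∀ φ, IsTest t₁ t₂ φ →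
    ∑ i : Fin 3, distD i.succ (electric A i) φ = ∑ n, q n * ∫ t in t₁..t₂, φ (t, z n t)
  /-- `div B = 0` -/
  gauss_magnetic : ∀ φ, IsTest t₁ t₂ φ →
    ∑ i : Fin 3, distD i.succ (magnetic A i) φ = 0

/-- The Lorentz-Dirac equation `m_n γ_n du_n^μ/dt = q_n u_{n,ν} F̃^{μν}(z_n)`, where `F̃^{μν}(z_n)`
is the renormalized limit of the averages of `F^{μν}` over small spheres around `z_n`. -/
def LorentzDirac {N : ℕ} (m q : Fin N → ℝ) (t₁ t₂ : ℝ) (z : Fin N → ℝ → Space)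
    (A : Spacetime → Fin 4 → ℝ) : Prop :=
  ∀ n, ∀ t ∈ Set.Ioo t₁ t₂, ∃ Ft : Fin 4 → Fin 4 → ℝ,
    (∀ μ ν, HasRLim (sphereAverage (fun x => field A μ ν (t, x)) (z n t)) (Ft μ ν)) ∧
    ∀ μ, m n * gamma (z n) t * deriv (fun τ => fourVelocity (z n) τ μ) t
      = q n * ∑ ν, metric ν * fourVelocity (z n) t ν * Ft μ ν

/-- The equations of motion of particles and field in the time interval `t₁ < t < t₂`. -/
def EquationsOfMotion {N : ℕ} (m q : Fin N → ℝ) (t₁ t₂ : ℝ) (z : Fin N → ℝ → Space)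
    (A : Spacetime → Fin 4 → ℝ) : Prop :=
  Maxwell q t₁ t₂ z A ∧ LorentzDirac m q t₁ t₂ z A

/-! ### Hamilton's principle -/

/-- `ε ↦ (Z ε, B ε)` is an admissible variation of the configuration `(z, A)`: a smooth family of
configurations in the definition domain of the action, equal to `(z, A)` for `ε = 0`, with
variations that vanish at `t = t₁` and `t = t₂` and whose derivatives vanish like `|x|⁻²` at
infinity. -/
structure IsAdmissibleVariation {N : ℕ} (m q : Fin N → ℝ) (t₁ t₂ : ℝ) (z : Fin N → ℝ → Space)
    (A : Spacetime → Fin 4 → ℝ) (η : ℝ) (Z : ℝ → Fin N → ℝ → Space)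
    (B : ℝ → Spacetime → Fin 4 → ℝ) : Prop where
  pos : 0 < η
  trajectory_zero : Z 0 = z
  potential_zero : B 0 = A
  inDomain : ∀ ε ∈ Set.Ioo (-η) η, InDomain m q t₁ t₂ (Z ε) (B ε)
  smooth : PointSingular (Set.Ioo (-η) η ×ˢ Set.Icc t₁ t₂) (fun n p => Z p.1 n p.2)
    (fun x : (ℝ × ℝ) × Space => B x.1.1 (x.1.2, x.2))
  trajectory_endpoint : ∀ ε ∈ Set.Ioo (-η) η, ∀ t, t = t₁ ∨ t = t₂ → ∀ n, Z ε n t = z n t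
  potential_endpoint : ∀ ε ∈ Set.Ioo (-η) η, ∀ t, t = t₁ ∨ t = t₂ →
    ∀ x, (∀ n, x ≠ z n t) → B ε (t, x) = A (t, x)
  decay : ∃ C R : ℝ, 0 < R ∧ ∀ ε ∈ Set.Ioo (-η) η, ∀ t ∈ Set.Ioo t₁ t₂, ∀ x : Space, R ≤ ‖x‖ →
    ∀ μ ν, |deriv (fun e => partialD μ (fun p => B e p ν) (t, x)) ε| ≤ C / ‖x‖ ^ 2

/-- `δ ∫ L dt = 0` for all admissible variations. -/
def IsStationary {N : ℕ} (m q : Fin N → ℝ) (t₁ t₂ : ℝ) (z : Fin N → ℝ → Space)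
    (A : Spacetime → Fin 4 → ℝ) : Prop :=
  ∀ (η : ℝ) (Z : ℝ → Fin N → ℝ → Space) (B : ℝ → Spacetime → Fin 4 → ℝ),
    IsAdmissibleVariation m q t₁ t₂ z A η Z B →
      HasDerivAt (fun ε => action m q t₁ t₂ (Z ε) (B ε)) 0 0

end

end PointCharges

open scoped ContDiff Topology
namespace PointCharges
open MeasureTheory Set Filter
set_option linter.unusedSectionVars false

section

/-! ### One-variable estimates -/

/-! The proof rests on one normal form. Near a particle at `z p` every function that occurs is `r⁻ᵏ
Φ(p, r, w) + φ(p, r w)` at the point `z p + r w`, where `Φ` is smooth across `r = 0` and `Φ(p, -r,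
-w) = (-1)^(k+1) Φ(p, r, w)`; the parameter `p` is the pair `(ε, t)` of a family. A derivative in
any direction keeps this form and raises `k` by one (`IsExpansion.fderiv`), so `k = 1` for the
potential and `k = 2` for the field and for the variation `∂_ε A` at a fixed point of space.

Parity makes the renormalization work. A mean over a sphere receives from the singular part only a
multiple of `1/r` and an error `O(r)`, so the renormalized value at the particle is the regular part
`φ(p, 0)` (`IsExpansion.hasRLim_sphereAverage`). For the integral of the square of the field the
sharp balls are replaced by a smooth even cutoff whose profile annihilates functions that are
homogeneous of degree `-4` (`integral_profileDiff_homogeneous`). With this profile the renormalized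
integral is an ordinary limit, approached at the rate `O(r)`, and increments in `ε` converge at the
rate `O(r)` times the increment. Hence the renormalized electromagnetic action is differentiable in
`ε`, and its derivative is the limit of the derivatives of the cut off actions
(`SingularFunction.hasDerivAt_integral_limit`).

The cut off derivative consists of terms with the gradient of the cutoff and of the pairing of
`F^{μν}` with the derivatives of the cut off variation (`FamBase.sum_cutSqD`). In the pairing the
cut off variation is replaced by `filledVar`, where the holes are filled with the regular value
`varAt` of the variation at the particle. All differences live in balls of radius `r` and have the
form `K/r + b + O(r)`, and the sum of the `b` is zero (`Fam.sum_localLimit`). The cancellation uses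
the antisymmetry of the field and the symmetry in `a` and `b` of the integral of `∂_a χ ∂_b h` for
the profile `χ`, which is an integration by parts (`integral_profileSlope_exchange`). So the
electromagnetic variation is minus the renormalized limit of the pairing of the field with the
filled variation (`Fam.hasRLim_emVariation`).

If the Maxwell equations hold, they may be tested with the filled variation
(`Fam.weakMaxwell_extended`), and the pairing equals the charges times the integrals of `(1, v)^ν`
against `varAt`, for every small `r`. The particle Lagrangian varies by the same expression with the
opposite sign, plus the displacement times the defect in the spatial Lorentz-Dirac equation, plus a
total time derivative (`FamBase.eps_particleLagrangian`). Hence the first variation is the sum of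
the time integrals of displacement times defect (`Fam.hasDerivAt_action`). The time component of the
Lorentz-Dirac equation follows from the spatial ones, by the constraint on the four-velocity and the
antisymmetry of the field (`Fam.lorentzDirac_iff`). This proves that solutions are stationary.

Conversely, adding `ε` times a test function to one component of `A` gives the inhomogeneous Maxwell
equations (`IsStationary.weakMaxwell`). The homogeneous ones hold for every configuration, since a
singularity of order one leaves no boundary term at the world-lines (`Fam.faraday`,
`Fam.gauss_magnetic`). Once the Maxwell equations are known, the formula for the first variation
applies to a family that displaces one particle and carries the nearby potential along with it;
arbitrary displacements then force the defect to vanish (`IsStationary.integral_lorentzDefect`). -/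

theorem abs_second_difference_le {u u' u'' : ℝ → ℝ} {r C : ℝ} (hr : 0 ≤ r)
    (hu : ∀ x ∈ Icc (-r) r, HasDerivAt u (u' x) x)
    (hu' : ∀ x ∈ Icc (-r) r, HasDerivAt u' (u'' x) x)
    (hC : ∀ x ∈ Icc (-r) r, |u'' x| ≤ C) :
    |u r + u (-r) - 2 * u 0| ≤ 2 * C * r ^ 2 := by
  have h0 : (0 : ℝ) ∈ Icc (0 : ℝ) r := ⟨le_rfl, hr⟩
  have hrr : r ∈ Icc (0 : ℝ) r := ⟨hr, le_rfl⟩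
  have hneg : ∀ x ∈ Icc (0 : ℝ) r, -x ∈ Icc (-r) r := fun x hx => ⟨by linarith [hx.2], by
    linarith [hx.1]⟩
  have hpos : ∀ x ∈ Icc (0 : ℝ) r, x ∈ Icc (-r) r := fun x hx => ⟨by linarith [hx.1], hx.2⟩
  have hC0 : 0 ≤ C := (abs_nonneg _).trans (hC 0 (hpos 0 h0))
  have hd : ∀ x ∈ Icc (0 : ℝ) r, |u' x - u' (-x)| ≤ 2 * C * r := by
    intro x hx
    have := (convex_Icc (-r) r).norm_image_sub_le_of_norm_hasDerivWithin_le
      (fun y hy => (hu' y hy).hasDerivWithinAt) (fun y hy => by simpa using hC y hy)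
      (hneg x hx) (hpos x hx)
    simp only [Real.norm_eq_abs] at this
    refine this.trans ?_
    have : |x - -x| = 2 * x := by rw [abs_of_nonneg] <;> linarith [hx.1]
    rw [this]
    nlinarith [hx.2]
  have := (convex_Icc (0 : ℝ) r).norm_image_sub_le_of_norm_hasDerivWithin_le
    (f := fun x => u x + u (-x)) (f' := fun x => u' x - u' (-x)) (C := 2 * C * r)
    (fun y hy => by
      have h2 : HasDerivAt (fun x => u (-x)) (-u' (-y)) y := by
        simpa [Function.comp_def] using (hu (-y) (hneg y hy)).scomp y (hasDerivAt_neg y)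
      simpa [sub_eq_add_neg] using ((hu y (hpos y hy)).fun_add h2).hasDerivWithinAt)
    (fun y hy => by simpa using hd y hy) h0 hrr
  simp only [Real.norm_eq_abs, neg_zero, sub_zero, abs_of_nonneg hr] at this
  calc |u r + u (-r) - 2 * u 0| = |u r + u (-r) - (u 0 + u 0)| := by ring_nf
    _ ≤ _ := this
    _ = _ := by ring

/-- The derivative of `u x - u (-x) - 2 x u' 0` is a second difference of `u'`, so the quadratic
bound on second differences is integrated once more. The constant is not sharp. -/
theorem abs_odd_difference_le {u u' u'' u''' : ℝ → ℝ} {r C : ℝ} (hr : 0 ≤ r)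
    (hu : ∀ x ∈ Icc (-r) r, HasDerivAt u (u' x) x)
    (hu' : ∀ x ∈ Icc (-r) r, HasDerivAt u' (u'' x) x)
    (hu'' : ∀ x ∈ Icc (-r) r, HasDerivAt u'' (u''' x) x)
    (hC : ∀ x ∈ Icc (-r) r, |u''' x| ≤ C) :
    |u r - u (-r) - 2 * r * u' 0| ≤ 2 * C * r ^ 3 := by
  have h0 : (0 : ℝ) ∈ Icc (0 : ℝ) r := ⟨le_rfl, hr⟩
  have hrr : r ∈ Icc (0 : ℝ) r := ⟨hr, le_rfl⟩
  have hneg : ∀ x ∈ Icc (0 : ℝ) r, -x ∈ Icc (-r) r := fun x hx => ⟨by linarith [hx.2], by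
    linarith [hx.1]⟩
  have hpos : ∀ x ∈ Icc (0 : ℝ) r, x ∈ Icc (-r) r := fun x hx => ⟨by linarith [hx.1], hx.2⟩
  have hC0 : 0 ≤ C := (abs_nonneg _).trans (hC 0 (hpos 0 h0))
  have hd : ∀ x ∈ Icc (0 : ℝ) r, |u' x + u' (-x) - 2 * u' 0| ≤ 2 * C * r ^ 2 := by
    intro x hx
    have hs : Icc (-x) x ⊆ Icc (-r) r := Icc_subset_Icc (by linarith [hx.2]) hx.2
    refine (abs_second_difference_le hx.1 (fun y hy => hu' y (hs hy)) (fun y hy => hu'' y (hs hy))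
      (fun y hy => hC y (hs hy))).trans ?_
    have := pow_le_pow_left₀ hx.1 hx.2 2
    gcongr
  have := (convex_Icc (0 : ℝ) r).norm_image_sub_le_of_norm_hasDerivWithin_le
    (f := fun x => u x - u (-x) - 2 * x * u' 0) (f' := fun x => u' x + u' (-x) - 2 * u' 0)
    (C := 2 * C * r ^ 2)
    (fun y hy => by
      have h2 : HasDerivAt (fun x => u (-x)) (-u' (-y)) y := by
        simpa [Function.comp_def] using (hu (-y) (hneg y hy)).scomp y (hasDerivAt_neg y)
      have h3 : HasDerivAt (fun x => 2 * x * u' 0) (2 * u' 0) y := by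
        simpa using ((hasDerivAt_id y).const_mul 2).mul_const (u' 0)
      have := (((hu y (hpos y hy)).sub h2).sub h3).hasDerivWithinAt (s := Icc 0 r)
      rw [sub_neg_eq_add] at this
      exact this)
    (fun y hy => by simpa using hd y hy) h0 hrr
  simp only [Real.norm_eq_abs, neg_zero, sub_zero, mul_zero, zero_mul, sub_self,
    abs_of_nonneg hr] at this
  calc _ ≤ _ := this
    _ = _ := by ring

/-- Going down by factors of two costs `C r`, `C r / 2`, `C r / 4` and so on; the factor `2` is the
sum of the geometric series. -/
theorem dyadic_bound {f : ℝ → ℝ} {C r0 : ℝ}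
    (h : ∀ r r', 0 < r' → r / 2 ≤ r' → r' ≤ r → r < r0 → |f r' - f r| ≤ C * r) :
    ∀ r r', 0 < r' → r' ≤ r → r < r0 → |f r' - f r| ≤ 2 * C * r := by
  have key : ∀ n : ℕ, ∀ r r', 0 < r' → r / 2 ^ (n + 1) ≤ r' → r' ≤ r → r < r0 →
      |f r' - f r| ≤ 2 * C * r := by
    intro n
    induction n with
    | zero =>
      intro r r' h0 h1 h2 h3
      have hb := h r r' h0 (by simpa using h1) h2 h3
      linarith [abs_nonneg (f r' - f r)]
    | succ n ih =>
      intro r r' h0 h1 h2 h3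
      rcases le_total (r / 2) r' with h4 | h4
      · have hb := h r r' h0 h4 h2 h3
        linarith [abs_nonneg (f r' - f r)]
      · have hr : 0 < r := h0.trans_le h2
        have hb := h r (r / 2) (by positivity) le_rfl (by linarith) h3
        have hi := ih (r / 2) r' h0 (by
          rw [div_div, ← pow_succ']; exact h1) h4 (by linarith)
        have := abs_sub_le (f r') (f (r / 2)) (f r)
        linarith
  intro r r' h0 h2 h3
  obtain ⟨n, hn⟩ := exists_pow_lt_of_lt_one (show 0 < r' / r by
    exact div_pos h0 (h0.trans_le h2)) (show (1 / 2 : ℝ) < 1 by norm_num)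
  refine key n r r' h0 ?_ h2 h3
  have hr : 0 < r := h0.trans_le h2
  rw [lt_div_iff₀ hr] at hn
  have h5 : r / 2 ^ (n + 1) ≤ (1 / 2) ^ n * r := by
    rw [one_div, inv_pow, div_eq_inv_mul]
    gcongr
    · norm_num
    · omega
  exact h5.trans hn.le

theorem exists_limit_of_dyadic {f : ℝ → ℝ} {C r0 : ℝ} (hr0 : 0 < r0)
    (h : ∀ r r', 0 < r' → r' ≤ r → r < r0 → |f r' - f r| ≤ C * r) :
    ∃ b, ∀ r, 0 < r → r < r0 → |f r - b| ≤ C * r := by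
  have hC : 0 ≤ C := by
    have := (abs_nonneg _).trans (h (r0 / 2) (r0 / 2) (by positivity) le_rfl (by linarith))
    exact nonneg_of_mul_nonneg_left this (by positivity)
  have hcau : Cauchy (map f (𝓝[>] (0 : ℝ))) := by
    rw [Metric.cauchy_iff]
    refine ⟨inferInstance, fun e he => ?_⟩
    -- Two points below `s` are each within `e / 2` of the value at `s`. The `+ 1` only avoids a
    -- division by zero.
    set s := min (r0 / 2) (e / (4 * (C + 1))) with hs
    have hs0 : 0 < s := by positivity
    have hs1 : s < r0 := (min_le_left _ _).trans_lt (by linarith)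
    have hs2 : C * s < e / 2 := by
      have : s ≤ e / (4 * (C + 1)) := min_le_right _ _
      rw [le_div_iff₀ (by positivity)] at this
      nlinarith
    refine ⟨f '' Ioc 0 s, image_mem_map (Ioc_mem_nhdsGT hs0), ?_⟩
    rintro _ ⟨x, hx, rfl⟩ _ ⟨y, hy, rfl⟩
    rw [Real.dist_eq]
    have h1 := h s x hx.1 hx.2 hs1
    have h2 := h s y hy.1 hy.2 hs1
    have h3 := abs_sub_le (f x) (f s) (f y)
    rw [abs_sub_comm (f s)] at h3
    linarith
  obtain ⟨b, hb⟩ := CompleteSpace.complete hcau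
  refine ⟨b, fun r hr hr' => ?_⟩
  have ht : Tendsto (fun r' => |f r - f r'|) (𝓝[>] (0 : ℝ)) (𝓝 |f r - b|) :=
    (tendsto_const_nhds.sub hb).abs
  refine le_of_tendsto ht ?_
  filter_upwards [Ioc_mem_nhdsGT hr] with r' h'
  rw [abs_sub_comm]
  exact h r r' h'.1 h'.2 hr'

/-! ### Derivatives within a set -/

theorem _root_.ContDiffOn.hasDerivWithinAt_comp_curve {E : Type*} [NormedAddCommGroup E]
    [NormedSpace ℝ E] {S : Set E} {f : E → ℝ} (hf : ContDiffOn ℝ ∞ f S) {c : ℝ → E} {v : E}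
    {T : Set ℝ} {s : ℝ} (hc : HasDerivWithinAt c v T s) (hT : MapsTo c T S) (hs : c s ∈ S) :
    HasDerivWithinAt (fun τ => f (c τ)) (fderivWithin ℝ f S (c s) v) T s :=
  ((hf.differentiableOn (by simp)) _ hs).hasFDerivWithinAt.comp_hasDerivWithinAt s hc hT

theorem _root_.ContDiffOn.fderivWithin_apply_vec {E : Type*} [NormedAddCommGroup E]
    [NormedSpace ℝ E] {S : Set E} {f : E → ℝ} (hf : ContDiffOn ℝ ∞ f S) (hS : UniqueDiffOn ℝ S)
    {v : E → E} (hv : ContDiffOn ℝ ∞ v S) :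
    ContDiffOn ℝ ∞ (fun x => fderivWithin ℝ f S x (v x)) S :=
  (hf.fderivWithin hS (by simp)).clm_apply hv

/-! ### Expansions near a moving point -/

variable {P : Type} [NormedAddCommGroup P] [NormedSpace ℝ P]

/-- The pairs `(r, w)` of a scale and a direction with `r w` in the punctured ball of radius `δ`. -/
def scaleDomain (δ : ℝ) : Set (ℝ × Space) := {q | q.2 ≠ 0 ∧ |q.1| * ‖q.2‖ < δ}

theorem isOpen_scaleDomain (δ : ℝ) : IsOpen (scaleDomain δ) := by
  apply IsOpen.inter
  · exact isOpen_ne_fun continuous_snd continuous_const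
  · exact isOpen_lt (f := fun q : ℝ × Space => |q.1| * ‖q.2‖) (by fun_prop) continuous_const

theorem neg_mem_scaleDomain {δ : ℝ} {q : ℝ × Space} (h : q ∈ scaleDomain δ) :
    -q ∈ scaleDomain δ := by
  simpa [scaleDomain] using h

theorem smul_mem_ball_of_scaleDomain {δ : ℝ} {q : ℝ × Space} (h : q ∈ scaleDomain δ) :
    q.1 • q.2 ∈ Metric.ball (0 : Space) δ := by
  simpa [norm_smul] using h.2

theorem _root_.UniqueDiffOn.prod_isOpen {E F : Type*} [NormedAddCommGroup E] [NormedSpace ℝ E]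
    [NormedAddCommGroup F] [NormedSpace ℝ F] {U : Set E} {V : Set F} (hU : UniqueDiffOn ℝ U)
    (hV : IsOpen V) : UniqueDiffOn ℝ (U ×ˢ V) := hU.prod hV.uniqueDiffOn

/-- `f(p, z(p) + r w) = r⁻ᵏ Φ(p, r, w) + φ(p, r w)` near the moving point `z`, where `Φ` is smooth
up to and beyond `r = 0` and has the parity of the half-retarded half-advanced potential
(`k = 1`) and of its derivatives (`k > 1`). -/
structure IsExpansion (U : Set P) (z : P → Space) (δ : ℝ) (k : ℕ) (f : P × Space → ℝ)
    (Φ : P × (ℝ × Space) → ℝ) (φ : P × Space → ℝ) : Prop where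
  smooth_sing : ContDiffOn ℝ ∞ Φ (U ×ˢ scaleDomain δ)
  smooth_reg : ContDiffOn ℝ ∞ φ (U ×ˢ Metric.ball 0 δ)
  parity : ∀ p ∈ U, ∀ q ∈ scaleDomain δ, Φ (p, -q) = (-1) ^ (k + 1) * Φ (p, q)
  eq : ∀ p ∈ U, ∀ r w, 0 < r → (r, w) ∈ scaleDomain δ →
    f (p, z p + r • w) = (r ^ k)⁻¹ * Φ (p, r, w) + φ (p, r • w)

/-- Differentiation of the parity identity: the flip fixes `p` and reverses `(r, w)`, so a direction
in `p` is kept while a direction in `(r, w)` changes its sign. -/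
theorem fderivWithin_flip {U : Set P} (hU : UniqueDiffOn ℝ U) {δ : ℝ} {Φ : P × (ℝ × Space) → ℝ}
    (hΦ : ContDiffOn ℝ ∞ Φ (U ×ˢ scaleDomain δ)) {c : ℝ}
    (hpar : ∀ p ∈ U, ∀ q ∈ scaleDomain δ, Φ (p, -q) = c * Φ (p, q))
    {p : P} (hp : p ∈ U) {q : ℝ × Space} (hq : q ∈ scaleDomain δ) (v : P) (u : ℝ × Space) :
    fderivWithin ℝ Φ (U ×ˢ scaleDomain δ) (p, -q) (v, -u) =
      c * fderivWithin ℝ Φ (U ×ˢ scaleDomain δ) (p, q) (v, u) := by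
  set S := U ×ˢ scaleDomain δ with hS
  have hSu : UniqueDiffOn ℝ S := hU.prod_isOpen (isOpen_scaleDomain δ)
  let σ : P × (ℝ × Space) →L[ℝ] P × (ℝ × Space) :=
    (ContinuousLinearMap.fst ℝ P (ℝ × Space)).prod (-(ContinuousLinearMap.snd ℝ P (ℝ × Space)))
  have hσ : ∀ x, σ x = (x.1, -x.2) := fun x => rfl
  have hmap : MapsTo σ S S := fun x hx => ⟨hx.1, neg_mem_scaleDomain hx.2⟩
  have hx : (p, q) ∈ S := ⟨hp, hq⟩
  have hx' : σ (p, q) ∈ S := hmap hx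
  have h1 : HasFDerivWithinAt Φ (fderivWithin ℝ Φ S (σ (p, q))) S (σ (p, q)) :=
    ((hΦ.differentiableOn (by simp)) _ hx').hasFDerivWithinAt
  have h2 := h1.comp (p, q) σ.hasFDerivWithinAt hmap
  have h3 : HasFDerivWithinAt (fun x => c * Φ x) (c • fderivWithin ℝ Φ S (p, q)) S (p, q) :=
    ((hΦ.differentiableOn (by simp)) _ hx).hasFDerivWithinAt.const_mul c
  have h4 : HasFDerivWithinAt (Φ ∘ σ) (c • fderivWithin ℝ Φ S (p, q)) S (p, q) :=
    h3.congr (fun x hx => hpar x.1 hx.1 x.2 hx.2) (hpar p hp q hq)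
  have h5 := (hSu _ hx).eq h2 h4
  have := congrArg (fun L => L (v, u)) h5
  simpa [hσ] using this

/-- Near a given point `f(p, x) = r⁻ᵏ Φ(p, r, (x - z p)/r) + φ(p, x - z p)` with `r` frozen, because
the expansion is available at every small scale. The chain rule differentiates `w` with a factor
`r⁻¹`; taking that factor out of the whole direction multiplies its `P`-component by `r` and raises
the order by one. -/
theorem IsExpansion.fderiv {U : Set P} (hU : UniqueDiffOn ℝ U) {z : P → Space}
    (hz : ContDiffOn ℝ ∞ z U) {δ : ℝ} {k : ℕ} {f : P × Space → ℝ}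
    {Φ : P × (ℝ × Space) → ℝ} {φ : P × Space → ℝ} (h : IsExpansion U z δ k f Φ φ)
    {S : Set (P × Space)} (hSu : UniqueDiffOn ℝ S) (hSU : ∀ x ∈ S, x.1 ∈ U)
    (hS : ∀ p ∈ U, ∀ y : Space, y ≠ 0 → ‖y‖ < δ → (p, z p + y) ∈ S) (v : P × Space) :
    IsExpansion U z δ (k + 1) (fun x => fderivWithin ℝ f S x v)
      (fun x => fderivWithin ℝ Φ (U ×ˢ scaleDomain δ) x
        (x.2.1 • v.1, (0, v.2 - fderivWithin ℝ z U x.1 v.1)))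
      (fun x => fderivWithin ℝ φ (U ×ˢ Metric.ball 0 δ) x (v.1, v.2 - fderivWithin ℝ z U x.1 v.1))
    where
  smooth_sing := by
    refine h.smooth_sing.fderivWithin_apply_vec (hU.prod_isOpen (isOpen_scaleDomain δ)) ?_
    have hdz : ContDiffOn ℝ ∞ (fun x : P × (ℝ × Space) => fderivWithin ℝ z U x.1 v.1)
        (U ×ˢ scaleDomain δ) :=
      ((hz.fderivWithin hU (by simp)).comp contDiffOn_fst (fun x hx => hx.1)).clm_apply
        contDiffOn_const
    have h1 : ContDiffOn ℝ ∞ (fun x : P × (ℝ × Space) => x.2.1 • v.1) (U ×ˢ scaleDomain δ) := by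
      fun_prop
    exact h1.prodMk (contDiffOn_const.prodMk (contDiffOn_const.sub hdz))
  smooth_reg := by
    refine h.smooth_reg.fderivWithin_apply_vec (hU.prod_isOpen Metric.isOpen_ball) ?_
    have hdz : ContDiffOn ℝ ∞ (fun x : P × Space => fderivWithin ℝ z U x.1 v.1)
        (U ×ˢ Metric.ball 0 δ) :=
      ((hz.fderivWithin hU (by simp)).comp contDiffOn_fst (fun x hx => hx.1)).clm_apply
        contDiffOn_const
    exact contDiffOn_const.prodMk (contDiffOn_const.sub hdz)
  parity := by
    intro p hp q hq
    -- At `-q` the direction has `P`-component `-(q.1 • v.1)`, so the flip carries it to minus the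
    -- direction at `q`. This additional sign moves the parity exponent from `k + 1` to `k + 2`.
    have h1 := fderivWithin_flip hU h.smooth_sing h.parity hp hq (-(q.1 • v.1))
      (-(0, v.2 - fderivWithin ℝ z U p v.1))
    have h2 : ((-(q.1 • v.1) : P), -((0 : ℝ), v.2 - fderivWithin ℝ z U p v.1)) =
        -(((q.1 • v.1) : P), ((0 : ℝ), v.2 - fderivWithin ℝ z U p v.1)) := by simp
    have h3 : (-q).1 • v.1 = -(q.1 • v.1) := by simp
    rw [h2, map_neg, neg_neg] at h1
    simp only [h3]
    rw [h1]
    ring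
  eq := by
    intro p hp r w hr hq
    set D := U ×ˢ scaleDomain δ with hD
    set D' := U ×ˢ Metric.ball (0 : Space) δ with hD'
    have hrw : r • w ≠ 0 := smul_ne_zero hr.ne' hq.1
    have hnrw : ‖r • w‖ < δ := by simpa using smul_mem_ball_of_scaleDomain hq
    set x₀ : P × Space := (p, z p + r • w) with hx₀
    have hx₀S : x₀ ∈ S := hS p hp _ hrw hnrw
    set dz := fderivWithin ℝ z U p with hdz
    have hzd : HasFDerivWithinAt (fun x : P × Space => z x.1)
        (dz.comp (ContinuousLinearMap.fst ℝ P Space)) S x₀ :=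
      HasFDerivWithinAt.comp (t := U) x₀ (((hz.differentiableOn (by simp)) p hp).hasFDerivWithinAt)
        hasFDerivWithinAt_fst (fun x hx => hSU x hx)
    have hyd : HasFDerivWithinAt (fun x : P × Space => x.2 - z x.1)
        (ContinuousLinearMap.snd ℝ P Space - dz.comp (ContinuousLinearMap.fst ℝ P Space)) S x₀ :=
      hasFDerivWithinAt_snd.sub hzd
    have hy₀ : x₀.2 - z x₀.1 = r • w := by simp [hx₀]
    have hnear : ∀ᶠ x in 𝓝[S] x₀, x.2 - z x.1 ≠ 0 ∧ ‖x.2 - z x.1‖ < δ := by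
      have hc : Tendsto (fun x : P × Space => x.2 - z x.1) (𝓝[S] x₀) (𝓝 (r • w)) := by
        have := hyd.continuousWithinAt.tendsto
        rwa [hy₀] at this
      have ho : IsOpen {y : Space | y ≠ 0 ∧ ‖y‖ < δ} :=
        (isOpen_ne_fun continuous_id continuous_const).inter
          (isOpen_lt continuous_norm continuous_const)
      exact hc (ho.mem_nhds ⟨hrw, hnrw⟩)
    -- On `S'`, which is a neighbourhood of `x₀` within `S`, the expansion with this one value of
    -- `r` represents `f`.
    set S' := S ∩ {x | x.2 - z x.1 ≠ 0 ∧ ‖x.2 - z x.1‖ < δ} with hS'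
    have hS'n : 𝓝[S'] x₀ = 𝓝[S] x₀ :=
      le_antisymm (nhdsWithin_mono _ inter_subset_left)
        (nhdsWithin_le_of_mem (inter_mem self_mem_nhdsWithin hnear))
    have hx₀S' : x₀ ∈ S' := ⟨hx₀S, by rw [mem_ofPred_eq, hy₀]; exact ⟨hrw, hnrw⟩⟩
    have hwd : HasFDerivWithinAt (fun x : P × Space => r⁻¹ • (x.2 - z x.1))
        (r⁻¹ • (ContinuousLinearMap.snd ℝ P Space - dz.comp (ContinuousLinearMap.fst ℝ P Space)))
        S' x₀ := (hyd.mono inter_subset_left).const_smul r⁻¹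
    have hw₀ : r⁻¹ • (x₀.2 - z x₀.1) = w := by rw [hy₀, inv_smul_smul₀ hr.ne']
    have hscale : ∀ y : Space, y ≠ 0 → ‖y‖ < δ → (r, r⁻¹ • y) ∈ scaleDomain δ := by
      intro y hy hy'
      refine ⟨smul_ne_zero (inv_ne_zero hr.ne') hy, ?_⟩
      simp only [norm_smul, norm_inv, Real.norm_eq_abs]
      rw [← mul_assoc, mul_inv_cancel₀ (abs_pos.2 hr.ne').ne', one_mul]
      exact hy'
    have hin1 : HasFDerivWithinAt (fun x : P × Space => (x.1, r, r⁻¹ • (x.2 - z x.1)))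
        ((ContinuousLinearMap.fst ℝ P Space).prod ((0 : P × Space →L[ℝ] ℝ).prod
        (r⁻¹ • (ContinuousLinearMap.snd ℝ P Space - dz.comp (ContinuousLinearMap.fst ℝ P Space)))))
        S' x₀ := by
      exact hasFDerivWithinAt_fst.prodMk ((hasFDerivWithinAt_const r x₀ S').prodMk hwd)
    have hin2 : HasFDerivWithinAt (fun x : P × Space => (x.1, x.2 - z x.1))
        ((ContinuousLinearMap.fst ℝ P Space).prod
        (ContinuousLinearMap.snd ℝ P Space - dz.comp (ContinuousLinearMap.fst ℝ P Space)))
        S' x₀ := hasFDerivWithinAt_fst.prodMk (hyd.mono inter_subset_left)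
    have hΦd : HasFDerivWithinAt Φ (fderivWithin ℝ Φ D (p, r, w)) D
        ((fun x : P × Space => (x.1, r, r⁻¹ • (x.2 - z x.1))) x₀) := by
      simp only [hw₀]
      exact ((h.smooth_sing.differentiableOn (by simp)) (p, r, w) ⟨hp, hq⟩).hasFDerivWithinAt
    have hφd : HasFDerivWithinAt φ (fderivWithin ℝ φ D' (p, r • w)) D'
        ((fun x : P × Space => (x.1, x.2 - z x.1)) x₀) := by
      simp only [hy₀]
      exact ((h.smooth_reg.differentiableOn (by simp)) (p, r • w)
        ⟨hp, by simpa using hnrw⟩).hasFDerivWithinAt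
    have hm1 : MapsTo (fun x : P × Space => (x.1, r, r⁻¹ • (x.2 - z x.1))) S' D := fun x hx =>
      ⟨hSU x hx.1, hscale _ hx.2.1 hx.2.2⟩
    have hm2 : MapsTo (fun x : P × Space => (x.1, x.2 - z x.1)) S' D' := fun x hx =>
      ⟨hSU x hx.1, by simpa using hx.2.2⟩
    have hg := ((hΦd.comp x₀ hin1 hm1).const_mul ((r ^ k)⁻¹)).add (hφd.comp x₀ hin2 hm2)
    have hfg : ∀ x ∈ S', f x = (r ^ k)⁻¹ * Φ (x.1, r, r⁻¹ • (x.2 - z x.1)) +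
        φ (x.1, x.2 - z x.1) := by
      intro x hx
      have := h.eq x.1 (hSU x hx.1) r _ hr (hscale _ hx.2.1 hx.2.2)
      rw [smul_inv_smul₀ hr.ne', add_sub_cancel] at this
      exact this
    have hf' := hg.congr hfg (hfg x₀ hx₀S')
    have hf'' : HasFDerivWithinAt f _ S x₀ := hf'.mono_of_mem_nhdsWithin (by
      rw [← hS'n]; exact self_mem_nhdsWithin)
    rw [hf''.fderivWithin (hSu x₀ hx₀S)]
    have hlin : ((v.1, ((0 : ℝ), r⁻¹ • (v.2 - dz v.1))) : P × (ℝ × Space)) =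
        r⁻¹ • (r • v.1, ((0 : ℝ), v.2 - dz v.1)) := by
      simp [inv_smul_smul₀ hr.ne']
    simp only [_root_.add_apply, _root_.smul_apply,
      ContinuousLinearMap.comp_apply, ContinuousLinearMap.prod_apply,
      _root_.sub_apply, ContinuousLinearMap.coe_fst', ContinuousLinearMap.coe_snd',
      _root_.zero_apply]
    rw [hlin, map_smul]
    simp only [smul_eq_mul]
    rw [pow_succ, mul_inv]
    ring

end

section

variable {P : Type} [NormedAddCommGroup P] [NormedSpace ℝ P]

/-! ### Uniform bounds for expansions -/

/-- A closed annulus that contains the support of the gradient of the cutoff profile. -/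
def annulus : Set Space := {w | 1 / 8 ≤ ‖w‖ ∧ ‖w‖ ≤ 1}

theorem isCompact_annulus : IsCompact annulus := by
  have h1 : IsClosed annulus :=
    (isClosed_le continuous_const continuous_norm).inter
      (isClosed_le continuous_norm continuous_const)
  refine (isCompact_closedBall (0 : Space) 1).of_isClosed_subset h1 (fun w hw => ?_)
  simpa using hw.2

theorem measurableSet_annulus : MeasurableSet annulus := isCompact_annulus.isClosed.measurableSet

theorem neg_mem_annulus {w : Space} (h : w ∈ annulus) : -w ∈ annulus := by
  simpa [annulus] using h

theorem ne_zero_of_mem_annulus {w : Space} (h : w ∈ annulus) : w ≠ 0 := by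
  rintro rfl
  have := h.1
  simp at this
  linarith

theorem mem_scaleDomain_of_annulus {δ r : ℝ} {w : Space} (hr : |r| < δ) (hw : w ∈ annulus) :
    (r, w) ∈ scaleDomain δ :=
  ⟨ne_zero_of_mem_annulus hw, by nlinarith [hw.2, abs_nonneg r, norm_nonneg w]⟩

theorem exists_bound_scale {U : Set P} (hU : IsCompact U) {δ r0 : ℝ} (hr0 : r0 < δ)
    {f : P × (ℝ × Space) → ℝ} (hf : ContinuousOn f (U ×ˢ scaleDomain δ)) :
    ∃ C, 0 ≤ C ∧ ∀ p ∈ U, ∀ r, |r| ≤ r0 → ∀ w ∈ annulus, |f (p, r, w)| ≤ C := by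
  have hc : IsCompact (U ×ˢ (Icc (-r0) r0 ×ˢ annulus)) :=
    hU.prod (isCompact_Icc.prod isCompact_annulus)
  have hs : U ×ˢ (Icc (-r0) r0 ×ˢ annulus) ⊆ U ×ˢ scaleDomain δ := by
    rintro ⟨p, r, w⟩ ⟨hp, hr, hw⟩
    exact ⟨hp, mem_scaleDomain_of_annulus ((abs_le.2 hr).trans_lt hr0) hw⟩
  obtain ⟨C, hC⟩ := hc.exists_bound_of_continuousOn (hf.mono hs)
  refine ⟨max C 0, le_max_right _ _, fun p hp r hr w hw => ?_⟩
  exact (hC (p, r, w) ⟨hp, abs_le.1 hr, hw⟩).trans (le_max_left _ _)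

/-- The derivative in the scale `r`. -/
noncomputable def scaleD (U : Set P) (δ : ℝ) (E : P × (ℝ × Space) → ℝ) (x : P × (ℝ × Space)) : ℝ :=
  fderivWithin ℝ E (U ×ˢ scaleDomain δ) x (0, (1, 0))

theorem contDiffOn_scaleD {U : Set P} (hU : UniqueDiffOn ℝ U) {δ : ℝ} {E : P × (ℝ × Space) → ℝ}
    (hE : ContDiffOn ℝ ∞ E (U ×ˢ scaleDomain δ)) :
    ContDiffOn ℝ ∞ (scaleD U δ E) (U ×ˢ scaleDomain δ) :=
  hE.fderivWithin_apply_vec (hU.prod_isOpen (isOpen_scaleDomain δ)) contDiffOn_const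

theorem hasDerivAt_scale {U : Set P} {δ : ℝ} {E : P × (ℝ × Space) → ℝ}
    (hE : ContDiffOn ℝ ∞ E (U ×ˢ scaleDomain δ)) {p : P} (hp : p ∈ U) {r : ℝ} {w : Space}
    (h : (r, w) ∈ scaleDomain δ) :
    HasDerivAt (fun τ => E (p, τ, w)) (scaleD U δ E (p, r, w)) r := by
  have hT : {τ : ℝ | (τ, w) ∈ scaleDomain δ} ∈ 𝓝 r :=
    ((isOpen_scaleDomain δ).preimage (by fun_prop : Continuous fun τ : ℝ => (τ, w))).mem_nhds h
  have hc : HasDerivAt (fun τ : ℝ => ((p, τ, w) : P × (ℝ × Space))) (0, (1, 0)) r :=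
    (hasDerivAt_const r p).prodMk ((hasDerivAt_id r).prodMk (hasDerivAt_const r w))
  exact (hE.hasDerivWithinAt_comp_curve (c := fun τ => (p, τ, w)) hc.hasDerivWithinAt
    (fun τ hτ => ⟨hp, hτ⟩) ⟨hp, h⟩).hasDerivAt hT

theorem exists_lipschitz_scale {U : Set P} (hUc : IsCompact U) (hU : UniqueDiffOn ℝ U) {δ r0 : ℝ}
    (hr0 : r0 < δ) {E : P × (ℝ × Space) → ℝ} (hE : ContDiffOn ℝ ∞ E (U ×ˢ scaleDomain δ)) :
    ∃ C, 0 ≤ C ∧ ∀ p ∈ U, ∀ r, 0 ≤ r → r ≤ r0 → ∀ w ∈ annulus,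
      |E (p, r, w) - E (p, 0, w)| ≤ C * r := by
  obtain ⟨C, hC0, hC⟩ := exists_bound_scale hUc hr0 (contDiffOn_scaleD hU hE).continuousOn
  refine ⟨C, hC0, fun p hp r hr hr' w hw => ?_⟩
  have := (convex_Icc (0 : ℝ) r).norm_image_sub_le_of_norm_hasDerivWithin_le
    (f := fun τ => E (p, τ, w)) (f' := fun τ => scaleD U δ E (p, τ, w)) (C := C)
    (fun y hy => (hasDerivAt_scale hE hp (mem_scaleDomain_of_annulus
      (by rw [abs_of_nonneg hy.1]; linarith [hy.2]) hw)).hasDerivWithinAt)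
    (fun y hy => hC p hp y (by rw [abs_of_nonneg hy.1]; linarith [hy.2]) w hw)
    ⟨le_rfl, hr⟩ ⟨hr, le_rfl⟩
  simpa [abs_of_nonneg hr] using this

/-- Parity turns `E(r, -w)` into `E(-r, w)`, so the expression is a second difference in the scale
at a fixed direction. In powers of `r`, the linear term is odd in `w` and disappears. -/
theorem exists_even_bound {U : Set P} (hUc : IsCompact U) (hU : UniqueDiffOn ℝ U) {δ r0 : ℝ}
    (hr0 : r0 < δ) {E : P × (ℝ × Space) → ℝ} (hE : ContDiffOn ℝ ∞ E (U ×ˢ scaleDomain δ))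
    (hpar : ∀ p ∈ U, ∀ q ∈ scaleDomain δ, E (p, -q) = E (p, q)) :
    ∃ C, 0 ≤ C ∧ ∀ p ∈ U, ∀ r, 0 ≤ r → r ≤ r0 → ∀ w ∈ annulus,
      |E (p, r, w) + E (p, r, -w) - 2 * E (p, 0, w)| ≤ C * r ^ 2 := by
  obtain ⟨C, hC0, hC⟩ := exists_bound_scale hUc hr0
    (contDiffOn_scaleD hU (contDiffOn_scaleD hU hE)).continuousOn
  refine ⟨2 * C, by positivity, fun p hp r hr hr' w hw => ?_⟩
  have hdom : ∀ x ∈ Icc (-r) r, (x, w) ∈ scaleDomain δ := fun x hx =>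
    mem_scaleDomain_of_annulus ((abs_le.2 hx).trans_lt (by linarith)) hw
  have h1 := abs_second_difference_le hr
    (fun x hx => hasDerivAt_scale hE hp (hdom x hx))
    (fun x hx => hasDerivAt_scale (contDiffOn_scaleD hU hE) hp (hdom x hx))
    (fun x hx => hC p hp x ((abs_le.2 hx).trans hr') w hw)
  have h2 := hpar p hp (-r, w) (hdom (-r) ⟨le_rfl, by linarith⟩)
  simp only [Prod.neg_mk, neg_neg] at h2
  rwa [h2]

/-- Parity turns `E(r, -w)` into `-E(-r, w)`: only odd powers of `r` remain after symmetrization in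
`w`, hence the jump from order one to order three. -/
theorem exists_odd_bound {U : Set P} (hUc : IsCompact U) (hU : UniqueDiffOn ℝ U) {δ r0 : ℝ}
    (hr0 : r0 < δ) {E : P × (ℝ × Space) → ℝ} (hE : ContDiffOn ℝ ∞ E (U ×ˢ scaleDomain δ))
    (hpar : ∀ p ∈ U, ∀ q ∈ scaleDomain δ, E (p, -q) = -E (p, q)) :
    ∃ C, 0 ≤ C ∧ ∀ p ∈ U, ∀ r, 0 ≤ r → r ≤ r0 → ∀ w ∈ annulus,
      |E (p, r, w) + E (p, r, -w) - 2 * r * scaleD U δ E (p, 0, w)| ≤ C * r ^ 3 := by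
  obtain ⟨C, hC0, hC⟩ := exists_bound_scale hUc hr0
    (contDiffOn_scaleD hU (contDiffOn_scaleD hU (contDiffOn_scaleD hU hE))).continuousOn
  refine ⟨2 * C, by positivity, fun p hp r hr hr' w hw => ?_⟩
  have hdom : ∀ x ∈ Icc (-r) r, (x, w) ∈ scaleDomain δ := fun x hx =>
    mem_scaleDomain_of_annulus ((abs_le.2 hx).trans_lt (by linarith)) hw
  have h1 := abs_odd_difference_le hr
    (fun x hx => hasDerivAt_scale hE hp (hdom x hx))
    (fun x hx => hasDerivAt_scale (contDiffOn_scaleD hU hE) hp (hdom x hx))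
    (fun x hx => hasDerivAt_scale (contDiffOn_scaleD hU (contDiffOn_scaleD hU hE)) hp (hdom x hx))
    (fun x hx => hC p hp x ((abs_le.2 hx).trans hr') w hw)
  have h2 := hpar p hp (-r, w) (hdom (-r) ⟨le_rfl, by linarith⟩)
  simp only [Prod.neg_mk, neg_neg] at h2
  rw [h2, ← sub_eq_add_neg]
  exact h1

/-! ### Moving singular points -/

/-- Space-time (with the parameter in place of the time) without the moving points. -/
def offLines {N : ℕ} (U : Set P) (z : Fin N → P → Space) : Set (P × Space) :=
  {x | x.1 ∈ U ∧ ∀ n, x.2 ≠ z n x.1}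

/-- Smoothly moving points with mutual distances bounded below, over a compact set. -/
structure SeparatedPoints {N : ℕ} (U : Set P) (z : Fin N → P → Space) (δ : ℝ) : Prop where
  compact : IsCompact U
  unique : UniqueDiffOn ℝ U
  smooth : ∀ n, ContDiffOn ℝ ∞ (z n) U
  pos : 0 < δ
  sep : ∀ p ∈ U, ∀ n m, n ≠ m → 2 * δ ≤ ‖z n p - z m p‖

variable {N : ℕ} {U : Set P} {z : Fin N → P → Space} {δ : ℝ}

/-- The mutual distances are continuous and positive on a compact set, and there are finitely many
pairs. -/
theorem eventually_separated (hUc : IsCompact U) (hz : ∀ n, ContDiffOn ℝ ∞ (z n) U)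
    (hd : ∀ p ∈ U, Function.Injective (fun n => z n p)) :
    ∀ᶠ δ : ℝ in 𝓝[>] 0, ∀ p ∈ U, ∀ n m, n ≠ m → 2 * δ ≤ ‖z n p - z m p‖ := by
  have key : ∀ n m, ∀ᶠ δ : ℝ in 𝓝[>] 0, n ≠ m → ∀ p ∈ U, 2 * δ ≤ ‖z n p - z m p‖ := by
    intro n m
    by_cases hnm : n = m
    · simp [hnm]
    have hc : ContinuousOn (fun p => ‖z n p - z m p‖) U :=
      ((hz n).continuousOn.sub (hz m).continuousOn).norm
    obtain ⟨c, hc0, hc⟩ : ∃ c > 0, ∀ p ∈ U, c ≤ ‖z n p - z m p‖ := by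
      rcases U.eq_empty_or_nonempty with rfl | hne
      · exact ⟨1, one_pos, by simp⟩
      · obtain ⟨p, hp, hmin⟩ := hUc.exists_isMinOn hne hc
        refine ⟨_, ?_, fun q hq => hmin hq⟩
        exact norm_pos_iff.2 (sub_ne_zero.2 fun h => hnm (hd p hp h))
    filter_upwards [Ioc_mem_nhdsGT (show 0 < c / 2 by positivity)] with δ hδ _ p hp
    linarith [hδ.2, hc p hp]
  filter_upwards [eventually_all.2 fun n => eventually_all.2 fun m => key n m] with δ h p hp n m hnm
  exact h n m hnm p hp

theorem offLines_mem_nhdsWithin (hz : ∀ n, ContinuousOn (z n) U) {x : P × Space}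
    (hx : x ∈ offLines U z) : offLines U z ∈ 𝓝[U ×ˢ univ] x := by
  have h : ∀ n, ∀ᶠ y in 𝓝[U ×ˢ univ] x, y.2 ≠ z n y.1 := by
    intro n
    have h1 : ContinuousWithinAt (fun y : P × Space => y.2 - z n y.1) (U ×ˢ univ) x :=
      continuousWithinAt_snd.sub
        (ContinuousWithinAt.comp (t := U) (hz n x.1 hx.1) continuousWithinAt_fst
          (fun y hy => hy.1))
    filter_upwards [h1.eventually_ne (sub_ne_zero.2 (hx.2 n))] with y hy
    exact sub_ne_zero.1 hy
  filter_upwards [eventually_all.2 h, self_mem_nhdsWithin] with y hy hy'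
  exact ⟨hy'.1, hy⟩

theorem offLines_subset : offLines U z ⊆ U ×ˢ univ := fun _ hx => ⟨hx.1, mem_univ _⟩

theorem nhdsWithin_offLines (hz : ∀ n, ContinuousOn (z n) U) {x : P × Space}
    (hx : x ∈ offLines U z) : 𝓝[offLines U z] x = 𝓝[U ×ˢ univ] x :=
  le_antisymm (nhdsWithin_mono _ offLines_subset)
    (nhdsWithin_le_of_mem (offLines_mem_nhdsWithin hz hx))

theorem uniqueDiffOn_offLines (hU : UniqueDiffOn ℝ U) (hz : ∀ n, ContinuousOn (z n) U) :
    UniqueDiffOn ℝ (offLines U z) := fun x hx =>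
  (uniqueDiffWithinAt_congr (nhdsWithin_offLines hz hx)).2
    ((hU.prod uniqueDiffOn_univ) x (offLines_subset hx))

namespace SeparatedPoints

theorem continuousOn (h : SeparatedPoints U z δ) (n : Fin N) : ContinuousOn (z n) U := (h.smooth n).continuousOn

theorem uniqueDiffOn_offLines (h : SeparatedPoints U z δ) : UniqueDiffOn ℝ (offLines U z) :=
  PointCharges.uniqueDiffOn_offLines h.unique h.continuousOn

theorem add_mem_offLines (h : SeparatedPoints U z δ) {p : P} (hp : p ∈ U) (n : Fin N) {y : Space} (hy : y ≠ 0)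
    (hy' : ‖y‖ < δ) : (p, z n p + y) ∈ offLines U z := by
  refine ⟨hp, fun m hm => ?_⟩
  by_cases hnm : n = m
  · subst hnm
    exact hy (by simpa using hm)
  · have h1 := h.sep p hp n m hnm
    have h2 : z n p - z m p = -y := by
      have : z n p + y = z m p := hm
      rw [← this]; abel
    rw [h2, norm_neg] at h1
    linarith [h.pos]

end SeparatedPoints

/-- A smooth function off the moving points with an expansion of order `k` near each of them. -/
structure SingularFunction (U : Set P) (z : Fin N → P → Space) (δ : ℝ) (k : ℕ)
    (f : P × Space → ℝ) (Φ : Fin N → P × (ℝ × Space) → ℝ) (φ : Fin N → P × Space → ℝ) : Prop where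
  smooth_off : ContDiffOn ℝ ∞ f (offLines U z)
  expansion : ∀ n, IsExpansion U (z n) δ k f (Φ n) (φ n)

theorem SingularFunction.fderiv (hs : SeparatedPoints U z δ) {k : ℕ} {f : P × Space → ℝ}
    {Φ : Fin N → P × (ℝ × Space) → ℝ} {φ : Fin N → P × Space → ℝ}
    (h : SingularFunction U z δ k f Φ φ) (v : P × Space) :
    SingularFunction U z δ (k + 1) (fun x => fderivWithin ℝ f (offLines U z) x v)
      (fun n x => fderivWithin ℝ (Φ n) (U ×ˢ scaleDomain δ) x
        (x.2.1 • v.1, (0, v.2 - fderivWithin ℝ (z n) U x.1 v.1)))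
      (fun n x => fderivWithin ℝ (φ n) (U ×ˢ Metric.ball 0 δ) x
        (v.1, v.2 - fderivWithin ℝ (z n) U x.1 v.1)) where
  smooth_off := h.smooth_off.fderivWithin_apply_vec hs.uniqueDiffOn_offLines contDiffOn_const
  expansion n := (h.expansion n).fderiv hs.unique (hs.smooth n) hs.uniqueDiffOn_offLines
    (fun _ hx => hx.1) (fun _ hp _ hy hy' => hs.add_mem_offLines hp n hy hy') v

theorem SingularFunction.linear_comb {k : ℕ} {f g : P × Space → ℝ}
    {Φ Ψ : Fin N → P × (ℝ × Space) → ℝ} {φ ψ : Fin N → P × Space → ℝ}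
    (hf : SingularFunction U z δ k f Φ φ) (hg : SingularFunction U z δ k g Ψ ψ) (a b : ℝ) :
    SingularFunction U z δ k (fun x => a * f x - b * g x) (fun n x => a * Φ n x - b * Ψ n x)
      (fun n x => a * φ n x - b * ψ n x) where
  smooth_off := (contDiffOn_const.mul hf.smooth_off).sub (contDiffOn_const.mul hg.smooth_off)
  expansion n :=
    { smooth_sing := (contDiffOn_const.mul (hf.expansion n).smooth_sing).sub
        (contDiffOn_const.mul (hg.expansion n).smooth_sing)
      smooth_reg := (contDiffOn_const.mul (hf.expansion n).smooth_reg).sub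
        (contDiffOn_const.mul (hg.expansion n).smooth_reg)
      parity := fun p hp q hq => by
        rw [(hf.expansion n).parity p hp q hq, (hg.expansion n).parity p hp q hq]; ring
      eq := fun p hp r w hr hq => by
        rw [(hf.expansion n).eq p hp r w hr hq, (hg.expansion n).eq p hp r w hr hq]; ring }

/-! ### The cutoff profile -/

/-- The basic bump function. -/
noncomputable def bump : ContDiffBump (0 : Space) := ⟨1 / 4, 1 / 2, by norm_num, by norm_num⟩

/-- A smooth profile equal to `1` near `0`, with compact support, even, and normalized in such a
way that smooth cutoffs give renormalized integrals as ordinary limits. -/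
noncomputable def profile (w : Space) : ℝ := 2 * bump ((1 / 2 : ℝ) • w) - bump w

theorem profile_contDiff : ContDiff ℝ ∞ profile := by
  unfold profile
  exact (contDiff_const.mul (bump.contDiff.comp (contDiff_const_smul _))).sub bump.contDiff

theorem profile_neg (w : Space) : profile (-w) = profile w := by
  simp [profile, ContDiffBump.neg]

theorem bump_eq_one {w : Space} (h : ‖w‖ ≤ 1 / 4) : bump w = 1 :=
  bump.one_of_mem_closedBall (by simpa [bump] using h)

theorem bump_eq_zero {w : Space} (h : 1 / 2 ≤ ‖w‖) : bump w = 0 :=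
  bump.zero_of_le_dist (by simpa [bump] using h)

theorem profile_eq_one {w : Space} (h : ‖w‖ ≤ 1 / 4) : profile w = 1 := by
  rw [profile, bump_eq_one h, bump_eq_one]
  · norm_num
  · rw [norm_smul]; norm_num; linarith [norm_nonneg w]

theorem profile_eq_zero {w : Space} (h : 1 ≤ ‖w‖) : profile w = 0 := by
  rw [profile, bump_eq_zero (w := w) (by linarith), bump_eq_zero]
  · norm_num
  · rw [norm_smul]; norm_num; linarith [norm_nonneg w]

theorem abs_profile_le (w : Space) : |profile w| ≤ 2 := by
  have h1 := bump.nonneg (x := w)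
  have h2 := bump.le_one (x := w)
  have h3 := bump.nonneg (x := (1 / 2 : ℝ) • w)
  have h4 := bump.le_one (x := (1 / 2 : ℝ) • w)
  rw [profile, abs_le]
  constructor <;> linarith

/-- The spatial cutoff that removes the balls of radius `r / 4` around the moving points. -/
noncomputable def cut (z : Fin N → P → Space) (r : ℝ) (x : P × Space) : ℝ :=
  1 - ∑ n, profile (r⁻¹ • (x.2 - z n x.1))

theorem profile_scaled_eq_zero {r : ℝ} (hr : 0 < r) {y : Space} (hy : r ≤ ‖y‖) :
    profile (r⁻¹ • y) = 0 := by
  apply profile_eq_zero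
  rw [norm_smul, norm_inv, Real.norm_of_nonneg hr.le, ← div_eq_inv_mul, le_div_iff₀ hr, one_mul]
  exact hy

theorem profile_scaled_eq_one {r : ℝ} (hr : 0 < r) {y : Space} (hy : ‖y‖ ≤ r / 4) :
    profile (r⁻¹ • y) = 1 := by
  apply profile_eq_one
  rw [norm_smul, norm_inv, Real.norm_of_nonneg hr.le, ← div_eq_inv_mul, div_le_iff₀ hr]
  linarith

theorem cut_eq_one {r : ℝ} (hr : 0 < r) {x : P × Space} (hx : ∀ n, r ≤ ‖x.2 - z n x.1‖) :
    cut z r x = 1 := by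
  rw [cut, Finset.sum_eq_zero (fun n _ => profile_scaled_eq_zero hr (hx n)), sub_zero]

theorem SeparatedPoints.le_norm_sub (h : SeparatedPoints U z δ) {r : ℝ} (hr' : r ≤ δ)
    {x : P × Space} (hx : x.1 ∈ U) {n : Fin N} (hxn : ‖x.2 - z n x.1‖ < r) {m : Fin N}
    (hm : m ≠ n) : r ≤ ‖x.2 - z m x.1‖ := by
  have h1 := h.sep x.1 hx m n hm
  have h2 : z m x.1 - z n x.1 = (x.2 - z n x.1) - (x.2 - z m x.1) := by abel
  have h3 := norm_sub_le (x.2 - z n x.1) (x.2 - z m x.1)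
  rw [← h2] at h3
  linarith

theorem SeparatedPoints.sum_profile (h : SeparatedPoints U z δ) {r : ℝ} (hr : 0 < r) (hr' : r ≤ δ)
    {x : P × Space} (hx : x.1 ∈ U) {n : Fin N} (hxn : ‖x.2 - z n x.1‖ < r) :
    ∑ m, profile (r⁻¹ • (x.2 - z m x.1)) = profile (r⁻¹ • (x.2 - z n x.1)) :=
  Finset.sum_eq_single n
    (fun _ _ hm => profile_scaled_eq_zero hr (h.le_norm_sub hr' hx hxn hm)) (by simp)

theorem contDiffOn_cut (hz : ∀ n, ContDiffOn ℝ ∞ (z n) U) (r : ℝ) :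
    ContDiffOn ℝ ∞ (cut z r) (U ×ˢ univ) := by
  unfold cut
  refine contDiffOn_const.sub (ContDiffOn.sum fun n _ => ?_)
  refine profile_contDiff.comp_contDiffOn (contDiffOn_const.fun_smul (contDiffOn_snd.sub ?_))
  exact (hz n).comp contDiffOn_fst (fun x hx => hx.1)

theorem SeparatedPoints.cut_eventually_zero (h : SeparatedPoints U z δ) {r : ℝ} (hr : 0 < r)
    (hr' : r ≤ δ) {x : P × Space} (hx : x.1 ∈ U) {n : Fin N} (hxn : x.2 = z n x.1) :
    ∀ᶠ y in 𝓝[U ×ˢ univ] x, cut z r y = 0 := by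
  have h1 : ContinuousWithinAt (fun y : P × Space => ‖y.2 - z n y.1‖) (U ×ˢ univ) x :=
    (continuousWithinAt_snd.sub
      (ContinuousWithinAt.comp (t := U) (h.continuousOn n x.1 hx) continuousWithinAt_fst
        (fun y hy => hy.1))).norm
  have h2 : ‖x.2 - z n x.1‖ < r / 4 := by rw [hxn, sub_self, norm_zero]; positivity
  filter_upwards [h1.eventually (gt_mem_nhds h2), self_mem_nhdsWithin] with y hy hyU
  rw [cut, h.sum_profile hr hr' hyU.1 (hy.trans (by linarith)), profile_scaled_eq_one hr hy.le,
    sub_self]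

/-- In a neighbourhood of a moving point the cutoff is identically zero, so the product is smooth
there whatever the values of `g` on the world-line are. -/
theorem SeparatedPoints.contDiffOn_cut_mul (h : SeparatedPoints U z δ) {r : ℝ} (hr : 0 < r)
    (hr' : r ≤ δ) {g : P × Space → ℝ} (hg : ContDiffOn ℝ ∞ g (offLines U z)) :
    ContDiffOn ℝ ∞ (fun x => cut z r x * g x) (U ×ˢ univ) := by
  intro x hx
  by_cases hoff : ∀ n, x.2 ≠ z n x.1
  · have hx' : x ∈ offLines U z := ⟨hx.1, hoff⟩
    have h1 : ContDiffWithinAt ℝ ∞ g (U ×ˢ univ) x :=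
      (hg x hx').mono_of_mem_nhdsWithin (offLines_mem_nhdsWithin h.continuousOn hx')
    exact (contDiffOn_cut h.smooth r x hx).mul h1
  · push Not at hoff
    obtain ⟨n, hn⟩ := hoff
    have h0 := h.cut_eventually_zero hr hr' hx.1 hn
    refine (contDiffWithinAt_const (c := (0 : ℝ))).congr_of_eventuallyEq_of_mem ?_ hx
    filter_upwards [h0] with y hy
    rw [hy, zero_mul]

end

section

variable {P : Type} [NormedAddCommGroup P] [NormedSpace ℝ P]

/-! ### Integrals over the annulus -/

theorem integrable_weight {m g : Space → ℝ} {M : ℝ} (hm : Measurable m) (hM : ∀ w, |m w| ≤ M)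
    (h0 : ∀ w, w ∉ annulus → m w = 0) (hg : ContinuousOn g annulus) :
    Integrable (fun w => m w * g w) := by
  have h1 : IntegrableOn g annulus := hg.integrableOn_compact isCompact_annulus
  have h2 : IntegrableOn (fun w => m w * g w) annulus :=
    h1.bdd_mul hm.aestronglyMeasurable (c := M) (Eventually.of_forall fun w => by simpa using hM w)
  refine (integrableOn_iff_integrable_of_support_subset fun w hw => ?_).1 h2
  by_contra hc
  exact hw (by simp [h0 w hc])

theorem abs_integral_weight_le {m g : Space → ℝ} {M C : ℝ} (hM : ∀ w, |m w| ≤ M) (hM0 : 0 ≤ M)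
    (h0 : ∀ w, w ∉ annulus → m w = 0) (hC : ∀ w ∈ annulus, |g w| ≤ C) :
    |∫ w, m w * g w| ≤ M * C * volume.real annulus := by
  have h1 : ∫ w, m w * g w = ∫ w in annulus, m w * g w := by
    rw [setIntegral_eq_integral_of_forall_compl_eq_zero]
    intro w hw
    rw [h0 w hw, zero_mul]
  rw [h1]
  have := norm_setIntegral_le_of_norm_le_const (μ := volume) (s := annulus)
    (f := fun w => m w * g w) (C := M * C) isCompact_annulus.measure_lt_top
    (fun w hw => by
      rw [Real.norm_eq_abs, abs_mul]
      exact mul_le_mul (hM w) (hC w hw) (abs_nonneg _) hM0)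
  simpa using this

/-- An even weight does not distinguish `g(w)` from `g(-w)`, so twice the difference of the
integrals is the integral of the symmetrized difference. This is how odd terms of expansions are
discarded. -/
theorem abs_even_integral_sub_le {m g g₀ : Space → ℝ} {M C : ℝ} (hm : Measurable m)
    (hM : ∀ w, |m w| ≤ M) (hM0 : 0 ≤ M) (h0 : ∀ w, w ∉ annulus → m w = 0)
    (heven : ∀ w, m (-w) = m w) (hg : ContinuousOn g annulus) (hg₀ : ContinuousOn g₀ annulus)
    (hC : ∀ w ∈ annulus, |g w + g (-w) - 2 * g₀ w| ≤ C) :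
    |(∫ w, m w * g w) - ∫ w, m w * g₀ w| ≤ M * C * volume.real annulus := by
  have hgn : ContinuousOn (fun w => g (-w)) annulus :=
    hg.comp continuous_neg.continuousOn (fun w hw => neg_mem_annulus hw)
  have i1 := integrable_weight hm hM h0 hg
  have i2 := integrable_weight hm hM h0 hgn
  have i3 := integrable_weight hm hM h0 hg₀
  have h1 : ∫ w, m w * g (-w) = ∫ w, m w * g w := by
    rw [← integral_neg_eq_self (fun w => m w * g w)]
    simp only [heven]
  have h2 : ∫ w, m w * (g w + g (-w) - 2 * g₀ w) =
      2 * ((∫ w, m w * g w) - ∫ w, m w * g₀ w) := by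
    have : ∀ w, m w * (g w + g (-w) - 2 * g₀ w) =
        m w * g w + m w * g (-w) - 2 * (m w * g₀ w) := fun w => by ring
    simp only [this]
    have i4 : Integrable (fun w => m w * g w + m w * g (-w)) := i1.add i2
    rw [integral_sub i4 (i3.const_mul 2), integral_add i1 i2, h1, integral_const_mul]
    ring
  have h3 := abs_integral_weight_le hM hM0 h0 hC
  rw [h2, abs_mul, abs_two] at h3
  linarith [abs_nonneg ((∫ w, m w * g w) - ∫ w, m w * g₀ w)]

theorem integral_scaled (g : Space → ℝ) (c : Space) {r : ℝ} (hr : 0 < r) :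
    ∫ x, g (r⁻¹ • (x - c)) = r ^ 3 * ∫ w, g w := by
  rw [integral_sub_right_eq_self (fun x => g (r⁻¹ • x)) c,
    Measure.integral_comp_inv_smul_of_nonneg _ _ hr.le]
  simp

theorem integrable_scaled {g : Space → ℝ} (hg : Integrable g) (c : Space) {r : ℝ} (hr : 0 < r) :
    Integrable (fun x => g (r⁻¹ • (x - c))) :=
  (hg.comp_smul (inv_ne_zero hr.ne')).comp_sub_right c

theorem integral_scaled_mul (m f : Space → ℝ) (c : Space) {r : ℝ} (hr : 0 < r) :
    ∫ x, m (r⁻¹ • (x - c)) * f x = r ^ 3 * ∫ w, m w * f (c + r • w) := by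
  rw [← integral_scaled (fun w => m w * f (c + r • w)) c hr]
  simp only [smul_inv_smul₀ hr.ne', add_sub_cancel]

theorem integrable_scaled_mul {m f : Space → ℝ} (c : Space) {r : ℝ} (hr : 0 < r)
    (h : Integrable (fun w => m w * f (c + r • w))) :
    Integrable (fun x => m (r⁻¹ • (x - c)) * f x) := by
  have := integrable_scaled h c hr
  simpa only [smul_inv_smul₀ hr.ne', add_sub_cancel] using this

/-- The difference of the profiles at two scales. -/
noncomputable def profileDiff (s : ℝ) (w : Space) : ℝ := profile (s • w) - profile w

theorem profileDiff_measurable (s : ℝ) : Measurable (profileDiff s) :=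
  ((profile_contDiff.continuous.comp (continuous_const_smul s)).sub
    profile_contDiff.continuous).measurable

theorem profileDiff_neg (s : ℝ) (w : Space) : profileDiff s (-w) = profileDiff s w := by
  simp [profileDiff, profile_neg]

theorem abs_profileDiff_le (s : ℝ) (w : Space) : |profileDiff s w| ≤ 4 := by
  have h1 := abs_le.1 (abs_profile_le w)
  have h2 := abs_le.1 (abs_profile_le (s • w))
  rw [profileDiff, abs_le]
  constructor <;> linarith [h1.1, h1.2, h2.1, h2.2]

/-- The inner radius `1/8` of the annulus is the radius `1/4` on which the profile is `1`, divided
by the largest admissible ratio `2` of the scales. -/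
theorem profileDiff_eq_zero {s : ℝ} (h1 : 1 ≤ s) (h2 : s ≤ 2) {w : Space} (hw : w ∉ annulus) :
    profileDiff s w = 0 := by
  have hn : ‖s • w‖ = s * ‖w‖ := by rw [norm_smul, Real.norm_of_nonneg (by linarith)]
  have h3 : ‖w‖ < 1 / 8 ∨ 1 < ‖w‖ := by
    by_contra hc
    push Not at hc
    exact hw hc
  rcases h3 with h3 | h3
  · rw [profileDiff, profile_eq_one (by rw [hn]; nlinarith [norm_nonneg w]),
      profile_eq_one (by linarith), sub_self]
  · rw [profileDiff, profile_eq_zero (by rw [hn]; nlinarith [norm_nonneg w]),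
      profile_eq_zero h3.le, sub_self]

/-- The normalization of the profile: the weight `profileDiff` annihilates functions that are
homogeneous of degree `-4`. -/
theorem integral_profileDiff_homogeneous {s : ℝ} (h1 : 1 ≤ s) (h2 : s ≤ 2) {G : Space → ℝ}
    (hG : ContinuousOn G {0}ᶜ) (hom : ∀ w ≠ 0, G ((2 : ℝ) • w) = (2 ^ 4)⁻¹ * G w) :
    ∫ w, profileDiff s w * G w = 0 := by
  -- By the definition of the profile, the weight is `2 m(w/2) - m(w)`. The substitution `w = 2 u`
  -- gives a volume factor `8` and, by homogeneity, a factor `1/16`, so the integral of `m(w/2) G`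
  -- is half of that of `m G`, and the two terms cancel.
  set m : Space → ℝ := fun w => bump (s • w) - bump w with hm
  have hGa : ContinuousOn G annulus := hG.mono fun w hw => ne_zero_of_mem_annulus hw
  have hmm : Measurable m := ((bump.continuous.comp (continuous_const_smul s)).sub
    bump.continuous).measurable
  have hm1 : ∀ w, |m w| ≤ 1 := by
    intro w
    have h1 := bump.nonneg (x := w)
    have h2 := bump.le_one (x := w)
    have h3 := bump.nonneg (x := s • w)
    have h4 := bump.le_one (x := s • w)
    rw [hm, abs_le]
    constructor <;> dsimp only <;> linarith
  have hn : ∀ w : Space, ‖s • w‖ = s * ‖w‖ := fun w => by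
    rw [norm_smul, Real.norm_of_nonneg (by linarith)]
  have hm0 : ∀ w, w ∉ annulus → m w = 0 := by
    intro w hw
    have h3 : ‖w‖ < 1 / 8 ∨ 1 < ‖w‖ := by
      by_contra hc
      push Not at hc
      exact hw hc
    rcases h3 with h3 | h3
    · rw [hm]
      dsimp only
      rw [bump_eq_one (by rw [hn]; nlinarith [norm_nonneg w]), bump_eq_one (by linarith), sub_self]
    · rw [hm]
      dsimp only
      rw [bump_eq_zero (by rw [hn]; nlinarith [norm_nonneg w]), bump_eq_zero (by linarith),
        sub_self]
  have i1 := integrable_weight hmm hm1 hm0 hGa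
  have hhalf : ∀ w, m ((2 : ℝ)⁻¹ • w) * G w = 16⁻¹ * (m ((2 : ℝ)⁻¹ • w) * G ((2 : ℝ)⁻¹ • w)) := by
    intro w
    by_cases hw : w = 0
    · have : m ((2 : ℝ)⁻¹ • w) = 0 := hm0 _ (by
        rw [hw, smul_zero]; exact fun h => ne_zero_of_mem_annulus h rfl)
      rw [this]; ring
    · have h3 := hom ((2 : ℝ)⁻¹ • w) (smul_ne_zero (by norm_num) hw)
      rw [smul_inv_smul₀ two_ne_zero] at h3
      rw [h3]; norm_num; ring
  have i2 : Integrable (fun w => m ((2 : ℝ)⁻¹ • w) * G w) := by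
    simp only [hhalf]
    exact (i1.comp_smul (by norm_num : (2 : ℝ)⁻¹ ≠ 0)).const_mul _
  have e1 : ∫ w, m ((2 : ℝ)⁻¹ • w) * G w = 2⁻¹ * ∫ w, m w * G w := by
    simp only [hhalf]
    rw [integral_const_mul]
    have := integral_scaled (fun w => m w * G w) 0 (r := 2) two_pos
    simp only [sub_zero] at this
    rw [this]; norm_num; ring
  have e2 : ∀ w, profileDiff s w * G w = 2 * (m ((2 : ℝ)⁻¹ • w) * G w) - m w * G w := by
    intro w
    simp only [profileDiff, profile, hm, one_div]
    rw [smul_comm s (2 : ℝ)⁻¹ w]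
    ring
  simp only [e2]
  rw [integral_sub (i2.const_mul 2) i1, integral_const_mul, e1]
  ring

/-! ### Decay at infinity -/

/-- `f(p, x) = O(|x|⁻ʲ)` at infinity, uniformly in `p`. -/
def DecaysLike (U : Set P) (j : ℕ) (f : P × Space → ℝ) : Prop :=
  ∃ C R, 0 < R ∧ ∀ p ∈ U, ∀ x : Space, R ≤ ‖x‖ → |f (p, x)| ≤ C / ‖x‖ ^ j

theorem DecaysLike.mul {U : Set P} {i j : ℕ} {f g : P × Space → ℝ} (hf : DecaysLike U i f)
    (hg : DecaysLike U j g) : DecaysLike U (i + j) (fun x => f x * g x) := by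
  obtain ⟨C, R, hR, h⟩ := hf
  obtain ⟨C', R', hR', h'⟩ := hg
  refine ⟨C * C', max R R', by positivity, fun p hp x hx => ?_⟩
  have h1 := h p hp x ((le_max_left _ _).trans hx)
  have h2 := h' p hp x ((le_max_right _ _).trans hx)
  rw [abs_mul, pow_add, mul_div_mul_comm]
  exact mul_le_mul h1 h2 (abs_nonneg _) ((abs_nonneg _).trans h1)

theorem DecaysLike.linear_comb {U : Set P} {j : ℕ} {f g : P × Space → ℝ} (hf : DecaysLike U j f)
    (hg : DecaysLike U j g) (a b : ℝ) : DecaysLike U j (fun x => a * f x - b * g x) := by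
  obtain ⟨C, R, hR, h⟩ := hf
  obtain ⟨C', R', hR', h'⟩ := hg
  refine ⟨|a| * C + |b| * C', max R R', by positivity, fun p hp x hx => ?_⟩
  have h1 := h p hp x ((le_max_left _ _).trans hx)
  have h2 := h' p hp x ((le_max_right _ _).trans hx)
  calc |a * f (p, x) - b * g (p, x)| ≤ |a * f (p, x)| + |b * g (p, x)| := abs_sub _ _
    _ = |a| * |f (p, x)| + |b| * |g (p, x)| := by rw [abs_mul, abs_mul]
    _ ≤ |a| * (C / ‖x‖ ^ j) + |b| * (C' / ‖x‖ ^ j) := by gcongr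
    _ = _ := by ring

theorem DecaysLike.congr {U : Set P} {j : ℕ} {f g : P × Space → ℝ} (hf : DecaysLike U j f)
    (hfg : ∃ R, ∀ p ∈ U, ∀ x : Space, R ≤ ‖x‖ → g (p, x) = f (p, x)) : DecaysLike U j g := by
  obtain ⟨C, R, hR, h⟩ := hf
  obtain ⟨R', h'⟩ := hfg
  refine ⟨C, max R R', by positivity, fun p hp x hx => ?_⟩
  rw [h' p hp x ((le_max_right _ _).trans hx)]
  exact h p hp x ((le_max_left _ _).trans hx)

/-- The decay controls large `x`, and compactness of the parameter range controls the rest. The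
resulting bound is one function of `x` for all parameters, as dominated convergence needs. -/
theorem DecaysLike.exists_bound {U : Set P} (hU : IsCompact U) {j : ℕ} {f : P × Space → ℝ}
    (hf : DecaysLike U j f) (hc : ContinuousOn f (U ×ˢ univ)) :
    ∃ C, 0 ≤ C ∧ ∀ p ∈ U, ∀ x : Space, |f (p, x)| ≤ C * ((1 + ‖x‖) ^ j)⁻¹ := by
  obtain ⟨C, R, hR, h⟩ := hf
  obtain ⟨C', hC'⟩ := (hU.prod (isCompact_closedBall (0 : Space) (max R 1))).exists_bound_of_continuousOn
    (hc.mono (prod_mono_right (subset_univ _)))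
  refine ⟨max (|C| * 2 ^ j) (|C'| * (1 + max R 1) ^ j), by positivity, fun p hp x => ?_⟩
  rw [← div_eq_mul_inv, le_div_iff₀ (by positivity)]
  rcases le_total (max R 1) ‖x‖ with hx | hx
  · have h1 := h p hp x ((le_max_left _ _).trans hx)
    have hx1 : 1 ≤ ‖x‖ := (le_max_right _ _).trans hx
    refine le_trans ?_ (le_max_left _ _)
    have h2 : |f (p, x)| ≤ |C| / ‖x‖ ^ j := h1.trans (by gcongr; exact le_abs_self C)
    have h3 : (1 + ‖x‖) ^ j ≤ (2 * ‖x‖) ^ j := by gcongr; linarith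
    calc |f (p, x)| * (1 + ‖x‖) ^ j ≤ |C| / ‖x‖ ^ j * (2 * ‖x‖) ^ j := by gcongr
      _ = |C| * 2 ^ j := by rw [mul_pow]; field_simp
  · refine le_trans ?_ (le_max_right _ _)
    have h1 := hC' (p, x) ⟨hp, by simpa using hx⟩
    rw [Real.norm_eq_abs] at h1
    have h2 := h1.trans (le_abs_self C')
    gcongr

theorem integrable_decay {j : ℕ} (hj : 3 < j) : Integrable fun x : Space => ((1 + ‖x‖) ^ j)⁻¹ := by
  have := integrable_one_add_norm (μ := (volume : Measure Space)) (r := j) (by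
    simp only [finrank_euclideanSpace, Fintype.card_fin]; exact_mod_cast hj)
  refine this.congr (Eventually.of_forall fun x => ?_)
  dsimp only
  rw [Real.rpow_neg (by positivity), Real.rpow_natCast]

theorem continuous_slice {U : Set P} {f : P × Space → ℝ} (hc : ContinuousOn f (U ×ˢ univ)) {p : P}
    (hp : p ∈ U) : Continuous fun x => f (p, x) := by
  rw [← continuousOn_univ]
  exact hc.comp (by fun_prop) (fun x hx => ⟨hp, hx⟩)

theorem DecaysLike.integrable {U : Set P} (hU : IsCompact U) {j : ℕ} (hj : 3 < j)
    {f : P × Space → ℝ} (hf : DecaysLike U j f) (hc : ContinuousOn f (U ×ˢ univ)) {p : P}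
    (hp : p ∈ U) : Integrable fun x => f (p, x) := by
  obtain ⟨C, hC0, hC⟩ := hf.exists_bound hU hc
  exact ((integrable_decay hj).const_mul C).mono' (continuous_slice hc hp).aestronglyMeasurable
    (Eventually.of_forall fun x => hC p hp x)

theorem DecaysLike.continuousOn_integral {U : Set P} (hU : IsCompact U) {j : ℕ} (hj : 3 < j)
    {f : P × Space → ℝ} (hf : DecaysLike U j f) (hc : ContinuousOn f (U ×ˢ univ)) :
    ContinuousOn (fun p => ∫ x, f (p, x)) U := by
  obtain ⟨C, hC0, hC⟩ := hf.exists_bound hU hc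
  refine MeasureTheory.continuousOn_of_dominated
    (fun p hp => (continuous_slice hc hp).aestronglyMeasurable)
    (fun p hp => Eventually.of_forall fun x => hC p hp x) ((integrable_decay hj).const_mul C)
    (Eventually.of_forall fun x => hc.comp (by fun_prop) (fun p hp => ⟨hp, mem_univ _⟩))

end

section

variable {P : Type} [NormedAddCommGroup P] [NormedSpace ℝ P]
variable {N : ℕ} {U : Set P} {z : Fin N → P → Space} {δ : ℝ}

/-! ### The square of a singular function of order two -/

/-- The part of `r² φ(p, r w)` of an expansion that is regular in space. -/
def regScaled (φ : P × Space → ℝ) (x : P × (ℝ × Space)) : ℝ := φ (x.1, x.2.1 • x.2.2)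

theorem contDiffOn_regScaled {φ : P × Space → ℝ} (hφ : ContDiffOn ℝ ∞ φ (U ×ˢ Metric.ball 0 δ)) :
    ContDiffOn ℝ ∞ (regScaled φ) (U ×ˢ scaleDomain δ) := by
  refine hφ.comp (t := U ×ˢ Metric.ball 0 δ) (ContDiff.contDiffOn (by fun_prop)) ?_
  intro x hx
  exact ⟨hx.1, smul_mem_ball_of_scaleDomain hx.2⟩

/-- `r⁴ f(p, z + r w)²` for a function `f` with an expansion of order two. -/
def squareScaled (Φ : P × (ℝ × Space) → ℝ) (φ : P × Space → ℝ) (x : P × (ℝ × Space)) : ℝ :=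
  Φ x ^ 2 + x.2.1 ^ 2 * (2 * Φ x * regScaled φ x + x.2.1 ^ 2 * regScaled φ x ^ 2)

theorem contDiffOn_scale_pow (k : ℕ) :
    ContDiffOn ℝ ∞ (fun x : P × (ℝ × Space) => x.2.1 ^ k) (U ×ˢ scaleDomain δ) :=
  ContDiff.contDiffOn (by fun_prop)

theorem contDiffOn_squareRemainder {Φ : P × (ℝ × Space) → ℝ} {φ : P × Space → ℝ}
    (hΦ : ContDiffOn ℝ ∞ Φ (U ×ˢ scaleDomain δ))
    (hφ : ContDiffOn ℝ ∞ φ (U ×ˢ Metric.ball 0 δ)) :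
    ContDiffOn ℝ ∞ (fun x => 2 * Φ x * regScaled φ x + x.2.1 ^ 2 * regScaled φ x ^ 2)
      (U ×ˢ scaleDomain δ) :=
  ((contDiffOn_const.mul hΦ).mul (contDiffOn_regScaled hφ)).add
    ((contDiffOn_scale_pow 2).mul ((contDiffOn_regScaled hφ).pow 2))

theorem contDiffOn_squareScaled {Φ : P × (ℝ × Space) → ℝ} {φ : P × Space → ℝ}
    (hΦ : ContDiffOn ℝ ∞ Φ (U ×ˢ scaleDomain δ))
    (hφ : ContDiffOn ℝ ∞ φ (U ×ˢ Metric.ball 0 δ)) :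
    ContDiffOn ℝ ∞ (squareScaled Φ φ) (U ×ˢ scaleDomain δ) :=
  (hΦ.pow 2).add ((contDiffOn_scale_pow 2).mul (contDiffOn_squareRemainder hΦ hφ))

theorem IsExpansion.sq_eq {z : P → Space} {f : P × Space → ℝ} {Φ : P × (ℝ × Space) → ℝ}
    {φ : P × Space → ℝ} (h : IsExpansion U z δ 2 f Φ φ) {p : P} (hp : p ∈ U) {r : ℝ} {w : Space}
    (hr : 0 < r) (hw : (r, w) ∈ scaleDomain δ) :
    f (p, z p + r • w) ^ 2 = (r ^ 4)⁻¹ * squareScaled Φ φ (p, r, w) := by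
  rw [h.eq p hp r w hr hw]
  simp only [squareScaled, regScaled]
  field_simp
  ring

theorem continuousOn_slice_annulus {E : P × (ℝ × Space) → ℝ}
    (hE : ContinuousOn E (U ×ˢ scaleDomain δ)) {p : P} (hp : p ∈ U) {r : ℝ} (hr : |r| < δ) :
    ContinuousOn (fun w => E (p, r, w)) annulus :=
  hE.comp (by fun_prop) (fun _ hw => ⟨hp, mem_scaleDomain_of_annulus hr hw⟩)

/-- The same point `r (2 w) = (2 r) w` is expanded at the two scales `r` and `2 r`. The regular
parts coincide, so the singular parts do, and `r → 0` gives the relation. Only the dilation by `2`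
is needed later. -/
theorem IsExpansion.homogeneous {z : P → Space} {k : ℕ} {f : P × Space → ℝ}
    {Φ : P × (ℝ × Space) → ℝ} {φ : P × Space → ℝ} (h : IsExpansion U z δ k f Φ φ) (hδ : 0 < δ)
    {p : P} (hp : p ∈ U) {w : Space} (hw : w ≠ 0) :
    Φ (p, 0, (2 : ℝ) • w) = (2 ^ k)⁻¹ * Φ (p, 0, w) := by
  have hw2 : (2 : ℝ) • w ≠ 0 := smul_ne_zero two_ne_zero hw
  have hcont : ∀ v : Space, v ≠ 0 → ContinuousAt (fun r : ℝ => Φ (p, r, v)) 0 := fun v hv =>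
    (hasDerivAt_scale h.smooth_sing hp ⟨hv, by simpa using hδ⟩).continuousAt
  have h1 : Tendsto (fun r : ℝ => Φ (p, r, (2 : ℝ) • w)) (𝓝[>] 0) (𝓝 (Φ (p, 0, (2 : ℝ) • w))) :=
    (hcont _ hw2).tendsto.mono_left nhdsWithin_le_nhds
  have h2 : Tendsto (fun r : ℝ => (2 ^ k)⁻¹ * Φ (p, 2 * r, w)) (𝓝[>] 0)
      (𝓝 ((2 ^ k)⁻¹ * Φ (p, 0, w))) := by
    have h3 : Tendsto (fun r : ℝ => 2 * r) (𝓝[>] 0) (𝓝 0) := by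
      have : Tendsto (fun r : ℝ => 2 * r) (𝓝 0) (𝓝 (2 * 0)) := (continuous_const_mul 2).tendsto 0
      rw [mul_zero] at this
      exact this.mono_left nhdsWithin_le_nhds
    exact ((hcont w hw).tendsto.comp h3).const_mul _
  refine tendsto_nhds_unique h1 (h2.congr' ?_)
  have hn : 0 < ‖w‖ := norm_pos_iff.2 hw
  filter_upwards [Ioo_mem_nhdsGT (show 0 < δ / (2 * ‖w‖) by positivity)] with r hr
  have hr2 : r * (2 * ‖w‖) < δ := (lt_div_iff₀ (by positivity)).1 hr.2
  have e1 := h.eq p hp r ((2 : ℝ) • w) hr.1 ⟨hw2, by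
    simp only [norm_smul, abs_of_pos hr.1, Real.norm_ofNat]; exact hr2⟩
  have e2 := h.eq p hp (2 * r) w (by linarith [hr.1]) ⟨hw, by
    simp only [abs_of_pos (show 0 < 2 * r by linarith [hr.1])]; linarith⟩
  have e3 : r • (2 : ℝ) • w = (2 * r) • w := by rw [smul_smul, mul_comm]
  rw [e3] at e1
  have e4 := e1.symm.trans e2
  have hr0 := hr.1.ne'
  rw [mul_pow, mul_inv] at e4
  have e5 : (r ^ k)⁻¹ * Φ (p, r, (2 : ℝ) • w) = (r ^ k)⁻¹ * ((2 ^ k)⁻¹ * Φ (p, 2 * r, w)) := by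
    linarith
  exact (mul_left_cancel₀ (inv_ne_zero (pow_ne_zero k hr0)) e5).symm

/-- `E + r² M` is even up to `O(r²)` if `E` is even. -/
theorem exists_almost_even_bound (hUc : IsCompact U) (hU : UniqueDiffOn ℝ U) {r₀ : ℝ}
    (hr₀ : r₀ < δ) {E M : P × (ℝ × Space) → ℝ} (hE : ContDiffOn ℝ ∞ E (U ×ˢ scaleDomain δ))
    (hM : ContinuousOn M (U ×ˢ scaleDomain δ))
    (hpar : ∀ p ∈ U, ∀ q ∈ scaleDomain δ, E (p, -q) = E (p, q)) :
    ∃ C, 0 ≤ C ∧ ∀ p ∈ U, ∀ r, 0 ≤ r → r ≤ r₀ → ∀ w ∈ annulus,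
      |E (p, r, w) + r ^ 2 * M (p, r, w) + (E (p, r, -w) + r ^ 2 * M (p, r, -w))
        - 2 * E (p, 0, w)| ≤ C * r ^ 2 := by
  obtain ⟨C, hC0, hC⟩ := exists_even_bound hUc hU hr₀ hE hpar
  obtain ⟨C', hC0', hC'⟩ := exists_bound_scale hUc hr₀ hM
  refine ⟨C + 2 * C', by positivity, fun p hp r hr hr' w hw => ?_⟩
  have h1 := abs_le.1 (hC p hp r hr hr' w hw)
  have hra : |r| ≤ r₀ := by rwa [abs_of_nonneg hr]
  have h2 := abs_le.1 (hC' p hp r hra w hw)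
  have h3 := abs_le.1 (hC' p hp r hra (-w) (neg_mem_annulus hw))
  have hr2 := sq_nonneg r
  rw [abs_le]
  constructor
  · nlinarith [mul_le_mul_of_nonneg_left h2.1 hr2, mul_le_mul_of_nonneg_left h3.1 hr2, h1.1]
  · nlinarith [mul_le_mul_of_nonneg_left h2.2 hr2, mul_le_mul_of_nonneg_left h3.2 hr2, h1.2]

theorem IsExpansion.sq_even {z : P → Space} {f : P × Space → ℝ}
    {Φ : P × (ℝ × Space) → ℝ} {φ : P × Space → ℝ} (h : IsExpansion U z δ 2 f Φ φ) :
    ∀ p ∈ U, ∀ q ∈ scaleDomain δ, Φ (p, -q) ^ 2 = Φ (p, q) ^ 2 := by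
  intro p hp q hq
  rw [h.parity p hp q hq]; ring

theorem squareScaled_zero (Φ : P × (ℝ × Space) → ℝ) (φ : P × Space → ℝ) (p : P) (w : Space) :
    squareScaled Φ φ (p, 0, w) = Φ (p, 0, w) ^ 2 := by
  simp [squareScaled]

theorem IsExpansion.exists_square_bound (hUc : IsCompact U) (hU : UniqueDiffOn ℝ U) {r₀ : ℝ}
    (hr₀ : r₀ < δ) {z : P → Space} {f : P × Space → ℝ} {Φ : P × (ℝ × Space) → ℝ}
    {φ : P × Space → ℝ} (h : IsExpansion U z δ 2 f Φ φ) :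
    ∃ C, 0 ≤ C ∧ ∀ p ∈ U, ∀ r, 0 ≤ r → r ≤ r₀ → ∀ w ∈ annulus,
      |squareScaled Φ φ (p, r, w) + squareScaled Φ φ (p, r, -w)
        - 2 * squareScaled Φ φ (p, 0, w)| ≤ C * r ^ 2 := by
  obtain ⟨C, hC0, hC⟩ := exists_almost_even_bound hUc hU hr₀ (h.smooth_sing.pow 2)
    (contDiffOn_squareRemainder h.smooth_sing h.smooth_reg).continuousOn h.sq_even
  refine ⟨C, hC0, fun p hp r hr hr' w hw => ?_⟩
  rw [squareScaled_zero]
  exact hC p hp r hr hr' w hw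

/-- For order two, the leading coefficient of the square scales by `2⁻⁴` under doubling, which is
the homogeneity that the profile is normalized to annihilate. -/
theorem IsExpansion.integral_profileDiff_square_zero {z : P → Space} {f : P × Space → ℝ}
    {Φ : P × (ℝ × Space) → ℝ} {φ : P × Space → ℝ} (h : IsExpansion U z δ 2 f Φ φ) (hδ : 0 < δ)
    {p : P} (hp : p ∈ U) {s : ℝ} (h1 : 1 ≤ s) (h2 : s ≤ 2) :
    ∫ w, profileDiff s w * squareScaled Φ φ (p, 0, w) = 0 := by
  refine integral_profileDiff_homogeneous h1 h2 ?_ fun w hw => ?_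
  · refine (contDiffOn_squareScaled h.smooth_sing h.smooth_reg).continuousOn.comp
      (by fun_prop) (fun w hw => ⟨hp, hw, by simpa using hδ⟩)
  · rw [squareScaled_zero, squareScaled_zero, h.homogeneous hδ hp hw]
    ring

/-! ### Smooth cutoffs -/

/-- The integral of `f²` with a smooth cutoff of size `r` around the moving points. -/
noncomputable def cutIntegral (z : Fin N → P → Space) (f : P × Space → ℝ) (r : ℝ) (p : P) : ℝ :=
  ∫ x, cut z r (p, x) * f (p, x) ^ 2

theorem SeparatedPoints.exists_far (hs : SeparatedPoints U z δ) :
    ∃ R, 0 < R ∧ ∀ p ∈ U, ∀ n, ∀ x : Space, R ≤ ‖x‖ → 2 * δ ≤ ‖x - z n p‖ := by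
  have : ∀ n, ∃ C, ∀ p ∈ U, ‖z n p‖ ≤ C := fun n =>
    hs.compact.exists_bound_of_continuousOn (hs.continuousOn n)
  choose C hC using this
  refine ⟨∑ n, |C n| + 2 * δ, by have := hs.pos; positivity, fun p hp n x hx => ?_⟩
  have h1 : |C n| ≤ ∑ n, |C n| :=
    Finset.single_le_sum (f := fun n => |C n|) (fun _ _ => abs_nonneg _) (Finset.mem_univ n)
  have h2 := norm_sub_norm_le x (z n p)
  have h3 := (hC n p hp).trans (le_abs_self _)
  linarith

theorem SeparatedPoints.decays_cut_mul (hs : SeparatedPoints U z δ) {r : ℝ} (hr : 0 < r)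
    (hr' : r ≤ δ) {j : ℕ} {g : P × Space → ℝ} (hg : DecaysLike U j g) :
    DecaysLike U j (fun x => cut z r x * g x) := by
  obtain ⟨R, hR, h⟩ := hs.exists_far
  refine hg.congr ⟨R, fun p hp x hx => ?_⟩
  rw [cut_eq_one hr, one_mul]
  intro n
  have := h p hp n x hx
  linarith [hs.pos]

theorem SingularFunction.contDiffOn_cut_sq (hs : SeparatedPoints U z δ) {f : P × Space → ℝ}
    (hf : ContDiffOn ℝ ∞ f (offLines U z)) {r : ℝ} (hr : 0 < r) (hr' : r ≤ δ) :
    ContDiffOn ℝ ∞ (fun x => cut z r x * f x ^ 2) (U ×ˢ univ) :=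
  hs.contDiffOn_cut_mul hr hr' (hf.pow 2)

theorem DecaysLike.sq {j : ℕ} {f : P × Space → ℝ} (hf : DecaysLike U j f) :
    DecaysLike U (j + j) (fun x => f x ^ 2) := by
  simpa only [pow_two] using hf.mul hf

section CutIntegral

variable {f : P × Space → ℝ} {Φ : Fin N → P × (ℝ × Space) → ℝ} {φ : Fin N → P × Space → ℝ}

theorem SingularFunction.integrable_cut_sq (hs : SeparatedPoints U z δ)
    (hf : SingularFunction U z δ 2 f Φ φ) (hd : DecaysLike U 2 f) {r : ℝ} (hr : 0 < r)
    (hr' : r ≤ δ) {p : P} (hp : p ∈ U) : Integrable fun x => cut z r (p, x) * f (p, x) ^ 2 :=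
  (hs.decays_cut_mul hr hr' hd.sq).integrable hs.compact (by norm_num)
    (SingularFunction.contDiffOn_cut_sq hs hf.smooth_off hr hr').continuousOn hp

theorem SingularFunction.continuousOn_cutIntegral (hs : SeparatedPoints U z δ)
    (hf : SingularFunction U z δ 2 f Φ φ) (hd : DecaysLike U 2 f) {r : ℝ} (hr : 0 < r)
    (hr' : r ≤ δ) : ContinuousOn (cutIntegral z f r) U :=
  (hs.decays_cut_mul hr hr' hd.sq).continuousOn_integral hs.compact (by norm_num)
    (SingularFunction.contDiffOn_cut_sq hs hf.smooth_off hr hr').continuousOn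

theorem IsExpansion.weight_sq_scaled {z : P → Space} {Φ : P × (ℝ × Space) → ℝ}
    {φ : P × Space → ℝ} (h : IsExpansion U z δ 2 f Φ φ) {m : Space → ℝ}
    (h0 : ∀ w, w ∉ annulus → m w = 0) {r : ℝ} (hr : 0 < r) (hr' : r < δ) {p : P} (hp : p ∈ U)
    (w : Space) : m w * f (p, z p + r • w) ^ 2 =
      (r ^ 4)⁻¹ * (m w * squareScaled Φ φ (p, r, w)) := by
  by_cases hw : w ∈ annulus
  · rw [h.sq_eq hp hr (mem_scaleDomain_of_annulus (by rwa [abs_of_pos hr]) hw)]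
    ring
  · rw [h0 w hw]; ring

theorem IsExpansion.integrable_weight_sq {z : P → Space} {Φ : P × (ℝ × Space) → ℝ}
    {φ : P × Space → ℝ} (h : IsExpansion U z δ 2 f Φ φ) {m : Space → ℝ} {M : ℝ}
    (hm : Measurable m) (hM : ∀ w, |m w| ≤ M) (h0 : ∀ w, w ∉ annulus → m w = 0) {r : ℝ}
    (hr : 0 < r) (hr' : r < δ) {p : P} (hp : p ∈ U) :
    Integrable (fun x => m (r⁻¹ • (x - z p)) * f (p, x) ^ 2) := by
  refine integrable_scaled_mul (f := fun x => f (p, x) ^ 2) (z p) hr ?_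
  simp only [h.weight_sq_scaled h0 hr hr' hp]
  exact (integrable_weight hm hM h0 (continuousOn_slice_annulus
    (contDiffOn_squareScaled h.smooth_sing h.smooth_reg).continuousOn hp
    (by rwa [abs_of_pos hr]))).const_mul _

theorem IsExpansion.integral_weight_sq {z : P → Space} {Φ : P × (ℝ × Space) → ℝ}
    {φ : P × Space → ℝ} (h : IsExpansion U z δ 2 f Φ φ) {m : Space → ℝ}
    (h0 : ∀ w, w ∉ annulus → m w = 0) {r : ℝ} (hr : 0 < r) (hr' : r < δ) {p : P} (hp : p ∈ U) :
    ∫ x, m (r⁻¹ • (x - z p)) * f (p, x) ^ 2 =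
      r⁻¹ * ∫ w, m w * squareScaled Φ φ (p, r, w) := by
  rw [integral_scaled_mul m (fun x => f (p, x) ^ 2) (z p) hr]
  simp only [h.weight_sq_scaled h0 hr hr' hp]
  rw [integral_const_mul, ← mul_assoc]
  congr 1
  field_simp

/-- In the variable `(x - z)/r` the difference of two cutoffs at comparable scales is `profileDiff
(r / r')`. The powers of the scale are `r³` from the volume and `r⁻⁴` from the square. -/
theorem SingularFunction.cutIntegral_sub (hs : SeparatedPoints U z δ)
    (hf : SingularFunction U z δ 2 f Φ φ) (hd : DecaysLike U 2 f) {r r' : ℝ} (hr' : 0 < r')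
    (h1 : r / 2 ≤ r') (h2 : r' ≤ r) (h3 : r < δ) {p : P} (hp : p ∈ U) :
    cutIntegral z f r p - cutIntegral z f r' p =
      ∑ n, r⁻¹ * ∫ w, profileDiff (r / r') w * squareScaled (Φ n) (φ n) (p, r, w) := by
  have hr : 0 < r := hr'.trans_le h2
  have hs1 : 1 ≤ r / r' := (one_le_div hr').2 h2
  have hs2 : r / r' ≤ 2 := (div_le_iff₀ hr').2 (by linarith)
  rw [cutIntegral, cutIntegral, ← integral_sub (hf.integrable_cut_sq hs hd hr h3.le hp)
    (hf.integrable_cut_sq hs hd hr' (h2.trans h3.le) hp)]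
  have hint : ∀ n, Integrable fun x =>
      profileDiff (r / r') (r⁻¹ • (x - z n p)) * f (p, x) ^ 2 := fun n =>
    (hf.expansion n).integrable_weight_sq (profileDiff_measurable _) (abs_profileDiff_le _)
      (fun w hw => profileDiff_eq_zero hs1 hs2 hw) hr h3 hp
  simp only [← (hf.expansion _).integral_weight_sq
    (fun w hw => profileDiff_eq_zero hs1 hs2 hw) hr h3 hp]
  rw [← integral_finsetSum _ fun n _ => hint n]
  refine integral_congr_ae (Eventually.of_forall fun x => ?_)
  dsimp only
  rw [← sub_mul, ← Finset.sum_mul]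
  congr 1
  simp only [cut, profileDiff, Finset.sum_sub_distrib]
  have : ∀ y : Space, (r / r') • r⁻¹ • y = r'⁻¹ • y := fun y => by
    rw [smul_smul]; congr 1; field_simp
  simp only [this]
  ring

/-- In each local difference, with its prefactor `r⁻¹`, the term of order zero vanishes by the
normalization of the profile and the term of order one by parity. What remains is `r⁻¹ O(r²)`, and
the dyadic sum removes the restriction to comparable scales. -/
theorem SingularFunction.exists_cutIntegral_bound (hs : SeparatedPoints U z δ)
    (hf : SingularFunction U z δ 2 f Φ φ) (hd : DecaysLike U 2 f) :
    ∃ C, 0 ≤ C ∧ ∀ p ∈ U, ∀ r r', 0 < r' → r' ≤ r → r < δ / 2 →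
      |cutIntegral z f r' p - cutIntegral z f r p| ≤ C * r := by
  have hδ := hs.pos
  have : ∀ n, _ := fun n => (hf.expansion n).exists_square_bound hs.compact hs.unique
    (show δ / 2 < δ by linarith)
  choose C hC0 hC using this
  refine ⟨2 * ∑ n, 4 * C n * volume.real annulus, mul_nonneg zero_le_two (Finset.sum_nonneg
    fun n _ => mul_nonneg (mul_nonneg zero_le_four (hC0 n)) measureReal_nonneg), fun p hp => ?_⟩
  refine dyadic_bound (f := fun r => cutIntegral z f r p) fun r r' hr' h1 h2 h3 => ?_
  have hr : 0 < r := hr'.trans_le h2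
  have h3' : r < δ := by linarith
  have hs1 : 1 ≤ r / r' := (one_le_div hr').2 h2
  have hs2 : r / r' ≤ 2 := (div_le_iff₀ hr').2 (by linarith)
  rw [abs_sub_comm, hf.cutIntegral_sub hs hd hr' h1 h2 h3' hp, Finset.sum_mul]
  refine (Finset.abs_sum_le_sum_abs _ _).trans (Finset.sum_le_sum fun n _ => ?_)
  have hsq := (contDiffOn_squareScaled (hf.expansion n).smooth_sing
    (hf.expansion n).smooth_reg).continuousOn
  have h4 := abs_even_integral_sub_le (profileDiff_measurable _) (abs_profileDiff_le _) zero_le_four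
    (fun w hw => profileDiff_eq_zero hs1 hs2 hw) (profileDiff_neg (r / r'))
    (continuousOn_slice_annulus hsq hp (r := r) (by rwa [abs_of_pos hr]))
    (continuousOn_slice_annulus hsq hp (r := 0) (by simpa using hδ))
    (fun w hw => hC n p hp r hr.le h3.le w hw)
  rw [(hf.expansion n).integral_profileDiff_square_zero hδ hp hs1 hs2, sub_zero] at h4
  rw [abs_mul, abs_of_pos (inv_pos.2 hr)]
  calc r⁻¹ * _ ≤ r⁻¹ * (4 * (C n * r ^ 2) * volume.real annulus) := by gcongr
    _ = _ := by field_simp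

/-- The limit of the smoothly cut off integrals of `f²`. -/
theorem SingularFunction.exists_cutIntegral_limit (hs : SeparatedPoints U z δ)
    (hf : SingularFunction U z δ 2 f Φ φ) (hd : DecaysLike U 2 f) :
    ∃ (b : P → ℝ) (C : ℝ), 0 ≤ C ∧ ∀ p ∈ U, ∀ r, 0 < r → r < δ / 2 →
      |cutIntegral z f r p - b p| ≤ C * r := by
  obtain ⟨C, hC0, hC⟩ := hf.exists_cutIntegral_bound hs hd
  have hδ := hs.pos
  have : ∀ p, ∃ b, p ∈ U → ∀ r, 0 < r → r < δ / 2 → |cutIntegral z f r p - b| ≤ C * r := by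
    intro p
    by_cases hp : p ∈ U
    · obtain ⟨b, hb⟩ := exists_limit_of_dyadic (f := fun r => cutIntegral z f r p)
        (half_pos hδ) (hC p hp)
      exact ⟨b, fun _ => hb⟩
    · exact ⟨0, fun h => absurd h hp⟩
  choose b hb using this
  exact ⟨b, C, hC0, fun p hp => hb p hp⟩

/-- The difference of the smooth and the sharp cutoff of size one. -/
noncomputable def sharpDiff (w : Space) : ℝ := profile w - (Metric.closedBall (0 : Space) 1).indicator 1 w

theorem sharpDiff_measurable : Measurable sharpDiff :=
  profile_contDiff.continuous.measurable.sub
    (measurable_one.indicator Metric.isClosed_closedBall.measurableSet)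

theorem sharpDiff_neg (w : Space) : sharpDiff (-w) = sharpDiff w := by
  simp [sharpDiff, profile_neg, indicator]

theorem abs_sharpDiff_le (w : Space) : |sharpDiff w| ≤ 3 := by
  have h1 := abs_le.1 (abs_profile_le w)
  rw [sharpDiff, abs_le]
  by_cases h : w ∈ Metric.closedBall (0 : Space) 1
  · rw [indicator_of_mem h, Pi.one_apply]; constructor <;> linarith [h1.1, h1.2]
  · rw [indicator_of_notMem h]; constructor <;> linarith [h1.1, h1.2]

theorem sharpDiff_eq_zero {w : Space} (hw : w ∉ annulus) : sharpDiff w = 0 := by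
  have h3 : ‖w‖ < 1 / 8 ∨ 1 < ‖w‖ := by
    by_contra hc
    push Not at hc
    exact hw hc
  rcases h3 with h3 | h3
  · rw [sharpDiff, profile_eq_one (by linarith), indicator_of_mem (by simp; linarith), Pi.one_apply,
      sub_self]
  · rw [sharpDiff, profile_eq_zero h3.le, indicator_of_notMem (by simpa using h3), sub_self]

theorem SeparatedPoints.indicator_cutoffRegion (hs : SeparatedPoints U z δ) {r : ℝ} (hr : 0 < r)
    (hr' : r < δ) {p : P} (hp : p ∈ U) (x : Space) :
    (cutoffRegion (fun n => z n p) r).indicator 1 x =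
      cut z r (p, x) + ∑ n, sharpDiff (r⁻¹ • (x - z n p)) := by
  have hmem : ∀ n, r⁻¹ • (x - z n p) ∈ Metric.closedBall (0 : Space) 1 ↔ ‖x - z n p‖ ≤ r := by
    intro n
    rw [mem_closedBall_zero_iff, norm_smul, norm_inv, Real.norm_of_nonneg hr.le, ← div_eq_inv_mul,
      div_le_one hr]
  have key : (cutoffRegion (fun n => z n p) r).indicator (1 : Space → ℝ) x =
      1 - ∑ n, (Metric.closedBall (0 : Space) 1).indicator (1 : Space → ℝ) (r⁻¹ • (x - z n p)) := by
    by_cases hx : ∀ n, r < ‖x - z n p‖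
    · rw [indicator_of_mem (show x ∈ cutoffRegion _ r from hx), Finset.sum_eq_zero, sub_zero,
        Pi.one_apply]
      intro n _
      exact indicator_of_notMem (by rw [hmem]; exact not_le.2 (hx n)) _
    · rw [indicator_of_notMem (show x ∉ cutoffRegion _ r from hx)]
      push Not at hx
      obtain ⟨n, hn⟩ := hx
      rw [Finset.sum_eq_single n, indicator_of_mem ((hmem n).2 hn), Pi.one_apply, sub_self]
      · intro m _ hm
        refine indicator_of_notMem ?_ _
        rw [hmem, not_le]
        exact hr'.trans_le (hs.le_norm_sub (x := (p, x)) le_rfl hp (hn.trans_lt hr') hm)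
      · simp
  rw [key, cut]
  simp only [sharpDiff, Finset.sum_sub_distrib]
  ring

theorem SingularFunction.sharp_integral (hs : SeparatedPoints U z δ)
    (hf : SingularFunction U z δ 2 f Φ φ) (hd : DecaysLike U 2 f) {r : ℝ} (hr : 0 < r)
    (hr' : r < δ) {p : P} (hp : p ∈ U) :
    IntegrableOn (fun x => f (p, x) ^ 2) (cutoffRegion (fun n => z n p) r) ∧
    ∫ x in cutoffRegion (fun n => z n p) r, f (p, x) ^ 2 = cutIntegral z f r p +
      ∑ n, r⁻¹ * ∫ w, sharpDiff w * squareScaled (Φ n) (φ n) (p, r, w) := by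
  have hmeas : MeasurableSet (cutoffRegion (fun n => z n p) r) := by
    have : cutoffRegion (fun n => z n p) r = ⋂ n, {x | r < ‖x - z n p‖} := by
      ext x; simp [cutoffRegion]
    rw [this]
    exact MeasurableSet.iInter fun n => (isOpen_lt continuous_const (by fun_prop)).measurableSet
  have hint : ∀ n, Integrable fun x => sharpDiff (r⁻¹ • (x - z n p)) * f (p, x) ^ 2 := fun n =>
    (hf.expansion n).integrable_weight_sq sharpDiff_measurable abs_sharpDiff_le
      (fun w hw => sharpDiff_eq_zero hw) hr hr' hp
  have hcut := hf.integrable_cut_sq hs hd hr hr'.le hp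
  have hsum : Integrable fun x => ∑ n, sharpDiff (r⁻¹ • (x - z n p)) * f (p, x) ^ 2 :=
    integrable_finsetSum _ fun n _ => hint n
  have hind : (cutoffRegion (fun n => z n p) r).indicator (fun x => f (p, x) ^ 2) = fun x =>
      cut z r (p, x) * f (p, x) ^ 2 + ∑ n, sharpDiff (r⁻¹ • (x - z n p)) * f (p, x) ^ 2 := by
    ext x
    rw [← Finset.sum_mul, ← add_mul, ← hs.indicator_cutoffRegion hr hr' hp x]
    by_cases hx : x ∈ cutoffRegion (fun n => z n p) r <;> simp [hx]
  constructor
  · rw [← integrable_indicator_iff hmeas, hind]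
    exact hcut.add hsum
  · rw [← integral_indicator hmeas, hind, integral_add hcut hsum,
      integral_finsetSum _ fun n _ => hint n]
    congr 1
    refine Finset.sum_congr rfl fun n _ => ?_
    exact (hf.expansion n).integral_weight_sq (fun w hw => sharpDiff_eq_zero hw) hr hr' hp

theorem hasRLim_of_bound {F : ℝ → ℝ} {a b C r₀ : ℝ} (hr₀ : 0 < r₀)
    (h : ∀ r, 0 < r → r < r₀ → |F r - (a / r + b)| ≤ C * r) : HasRLim F b := by
  refine ⟨a, Asymptotics.IsBigO.of_bound C ?_⟩
  filter_upwards [Ioo_mem_nhdsGT hr₀] with r hr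
  rw [Real.norm_eq_abs, Real.norm_eq_abs, abs_of_pos hr.1]
  exact h r hr.1 hr.2

theorem HasRLim.rLim_eq {F : ℝ → ℝ} {b : ℝ} (h : HasRLim F b) : rLim F = b := by
  have hex : ∃ b, HasRLim F b := ⟨b, h⟩
  rw [rLim, dif_pos hex]
  exact hex.choose_spec.unique h

/-- Passing from the smooth to the sharp cutoff changes the integral by `a / r + O(r)`: the leading
coefficient of the square produces `a`, and parity removes the term of order zero in `r`. So the
renormalized integral is the limit `b` of the smooth cutoffs. -/
theorem SingularFunction.hasRLim_sharp (hs : SeparatedPoints U z δ)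
    (hf : SingularFunction U z δ 2 f Φ φ) (hd : DecaysLike U 2 f) {p : P} (hp : p ∈ U) {b C : ℝ}
    (hb : ∀ r, 0 < r → r < δ / 2 → |cutIntegral z f r p - b| ≤ C * r) :
    HasRLim (fun r => ∫ x in cutoffRegion (fun n => z n p) r, f (p, x) ^ 2) b := by
  have hδ := hs.pos
  have : ∀ n, _ := fun n => (hf.expansion n).exists_square_bound hs.compact hs.unique
    (show δ / 2 < δ by linarith)
  choose C' hC0 hC' using this
  refine hasRLim_of_bound (half_pos hδ)
    (a := ∑ n, ∫ w, sharpDiff w * squareScaled (Φ n) (φ n) (p, 0, w))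
    (C := C + ∑ n, 3 * C' n * volume.real annulus) fun r hr hr2 => ?_
  have hr' : r < δ := by linarith
  rw [(hf.sharp_integral hs hd hr hr' hp).2]
  have h1 := hb r hr hr2
  have h2 : |∑ n, (r⁻¹ * (∫ w, sharpDiff w * squareScaled (Φ n) (φ n) (p, r, w)) -
      r⁻¹ * ∫ w, sharpDiff w * squareScaled (Φ n) (φ n) (p, 0, w))| ≤
      ∑ n, 3 * C' n * volume.real annulus * r := by
    refine (Finset.abs_sum_le_sum_abs _ _).trans (Finset.sum_le_sum fun n _ => ?_)
    have hsq := (contDiffOn_squareScaled (hf.expansion n).smooth_sing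
      (hf.expansion n).smooth_reg).continuousOn
    have h4 := abs_even_integral_sub_le sharpDiff_measurable abs_sharpDiff_le zero_le_three
      (fun w hw => sharpDiff_eq_zero hw) sharpDiff_neg
      (continuousOn_slice_annulus hsq hp (r := r) (by rwa [abs_of_pos hr]))
      (continuousOn_slice_annulus hsq hp (r := 0) (by simpa using hδ))
      (fun w hw => hC' n p hp r hr.le hr2.le w hw)
    rw [← mul_sub, abs_mul, abs_of_pos (inv_pos.2 hr)]
    calc r⁻¹ * _ ≤ r⁻¹ * (3 * (C' n * r ^ 2) * volume.real annulus) := by gcongr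
      _ = _ := by field_simp
  rw [Finset.sum_sub_distrib, ← Finset.mul_sum, ← Finset.mul_sum, ← Finset.sum_mul] at h2
  rw [← Finset.mul_sum, div_eq_inv_mul, add_mul]
  refine le_trans (le_of_eq ?_) ((abs_add_le _ _).trans (add_le_add h1 h2))
  congr 1
  ring

end CutIntegral

end

section

section General
variable {P : Type} [NormedAddCommGroup P] [NormedSpace ℝ P]
variable {N : ℕ} {U : Set P} {z : Fin N → P → Space} {δ : ℝ}

/-! ### Derivatives of cut off functions -/

theorem fderiv_profile_eq_zero {w : Space} (hw : w ∉ annulus) : fderiv ℝ profile w = 0 := by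
  have h3 : ‖w‖ < 1 / 8 ∨ 1 < ‖w‖ := by
    by_contra hc
    push Not at hc
    exact hw hc
  rcases h3 with h3 | h3
  · have : profile =ᶠ[𝓝 w] fun _ => 1 := by
      filter_upwards [continuous_norm.continuousAt.eventually (gt_mem_nhds h3)] with y hy
      exact profile_eq_one (by linarith)
    rw [this.fderiv_eq]
    simp
  · have : profile =ᶠ[𝓝 w] fun _ => 0 := by
      filter_upwards [continuous_norm.continuousAt.eventually (lt_mem_nhds h3)] with y hy
      exact profile_eq_zero hy.le
    rw [this.fderiv_eq]
    simp

theorem fderivWithin_cut (hU : UniqueDiffOn ℝ U) (hz : ∀ n, ContDiffOn ℝ ∞ (z n) U) (r : ℝ)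
    {x : P × Space} (hx : x.1 ∈ U) (v : P × Space) :
    fderivWithin ℝ (cut z r) (U ×ˢ univ) x v =
      -∑ n, r⁻¹ * fderiv ℝ profile (r⁻¹ • (x.2 - z n x.1))
        (v.2 - fderivWithin ℝ (z n) U x.1 v.1) := by
  have hxU : x ∈ U ×ˢ (univ : Set Space) := ⟨hx, mem_univ _⟩
  have h1 : ∀ n, HasFDerivWithinAt (fun x : P × Space => profile (r⁻¹ • (x.2 - z n x.1)))
      ((fderiv ℝ profile (r⁻¹ • (x.2 - z n x.1))).comp
        (r⁻¹ • (ContinuousLinearMap.snd ℝ P Space -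
          (fderivWithin ℝ (z n) U x.1).comp (ContinuousLinearMap.fst ℝ P Space))))
      (U ×ˢ univ) x := by
    intro n
    have hzd : HasFDerivWithinAt (fun x : P × Space => z n x.1)
        ((fderivWithin ℝ (z n) U x.1).comp (ContinuousLinearMap.fst ℝ P Space)) (U ×ˢ univ) x :=
      HasFDerivWithinAt.comp (t := U) x
        ((((hz n).differentiableOn (by simp)) x.1 hx).hasFDerivWithinAt)
        hasFDerivWithinAt_fst (fun y hy => hy.1)
    have hp := ((profile_contDiff.differentiable (by simp)) (r⁻¹ • (x.2 - z n x.1))).hasFDerivAt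
    exact hp.comp_hasFDerivWithinAt x ((hasFDerivWithinAt_snd.sub hzd).const_smul r⁻¹)
  have h2 := (HasFDerivWithinAt.fun_sum (u := Finset.univ) fun n _ => h1 n).const_sub 1
  have h3 : HasFDerivWithinAt (cut z r) _ (U ×ˢ univ) x := h2
  rw [h3.fderivWithin ((hU.prod uniqueDiffOn_univ) x hxU)]
  simp

theorem SeparatedPoints.hasFDerivWithinAt_off (hs : SeparatedPoints U z δ) {g : P × Space → ℝ}
    (hg : ContDiffOn ℝ ∞ g (offLines U z)) {x : P × Space} (hx : x ∈ offLines U z) :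
    HasFDerivWithinAt g (fderivWithin ℝ g (offLines U z) x) (U ×ˢ univ) x :=
  ((hg.differentiableOn (by simp)) x hx).hasFDerivWithinAt.mono_of_mem_nhdsWithin
    (offLines_mem_nhdsWithin hs.continuousOn hx)

theorem SeparatedPoints.fderivWithin_cut_mul (hs : SeparatedPoints U z δ) (r : ℝ)
    {g : P × Space → ℝ} (hg : ContDiffOn ℝ ∞ g (offLines U z)) {x : P × Space}
    (hx : x ∈ offLines U z) (v : P × Space) :
    fderivWithin ℝ (fun x => cut z r x * g x) (U ×ˢ univ) x v =
      cut z r x * fderivWithin ℝ g (offLines U z) x v +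
        fderivWithin ℝ (cut z r) (U ×ˢ univ) x v * g x := by
  have h1 := hs.hasFDerivWithinAt_off hg hx
  have h2 := (((contDiffOn_cut hs.smooth r).differentiableOn (by simp)) x
    (offLines_subset hx)).hasFDerivWithinAt
  rw [(h2.fun_mul h1).fderivWithin ((hs.unique.prod uniqueDiffOn_univ) x (offLines_subset hx))]
  simp [mul_comm]

theorem SeparatedPoints.fderivWithin_sq (hs : SeparatedPoints U z δ) {f : P × Space → ℝ}
    (hf : ContDiffOn ℝ ∞ f (offLines U z)) {x : P × Space} (hx : x ∈ offLines U z)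
    (v : P × Space) :
    fderivWithin ℝ (fun x => f x ^ 2) (offLines U z) x v =
      2 * f x * fderivWithin ℝ f (offLines U z) x v := by
  have h1 := ((hf.differentiableOn (by simp)) x hx).hasFDerivWithinAt
  rw [(h1.pow 2).fderivWithin (hs.uniqueDiffOn_offLines x hx)]
  simp

theorem SeparatedPoints.fderivWithin_cut_far (hs : SeparatedPoints U z δ) :
    ∃ R, 0 < R ∧ ∀ r, 0 < r → r ≤ δ → ∀ p ∈ U, ∀ x : Space, R ≤ ‖x‖ → cut z r (p, x) = 1 ∧
      (p, x) ∈ offLines U z ∧ ∀ v, fderivWithin ℝ (cut z r) (U ×ˢ univ) (p, x) v = 0 := by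
  obtain ⟨R, hR, h⟩ := hs.exists_far
  refine ⟨R, hR, fun r hr hr' p hp x hx => ⟨cut_eq_one hr fun n => ?_, ⟨hp, fun n hn => ?_⟩,
    fun v => ?_⟩⟩
  · have := h p hp n x hx
    dsimp only
    linarith
  · have h1 := h p hp n x hx
    have hn' : x = z n p := hn
    rw [hn', sub_self, norm_zero] at h1
    linarith [hs.pos]
  · rw [fderivWithin_cut hs.unique hs.smooth r hp, neg_eq_zero]
    refine Finset.sum_eq_zero fun n _ => ?_
    rw [fderiv_profile_eq_zero]
    · simp
    · intro hmem
      have h1 := hmem.2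
      have h2 := h p hp n x hx
      rw [norm_smul, norm_inv, Real.norm_of_nonneg hr.le, ← div_eq_inv_mul, div_le_one hr] at h1
      dsimp only at h1
      linarith [hs.pos]

theorem SeparatedPoints.decays_fderivWithin_cut_mul (hs : SeparatedPoints U z δ) {r : ℝ}
    (hr : 0 < r) (hr' : r ≤ δ) {g : P × Space → ℝ} (hg : ContDiffOn ℝ ∞ g (offLines U z))
    {j : ℕ} {v : P × Space}
    (hd : DecaysLike U j (fun x => fderivWithin ℝ g (offLines U z) x v)) :
    DecaysLike U j (fun x => fderivWithin ℝ (fun x => cut z r x * g x) (U ×ˢ univ) x v) := by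
  obtain ⟨R, hR, h⟩ := hs.fderivWithin_cut_far
  refine hd.congr ⟨R, fun p hp x hx => ?_⟩
  obtain ⟨h1, h2, h3⟩ := h r hr hr' p hp x hx
  rw [hs.fderivWithin_cut_mul r hg h2, h1, h3]
  ring

theorem SeparatedPoints.decays_fderivWithin_sq (hs : SeparatedPoints U z δ) {f : P × Space → ℝ}
    (hf : ContDiffOn ℝ ∞ f (offLines U z)) {v : P × Space} (hd : DecaysLike U 2 f)
    (hd' : DecaysLike U 2 (fun x => fderivWithin ℝ f (offLines U z) x v)) :
    DecaysLike U 4 (fun x => fderivWithin ℝ (fun x => f x ^ 2) (offLines U z) x v) := by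
  obtain ⟨R, hR, h⟩ := hs.fderivWithin_cut_far
  have h4 := (hd.mul hd').linear_comb (hd.mul hd') 2 0
  refine h4.congr ⟨R, fun p hp x hx => ?_⟩
  obtain ⟨h1, h2, h3⟩ := h δ hs.pos le_rfl p hp x hx
  rw [hs.fderivWithin_sq hf h2]
  ring

end General

/-! ### Families of configurations -/

/-- The range of the pairs (variation parameter, time). -/
def slab (η ta tb : ℝ) : Set (ℝ × ℝ) := Icc (-η) η ×ˢ Icc ta tb

variable {η ta tb : ℝ}

theorem isCompact_slab : IsCompact (slab η ta tb) := isCompact_Icc.prod isCompact_Icc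

theorem uniqueDiffOn_slab (hη : 0 < η) (ht : ta < tb) : UniqueDiffOn ℝ (slab η ta tb) :=
  (uniqueDiffOn_Icc (by linarith)).prod (uniqueDiffOn_Icc ht)

theorem hasDerivWithinAt_eps {F : Type*} [NormedAddCommGroup F] [NormedSpace ℝ F] {O : Set F}
    {f : (ℝ × ℝ) × F → ℝ} (hf : ContDiffOn ℝ ∞ f (slab η ta tb ×ˢ O)) {ε t : ℝ} {q : F}
    (hε : ε ∈ Icc (-η) η) (ht : t ∈ Icc ta tb) (hq : q ∈ O) :
    HasDerivWithinAt (fun e => f ((e, t), q))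
      (fderivWithin ℝ f (slab η ta tb ×ˢ O) ((ε, t), q) ((1, 0), 0)) (Icc (-η) η) ε := by
  have hc : HasDerivAt (fun e : ℝ => (((e, t), q) : (ℝ × ℝ) × F)) ((1, 0), 0) ε :=
    ((hasDerivAt_id ε).prodMk (hasDerivAt_const ε t)).prodMk (hasDerivAt_const ε q)
  exact hf.hasDerivWithinAt_comp_curve (c := fun e => ((e, t), q)) hc.hasDerivWithinAt
    (fun e he => ⟨⟨he, ht⟩, hq⟩) ⟨⟨hε, ht⟩, hq⟩

theorem abs_sub_le_of_eps_bound {F : Type*} [NormedAddCommGroup F] [NormedSpace ℝ F] {G G' : ℝ → ℝ}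
    {C : ℝ} (hG : ∀ ε ∈ Icc (-η) η, HasDerivWithinAt G (G' ε) (Icc (-η) η) ε)
    (hC : ∀ ε ∈ Icc (-η) η, |G' ε| ≤ C) {ε ε' : ℝ} (hε : ε ∈ Icc (-η) η) (hε' : ε' ∈ Icc (-η) η) :
    |G ε' - G ε| ≤ C * |ε' - ε| :=
  (convex_Icc (-η) η).norm_image_sub_le_of_norm_hasDerivWithin_le hG hC hε hε'

variable {N : ℕ} {z : Fin N → ℝ × ℝ → Space} {δ : ℝ}

/-- The even bound is applied to the derivative in `ε` and integrated along `ε`, so that the error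
acquires the factor `|ε' - ε|`. -/
theorem IsExpansion.exists_square_bound_eps (hη : 0 < η) (ht : ta < tb) {r0 : ℝ}
    (hr0 : r0 < δ) {z : ℝ × ℝ → Space} {f : (ℝ × ℝ) × Space → ℝ}
    {Φ : (ℝ × ℝ) × (ℝ × Space) → ℝ}
    {φ : (ℝ × ℝ) × Space → ℝ} (h : IsExpansion (slab η ta tb) z δ 2 f Φ φ) :
    ∃ C, 0 ≤ C ∧ ∀ ε ∈ Icc (-η) η, ∀ ε' ∈ Icc (-η) η, ∀ t ∈ Icc ta tb,
      ∀ r, 0 ≤ r → r ≤ r0 → ∀ w ∈ annulus,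
      |squareScaled Φ φ ((ε', t), r, w) - squareScaled Φ φ ((ε, t), r, w)
        + (squareScaled Φ φ ((ε', t), r, -w) - squareScaled Φ φ ((ε, t), r, -w))
        - 2 * (squareScaled Φ φ ((ε', t), 0, w) - squareScaled Φ φ ((ε, t), 0, w))| ≤
        C * |ε' - ε| * r ^ 2 := by
  have hU := uniqueDiffOn_slab hη ht
  have hD := hU.prod_isOpen (isOpen_scaleDomain δ)
  set E : (ℝ × ℝ) × (ℝ × Space) → ℝ := fun x => Φ x ^ 2 with hEdef
  set M : (ℝ × ℝ) × (ℝ × Space) → ℝ :=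
    fun x => 2 * Φ x * regScaled φ x + x.2.1 ^ 2 * regScaled φ x ^ 2 with hMdef
  have hE : ContDiffOn ℝ ∞ E (slab η ta tb ×ˢ scaleDomain δ) := h.smooth_sing.pow 2
  have hM := contDiffOn_squareRemainder h.smooth_sing h.smooth_reg
  have hE' := hE.fderivWithin_apply_vec hD (contDiffOn_const (c := (((1, 0), 0) : (ℝ × ℝ) × (ℝ × Space))))
  have hM' := hM.fderivWithin_apply_vec hD (contDiffOn_const (c := (((1, 0), 0) : (ℝ × ℝ) × (ℝ × Space))))
  obtain ⟨C, hC0, hC⟩ := exists_almost_even_bound isCompact_slab hU hr0 hE' hM'.continuousOn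
    -- The direction of `ε` does not involve `(r, w)`, so the `ε`-derivative of the even function
    -- `E` is again even.
    (fun p hp q hq => by
      have := fderivWithin_flip hU hE (c := 1)
        (fun p hp q hq => by rw [one_mul]; exact h.sq_even p hp q hq) hp hq (1, 0) 0
      simpa using this)
  refine ⟨C, hC0, fun ε hε ε' hε' t ht r hr hr' w hw => ?_⟩
  have hmem : ∀ w ∈ annulus, (r, w) ∈ scaleDomain δ := fun w hw =>
    mem_scaleDomain_of_annulus (by rw [abs_of_nonneg hr]; linarith) hw
  have hmem0 : (0, w) ∈ scaleDomain δ :=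
    mem_scaleDomain_of_annulus (by rw [abs_zero]; linarith) hw
  have key := abs_sub_le_of_eps_bound (F := ℝ) (η := η)
    (fun e he => (((hasDerivWithinAt_eps hE he ht (hmem w hw)).fun_add
      ((hasDerivWithinAt_eps hM he ht (hmem w hw)).const_mul (r ^ 2))).fun_add
      ((hasDerivWithinAt_eps hE he ht (hmem (-w) (neg_mem_annulus hw))).fun_add
      ((hasDerivWithinAt_eps hM he ht (hmem (-w) (neg_mem_annulus hw))).const_mul
        (r ^ 2)))).fun_sub ((hasDerivWithinAt_eps hE he ht hmem0).const_mul 2))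
    (fun e he => hC (e, t) ⟨he, ht⟩ r hr hr' w hw) hε hε'
  have e1 : ∀ ε, squareScaled Φ φ ((ε, t), 0, w) = E ((ε, t), 0, w) := fun ε =>
    squareScaled_zero _ _ _ _
  have e2 : ∀ ε w, squareScaled Φ φ ((ε, t), r, w) =
      E ((ε, t), r, w) + r ^ 2 * M ((ε, t), r, w) := fun ε w => rfl
  rw [e1, e1, e2, e2, e2, e2]
  refine le_trans (le_of_eq ?_) (key.trans (le_of_eq (by ring)))
  congr 1
  ring

section
variable {f : (ℝ × ℝ) × Space → ℝ} {Φ : Fin N → (ℝ × ℝ) × (ℝ × Space) → ℝ}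
  {φ : Fin N → (ℝ × ℝ) × Space → ℝ}

/-- The argument for a single parameter is repeated for increments in `ε`. The factor `|ε' - ε|` on
the right is what later gives uniform convergence of the derivatives. -/
theorem SingularFunction.exists_cutIntegral_bound_eps (hη : 0 < η) (ht : ta < tb)
    (hs : SeparatedPoints (slab η ta tb) z δ)
    (hf : SingularFunction (slab η ta tb) z δ 2 f Φ φ) (hd : DecaysLike (slab η ta tb) 2 f) :
    ∃ C, 0 ≤ C ∧ ∀ ε ∈ Icc (-η) η, ∀ ε' ∈ Icc (-η) η, ∀ t ∈ Icc ta tb,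
      ∀ r r', 0 < r' → r' ≤ r → r < δ / 2 →
      |(cutIntegral z f r' (ε', t) - cutIntegral z f r' (ε, t)) -
        (cutIntegral z f r (ε', t) - cutIntegral z f r (ε, t))| ≤ C * |ε' - ε| * r := by
  have hδ := hs.pos
  have : ∀ n, _ := fun n => (hf.expansion n).exists_square_bound_eps hη ht
    (show δ / 2 < δ by linarith)
  choose C hC0 hC using this
  refine ⟨2 * ∑ n, 4 * C n * volume.real annulus, mul_nonneg zero_le_two (Finset.sum_nonneg
    fun n _ => mul_nonneg (mul_nonneg zero_le_four (hC0 n)) measureReal_nonneg),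
    fun ε hε ε' hε' t ht => ?_⟩
  rw [mul_assoc]
  refine dyadic_bound (f := fun r => cutIntegral z f r (ε', t) - cutIntegral z f r (ε, t))
    fun r r' hr' h1 h2 h3 => ?_
  have hp : (ε, t) ∈ slab η ta tb := ⟨hε, ht⟩
  have hp' : (ε', t) ∈ slab η ta tb := ⟨hε', ht⟩
  have hr : 0 < r := hr'.trans_le h2
  have h3' : r < δ := by linarith
  have hs1 : 1 ≤ r / r' := (one_le_div hr').2 h2
  have hs2 : r / r' ≤ 2 := (div_le_iff₀ hr').2 (by linarith)
  have e1 := hf.cutIntegral_sub hs hd hr' h1 h2 h3' hp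
  have e2 := hf.cutIntegral_sub hs hd hr' h1 h2 h3' hp'
  have e3 : (cutIntegral z f r' (ε', t) - cutIntegral z f r' (ε, t)) -
        (cutIntegral z f r (ε', t) - cutIntegral z f r (ε, t)) =
      -((cutIntegral z f r (ε', t) - cutIntegral z f r' (ε', t)) -
        (cutIntegral z f r (ε, t) - cutIntegral z f r' (ε, t))) := by ring
  rw [e3, abs_neg, e1, e2, ← Finset.sum_sub_distrib, Finset.sum_mul, Finset.sum_mul]
  refine (Finset.abs_sum_le_sum_abs _ _).trans (Finset.sum_le_sum fun n _ => ?_)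
  have hsq := (contDiffOn_squareScaled (hf.expansion n).smooth_sing
    (hf.expansion n).smooth_reg).continuousOn
  have hcr : ∀ p ∈ slab η ta tb, _ := fun p hp =>
    continuousOn_slice_annulus hsq hp (r := r) (by rwa [abs_of_pos hr])
  have hc0 : ∀ p ∈ slab η ta tb, _ := fun p hp =>
    continuousOn_slice_annulus hsq hp (r := 0) (by simpa using hδ)
  have h4 := abs_even_integral_sub_le (profileDiff_measurable _) (abs_profileDiff_le _) zero_le_four
    (fun w hw => profileDiff_eq_zero hs1 hs2 hw) (profileDiff_neg (r / r'))
    ((hcr _ hp').sub (hcr _ hp)) ((hc0 _ hp').sub (hc0 _ hp))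
    (fun w hw => hC n ε hε ε' hε' t ht r hr.le h3.le w hw)
  have hi : ∀ p ∈ slab η ta tb, Integrable fun w =>
      profileDiff (r / r') w * squareScaled (Φ n) (φ n) (p, r, w) := fun p hp =>
    integrable_weight (profileDiff_measurable _) (abs_profileDiff_le _)
    (fun w hw => profileDiff_eq_zero hs1 hs2 hw) (hcr p hp)
  have hi0 : ∀ p ∈ slab η ta tb, Integrable fun w =>
      profileDiff (r / r') w * squareScaled (Φ n) (φ n) (p, 0, w) := fun p hp =>
    integrable_weight (profileDiff_measurable _) (abs_profileDiff_le _)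
    (fun w hw => profileDiff_eq_zero hs1 hs2 hw) (hc0 p hp)
  simp only [Pi.sub_apply, mul_sub] at h4
  rw [integral_sub (hi _ hp') (hi _ hp), integral_sub (hi0 _ hp') (hi0 _ hp),
    (hf.expansion n).integral_profileDiff_square_zero hδ hp hs1 hs2,
    (hf.expansion n).integral_profileDiff_square_zero hδ hp' hs1 hs2, sub_zero, sub_zero] at h4
  rw [← mul_sub, abs_mul, abs_of_pos (inv_pos.2 hr)]
  calc r⁻¹ * _ ≤ r⁻¹ * (4 * (C n * |ε' - ε| * r ^ 2) * volume.real annulus) := by gcongr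
    _ = _ := by field_simp

/-- The derivative in `ε` of the cut off square. -/
noncomputable def cutSqD (η ta tb : ℝ) (z : Fin N → ℝ × ℝ → Space) (f : (ℝ × ℝ) × Space → ℝ)
    (r : ℝ) (x : (ℝ × ℝ) × Space) : ℝ :=
  fderivWithin ℝ (fun x => cut z r x * f x ^ 2) (slab η ta tb ×ˢ univ) x ((1, 0), 0)

/-- The derivative in `ε`, off the moving points. -/
noncomputable def epsD (η ta tb : ℝ) (z : Fin N → ℝ × ℝ → Space) (f : (ℝ × ℝ) × Space → ℝ)
    (x : (ℝ × ℝ) × Space) : ℝ :=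
  fderivWithin ℝ f (offLines (slab η ta tb) z) x ((1, 0), 0)

theorem SingularFunction.cutSqD_facts (hη : 0 < η) (ht : ta < tb)
    (hs : SeparatedPoints (slab η ta tb) z δ)
    (hf : SingularFunction (slab η ta tb) z δ 2 f Φ φ) (hd : DecaysLike (slab η ta tb) 2 f)
    (hd' : DecaysLike (slab η ta tb) 2 (epsD η ta tb z f)) {r : ℝ} (hr : 0 < r) (hr' : r ≤ δ) :
    ContinuousOn (cutSqD η ta tb z f r) (slab η ta tb ×ˢ univ) ∧
      DecaysLike (slab η ta tb) 4 (cutSqD η ta tb z f r) :=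
  ⟨((SingularFunction.contDiffOn_cut_sq hs hf.smooth_off hr hr').fderivWithin_apply_vec
    ((uniqueDiffOn_slab hη ht).prod uniqueDiffOn_univ) contDiffOn_const).continuousOn,
  hs.decays_fderivWithin_cut_mul hr hr' (hf.smooth_off.pow 2)
    (hs.decays_fderivWithin_sq hf.smooth_off hd hd')⟩

theorem SingularFunction.hasDerivAt_cutIntegral (hη : 0 < η) (ht : ta < tb)
    (hs : SeparatedPoints (slab η ta tb) z δ)
    (hf : SingularFunction (slab η ta tb) z δ 2 f Φ φ) (hd : DecaysLike (slab η ta tb) 2 f)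
    (hd' : DecaysLike (slab η ta tb) 2 (epsD η ta tb z f)) {r : ℝ} (hr : 0 < r) (hr' : r ≤ δ)
    {ε t : ℝ} (hε : ε ∈ Ioo (-η) η) (ht' : t ∈ Icc ta tb) :
    HasDerivAt (fun e => cutIntegral z f r (e, t)) (∫ x, cutSqD η ta tb z f r ((ε, t), x)) ε := by
  obtain ⟨hc, hdec⟩ := hf.cutSqD_facts hη ht hs hd hd' hr hr'
  obtain ⟨C, hC0, hC⟩ := hdec.exists_bound isCompact_slab hc
  have hq := SingularFunction.contDiffOn_cut_sq hs hf.smooth_off hr hr'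
  have hsub : ∀ e ∈ Ioo (-η) η, (e, t) ∈ slab η ta tb := fun e he => ⟨Ioo_subset_Icc_self he, ht'⟩
  refine (hasDerivAt_integral_of_dominated_loc_of_deriv_le (𝕜 := ℝ) (s := Ioo (-η) η)
    (F := fun e x => cut z r ((e, t), x) * f ((e, t), x) ^ 2)
    (F' := fun e x => cutSqD η ta tb z f r ((e, t), x))
    (bound := fun x => C * ((1 + ‖x‖) ^ 4)⁻¹) (isOpen_Ioo.mem_nhds hε) ?_ ?_ ?_ ?_ ?_ ?_).2
  · filter_upwards [isOpen_Ioo.mem_nhds hε] with e he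
    exact (continuous_slice hq.continuousOn (hsub e he)).aestronglyMeasurable
  · exact hf.integrable_cut_sq hs hd hr hr' (hsub ε hε)
  · exact (continuous_slice hc (hsub ε hε)).aestronglyMeasurable
  · exact Eventually.of_forall fun x e he => hC _ (hsub e he) x
  · exact (integrable_decay (by norm_num)).const_mul C
  · exact Eventually.of_forall fun x e he =>
      (hasDerivWithinAt_eps hq (Ioo_subset_Icc_self he) ht' (mem_univ x)).hasDerivAt
        (Icc_mem_nhds he.1 he.2)

/-- The difference of the cut off integrals at the two scales satisfies a Lipschitz estimate at `ε`
with constant `C r`, which bounds its derivative. The derivative itself, in which the moving cutoff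
is differentiated as well, need not be expanded. -/
theorem SingularFunction.exists_cutSqD_bound (hη : 0 < η) (ht : ta < tb)
    (hs : SeparatedPoints (slab η ta tb) z δ)
    (hf : SingularFunction (slab η ta tb) z δ 2 f Φ φ) (hd : DecaysLike (slab η ta tb) 2 f)
    (hd' : DecaysLike (slab η ta tb) 2 (epsD η ta tb z f)) :
    ∃ C, 0 ≤ C ∧ ∀ ε ∈ Ioo (-η) η, ∀ t ∈ Icc ta tb, ∀ r r', 0 < r' → r' ≤ r → r < δ / 2 →
      |(∫ x, cutSqD η ta tb z f r' ((ε, t), x)) - ∫ x, cutSqD η ta tb z f r ((ε, t), x)| ≤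
        C * r := by
  obtain ⟨C, hC0, hC⟩ := hf.exists_cutIntegral_bound_eps hη ht hs hd
  refine ⟨C, hC0, fun ε hε t ht' r r' hr' h2 h3 => ?_⟩
  have hδ := hs.pos
  have hr : 0 < r := hr'.trans_le h2
  have h4 := (hf.hasDerivAt_cutIntegral hη ht hs hd hd' hr' (by linarith) hε ht').sub
    (hf.hasDerivAt_cutIntegral hη ht hs hd hd' hr (by linarith) hε ht')
  refine h4.le_of_lip' (by positivity) ?_
  filter_upwards [Icc_mem_nhds hε.1 hε.2] with e he
  have := hC ε (Ioo_subset_Icc_self hε) e he t ht' r r' hr' h2 h3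
  simp only [Pi.sub_apply, Real.norm_eq_abs]
  refine le_trans (le_of_eq ?_) (this.trans (le_of_eq (by ring)))
  congr 1
  ring

theorem SingularFunction.continuousOn_limit (hs : SeparatedPoints (slab η ta tb) z δ)
    (hf : SingularFunction (slab η ta tb) z δ 2 f Φ φ) (hd : DecaysLike (slab η ta tb) 2 f)
    {b : ℝ × ℝ → ℝ} {C : ℝ}
    (hb : ∀ p ∈ slab η ta tb, ∀ r, 0 < r → r < δ / 2 → |cutIntegral z f r p - b p| ≤ C * r) :
    ContinuousOn b (slab η ta tb) := by
  have hδ := hs.pos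
  have hu : TendstoUniformlyOn (fun r => cutIntegral z f r) b (𝓝[>] 0) (slab η ta tb) := by
    rw [Metric.tendstoUniformlyOn_iff]
    intro e he
    filter_upwards [Ioo_mem_nhdsGT (show 0 < min (δ / 2) (e / (|C| + 1)) by positivity)] with
      r hr p hp
    have h1 := hb p hp r hr.1 (hr.2.trans_le (min_le_left _ _))
    have h2 : r < e / (|C| + 1) := hr.2.trans_le (min_le_right _ _)
    rw [lt_div_iff₀ (by positivity)] at h2
    rw [dist_comm, Real.dist_eq]
    nlinarith [le_abs_self C, hr.1]
  refine hu.continuousOn (Eventually.frequently ?_)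
  filter_upwards [Ioo_mem_nhdsGT hδ] with r hr
  exact hf.continuousOn_cutIntegral hs hd hr.1 hr.2.le

/-- The time integral of the renormalized integral of `f²` is differentiable in the variation
parameter, and its derivative is the limit of the derivatives of the cut off integrals. -/
theorem SingularFunction.hasDerivAt_integral_limit (hη : 0 < η) (ht : ta < tb)
    (hs : SeparatedPoints (slab η ta tb) z δ)
    (hf : SingularFunction (slab η ta tb) z δ 2 f Φ φ) (hd : DecaysLike (slab η ta tb) 2 f)
    (hd' : DecaysLike (slab η ta tb) 2 (epsD η ta tb z f)) {b : ℝ × ℝ → ℝ} {C : ℝ}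
    (hb : ∀ p ∈ slab η ta tb, ∀ r, 0 < r → r < δ / 2 → |cutIntegral z f r p - b p| ≤ C * r) :
    ∃ D, HasDerivAt (fun ε => ∫ t in ta..tb, b (ε, t)) D 0 ∧
      HasRLim (fun r => ∫ t in ta..tb, ∫ x, cutSqD η ta tb z f r ((0, t), x)) D := by
  have hδ := hs.pos
  obtain ⟨C', hC0', hC'⟩ := hf.exists_cutSqD_bound hη ht hs hd hd'
  have hIoc : uIoc ta tb = Ioc ta tb := uIoc_of_le ht.le
  have hcD : ∀ r, 0 < r → r ≤ δ →
      ContinuousOn (fun p => ∫ x, cutSqD η ta tb z f r (p, x)) (slab η ta tb) := by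
    intro r hr hr'
    obtain ⟨hc, hdec⟩ := hf.cutSqD_facts hη ht hs hd hd' hr hr'
    exact hdec.continuousOn_integral isCompact_slab (by norm_num) hc
  have hslice : ∀ {g : ℝ × ℝ → ℝ}, ContinuousOn g (slab η ta tb) → ∀ ε ∈ Icc (-η) η,
      ContinuousOn (fun t => g (ε, t)) (Icc ta tb) := fun hg ε hε =>
    hg.comp (by fun_prop) (fun t ht => ⟨hε, ht⟩)
  have hint : ∀ {g : ℝ × ℝ → ℝ}, ContinuousOn g (slab η ta tb) → ∀ ε ∈ Icc (-η) η,
      IntervalIntegrable (fun t => g (ε, t)) volume ta tb := fun hg ε hε => by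
    refine ContinuousOn.intervalIntegrable ?_
    rw [uIcc_of_le ht.le]
    exact hslice hg ε hε
  have hcV : ∀ r, 0 < r → r ≤ δ → ContinuousOn (cutIntegral z f r) (slab η ta tb) :=
    fun r hr hr' => hf.continuousOn_cutIntegral hs hd hr hr'
  have hbc := hf.continuousOn_limit hs hd hb
  have hT : ∀ r, 0 < r → r ≤ δ → ∀ ε ∈ Ioo (-η) η,
      HasDerivAt (fun e => ∫ t in ta..tb, cutIntegral z f r (e, t))
        (∫ t in ta..tb, ∫ x, cutSqD η ta tb z f r ((ε, t), x)) ε := by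
    intro r hr hr' ε hε
    obtain ⟨K, hK⟩ := isCompact_slab.exists_bound_of_continuousOn (hcD r hr hr')
    refine (intervalIntegral.hasDerivAt_integral_of_dominated_loc_of_deriv_le (s := Ioo (-η) η)
      (a := ta) (b := tb) (μ := volume) (F := fun e t => cutIntegral z f r (e, t))
      (F' := fun e t => ∫ x, cutSqD η ta tb z f r ((e, t), x)) (bound := fun _ => K) (isOpen_Ioo.mem_nhds hε) ?_ ?_ ?_ ?_ ?_ ?_).2
    · filter_upwards [isOpen_Ioo.mem_nhds hε] with e he
      exact (hint (hcV r hr hr') e (Ioo_subset_Icc_self he)).aestronglyMeasurable_restrict_uIoc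
    · exact hint (hcV r hr hr') ε (Ioo_subset_Icc_self hε)
    · exact (hint (hcD r hr hr') ε (Ioo_subset_Icc_self hε)).aestronglyMeasurable_restrict_uIoc
    · refine Eventually.of_forall fun t htI e he => ?_
      rw [hIoc] at htI
      exact hK (e, t) ⟨Ioo_subset_Icc_self he, Ioc_subset_Icc_self htI⟩
    · simp
    · refine Eventually.of_forall fun t htI e he => ?_
      rw [hIoc] at htI
      exact hf.hasDerivAt_cutIntegral hη ht hs hd hd' hr hr' he (Ioc_subset_Icc_self htI)
  have hbound : ∀ ε ∈ Ioo (-η) η, ∀ r r', 0 < r' → r' ≤ r → r < δ / 2 →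
      |(∫ t in ta..tb, ∫ x, cutSqD η ta tb z f r' ((ε, t), x)) -
        ∫ t in ta..tb, ∫ x, cutSqD η ta tb z f r ((ε, t), x)| ≤ C' * (tb - ta) * r := by
    intro ε hε r r' hr' h1 h2
    have hr : 0 < r := hr'.trans_le h1
    rw [← intervalIntegral.integral_sub (hint (hcD r' hr' (by linarith)) ε (Ioo_subset_Icc_self hε))
      (hint (hcD r hr (by linarith)) ε (Ioo_subset_Icc_self hε))]
    have := intervalIntegral.norm_integral_le_of_norm_le_const (a := ta) (b := tb) (C := C' * r)
      (f := fun t => (∫ x, cutSqD η ta tb z f r' ((ε, t), x)) -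
        ∫ x, cutSqD η ta tb z f r ((ε, t), x)) (fun t htI => by
          rw [hIoc] at htI
          exact hC' ε hε t (Ioc_subset_Icc_self htI) r r' hr' h1 h2)
    rw [abs_of_pos (sub_pos.2 ht)] at this
    exact this.trans (le_of_eq (by ring))
  have hlim : ∀ ε, ∃ D, ε ∈ Ioo (-η) η → ∀ r, 0 < r → r < δ / 2 →
      |(∫ t in ta..tb, ∫ x, cutSqD η ta tb z f r ((ε, t), x)) - D| ≤ C' * (tb - ta) * r := by
    intro ε
    by_cases hε : ε ∈ Ioo (-η) η
    · obtain ⟨D, hD⟩ := exists_limit_of_dyadic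
        (f := fun r => ∫ t in ta..tb, ∫ x, cutSqD η ta tb z f r ((ε, t), x)) (half_pos hδ)
        (hbound ε hε)
      exact ⟨D, fun _ => hD⟩
    · exact ⟨0, fun h => absurd h hε⟩
  choose D hD using hlim
  have h0 : (0 : ℝ) ∈ Ioo (-η) η := ⟨by linarith, hη⟩
  refine ⟨D 0, ?_, hasRLim_of_bound (a := 0) (half_pos hδ) (C := C' * (tb - ta))
    fun r hr hr' => by simpa using hD 0 h0 r hr hr'⟩
  refine hasDerivAt_of_tendstoUniformlyOn (l := 𝓝[>] (0 : ℝ)) (s := Ioo (-η) η)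
    (f := fun r ε => ∫ t in ta..tb, cutIntegral z f r (ε, t))
    (f' := fun r ε => ∫ t in ta..tb, ∫ x, cutSqD η ta tb z f r ((ε, t), x)) isOpen_Ioo ?_ ?_ ?_ h0
  · rw [Metric.tendstoUniformlyOn_iff]
    intro e he
    have hK : 0 ≤ C' * (tb - ta) := mul_nonneg hC0' (by linarith)
    filter_upwards [Ioo_mem_nhdsGT (show 0 < min (δ / 2) (e / (C' * (tb - ta) + 1)) by positivity)]
      with r hr ε hε
    have h1 := hD ε hε r hr.1 (hr.2.trans_le (min_le_left _ _))
    have h2 : r < e / (C' * (tb - ta) + 1) := hr.2.trans_le (min_le_right _ _)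
    rw [lt_div_iff₀ (by positivity)] at h2
    rw [dist_comm, Real.dist_eq]
    nlinarith [hr.1]
  · filter_upwards [Ioo_mem_nhdsGT hδ] with r hr ε hε
    exact hT r hr.1 hr.2.le ε hε
  · intro ε hε
    rw [tendsto_iff_dist_tendsto_zero]
    have hlim0 : Tendsto (fun r : ℝ => |C| * r * (tb - ta)) (𝓝[>] 0) (𝓝 0) := by
      have : Tendsto (fun r : ℝ => |C| * r * (tb - ta)) (𝓝 0) (𝓝 (|C| * 0 * (tb - ta))) :=
        Continuous.tendsto (by fun_prop) 0
      simp only [mul_zero, zero_mul] at this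
      exact this.mono_left nhdsWithin_le_nhds
    refine squeeze_zero' (Eventually.of_forall fun _ => dist_nonneg) ?_ hlim0
    filter_upwards [Ioo_mem_nhdsGT (half_pos hδ)] with r hr
    rw [Real.dist_eq, ← intervalIntegral.integral_sub
      (hint (hcV r hr.1 (by linarith [hr.2])) ε (Ioo_subset_Icc_self hε))
      (hint hbc ε (Ioo_subset_Icc_self hε))]
    have := intervalIntegral.norm_integral_le_of_norm_le_const (a := ta) (b := tb) (C := |C| * r)
      (f := fun t => cutIntegral z f r (ε, t) - b (ε, t)) (fun t htI => by
          rw [hIoc] at htI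
          refine (hb (ε, t) ⟨Ioo_subset_Icc_self hε, Ioc_subset_Icc_self htI⟩ r hr.1 hr.2).trans ?_
          gcongr
          · exact hr.1.le
          · exact le_abs_self C)
    rwa [abs_of_pos (sub_pos.2 ht)] at this

end

end

section

/-! ### Averages over spheres -/

open scoped Pointwise in
-- The measure of a part of the sphere is defined through the volume of the cone over it, and the
-- antipodal map reflects that cone in the origin.
theorem measurePreserving_neg_sphere :
    MeasurePreserving (fun θ : Metric.sphere (0 : Space) 1 => -θ)
      (volume : Measure Space).toSphere (volume : Measure Space).toSphere := by
  have hm : Measurable (fun θ : Metric.sphere (0 : Space) 1 => -θ) := by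
    have : Continuous (fun θ : Metric.sphere (0 : Space) 1 => -θ) := continuous_neg
    exact this.measurable
  refine ⟨hm, Measure.ext fun s hs => ?_⟩
  rw [Measure.map_apply hm hs, Measure.toSphere_apply' _ hs, Measure.toSphere_apply' _ (hm hs)]
  congr 1
  have : Ioo (0 : ℝ) 1 • ((↑) '' ((fun θ : Metric.sphere (0 : Space) 1 => -θ) ⁻¹' s) : Set Space) =
      -(Ioo (0 : ℝ) 1 • ((↑) '' s : Set Space)) := by
    ext x
    simp only [Set.mem_neg, Set.mem_smul, Set.mem_image, Set.mem_preimage]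
    constructor
    · rintro ⟨a, ha, _, ⟨θ, hθ, rfl⟩, rfl⟩
      exact ⟨a, ha, _, ⟨-θ, hθ, rfl⟩, by simp⟩
    · rintro ⟨a, ha, _, ⟨θ, hθ, rfl⟩, h⟩
      refine ⟨a, ha, _, ⟨-θ, by simpa using hθ, rfl⟩, ?_⟩
      simp [h]
  rw [this, Measure.measure_neg]

/-- The mean value over the unit sphere. -/
noncomputable def sphereMean (g : Space → ℝ) : ℝ :=
  ⨍ θ : Metric.sphere (0 : Space) 1, g θ ∂(volume : Measure Space).toSphere

theorem mem_annulus_of_sphere (θ : Metric.sphere (0 : Space) 1) : (θ : Space) ∈ annulus := by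
  have : ‖(θ : Space)‖ = 1 := by simp
  constructor <;> rw [this]
  norm_num

theorem integrable_sphere {g : Space → ℝ} (hg : ContinuousOn g annulus) :
    Integrable (fun θ : Metric.sphere (0 : Space) 1 => g θ) (volume : Measure Space).toSphere := by
  have hc : Continuous (fun θ : Metric.sphere (0 : Space) 1 => g θ) :=
    hg.comp_continuous continuous_subtype_val mem_annulus_of_sphere
  have : CompactSpace (Metric.sphere (0 : Space) 1) :=
    isCompact_iff_compactSpace.1 (isCompact_sphere 0 1)
  exact hc.integrable_of_hasCompactSupport (HasCompactSupport.of_compactSpace _)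

theorem sphereMean_neg (g : Space → ℝ) : sphereMean (fun w => g (-w)) = sphereMean g := by
  rw [sphereMean, sphereMean, average_eq, average_eq]
  congr 1
  exact measurePreserving_neg_sphere.integral_comp (Homeomorph.neg _).measurableEmbedding
    (fun θ => g θ)

theorem abs_sphereMean_le {g : Space → ℝ} {C : ℝ} (h : ∀ w ∈ annulus, |g w| ≤ C) :
    |sphereMean g| ≤ C := by
  have hC : 0 ≤ C := (abs_nonneg _).trans (h (EuclideanSpace.single 0 1) (by
    simp [annulus]; norm_num))
  rw [sphereMean, average_eq, smul_eq_mul, abs_mul]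
  have h1 := norm_integral_le_of_norm_le_const (μ := (volume : Measure Space).toSphere)
    (f := fun θ : Metric.sphere (0 : Space) 1 => g θ) (C := C)
    (Eventually.of_forall fun θ => h θ (mem_annulus_of_sphere θ))
  rw [Real.norm_eq_abs] at h1
  set V := (volume : Measure Space).toSphere.real univ
  have hV : 0 ≤ V := measureReal_nonneg
  rw [abs_of_nonneg (inv_nonneg.2 hV)]
  calc V⁻¹ * _ ≤ V⁻¹ * (C * V) := by gcongr
    _ = C * (V⁻¹ * V) := by ring
    _ ≤ C * 1 := by gcongr; exact inv_mul_le_one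
    _ = C := mul_one C

theorem sphereMean_add {g h : Space → ℝ} (hg : ContinuousOn g annulus)
    (hh : ContinuousOn h annulus) :
    sphereMean (fun w => g w + h w) = sphereMean g + sphereMean h := by
  simp only [sphereMean, average_eq]
  rw [integral_add (integrable_sphere hg) (integrable_sphere hh), smul_add]

theorem sphereMean_const_mul (c : ℝ) (g : Space → ℝ) :
    sphereMean (fun w => c * g w) = c * sphereMean g := by
  simp only [sphereMean, average_eq, integral_const_mul, smul_eq_mul]
  ring

theorem sphereMean_congr {g h : Space → ℝ} (H : ∀ w ∈ annulus, g w = h w) :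
    sphereMean g = sphereMean h := by
  simp only [sphereMean]
  congr 1
  ext θ
  exact H θ (mem_annulus_of_sphere θ)

theorem abs_sphereMean_sub_le {g g₀ : Space → ℝ} {C : ℝ} (hg : ContinuousOn g annulus)
    (hg₀ : ContinuousOn g₀ annulus) (hC : ∀ w ∈ annulus, |g w + g (-w) - 2 * g₀ w| ≤ C) :
    |sphereMean g - sphereMean g₀| ≤ C := by
  have hgn : ContinuousOn (fun w => g (-w)) annulus :=
    hg.comp continuous_neg.continuousOn (fun w hw => neg_mem_annulus hw)
  have h1 := abs_sphereMean_le hC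
  have h2 : sphereMean (fun w => g w + g (-w) - 2 * g₀ w) =
      2 * (sphereMean g - sphereMean g₀) := by
    have h3 : (fun w => g w + g (-w) - 2 * g₀ w) = fun w => (g w + g (-w)) + (-2) * g₀ w := by
      ext w; ring
    rw [h3, sphereMean_add (g := fun w => g w + g (-w)) (h := fun w => (-2) * g₀ w)
      (hg.add hgn) (continuousOn_const.mul hg₀), sphereMean_add hg hgn,
      sphereMean_neg, sphereMean_const_mul]
    ring
  rw [h2, abs_mul, abs_two] at h1
  linarith [abs_nonneg (sphereMean g - sphereMean g₀)]

section
variable {P : Type} [NormedAddCommGroup P] [NormedSpace ℝ P]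
variable {U : Set P} {δ : ℝ} {z : P → Space} {f : P × Space → ℝ} {Φ : P × (ℝ × Space) → ℝ}
  {φ : P × Space → ℝ}

theorem IsExpansion.sphereAverage_eq {k : ℕ} (h : IsExpansion U z δ k f Φ φ) {p : P}
    (hp : p ∈ U) {r : ℝ} (hr : 0 < r) (hr' : r < δ) :
    sphereAverage (fun x => f (p, x)) (z p) r =
      (r ^ k)⁻¹ * sphereMean (fun w => Φ (p, r, w)) +
        sphereMean (fun w => regScaled φ (p, r, w)) := by
  have ha : |r| < δ := by rwa [abs_of_pos hr]
  have h1 : sphereAverage (fun x => f (p, x)) (z p) r =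
      sphereMean (fun w => (r ^ k)⁻¹ * Φ (p, r, w) + regScaled φ (p, r, w)) :=
    sphereMean_congr (g := fun w => f (p, z p + r • w))
      (fun w hw => h.eq p hp r w hr (mem_scaleDomain_of_annulus ha hw))
  rw [h1, sphereMean_add, sphereMean_const_mul]
  · exact continuousOn_const.mul (continuousOn_slice_annulus h.smooth_sing.continuousOn hp ha)
  · exact continuousOn_slice_annulus (contDiffOn_regScaled h.smooth_reg).continuousOn hp ha

/-- The renormalized limit of the averages over small spheres is the regular part. -/
theorem IsExpansion.hasRLim_sphereAverage (hUc : IsCompact U) (hU : UniqueDiffOn ℝ U)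
    (hδ : 0 < δ) {k : ℕ} (hk : k = 1 ∨ k = 2) (h : IsExpansion U z δ k f Φ φ) {p : P}
    (hp : p ∈ U) : HasRLim (sphereAverage (fun x => f (p, x)) (z p)) (φ (p, 0)) := by
  have hr0 : δ / 2 < δ := by linarith
  have h0 : |(0 : ℝ)| < δ := by rwa [abs_zero]
  obtain ⟨C, hC0, hC⟩ := exists_lipschitz_scale hUc hU hr0 (contDiffOn_regScaled h.smooth_reg)
  have hreg : ∀ r, 0 < r → r < δ / 2 →
      |sphereMean (fun w => regScaled φ (p, r, w)) - φ (p, 0)| ≤ 2 * C * r := by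
    intro r hr hr'
    have ha : |r| < δ := by rw [abs_of_pos hr]; linarith
    have hconst : sphereMean (fun w => regScaled φ (p, 0, w)) = φ (p, 0) := by
      have : Nontrivial Space := inferInstance
      have hne : (volume : Measure Space).toSphere ≠ 0 := Measure.toSphere_ne_zero _
      have : NeZero (volume : Measure Space).toSphere := ⟨hne⟩
      simp only [sphereMean, regScaled, zero_smul]
      exact average_const _ _
    rw [← hconst]
    refine abs_sphereMean_sub_le
      (continuousOn_slice_annulus (contDiffOn_regScaled h.smooth_reg).continuousOn hp ha)
      (continuousOn_slice_annulus (contDiffOn_regScaled h.smooth_reg).continuousOn hp h0) ?_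
    intro w hw
    have h1 := abs_le.1 (hC p hp r hr.le hr'.le w hw)
    have h2 := abs_le.1 (hC p hp r hr.le hr'.le (-w) (neg_mem_annulus hw))
    have h3 : regScaled φ (p, 0, -w) = regScaled φ (p, 0, w) := by simp [regScaled]
    rw [abs_le]
    constructor <;> linarith [h1.1, h1.2, h2.1, h2.2]
  have hcs : ∀ r, |r| < δ → ContinuousOn (fun w => Φ (p, r, w)) annulus := fun r hr =>
    continuousOn_slice_annulus h.smooth_sing.continuousOn hp hr
  rcases hk with rfl | rfl
  -- For `k = 1` the singular coefficient is even: its mean is a constant plus `O(r²)`, and division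
  -- by `r` leaves `a / r + O(r)`.
  · obtain ⟨C', hC0', hC'⟩ := exists_even_bound hUc hU hr0 h.smooth_sing
      (fun p hp q hq => by rw [h.parity p hp q hq]; norm_num)
    refine hasRLim_of_bound (half_pos hδ) (a := sphereMean (fun w => Φ (p, 0, w)))
      (C := C' + 2 * C) fun r hr hr' => ?_
    have ha : |r| < δ := by rw [abs_of_pos hr]; linarith
    have h1 := abs_sphereMean_sub_le (hcs r ha) (hcs 0 h0) (hC' p hp r hr.le hr'.le)
    rw [h.sphereAverage_eq hp hr (by linarith), pow_one, div_eq_inv_mul]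
    have h2 : |r⁻¹ * (sphereMean (fun w => Φ (p, r, w)) - sphereMean (fun w => Φ (p, 0, w)))| ≤
        C' * r := by
      rw [abs_mul, abs_of_pos (inv_pos.2 hr)]
      calc r⁻¹ * _ ≤ r⁻¹ * (C' * r ^ 2) := by gcongr
        _ = _ := by field_simp
    rw [add_mul]
    refine le_trans (le_of_eq ?_) ((abs_add_le _ _).trans (add_le_add h2 (hreg r hr hr')))
    congr 1
    ring
  -- For `k = 2` the coefficient is odd: its mean is linear in `r` up to `O(r³)`, and division by
  -- `r²` again leaves `a / r + O(r)`, with no constant term.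
  · obtain ⟨C', hC0', hC'⟩ := exists_odd_bound hUc hU hr0 h.smooth_sing
      (fun p hp q hq => by rw [h.parity p hp q hq]; norm_num)
    refine hasRLim_of_bound (half_pos hδ) (a := sphereMean (fun w => scaleD U δ Φ (p, 0, w)))
      (C := C' + 2 * C) fun r hr hr' => ?_
    have ha : |r| < δ := by rw [abs_of_pos hr]; linarith
    have hcd : ContinuousOn (fun w => r * scaleD U δ Φ (p, 0, w)) annulus :=
      continuousOn_const.mul
        (continuousOn_slice_annulus (contDiffOn_scaleD hU h.smooth_sing).continuousOn hp h0)
    have h1 := abs_sphereMean_sub_le (C := C' * r ^ 3) (hcs r ha) hcd (fun w hw => by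
      rw [← mul_assoc]; exact hC' p hp r hr.le hr'.le w hw)
    rw [sphereMean_const_mul] at h1
    rw [h.sphereAverage_eq hp hr (by linarith)]
    have h2 : |(r ^ 2)⁻¹ * (sphereMean (fun w => Φ (p, r, w)) -
        r * sphereMean (fun w => scaleD U δ Φ (p, 0, w)))| ≤ C' * r := by
      rw [abs_mul, abs_of_pos (inv_pos.2 (by positivity))]
      calc (r ^ 2)⁻¹ * _ ≤ (r ^ 2)⁻¹ * (C' * r ^ 3) := by gcongr
        _ = _ := by field_simp
    rw [add_mul]
    refine le_trans (le_of_eq ?_) ((abs_add_le _ _).trans (add_le_add h2 (hreg r hr hr')))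
    congr 1
    field_simp
    ring

end

end

section

/-! ### From point singularities to expansions -/

section
variable {P : Type} [NormedAddCommGroup P] [NormedSpace ℝ P] {N : ℕ}

/-- With `ρ = r ‖w‖` and `θ = w / ‖w‖` one has `ρ θ = r w`, and `ρ⁻¹ = r⁻¹ ‖w‖⁻¹`. Away from `w = 0`
the substitution is smooth, and it turns the given parity into evenness in `(r, w)`. Unlike the unit
vector `θ`, the vector `w` may be differentiated freely. -/
theorem isExpansion_of_polar {U : Set P} {z : P → Space} {δ δ' : ℝ} (hδ : δ ≤ δ')
    {f : P × Space → ℝ} {h : P × ℝ × Space → ℝ} {s : P × Space → ℝ}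
    (hh : ContDiffOn ℝ ∞ h (U ×ˢ (Ioo (-δ') δ' ×ˢ {0}ᶜ)))
    (hs : ContDiffOn ℝ ∞ s (U ×ˢ Metric.ball 0 δ'))
    (hpar : ∀ p ∈ U, ∀ ρ ∈ Ioo (-δ') δ', ∀ θ : Space, ‖θ‖ = 1 → h (p, -ρ, -θ) = h (p, ρ, θ))
    (heq : ∀ p ∈ U, ∀ ρ ∈ Ioo 0 δ', ∀ θ : Space, ‖θ‖ = 1 →
      f (p, z p + ρ • θ) = ρ⁻¹ * h (p, ρ, θ) + s (p, ρ • θ)) :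
    IsExpansion U z δ 1 f (fun x => ‖x.2.2‖⁻¹ * h (x.1, x.2.1 * ‖x.2.2‖, ‖x.2.2‖⁻¹ • x.2.2)) s where
  smooth_sing := by
    have hnorm : ContDiffOn ℝ ∞ (fun x : P × (ℝ × Space) => ‖x.2.2‖) (U ×ˢ scaleDomain δ) := by
      refine ContDiffOn.norm ℝ (ContDiff.contDiffOn (by fun_prop)) fun x hx => hx.2.1
    have hinv : ContDiffOn ℝ ∞ (fun x : P × (ℝ × Space) => ‖x.2.2‖⁻¹) (U ×ˢ scaleDomain δ) :=
      hnorm.inv fun x hx => (norm_pos_iff.2 hx.2.1).ne'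
    refine hinv.mul (hh.comp (contDiffOn_fst.prodMk
      (((ContDiff.contDiffOn (by fun_prop)).mul hnorm).prodMk
        (hinv.smul (ContDiff.contDiffOn (by fun_prop))))) ?_)
    intro x hx
    refine ⟨hx.1, ?_, ?_⟩
    · have h2 := hx.2.2
      rw [mem_Ioo, ← abs_lt]
      dsimp only
      rw [abs_mul, abs_norm]
      linarith
    · exact smul_ne_zero (inv_ne_zero (norm_pos_iff.2 hx.2.1).ne') hx.2.1
  smooth_reg := hs.mono (prod_mono_right (Metric.ball_subset_ball hδ))
  parity := by
    intro p hp q hq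
    have hn : ‖q.2‖ ≠ 0 := (norm_pos_iff.2 hq.1).ne'
    have := hpar p hp (q.1 * ‖q.2‖) (by
      rw [mem_Ioo, ← abs_lt, abs_mul, abs_norm]
      linarith [hq.2]) (‖q.2‖⁻¹ • q.2) (by
      rw [norm_smul, norm_inv, norm_norm, inv_mul_cancel₀ hn])
    simp only [Prod.fst_neg, Prod.snd_neg, norm_neg, neg_mul, smul_neg, this]
    ring
  eq := by
    intro p hp r w hr hq
    have hn : 0 < ‖w‖ := norm_pos_iff.2 hq.1
    have h2 := hq.2
    dsimp only at h2
    rw [abs_of_pos hr] at h2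
    have hrw : (r * ‖w‖) • ‖w‖⁻¹ • w = r • w := by
      rw [smul_smul, mul_assoc, mul_inv_cancel₀ hn.ne', mul_one]
    have := heq p hp (r * ‖w‖) ⟨by positivity, by linarith⟩ (‖w‖⁻¹ • w) (by
      rw [norm_smul, norm_inv, norm_norm, inv_mul_cancel₀ hn.ne'])
    rw [hrw] at this
    rw [this, mul_inv, pow_one]
    ring

theorem PointSingular.exists_expansion {U : Set P} {z : Fin N → P → Space}
    {A : P × Space → Fin 4 → ℝ} (h : PointSingular U z A) (hUc : IsCompact U)
    (hU : UniqueDiffOn ℝ U) :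
    ∃ (δ : ℝ) (H : Fin 4 → Fin N → P × (ℝ × Space) → ℝ) (s : Fin 4 → Fin N → P × Space → ℝ),
      SeparatedPoints U z δ ∧
      ∀ ν, SingularFunction U z δ 1 (fun x => A x ν) (H ν) (s ν) := by
  choose δn hδn hn sn h1 h2 h3 h4 using h.near
  have e1 := eventually_separated hUc h.smooth_trajectory h.distinct
  have e2 : ∀ᶠ δ : ℝ in 𝓝[>] 0, ∀ n, δ ≤ δn n := eventually_all.2 fun n => by
    filter_upwards [Ioc_mem_nhdsGT (hδn n)] with δ hδ using hδ.2
  have e3 : ∀ᶠ δ : ℝ in 𝓝[>] 0, 0 < δ := self_mem_nhdsWithin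
  obtain ⟨δ, d1, d2, d3⟩ := (e1.and (e2.and e3)).exists
  refine ⟨δ, fun ν n x => ‖x.2.2‖⁻¹ * hn n (x.1, x.2.1 * ‖x.2.2‖, ‖x.2.2‖⁻¹ • x.2.2) ν,
    fun ν n x => sn n x ν, ⟨hUc, hU, h.smooth_trajectory, d3, d1⟩, fun ν => ⟨?_, fun n => ?_⟩⟩
  · exact contDiffOn_pi.1 h.smooth_off ν
  · refine isExpansion_of_polar (d2 n) (contDiffOn_pi.1 (h1 n) ν) (contDiffOn_pi.1 (h2 n) ν)
      (fun p hp ρ hρ θ hθ => by rw [h3 n p hp ρ hρ θ hθ]) (fun p hp ρ hρ θ hθ => ?_)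
    rw [h4 n p hp ρ hρ θ hθ]
    simp

end

/-! ### Families of configurations -/

variable {N : ℕ}

/-- The trajectories of a family as functions of the pair `(ε, t)`. -/
def famZ (Z : ℝ → Fin N → ℝ → Space) (n : Fin N) (p : ℝ × ℝ) : Space := Z p.1 n p.2

/-- The potential of a family as a function of the pair `(ε, t)` and the position. -/
def famB (B : ℝ → Spacetime → Fin 4 → ℝ) (x : (ℝ × ℝ) × Space) : Fin 4 → ℝ :=
  B x.1.1 (x.1.2, x.2)

/-- The coordinate directions of space-time in the space of the triples `(ε, t, x)`. -/
noncomputable def jointDir (μ : Fin 4) : (ℝ × ℝ) × Space := ((0, (direction μ).1), (direction μ).2)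

/-- The derivative `∂_μ A^ν` of the potential of a family. -/
noncomputable def jointD (η ta tb : ℝ) (Z : ℝ → Fin N → ℝ → Space)
    (B : ℝ → Spacetime → Fin 4 → ℝ) (μ ν : Fin 4) (x : (ℝ × ℝ) × Space) : ℝ :=
  fderivWithin ℝ (fun x => famB B x ν) (offLines (slab η ta tb) (famZ Z)) x (jointDir μ)

/-- The field of a family. -/
noncomputable def jointField (η ta tb : ℝ) (Z : ℝ → Fin N → ℝ → Space)
    (B : ℝ → Spacetime → Fin 4 → ℝ) (μ ν : Fin 4) (x : (ℝ × ℝ) × Space) : ℝ :=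
  metric μ * jointD η ta tb Z B μ ν x - metric ν * jointD η ta tb Z B ν μ x

/-- The singular part of the derivative of a function in a given direction. -/
noncomputable def singD {P : Type} [NormedAddCommGroup P] [NormedSpace ℝ P] (U : Set P)
    (z : P → Space) (δ : ℝ) (v : P × Space) (Φ : P × (ℝ × Space) → ℝ) (x : P × (ℝ × Space)) : ℝ :=
  fderivWithin ℝ Φ (U ×ˢ scaleDomain δ) x (x.2.1 • v.1, (0, v.2 - fderivWithin ℝ z U x.1 v.1))

/-- The regular part of the derivative of a function in a given direction. -/
noncomputable def regD {P : Type} [NormedAddCommGroup P] [NormedSpace ℝ P] (U : Set P)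
    (z : P → Space) (δ : ℝ) (v : P × Space) (φ : P × Space → ℝ) (x : P × Space) : ℝ :=
  fderivWithin ℝ φ (U ×ˢ Metric.ball 0 δ) x (v.1, v.2 - fderivWithin ℝ z U x.1 v.1)

/-- A smooth family of trajectories and potentials over a compact parameter range, with a common
expansion. -/
structure FamBase (η ta tb : ℝ) (Z : ℝ → Fin N → ℝ → Space) (B : ℝ → Spacetime → Fin 4 → ℝ) (δ : ℝ)
    (H : Fin 4 → Fin N → (ℝ × ℝ) × (ℝ × Space) → ℝ) (s : Fin 4 → Fin N → (ℝ × ℝ) × Space → ℝ) :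
    Prop where
  eta_pos : 0 < η
  time_lt : ta < tb
  sep : SeparatedPoints (slab η ta tb) (famZ Z) δ
  potential : ∀ ν, SingularFunction (slab η ta tb) (famZ Z) δ 1 (fun x => famB B x ν) (H ν) (s ν)

/-- A smooth family of configurations whose fields and their variations decay at infinity. -/
structure Fam (η ta tb : ℝ) (Z : ℝ → Fin N → ℝ → Space) (B : ℝ → Spacetime → Fin 4 → ℝ) (δ : ℝ)
    (H : Fin 4 → Fin N → (ℝ × ℝ) × (ℝ × Space) → ℝ) (s : Fin 4 → Fin N → (ℝ × ℝ) × Space → ℝ) :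
    Prop extends FamBase η ta tb Z B δ H s where
  decay : ∀ μ ν, DecaysLike (slab η ta tb) 2 (jointField η ta tb Z B μ ν)
  decay_eps : ∀ μ ν, DecaysLike (slab η ta tb) 2
    (epsD η ta tb (famZ Z) (jointD η ta tb Z B μ ν))

/-- The velocity of a particle of a family. -/
noncomputable def famVel (η ta tb : ℝ) (Z : ℝ → Fin N → ℝ → Space) (n : Fin N) (p : ℝ × ℝ) : Space :=
  fderivWithin ℝ (famZ Z n) (slab η ta tb) p (0, 1)

/-- The singular part of the field of a family. -/
noncomputable def fieldSing (η ta tb : ℝ) (Z : ℝ → Fin N → ℝ → Space) (δ : ℝ)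
    (H : Fin 4 → Fin N → (ℝ × ℝ) × (ℝ × Space) → ℝ) (μ ν : Fin 4) (n : Fin N)
    (x : (ℝ × ℝ) × (ℝ × Space)) : ℝ :=
  metric μ * singD (slab η ta tb) (famZ Z n) δ (jointDir μ) (H ν n) x -
    metric ν * singD (slab η ta tb) (famZ Z n) δ (jointDir ν) (H μ n) x

/-- The regular part of the field of a family. -/
noncomputable def fieldReg (η ta tb : ℝ) (Z : ℝ → Fin N → ℝ → Space) (δ : ℝ)
    (s : Fin 4 → Fin N → (ℝ × ℝ) × Space → ℝ) (μ ν : Fin 4) (n : Fin N)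
    (x : (ℝ × ℝ) × Space) : ℝ :=
  metric μ * regD (slab η ta tb) (famZ Z n) δ (jointDir μ) (s ν n) x -
    metric ν * regD (slab η ta tb) (famZ Z n) δ (jointDir ν) (s μ n) x

theorem HasRLim.add {F G : ℝ → ℝ} {a b : ℝ} (hF : HasRLim F a) (hG : HasRLim G b) :
    HasRLim (fun r => F r + G r) (a + b) := by
  obtain ⟨c, hc⟩ := hF
  obtain ⟨d, hd⟩ := hG
  refine ⟨c + d, (hc.add hd).congr_left fun r => ?_⟩
  ring

theorem HasRLim.const_mul {F : ℝ → ℝ} {a : ℝ} (hF : HasRLim F a) (k : ℝ) :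
    HasRLim (fun r => k * F r) (k * a) := by
  obtain ⟨c, hc⟩ := hF
  refine ⟨k * c, (hc.const_mul_left k).congr_left fun r => ?_⟩
  ring

theorem HasRLim.congr' {F G : ℝ → ℝ} {a : ℝ} (hF : HasRLim F a) (h : F =ᶠ[𝓝[>] 0] G) :
    HasRLim G a := by
  obtain ⟨c, hc⟩ := hF
  refine ⟨c, hc.congr' ?_ EventuallyEq.rfl⟩
  filter_upwards [h] with r hr
  rw [hr]

theorem hasRLim_const (a : ℝ) : HasRLim (fun _ => a) a :=
  hasRLim_of_bound (a := 0) (C := 0) one_pos fun r _ _ => by simp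

theorem HasRLim.sum {ι : Type*} {S : Finset ι} {F : ι → ℝ → ℝ} {a : ι → ℝ}
    (h : ∀ i ∈ S, HasRLim (F i) (a i)) : HasRLim (fun r => ∑ i ∈ S, F i r) (∑ i ∈ S, a i) := by
  classical
  induction S using Finset.induction_on with
  | empty => simpa using hasRLim_const 0
  | insert i S hi ih =>
    simp only [Finset.sum_insert hi]
    exact (h i (Finset.mem_insert_self i S)).add
      (ih fun j hj => h j (Finset.mem_insert_of_mem hj))

namespace FamBase

variable {η ta tb : ℝ} {Z : ℝ → Fin N → ℝ → Space} {B : ℝ → Spacetime → Fin 4 → ℝ} {δ : ℝ}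
  {H : Fin 4 → Fin N → (ℝ × ℝ) × (ℝ × Space) → ℝ} {s : Fin 4 → Fin N → (ℝ × ℝ) × Space → ℝ}

theorem mem_slab {ε t : ℝ} (hε : ε ∈ Icc (-η) η) (ht : t ∈ Icc ta tb) : (ε, t) ∈ slab η ta tb :=
  ⟨hε, ht⟩

theorem singular_jointD (F : FamBase η ta tb Z B δ H s) (μ ν : Fin 4) :
    SingularFunction (slab η ta tb) (famZ Z) δ 2 (jointD η ta tb Z B μ ν)
      (fun n => singD (slab η ta tb) (famZ Z n) δ (jointDir μ) (H ν n))
      (fun n => regD (slab η ta tb) (famZ Z n) δ (jointDir μ) (s ν n)) :=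
  (F.potential ν).fderiv F.sep (jointDir μ)

theorem singular_field (F : FamBase η ta tb Z B δ H s) (μ ν : Fin 4) :
    SingularFunction (slab η ta tb) (famZ Z) δ 2 (jointField η ta tb Z B μ ν)
      (fieldSing η ta tb Z δ H μ ν) (fieldReg η ta tb Z δ s μ ν) :=
  (F.singular_jointD μ ν).linear_comb (F.singular_jointD ν μ) (metric μ) (metric ν)

theorem slab_mem_nhds {t : ℝ} (ht : t ∈ Ioo ta tb) {ε : ℝ} (hε : ε ∈ Icc (-η) η)
    (x : Space) : Tendsto (fun q : Spacetime => (((ε, q.1), q.2) : (ℝ × ℝ) × Space))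
      (𝓝 (t, x)) (𝓝[slab η ta tb ×ˢ univ] ((ε, t), x)) := by
  refine tendsto_nhdsWithin_iff.2 ⟨?_, ?_⟩
  · exact (show Continuous fun q : Spacetime => (((ε, q.1), q.2) : (ℝ × ℝ) × Space) by
      fun_prop).tendsto (t, x)
  · have : ∀ᶠ q : Spacetime in 𝓝 (t, x), q.1 ∈ Ioo ta tb :=
      continuous_fst.continuousAt.eventually (isOpen_Ioo.mem_nhds ht)
    filter_upwards [this] with q hq
    exact ⟨⟨hε, Ioo_subset_Icc_self hq⟩, mem_univ _⟩

theorem mem_off {ε t : ℝ} (hε : ε ∈ Icc (-η) η) (ht : t ∈ Icc ta tb) {x : Space}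
    (hx : ∀ n, x ≠ Z ε n t) : ((ε, t), x) ∈ offLines (slab η ta tb) (famZ Z) :=
  ⟨⟨hε, ht⟩, hx⟩

/-- Derivatives at a fixed value of the parameter, from joint derivatives. -/
theorem hasFDerivAt_slice (F : FamBase η ta tb Z B δ H s) {g : (ℝ × ℝ) × Space → ℝ}
    (hg : ContDiffOn ℝ ∞ g (offLines (slab η ta tb) (famZ Z))) {ε t : ℝ}
    (hε : ε ∈ Icc (-η) η) (ht : t ∈ Ioo ta tb) {x : Space} (hx : ∀ n, x ≠ Z ε n t) :
    HasFDerivAt (fun q : Spacetime => g ((ε, q.1), q.2))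
      ((fderivWithin ℝ g (offLines (slab η ta tb) (famZ Z)) ((ε, t), x)).comp
        ((ContinuousLinearMap.inr ℝ ℝ ℝ).prodMap (ContinuousLinearMap.id ℝ Space))) (t, x) := by
  have hoff := mem_off hε (Ioo_subset_Icc_self ht) hx
  have h1 := ((hg.differentiableOn (by simp)) _ hoff).hasFDerivWithinAt
  have h2 : HasFDerivAt (fun q : Spacetime => (((ε, q.1), q.2) : (ℝ × ℝ) × Space))
      ((ContinuousLinearMap.inr ℝ ℝ ℝ).prodMap (ContinuousLinearMap.id ℝ Space)) (t, x) := by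
    have e : (fun q : Spacetime => (((ε, q.1), q.2) : (ℝ × ℝ) × Space)) = fun q =>
        ((ε, 0), 0) + ((ContinuousLinearMap.inr ℝ ℝ ℝ).prodMap (ContinuousLinearMap.id ℝ Space)) q := by
      ext q <;> simp
    rw [e]
    exact (ContinuousLinearMap.hasFDerivAt _).const_add _
  have h3 : (fun q : Spacetime => (((ε, q.1), q.2) : (ℝ × ℝ) × Space)) ⁻¹'
      (offLines (slab η ta tb) (famZ Z)) ∈ 𝓝 (t, x) :=
    (slab_mem_nhds ht hε x) (offLines_mem_nhdsWithin F.sep.continuousOn hoff)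
  exact (HasFDerivWithinAt.comp (t, x) h1 h2.hasFDerivWithinAt (mapsTo_preimage _ _)).hasFDerivAt h3

theorem partialD_slice (F : FamBase η ta tb Z B δ H s) {g : (ℝ × ℝ) × Space → ℝ}
    (hg : ContDiffOn ℝ ∞ g (offLines (slab η ta tb) (famZ Z))) {ε t : ℝ}
    (hε : ε ∈ Icc (-η) η) (ht : t ∈ Ioo ta tb) {x : Space} (hx : ∀ n, x ≠ Z ε n t) (μ : Fin 4) :
    partialD μ (fun q : Spacetime => g ((ε, q.1), q.2)) (t, x) =
      fderivWithin ℝ g (offLines (slab η ta tb) (famZ Z)) ((ε, t), x) (jointDir μ) := by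
  rw [partialD, (F.hasFDerivAt_slice hg hε ht hx).fderiv]
  rfl

theorem partialD_eq (F : FamBase η ta tb Z B δ H s) {ε t : ℝ} (hε : ε ∈ Icc (-η) η)
    (ht : t ∈ Ioo ta tb) {x : Space} (hx : ∀ n, x ≠ Z ε n t) (μ ν : Fin 4) :
    partialD μ (fun q => B ε q ν) (t, x) = jointD η ta tb Z B μ ν ((ε, t), x) :=
  F.partialD_slice (F.potential ν).smooth_off hε ht hx μ

theorem field_eq (F : FamBase η ta tb Z B δ H s) {ε t : ℝ} (hε : ε ∈ Icc (-η) η)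
    (ht : t ∈ Ioo ta tb) {x : Space} (hx : ∀ n, x ≠ Z ε n t) (μ ν : Fin 4) :
    field (B ε) μ ν (t, x) = jointField η ta tb Z B μ ν ((ε, t), x) := by
  rw [field, F.partialD_eq hε ht hx, F.partialD_eq hε ht hx, jointField]

theorem hasDerivWithinAt_traj (F : FamBase η ta tb Z B δ H s) {ε t : ℝ} (hε : ε ∈ Icc (-η) η)
    (ht : t ∈ Icc ta tb) (n : Fin N) :
    HasDerivWithinAt (Z ε n) (famVel η ta tb Z n (ε, t)) (Icc ta tb) t := by
  have hc : HasDerivAt (fun τ : ℝ => ((ε, τ) : ℝ × ℝ)) (0, 1) t :=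
    (hasDerivAt_const t ε).prodMk (hasDerivAt_id t)
  exact (((F.sep.smooth n).differentiableOn (by simp)) _
    (mem_slab hε ht)).hasFDerivWithinAt.comp_hasDerivWithinAt t hc.hasDerivWithinAt
    (fun τ hτ => mem_slab hε hτ)

theorem deriv_traj (F : FamBase η ta tb Z B δ H s) {ε t : ℝ} (hε : ε ∈ Icc (-η) η)
    (ht : t ∈ Ioo ta tb) (n : Fin N) : deriv (Z ε n) t = famVel η ta tb Z n (ε, t) :=
  ((F.hasDerivWithinAt_traj hε (Ioo_subset_Icc_self ht) n).hasDerivAt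
    (Icc_mem_nhds ht.1 ht.2)).deriv

theorem derivWithin_traj (F : FamBase η ta tb Z B δ H s) {ε t : ℝ} (hε : ε ∈ Icc (-η) η)
    (ht : t ∈ Icc ta tb) (n : Fin N) :
    derivWithin (Z ε n) (Icc ta tb) t = famVel η ta tb Z n (ε, t) :=
  (F.hasDerivWithinAt_traj hε ht n).derivWithin (uniqueDiffOn_Icc F.time_lt t ht)

end FamBase

namespace Fam
open FamBase

variable {η ta tb : ℝ} {Z : ℝ → Fin N → ℝ → Space} {B : ℝ → Spacetime → Fin 4 → ℝ} {δ : ℝ}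
  {H : Fin 4 → Fin N → (ℝ × ℝ) × (ℝ × Space) → ℝ} {s : Fin 4 → Fin N → (ℝ × ℝ) × Space → ℝ}

theorem decay_eps_field (F : Fam η ta tb Z B δ H s) (μ ν : Fin 4) :
    DecaysLike (slab η ta tb) 2 (epsD η ta tb (famZ Z) (jointField η ta tb Z B μ ν)) := by
  obtain ⟨R, hR, h⟩ := F.sep.fderivWithin_cut_far
  refine ((F.decay_eps μ ν).linear_comb (F.decay_eps ν μ) (metric μ) (metric ν)).congr
    ⟨R, fun p hp x hx => ?_⟩
  have hoff := (h δ F.sep.pos le_rfl p hp x hx).2.1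
  have h1 := (((F.singular_jointD μ ν).smooth_off.differentiableOn (by simp)) _ hoff).hasFDerivWithinAt
  have h2 := (((F.singular_jointD ν μ).smooth_off.differentiableOn (by simp)) _ hoff).hasFDerivWithinAt
  have h3 : HasFDerivWithinAt (jointField η ta tb Z B μ ν) _ _ _ :=
    (h1.const_mul (metric μ)).fun_sub (h2.const_mul (metric ν))
  rw [epsD, h3.fderivWithin (F.sep.uniqueDiffOn_offLines _ hoff)]
  simp [epsD]

/-! ### The renormalized Lagrangian of a family -/

/-- The limits of the cut off integrals of the squares of the field components. -/
def IsFieldLimit (η ta tb : ℝ) (Z : ℝ → Fin N → ℝ → Space) (B : ℝ → Spacetime → Fin 4 → ℝ)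
    (δ : ℝ) (b : Fin 4 → Fin 4 → ℝ × ℝ → ℝ) (C : Fin 4 → Fin 4 → ℝ) : Prop :=
  ∀ μ ν, ∀ p ∈ slab η ta tb, ∀ r, 0 < r → r < δ / 2 →
    |cutIntegral (famZ Z) (jointField η ta tb Z B μ ν) r p - b μ ν p| ≤ C μ ν * r

theorem exists_fieldLimit (F : Fam η ta tb Z B δ H s) :
    ∃ b C, IsFieldLimit η ta tb Z B δ b C := by
  have : ∀ μ ν, _ := fun μ ν => (F.singular_field μ ν).exists_cutIntegral_limit F.sep (F.decay μ ν)
  choose b C hC0 hC using this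
  exact ⟨b, C, hC⟩

theorem rIntegrable_fieldSquare (F : Fam η ta tb Z B δ H s) {b : Fin 4 → Fin 4 → ℝ × ℝ → ℝ}
    {C : Fin 4 → Fin 4 → ℝ} (hb : IsFieldLimit η ta tb Z B δ b C) {ε t : ℝ}
    (hε : ε ∈ Icc (-η) η) (ht : t ∈ Ioo ta tb) :
    (∀ᶠ r in 𝓝[>] (0 : ℝ), IntegrableOn (fun x => fieldSquare (B ε) (t, x))
      (cutoffRegion (fun n => Z ε n t) r)) ∧
    HasRLim (fun r => ∫ x in cutoffRegion (fun n => Z ε n t) r, fieldSquare (B ε) (t, x))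
      (∑ μ, ∑ ν, metric μ * metric ν * b μ ν (ε, t)) := by
  have hp := mem_slab hε (Ioo_subset_Icc_self ht)
  have hmeas : ∀ r, MeasurableSet (cutoffRegion (fun n => Z ε n t) r) := by
    intro r
    have : cutoffRegion (fun n => Z ε n t) r = ⋂ n, {x | r < ‖x - Z ε n t‖} := by
      ext x; simp [cutoffRegion]
    rw [this]
    exact MeasurableSet.iInter fun n => (isOpen_lt continuous_const (by fun_prop)).measurableSet
  have hcongr : ∀ r, 0 < r → ∀ x ∈ cutoffRegion (fun n => Z ε n t) r,
      fieldSquare (B ε) (t, x) =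
        ∑ μ, ∑ ν, metric μ * metric ν * jointField η ta tb Z B μ ν ((ε, t), x) ^ 2 := by
    intro r hr x hx
    have hx' : ∀ n, x ≠ Z ε n t := fun n hn => by
      have := hx n
      rw [hn, sub_self, norm_zero] at this
      linarith
    simp only [fieldSquare, F.field_eq hε ht hx']
  have hI : ∀ r, 0 < r → r < δ → ∀ μ ν, IntegrableOn
      (fun x => metric μ * metric ν * jointField η ta tb Z B μ ν ((ε, t), x) ^ 2)
      (cutoffRegion (fun n => Z ε n t) r) := fun r hr hr' μ ν =>
    (((F.singular_field μ ν).sharp_integral F.sep (F.decay μ ν) hr hr' hp).1).const_mul _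
  have hδ := F.sep.pos
  constructor
  · filter_upwards [Ioo_mem_nhdsGT hδ] with r hr
    refine IntegrableOn.congr_fun (f := fun x =>
      ∑ μ, ∑ ν, metric μ * metric ν * jointField η ta tb Z B μ ν ((ε, t), x) ^ 2) ?_
      (fun x hx => (hcongr r hr.1 x hx).symm) (hmeas r)
    exact integrable_finsetSum _ fun μ _ => integrable_finsetSum _ fun ν _ => hI r hr.1 hr.2 μ ν
  · refine HasRLim.congr' (F := fun r => ∑ μ, ∑ ν, metric μ * metric ν *
      ∫ x in cutoffRegion (fun n => Z ε n t) r, jointField η ta tb Z B μ ν ((ε, t), x) ^ 2)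
      (HasRLim.sum fun μ _ => HasRLim.sum fun ν _ =>
        ((F.singular_field μ ν).hasRLim_sharp F.sep (F.decay μ ν) hp (hb μ ν _ hp)).const_mul _) ?_
    filter_upwards [Ioo_mem_nhdsGT hδ] with r hr
    rw [setIntegral_congr_fun (hmeas r) (hcongr r hr.1), integral_finsetSum]
    · refine Finset.sum_congr rfl fun μ _ => ?_
      rw [integral_finsetSum _ fun ν _ => hI r hr.1 hr.2 μ ν]
      exact Finset.sum_congr rfl fun ν _ => (integral_const_mul _ _).symm
    · exact fun μ _ => integrable_finsetSum _ fun ν _ => hI r hr.1 hr.2 μ ν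

theorem lagrangianEM_eq (F : Fam η ta tb Z B δ H s) {b : Fin 4 → Fin 4 → ℝ × ℝ → ℝ}
    {C : Fin 4 → Fin 4 → ℝ} (hb : IsFieldLimit η ta tb Z B δ b C) {ε t : ℝ}
    (hε : ε ∈ Icc (-η) η) (ht : t ∈ Ioo ta tb) :
    lagrangianEM (Z ε) (B ε) t = -(1 / 4) * ∑ μ, ∑ ν, metric μ * metric ν * b μ ν (ε, t) := by
  rw [lagrangianEM, rIntegral, (F.rIntegrable_fieldSquare hb hε ht).2.rLim_eq]

theorem hasRLim_potential (F : Fam η ta tb Z B δ H s) {ε t : ℝ} (hε : ε ∈ Icc (-η) η)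
    (ht : t ∈ Icc ta tb) (n : Fin N) (ν : Fin 4) :
    HasRLim (sphereAverage (fun x => B ε (t, x) ν) (Z ε n t)) (s ν n ((ε, t), 0)) :=
  ((F.potential ν).expansion n).hasRLim_sphereAverage F.sep.compact F.sep.unique F.sep.pos
    (Or.inl rfl) (mem_slab hε ht)

theorem hasRLim_field (F : Fam η ta tb Z B δ H s) {ε t : ℝ} (hε : ε ∈ Icc (-η) η)
    (ht : t ∈ Ioo ta tb) (n : Fin N) (μ ν : Fin 4) :
    HasRLim (sphereAverage (fun x => field (B ε) μ ν (t, x)) (Z ε n t))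
      (fieldReg η ta tb Z δ s μ ν n ((ε, t), 0)) := by
  have hp := mem_slab hε (Ioo_subset_Icc_self ht)
  refine (((F.singular_field μ ν).expansion n).hasRLim_sphereAverage F.sep.compact F.sep.unique
    F.sep.pos (Or.inr rfl) hp).congr' ?_
  filter_upwards [Ioo_mem_nhdsGT F.sep.pos] with r hr
  refine sphereMean_congr (g := fun w => jointField η ta tb Z B μ ν ((ε, t), Z ε n t + r • w))
    (h := fun w => field (B ε) μ ν (t, Z ε n t + r • w)) fun w hw => ?_
  refine (F.field_eq hε ht ?_ μ ν).symm
  have hne : r • w ≠ 0 := smul_ne_zero hr.1.ne' (ne_zero_of_mem_annulus hw)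
  have hlt : ‖r • w‖ < δ := by
    rw [norm_smul, Real.norm_of_nonneg hr.1.le]
    nlinarith [hw.2, hr.1, hr.2]
  exact (F.sep.add_mem_offLines hp n hne hlt).2

/-- The Lagrangian of the particles and their interaction with the field. -/
noncomputable def particleLagrangian (η ta tb : ℝ) (Z : ℝ → Fin N → ℝ → Space)
    (s : Fin 4 → Fin N → (ℝ × ℝ) × Space → ℝ) (m q : Fin N → ℝ) (n : Fin N) (p : ℝ × ℝ) : ℝ :=
  -(m n * √(1 - ‖famVel η ta tb Z n p‖ ^ 2)) +
    q n * (∑ i : Fin 3, famVel η ta tb Z n p i * s i.succ n (p, 0) - s 0 n (p, 0))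

theorem lagrangian_eq (F : Fam η ta tb Z B δ H s) {b : Fin 4 → Fin 4 → ℝ × ℝ → ℝ}
    {C : Fin 4 → Fin 4 → ℝ} (hb : IsFieldLimit η ta tb Z B δ b C) (m q : Fin N → ℝ) {ε t : ℝ}
    (hε : ε ∈ Icc (-η) η) (ht : t ∈ Ioo ta tb)
    (hv : ∀ n, ‖famVel η ta tb Z n (ε, t)‖ < 1) :
    lagrangian m q (Z ε) (B ε) t = -(1 / 4) * ∑ μ, ∑ ν, metric μ * metric ν * b μ ν (ε, t) +
      ∑ n, particleLagrangian η ta tb Z s m q n (ε, t) := by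
  rw [lagrangian, F.lagrangianEM_eq hb hε ht, add_assoc]
  congr 1
  rw [lagrangianPart, lagrangianInt, ← Finset.sum_neg_distrib, ← Finset.sum_add_distrib]
  refine Finset.sum_congr rfl fun n _ => ?_
  have hpot : ∀ ν, potentialAt (B ε) (Z ε n) t ν = s ν n ((ε, t), 0) := fun ν =>
    (F.hasRLim_potential hε (Ioo_subset_Icc_self ht) n ν).rLim_eq
  have hd := F.deriv_traj hε ht n
  have hpos : 0 < √(1 - ‖famVel η ta tb Z n (ε, t)‖ ^ 2) := by
    apply Real.sqrt_pos.2
    nlinarith [hv n, norm_nonneg (famVel η ta tb Z n (ε, t))]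
  rw [Fin.sum_univ_succ, particleLagrangian]
  simp only [hpot, fourVelocity, gamma, hd, Fin.cons_zero, Fin.cons_succ]
  have hm0 : metric 0 = -1 := rfl
  have hms : ∀ i : Fin 3, metric i.succ = 1 := by intro i; fin_cases i <;> rfl
  simp only [hm0, hms, one_mul]
  set g := √(1 - ‖famVel η ta tb Z n (ε, t)‖ ^ 2)
  have hsum : ∑ i : Fin 3, 1 / g * (famVel η ta tb Z n (ε, t)) i * s i.succ n ((ε, t), 0) =
      1 / g * ∑ i : Fin 3, famVel η ta tb Z n (ε, t) i * s i.succ n ((ε, t), 0) := by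
    rw [Finset.mul_sum]
    exact Finset.sum_congr rfl fun i _ => by ring
  rw [hsum]
  field_simp
  ring

end Fam

end

/-! ### Admissible variations as smooth families with uniform bounds -/

section

theorem PointSingular.comp {P Q : Type} [NormedAddCommGroup P] [NormedSpace ℝ P]
    [NormedAddCommGroup Q] [NormedSpace ℝ Q] {N : ℕ} {U : Set P} {z : Fin N → P → Space}
    {A : P × Space → Fin 4 → ℝ} (h : PointSingular U z A) {g : Q → P} (hg : ContDiff ℝ ∞ g)
    {V : Set Q} (hV : MapsTo g V U) :
    PointSingular V (fun n p => z n (g p)) (fun x => A (g x.1, x.2)) where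
  smooth_trajectory n := (h.smooth_trajectory n).comp hg.contDiffOn hV
  distinct p hp := h.distinct (g p) (hV hp)
  smooth_off := h.smooth_off.comp
    (ContDiff.contDiffOn (by fun_prop : ContDiff ℝ ∞ fun x : Q × Space => (g x.1, x.2)))
    (fun x hx => ⟨hV hx.1, hx.2⟩)
  near n := by
    obtain ⟨δ, hδ, a, s, h1, h2, h3, h4⟩ := h.near n
    refine ⟨δ, hδ, fun x => a (g x.1, x.2), fun x => s (g x.1, x.2), ?_, ?_, ?_, ?_⟩
    · exact h1.comp (ContDiff.contDiffOn
        (by fun_prop : ContDiff ℝ ∞ fun x : Q × ℝ × Space => (g x.1, x.2)))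
        (fun x hx => ⟨hV hx.1, hx.2⟩)
    · exact h2.comp (ContDiff.contDiffOn
        (by fun_prop : ContDiff ℝ ∞ fun x : Q × Space => (g x.1, x.2)))
        (fun x hx => ⟨hV hx.1, hx.2⟩)
    · exact fun p hp => h3 (g p) (hV hp)
    · exact fun p hp => h4 (g p) (hV hp)

variable {N : ℕ} {η ta tb : ℝ} {Z : ℝ → Fin N → ℝ → Space} {B : ℝ → Spacetime → Fin 4 → ℝ} {δ : ℝ}
  {H : Fin 4 → Fin N → (ℝ × ℝ) × (ℝ × Space) → ℝ} {s : Fin 4 → Fin N → (ℝ × ℝ) × Space → ℝ}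

theorem exists_famBase (hη : 0 < η) (ht : ta < tb)
    (h : PointSingular (slab η ta tb) (famZ Z) (famB B)) :
    ∃ δ H s, FamBase η ta tb Z B δ H s := by
  obtain ⟨δ, H, s, h1, h2⟩ := h.exists_expansion isCompact_slab (uniqueDiffOn_slab hη ht)
  exact ⟨δ, H, s, hη, ht, h1, h2⟩

namespace FamBase

theorem contDiffOn_famVel (F : FamBase η ta tb Z B δ H s) (n : Fin N) :
    ContDiffOn ℝ ∞ (famVel η ta tb Z n) (slab η ta tb) :=
  ((F.sep.smooth n).fderivWithin F.sep.unique (by simp)).clm_apply contDiffOn_const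

theorem contDiffOn_reg_zero {φ : (ℝ × ℝ) × Space → ℝ} (hδ : 0 < δ)
    (h : ContDiffOn ℝ ∞ φ (slab η ta tb ×ˢ Metric.ball 0 δ)) :
    ContDiffOn ℝ ∞ (fun p => φ (p, 0)) (slab η ta tb) :=
  h.comp (ContDiff.contDiffOn (by fun_prop)) (fun p hp => ⟨hp, by simpa using hδ⟩)

theorem contDiffOn_potential_zero (F : FamBase η ta tb Z B δ H s) (ν : Fin 4) (n : Fin N) :
    ContDiffOn ℝ ∞ (fun p => s ν n (p, 0)) (slab η ta tb) :=
  contDiffOn_reg_zero F.sep.pos ((F.potential ν).expansion n).smooth_reg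

/-- A bound for `|ε| < η`, `ta < t < tb` extends to the closure. -/
theorem decaysLike_of_interior (F : FamBase η ta tb Z B δ H s) {g : (ℝ × ℝ) × Space → ℝ}
    (hg : ContinuousOn g (offLines (slab η ta tb) (famZ Z))) {j : ℕ}
    (h : ∃ C R, ∀ ε ∈ Ioo (-η) η, ∀ t ∈ Ioo ta tb, ∀ x : Space, R ≤ ‖x‖ →
      |g ((ε, t), x)| ≤ C / ‖x‖ ^ j) : DecaysLike (slab η ta tb) j g := by
  obtain ⟨C, R, h⟩ := h
  obtain ⟨R', hR', hfar⟩ := F.sep.fderivWithin_cut_far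
  refine ⟨C, max R R', by positivity, fun p hp x hx => ?_⟩
  have hcont : ContinuousOn (fun p => |g (p, x)|) (slab η ta tb) :=
    (hg.comp (by fun_prop) (fun p hp =>
      (hfar δ F.sep.pos le_rfl p hp x ((le_max_right _ _).trans hx)).2.1)).abs
  have hclosed := hcont.preimage_isClosed_of_isClosed isCompact_slab.isClosed
    (isClosed_Iic (a := C / ‖x‖ ^ j))
  have hsub : Ioo (-η) η ×ˢ Ioo ta tb ⊆ slab η ta tb ∩ (fun p => |g (p, x)|) ⁻¹' Iic (C / ‖x‖ ^ j) := by
    rintro ⟨ε, t⟩ ⟨hε, ht⟩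
    exact ⟨⟨Ioo_subset_Icc_self hε, Ioo_subset_Icc_self ht⟩,
      h ε hε t ht x ((le_max_left _ _).trans hx)⟩
  have hcl := closure_minimal hsub hclosed
  have heta := F.eta_pos
  rw [closure_prod_eq, closure_Ioo (by linarith), closure_Ioo F.time_lt.ne] at hcl
  exact (hcl hp).2

theorem hasDerivAt_eps_off (F : FamBase η ta tb Z B δ H s) {g : (ℝ × ℝ) × Space → ℝ}
    (hg : ContDiffOn ℝ ∞ g (offLines (slab η ta tb) (famZ Z))) {ε t : ℝ} (hε : ε ∈ Ioo (-η) η)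
    (ht : t ∈ Icc ta tb) {x : Space} (hx : ∀ n, x ≠ Z ε n t) :
    HasDerivAt (fun e => g ((e, t), x)) (epsD η ta tb (famZ Z) g ((ε, t), x)) ε := by
  have hoff := mem_off (Ioo_subset_Icc_self hε) ht hx
  have hc : HasDerivAt (fun e : ℝ => (((e, t), x) : (ℝ × ℝ) × Space)) ((1, 0), 0) ε :=
    ((hasDerivAt_id ε).prodMk (hasDerivAt_const ε t)).prodMk (hasDerivAt_const ε x)
  have hmem : (fun e : ℝ => (((e, t), x) : (ℝ × ℝ) × Space)) ⁻¹'
      (offLines (slab η ta tb) (famZ Z)) ∈ 𝓝 ε := by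
    have h1 : Tendsto (fun e : ℝ => (((e, t), x) : (ℝ × ℝ) × Space)) (𝓝 ε)
        (𝓝[slab η ta tb ×ˢ univ] ((ε, t), x)) := by
      refine tendsto_nhdsWithin_iff.2 ⟨hc.continuousAt, ?_⟩
      filter_upwards [isOpen_Ioo.mem_nhds hε] with e he
      exact ⟨⟨Ioo_subset_Icc_self he, ht⟩, mem_univ _⟩
    exact h1 (offLines_mem_nhdsWithin F.sep.continuousOn hoff)
  exact (hg.hasDerivWithinAt_comp_curve (c := fun e => ((e, t), x)) hc.hasDerivWithinAt
    (mapsTo_preimage _ _) hoff).hasDerivAt hmem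

/-- A family with decaying initial field and decaying variation. -/
theorem toFam (F : FamBase η ta tb Z B δ H s)
    (h0 : ∃ C R : ℝ, ∀ t ∈ Ioo ta tb, ∀ x : Space, R ≤ ‖x‖ →
      ∀ μ ν, |field (B 0) μ ν (t, x)| ≤ C / ‖x‖ ^ 2)
    (h1 : ∃ C R : ℝ, ∀ ε ∈ Ioo (-η) η, ∀ t ∈ Ioo ta tb, ∀ x : Space,
      R ≤ ‖x‖ → ∀ μ ν, |deriv (fun e => partialD μ (fun p => B e p ν) (t, x)) ε| ≤ C / ‖x‖ ^ 2) :
    Fam η ta tb Z B δ H s := by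
  obtain ⟨C₀, R₀, h0⟩ := h0
  obtain ⟨C₁, R₁, h1⟩ := h1
  obtain ⟨R', hR', hfar⟩ := F.sep.fderivWithin_cut_far
  have heta := F.eta_pos
  have hz : (0 : ℝ) ∈ Ioo (-η) η := ⟨by linarith, heta⟩
  have hoff : ∀ ε ∈ Icc (-η) η, ∀ t ∈ Icc ta tb, ∀ x : Space, R' ≤ ‖x‖ → ∀ n, x ≠ Z ε n t :=
    fun ε hε t ht x hx => (hfar δ F.sep.pos le_rfl (ε, t) ⟨hε, ht⟩ x hx).2.1.2
  have hsm : ∀ μ ν, ContDiffOn ℝ ∞ (jointD η ta tb Z B μ ν) (offLines (slab η ta tb) (famZ Z)) :=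
    fun μ ν => (F.singular_jointD μ ν).smooth_off
  have hder : ∀ ε ∈ Ioo (-η) η, ∀ t ∈ Ioo ta tb, ∀ x : Space, max R₁ R' ≤ ‖x‖ → ∀ μ ν,
      |epsD η ta tb (famZ Z) (jointD η ta tb Z B μ ν) ((ε, t), x)| ≤ C₁ / ‖x‖ ^ 2 := by
    intro ε hε t ht x hx μ ν
    have hxR := (le_max_right _ _).trans hx
    have e1 := F.hasDerivAt_eps_off (hsm μ ν) hε (Ioo_subset_Icc_self ht)
      (hoff ε (Ioo_subset_Icc_self hε) t (Ioo_subset_Icc_self ht) x hxR)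
    have e2 : (fun e => partialD μ (fun p => B e p ν) (t, x)) =ᶠ[𝓝 ε]
        fun e => jointD η ta tb Z B μ ν ((e, t), x) := by
      filter_upwards [isOpen_Ioo.mem_nhds hε] with e he
      exact F.partialD_eq (Ioo_subset_Icc_self he) ht
        (hoff e (Ioo_subset_Icc_self he) t (Ioo_subset_Icc_self ht) x hxR) μ ν
    rw [← e1.deriv, ← e2.deriv_eq]
    exact h1 ε hε t ht x ((le_max_left _ _).trans hx) μ ν
  have hmet : ∀ μ, |metric μ| = 1 := by intro μ; fin_cases μ <;> simp [metric]
  -- Only the `ε`-derivatives of the first derivatives of the potential are assumed to decay. The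
  -- mean value inequality from `ε = 0` transfers this to their increments, and the decay of the
  -- initial field then gives that of the field for all `ε`.
  have hjd : ∀ ε ∈ Ioo (-η) η, ∀ t ∈ Ioo ta tb, ∀ x : Space, max R₁ R' ≤ ‖x‖ → ∀ μ ν,
      |jointD η ta tb Z B μ ν ((ε, t), x) - jointD η ta tb Z B μ ν ((0, t), x)| ≤
        C₁ / ‖x‖ ^ 2 * η := by
    intro ε hε t ht x hx μ ν
    have hxR := (le_max_right _ _).trans hx
    have := (convex_Ioo (-η) η).norm_image_sub_le_of_norm_hasDerivWithin_le
      (f := fun e => jointD η ta tb Z B μ ν ((e, t), x))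
      (fun e he => (F.hasDerivAt_eps_off (hsm μ ν) he (Ioo_subset_Icc_self ht)
        (hoff e (Ioo_subset_Icc_self he) t (Ioo_subset_Icc_self ht) x hxR)).hasDerivWithinAt)
      (fun e he => hder e he t ht x hx μ ν) hz hε
    have hC : 0 ≤ C₁ / ‖x‖ ^ 2 := (abs_nonneg _).trans (hder 0 hz t ht x hx μ ν)
    refine this.trans ?_
    gcongr
    rw [sub_zero, Real.norm_eq_abs]
    exact (abs_lt.2 hε).le
  refine { toFamBase := F, decay := fun μ ν => ?_, decay_eps := fun μ ν => ?_ }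
  · refine F.decaysLike_of_interior (F.singular_field μ ν).smooth_off.continuousOn
      ⟨C₀ + C₁ * η + C₁ * η, max R₀ (max R₁ R'), fun ε hε t ht x hx => ?_⟩
    have hx1 := (le_max_right _ _).trans hx
    have hxR := (le_max_right _ _).trans hx1
    have e0 := h0 t ht x ((le_max_left _ _).trans hx) μ ν
    rw [F.field_eq (Ioo_subset_Icc_self hz) ht
      (hoff 0 (Ioo_subset_Icc_self hz) t (Ioo_subset_Icc_self ht) x hxR)] at e0
    have a1 := hjd ε hε t ht x hx1 μ ν
    have a2 := hjd ε hε t ht x hx1 ν μ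
    have e3 : jointField η ta tb Z B μ ν ((ε, t), x) = jointField η ta tb Z B μ ν ((0, t), x) +
        metric μ * (jointD η ta tb Z B μ ν ((ε, t), x) - jointD η ta tb Z B μ ν ((0, t), x)) -
        metric ν * (jointD η ta tb Z B ν μ ((ε, t), x) - jointD η ta tb Z B ν μ ((0, t), x)) := by
      simp only [jointField]; ring
    rw [e3]
    calc _ ≤ |jointField η ta tb Z B μ ν ((0, t), x) +
        metric μ * (jointD η ta tb Z B μ ν ((ε, t), x) - jointD η ta tb Z B μ ν ((0, t), x))| +
        |metric ν * (jointD η ta tb Z B ν μ ((ε, t), x) - jointD η ta tb Z B ν μ ((0, t), x))| :=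
          abs_sub _ _
      _ ≤ (|jointField η ta tb Z B μ ν ((0, t), x)| +
        |metric μ * (jointD η ta tb Z B μ ν ((ε, t), x) - jointD η ta tb Z B μ ν ((0, t), x))|) +
        |metric ν * (jointD η ta tb Z B ν μ ((ε, t), x) - jointD η ta tb Z B ν μ ((0, t), x))| := by
          gcongr; exact abs_add_le _ _
      _ ≤ (C₀ / ‖x‖ ^ 2 + C₁ / ‖x‖ ^ 2 * η) + C₁ / ‖x‖ ^ 2 * η := by
          rw [abs_mul, abs_mul, hmet, hmet, one_mul, one_mul]
          gcongr
      _ = _ := by ring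
  · refine F.decaysLike_of_interior
      (((hsm μ ν).fderivWithin_apply_vec F.sep.uniqueDiffOn_offLines
        contDiffOn_const).continuousOn)
      ⟨C₁, max R₁ R', fun ε hε t ht x hx => hder ε hε t ht x hx μ ν⟩

end FamBase

namespace Fam
open FamBase

theorem continuousOn_fieldLimit (F : Fam η ta tb Z B δ H s) {b : Fin 4 → Fin 4 → ℝ × ℝ → ℝ}
    {C : Fin 4 → Fin 4 → ℝ} (hb : IsFieldLimit η ta tb Z B δ b C) (μ ν : Fin 4) :
    ContinuousOn (b μ ν) (slab η ta tb) :=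
  (F.singular_field μ ν).continuousOn_limit F.sep (F.decay μ ν) (hb μ ν)

theorem continuousOn_particleLagrangian (F : Fam η ta tb Z B δ H s) (m q : Fin N → ℝ) (n : Fin N) :
    ContinuousOn (particleLagrangian η ta tb Z s m q n) (slab η ta tb) := by
  have hv := (F.contDiffOn_famVel n).continuousOn
  have hvi : ∀ i : Fin 3, ContinuousOn (fun p => famVel η ta tb Z n p i) (slab η ta tb) := fun i =>
    (EuclideanSpace.proj (𝕜 := ℝ) i).continuous.comp_continuousOn hv
  have hs : ∀ ν, ContinuousOn (fun p => s ν n (p, 0)) (slab η ta tb) := fun ν =>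
    (F.contDiffOn_potential_zero ν n).continuousOn
  unfold particleLagrangian
  refine ContinuousOn.add (continuousOn_const.mul
    (continuousOn_const.sub (hv.norm.pow 2)).sqrt).neg (continuousOn_const.mul
    (ContinuousOn.sub (continuousOn_finsetSum _ fun i _ => (hvi i).mul (hs i.succ)) (hs 0)))

theorem intervalIntegrable_slice (F : Fam η ta tb Z B δ H s) {g : ℝ × ℝ → ℝ}
    (hg : ContinuousOn g (slab η ta tb)) {ε : ℝ} (hε : ε ∈ Icc (-η) η) :
    IntervalIntegrable (fun t => g (ε, t)) volume ta tb := by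
  refine ContinuousOn.intervalIntegrable ?_
  rw [uIcc_of_le F.time_lt.le]
  exact hg.comp (by fun_prop) (fun t ht => ⟨hε, ht⟩)

theorem intervalIntegrable_lagrangian (F : Fam η ta tb Z B δ H s) (m q : Fin N → ℝ) {ε : ℝ}
    (hε : ε ∈ Icc (-η) η) (hv : ∀ t ∈ Icc ta tb, ∀ n, ‖famVel η ta tb Z n (ε, t)‖ < 1) :
    IntervalIntegrable (lagrangian m q (Z ε) (B ε)) volume ta tb := by
  obtain ⟨b, C, hb⟩ := F.exists_fieldLimit
  have hc : ContinuousOn (fun p => -(1 / 4) * ∑ μ, ∑ ν, metric μ * metric ν * b μ ν p +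
      ∑ n, particleLagrangian η ta tb Z s m q n p) (slab η ta tb) :=
    (continuousOn_const.mul (continuousOn_finsetSum _ fun μ _ => continuousOn_finsetSum _
      fun ν _ => continuousOn_const.mul (F.continuousOn_fieldLimit hb μ ν))).add
      (continuousOn_finsetSum _ fun n _ => F.continuousOn_particleLagrangian m q n)
  refine (F.intervalIntegrable_slice hc hε).congr_ae ?_
  rw [uIoc_of_le F.time_lt.le, ← restrict_Ioo_eq_restrict_Ioc]
  filter_upwards [ae_restrict_mem measurableSet_Ioo] with t ht
  exact (F.lagrangian_eq hb m q hε ht (hv t (Ioo_subset_Icc_self ht))).symm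

/-- Apart from the shape of the singularities and the bound on the speeds, all requirements of the
domain are automatic for such a family: the renormalized limits exist because of the expansions, and
the Lagrangian is continuous in time on the closed slab up to the end points. -/
theorem inDomain (F : Fam η ta tb Z B δ H s) (m q : Fin N → ℝ) {ε : ℝ}
    (hε : ε ∈ Icc (-η) η) (hsing : PointSingular (Icc ta tb) (Z ε) (B ε))
    (hv : ∀ n, ∀ t ∈ Icc ta tb, ‖derivWithin (Z ε n) (Icc ta tb) t‖ < 1) :
    InDomain m q ta tb (Z ε) (B ε) where
  singular := hsing
  subluminal := hv
  decay := by
    have hdec := F.decay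
    choose C R hR h using hdec
    obtain ⟨R', hR', hfar⟩ := F.sep.fderivWithin_cut_far
    refine ⟨∑ μ, ∑ ν, |C μ ν|, (∑ μ, ∑ ν, R μ ν) + R', add_pos_of_nonneg_of_pos
      (Finset.sum_nonneg fun μ _ => Finset.sum_nonneg fun ν _ => (hR μ ν).le) hR',
      fun t ht x hx μ ν => ?_⟩
    have hRle : R μ ν ≤ ∑ μ, ∑ ν, R μ ν :=
      (Finset.single_le_sum (f := fun ν => R μ ν) (fun ν _ => (hR μ ν).le)
        (Finset.mem_univ ν)).trans (Finset.single_le_sum (f := fun μ => ∑ ν, R μ ν)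
        (fun μ _ => Finset.sum_nonneg fun ν _ => (hR μ ν).le) (Finset.mem_univ μ))
    have hCle : C μ ν ≤ ∑ μ, ∑ ν, |C μ ν| := (le_abs_self _).trans
      ((Finset.single_le_sum (f := fun ν => |C μ ν|) (fun ν _ => abs_nonneg _)
        (Finset.mem_univ ν)).trans (Finset.single_le_sum (f := fun μ => ∑ ν, |C μ ν|)
        (fun μ _ => Finset.sum_nonneg fun ν _ => abs_nonneg _) (Finset.mem_univ μ)))
    have hp := mem_slab hε (Ioo_subset_Icc_self ht)
    have hRpos := hR μ ν
    rw [F.field_eq hε ht (hfar δ F.sep.pos le_rfl _ hp x (by linarith)).2.1.2]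
    refine (h μ ν _ hp x (by linarith)).trans ?_
    gcongr
  rIntegrable t ht := by
    obtain ⟨b, C, hb⟩ := F.exists_fieldLimit
    obtain ⟨h1, h2⟩ := F.rIntegrable_fieldSquare hb hε ht
    exact ⟨h1, _, h2⟩
  hasRLim t ht n ν := ⟨_, F.hasRLim_potential hε (Ioo_subset_Icc_self ht) n ν⟩
  integrable := F.intervalIntegrable_lagrangian m q hε fun t ht n => by
    rw [← F.derivWithin_traj hε ht n]
    exact hv n t ht

end Fam

/-- An admissible variation, restricted to half of its parameter range, is a smooth family. -/
theorem IsAdmissibleVariation.exists_fam {m q : Fin N → ℝ} (ht : ta < tb) {z : Fin N → ℝ → Space}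
    {A : Spacetime → Fin 4 → ℝ} (hV : IsAdmissibleVariation m q ta tb z A η Z B) :
    ∃ δ H s, Fam (η / 2) ta tb Z B δ H s := by
  have hη := hV.pos
  -- Half of the range makes the parameters a closed interval inside the open one, since all uniform
  -- constants come from compactness.
  have hsub : ∀ ε ∈ Icc (-(η / 2)) (η / 2), ε ∈ Ioo (-η) η := fun ε hε =>
    ⟨by linarith [hε.1], by linarith [hε.2]⟩
  have hsing : PointSingular (slab (η / 2) ta tb) (famZ Z) (famB B) :=
    hV.smooth.comp (g := id) contDiff_id (fun p hp => ⟨hsub p.1 hp.1, hp.2⟩)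
  obtain ⟨δ, H, s, F⟩ := exists_famBase (half_pos hη) ht hsing
  have h0 := hV.inDomain 0 ⟨by linarith, hη⟩
  obtain ⟨C, R, _, hd⟩ := h0.decay
  obtain ⟨C', R', _, hd'⟩ := hV.decay
  exact ⟨δ, H, s, F.toFam ⟨C, R, hd⟩ ⟨C', R', fun ε hε =>
    hd' ε (hsub ε (Ioo_subset_Icc_self hε))⟩⟩

end

section

variable {P : Type} [NormedAddCommGroup P] [NormedSpace ℝ P]
variable {N : ℕ} {U : Set P} {z : Fin N → P → Space} {δ : ℝ}

/-! ### Integrals over the annulus -/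

theorem volume_annulus_lt_top : volume annulus < ⊤ := isCompact_annulus.measure_lt_top

theorem integrableOn_annulus {E : P × (ℝ × Space) → ℝ} (hE : ContinuousOn E (U ×ˢ scaleDomain δ))
    {p : P} (hp : p ∈ U) {r : ℝ} (hr : |r| < δ) :
    IntegrableOn (fun w => E (p, r, w)) annulus :=
  (continuousOn_slice_annulus hE hp hr).integrableOn_compact isCompact_annulus

theorem continuousOn_integral_annulus (hU : IsCompact U) {E : P × (ℝ × Space) → ℝ}
    (hE : ContinuousOn E (U ×ˢ scaleDomain δ)) {r : ℝ} (hr : |r| < δ) :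
    ContinuousOn (fun p => ∫ w in annulus, E (p, r, w)) U := by
  obtain ⟨C, hC0, hC⟩ := exists_bound_scale hU (show |r| < δ from hr) hE
  refine continuousOn_of_dominated (bound := fun _ => C) ?_ ?_ ?_ ?_
  · exact fun p hp => (integrableOn_annulus hE hp hr).aestronglyMeasurable
  · intro p hp
    filter_upwards [ae_restrict_mem measurableSet_annulus] with w hw
    exact hC p hp r le_rfl w hw
  · have := volume_annulus_lt_top
    exact (integrableOn_const this.ne)
  · filter_upwards [ae_restrict_mem measurableSet_annulus] with w hw
    exact hE.comp (by fun_prop) (fun p hp => ⟨hp, mem_scaleDomain_of_annulus hr hw⟩)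

theorem abs_integral_annulus_le {g : Space → ℝ} {C : ℝ} (hC : ∀ w ∈ annulus, |g w| ≤ C) :
    |∫ w in annulus, g w| ≤ C * volume.real annulus :=
  (Real.norm_eq_abs _).symm.trans_le (norm_setIntegral_le_of_norm_le_const volume_annulus_lt_top hC)

theorem exists_integral_annulus_lipschitz (hUc : IsCompact U) (hU : UniqueDiffOn ℝ U) {r0 : ℝ}
    (hr0 : r0 < δ) {E : P × (ℝ × Space) → ℝ} (hE : ContDiffOn ℝ ∞ E (U ×ˢ scaleDomain δ)) :
    ∃ C, 0 ≤ C ∧ ∀ p ∈ U, ∀ r, 0 ≤ r → r ≤ r0 →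
      |(∫ w in annulus, E (p, r, w)) - ∫ w in annulus, E (p, 0, w)| ≤ C * r := by
  obtain ⟨C, hC0, hC⟩ := exists_lipschitz_scale hUc hU hr0 hE
  refine ⟨C * volume.real annulus, by positivity, fun p hp r hr hr' => ?_⟩
  have h1 : |r| < δ := by rw [abs_of_nonneg hr]; linarith
  rw [← integral_sub (integrableOn_annulus hE.continuousOn hp h1)
    (integrableOn_annulus hE.continuousOn hp (by simpa using (abs_nonneg r).trans_lt h1))]
  exact (abs_integral_annulus_le fun w hw => hC p hp r hr hr' w hw).trans (le_of_eq (by ring))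

theorem integral_annulus_neg (g : Space → ℝ) :
    ∫ w in annulus, g (-w) = ∫ w in annulus, g w := by
  rw [← integral_indicator measurableSet_annulus, ← integral_indicator measurableSet_annulus,
    ← integral_neg_eq_self]
  congr 1
  ext w
  by_cases hw : w ∈ annulus
  · rw [indicator_of_mem hw, indicator_of_mem (neg_mem_annulus hw), neg_neg]
  · rw [indicator_of_notMem hw, indicator_of_notMem fun h => hw (by
      simpa using neg_mem_annulus h)]

/-- The annulus is symmetric, so the integral equals half the integral of the symmetrized function,
to which the odd bound applies. -/
theorem exists_integral_annulus_odd (hUc : IsCompact U) (hU : UniqueDiffOn ℝ U) {r0 : ℝ}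
    (hr0 : r0 < δ) {E : P × (ℝ × Space) → ℝ} (hE : ContDiffOn ℝ ∞ E (U ×ˢ scaleDomain δ))
    (hpar : ∀ p ∈ U, ∀ q ∈ scaleDomain δ, E (p, -q) = -E (p, q)) :
    ∃ C, 0 ≤ C ∧ ∀ p ∈ U, ∀ r, 0 ≤ r → r ≤ r0 →
      |(∫ w in annulus, E (p, r, w)) - r * ∫ w in annulus, scaleD U δ E (p, 0, w)| ≤
        C * r ^ 3 := by
  obtain ⟨C, hC0, hC⟩ := exists_odd_bound hUc hU hr0 hE hpar
  refine ⟨C * volume.real annulus, by positivity, fun p hp r hr hr' => ?_⟩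
  have h1 : |r| < δ := by rw [abs_of_nonneg hr]; linarith
  have i1 := integrableOn_annulus hE.continuousOn hp h1
  have i2 : IntegrableOn (fun w => E (p, r, -w)) annulus :=
    ((continuousOn_slice_annulus hE.continuousOn hp h1).comp continuous_neg.continuousOn
      fun w hw => neg_mem_annulus hw).integrableOn_compact isCompact_annulus
  have i3 := integrableOn_annulus (contDiffOn_scaleD hU hE).continuousOn hp
    (show |(0 : ℝ)| < δ by simpa using (abs_nonneg r).trans_lt h1)
  have h2 : |∫ w in annulus, (E (p, r, w) + E (p, r, -w) - 2 * r * scaleD U δ E (p, 0, w))| ≤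
    C * r ^ 3 * volume.real annulus := abs_integral_annulus_le fun w hw => hC p hp r hr hr' w hw
  rw [integral_sub (i1.fun_add i2) (i3.const_mul _), integral_add i1 i2,
    integral_annulus_neg fun w => E (p, r, w), integral_const_mul] at h2
  rw [show (∫ w in annulus, E (p, r, w)) + ∫ w in annulus, E (p, r, w) = 2 * ∫ w in annulus, E (p, r, w)
    by ring, mul_assoc, ← mul_sub, abs_mul, abs_two] at h2
  have : 0 ≤ C * r ^ 3 * volume.real annulus := by positivity
  linarith

/-! ### Integrals against the gradient of the cutoff -/

/-- The velocity, in the direction `v`, of a fixed point relative to the moving point `z`. -/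
noncomputable def relVel (U : Set P) (z : P → Space) (v : P × Space) (p : P) : Space :=
  v.2 - fderivWithin ℝ z U p v.1

theorem contDiffOn_relVel (hU : UniqueDiffOn ℝ U) {z : P → Space} (hz : ContDiffOn ℝ ∞ z U)
    (v : P × Space) : ContDiffOn ℝ ∞ (relVel U z v) U :=
  contDiffOn_const.sub ((hz.fderivWithin hU (by simp)).clm_apply contDiffOn_const)

/-- The derivative of the profile in the direction `c`. -/
noncomputable def profileSlope (c w : Space) : ℝ := fderiv ℝ profile w c

theorem profileSlope_eq_zero {c w : Space} (h : w ∉ annulus) : profileSlope c w = 0 := by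
  rw [profileSlope, fderiv_profile_eq_zero h]
  rfl

/-- The derivative of the profile in the direction of `relVel`. -/
noncomputable def profileD (U : Set P) (z : P → Space) (v : P × Space) (x : P × (ℝ × Space)) : ℝ :=
  profileSlope (relVel U z v x.1) x.2.2

theorem contDiffOn_profileD (hU : UniqueDiffOn ℝ U) {z : P → Space} (hz : ContDiffOn ℝ ∞ z U)
    (v : P × Space) (O : Set (ℝ × Space)) : ContDiffOn ℝ ∞ (profileD U z v) (U ×ˢ O) := by
  have h1 : ContDiff ℝ ∞ (fderiv ℝ profile) := profile_contDiff.fderiv_right (by simp)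
  exact ((h1.comp (by fun_prop : ContDiff ℝ ∞ fun x : P × (ℝ × Space) => x.2.2)).contDiffOn).clm_apply
    ((contDiffOn_relVel hU hz v).comp contDiffOn_fst fun x hx => hx.1)

theorem profileSlope_neg (c w : Space) : profileSlope c (-w) = -profileSlope c w := by
  have h1 := (profile_contDiff.differentiable (by simp) (-w)).hasFDerivAt
  have h2 := HasFDerivAt.comp w h1 (hasFDerivAt_id w).neg
  have h3 : profile ∘ Neg.neg = profile := funext fun w => profile_neg w
  rw [h3] at h2
  rw [profileSlope, profileSlope, h2.fderiv]
  simp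

theorem integral_eq_integral_annulus {g : Space → ℝ} (h : ∀ w, w ∉ annulus → g w = 0) :
    ∫ w, g w = ∫ w in annulus, g w :=
  (setIntegral_eq_integral_of_forall_compl_eq_zero h).symm

section Quadratic

variable {f g : P × Space → ℝ} {Φ Ψ : P × (ℝ × Space) → ℝ} {φ ψ : P × Space → ℝ}

/-- The term of order zero in `r⁴ f g`, divided by `r²`. -/
def mixedScaled (Φ Ψ : P × (ℝ × Space) → ℝ) (φ ψ : P × Space → ℝ) (x : P × (ℝ × Space)) : ℝ :=
  Φ x * regScaled ψ x + regScaled φ x * Ψ x + x.2.1 ^ 2 * (regScaled φ x * regScaled ψ x)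

theorem IsExpansion.mul_eq {z : P → Space} (hf : IsExpansion U z δ 2 f Φ φ)
    (hg : IsExpansion U z δ 2 g Ψ ψ) {p : P} (hp : p ∈ U) {r : ℝ} (hr : 0 < r) {w : Space}
    (hw : (r, w) ∈ scaleDomain δ) :
    f (p, z p + r • w) * g (p, z p + r • w) =
      (r ^ 4)⁻¹ * (Φ (p, r, w) * Ψ (p, r, w) + r ^ 2 * mixedScaled Φ Ψ φ ψ (p, r, w)) := by
  rw [hf.eq p hp r w hr hw, hg.eq p hp r w hr hw]
  simp only [mixedScaled, regScaled]
  field_simp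
  ring

/-- The gradient of the cutoff contributes `r⁻¹`, the volume `r³` and the product `r⁻⁴`. The purely
singular product is kept apart because its coefficient `r⁻²` has to be compensated by parity. -/
theorem IsExpansion.integral_profileD_mul {z : P → Space}
    (hf : IsExpansion U z δ 2 f Φ φ) (hg : IsExpansion U z δ 2 g Ψ ψ)
    (hU : UniqueDiffOn ℝ U) (hz : ContDiffOn ℝ ∞ z U) (v : P × Space) {p : P} (hp : p ∈ U)
    {r : ℝ} (hr : 0 < r) (hr' : r < δ) :
    Integrable (fun x => r⁻¹ * profileSlope (relVel U z v p) (r⁻¹ • (x - z p)) *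
        (f (p, x) * g (p, x))) ∧
    ∫ x, r⁻¹ * profileSlope (relVel U z v p) (r⁻¹ • (x - z p)) * (f (p, x) * g (p, x)) =
      (r ^ 2)⁻¹ * (∫ w in annulus, profileD U z v (p, r, w) * (Φ (p, r, w) * Ψ (p, r, w))) +
        ∫ w in annulus, profileD U z v (p, r, w) * mixedScaled Φ Ψ φ ψ (p, r, w) := by
  have hra : |r| < δ := by rwa [abs_of_pos hr]
  set m : Space → ℝ := profileSlope (relVel U z v p) with hm
  have hm0 : ∀ w, w ∉ annulus → m w = 0 := fun w hw => profileSlope_eq_zero hw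
  have hΦΨ : ContDiffOn ℝ ∞ (fun x => profileD U z v x * (Φ x * Ψ x)) (U ×ˢ scaleDomain δ) :=
    (contDiffOn_profileD hU hz v _).mul (hf.smooth_sing.mul hg.smooth_sing)
  have hM : ContDiffOn ℝ ∞ (fun x => profileD U z v x * mixedScaled Φ Ψ φ ψ x)
      (U ×ˢ scaleDomain δ) := (contDiffOn_profileD hU hz v _).mul
    (((hf.smooth_sing.mul (contDiffOn_regScaled hg.smooth_reg)).add
      ((contDiffOn_regScaled hf.smooth_reg).mul hg.smooth_sing)).add
      ((contDiffOn_scale_pow 2).mul ((contDiffOn_regScaled hf.smooth_reg).mul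
        (contDiffOn_regScaled hg.smooth_reg))))
  have i1 := integrableOn_annulus hΦΨ.continuousOn hp hra
  have i2 := integrableOn_annulus hM.continuousOn hp hra
  have key : ∀ w, m w * (f (p, z p + r • w) * g (p, z p + r • w)) =
      annulus.indicator (fun w => (r ^ 4)⁻¹ * (profileD U z v (p, r, w) * (Φ (p, r, w) * Ψ (p, r, w))
        + r ^ 2 * (profileD U z v (p, r, w) * mixedScaled Φ Ψ φ ψ (p, r, w)))) w := by
    intro w
    by_cases hw : w ∈ annulus
    · rw [indicator_of_mem hw, hf.mul_eq hg hp hr (mem_scaleDomain_of_annulus hra hw)]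
      simp only [hm, profileD]
      ring
    · rw [indicator_of_notMem hw, hm0 w hw, zero_mul]
  have hI : Integrable fun w => m w * (f (p, z p + r • w) * g (p, z p + r • w)) := by
    simp only [key]
    rw [integrable_indicator_iff measurableSet_annulus]
    exact (i1.add (i2.const_mul _)).const_mul _
  simp only [mul_assoc]
  constructor
  · exact (integrable_scaled_mul (f := fun x => f (p, x) * g (p, x)) (z p) hr hI).const_mul r⁻¹
  · rw [integral_const_mul, integral_scaled_mul m (fun x => f (p, x) * g (p, x)) (z p) hr]
    simp only [key]
    rw [integral_indicator measurableSet_annulus, integral_const_mul,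
      integral_add i1 (i2.const_mul _), integral_const_mul]
    field_simp

/-- The expansion of a localized integral of the product of two functions that are singular at
a moving point. -/
theorem IsExpansion.exists_integral_profileD_mul {z : P → Space}
    (hf : IsExpansion U z δ 2 f Φ φ) (hg : IsExpansion U z δ 2 g Ψ ψ) (hUc : IsCompact U)
    (hU : UniqueDiffOn ℝ U) (hz : ContDiffOn ℝ ∞ z U) (hδ : 0 < δ) (v : P × Space) :
    ∃ (K : P → ℝ) (C : ℝ), ContinuousOn K U ∧ ∀ p ∈ U, ∀ r, 0 < r → r ≤ δ / 2 →
      |(∫ x, r⁻¹ * profileSlope (relVel U z v p) (r⁻¹ • (x - z p)) * (f (p, x) * g (p, x))) -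
        (K p / r + ∫ w in annulus, profileD U z v (p, 0, w) *
          (Φ (p, 0, w) * ψ (p, 0) + φ (p, 0) * Ψ (p, 0, w)))| ≤ C * r := by
  have hΦΨ : ContDiffOn ℝ ∞ (fun x => profileD U z v x * (Φ x * Ψ x)) (U ×ˢ scaleDomain δ) :=
    (contDiffOn_profileD hU hz v _).mul (hf.smooth_sing.mul hg.smooth_sing)
  have hM : ContDiffOn ℝ ∞ (fun x => profileD U z v x * mixedScaled Φ Ψ φ ψ x)
      (U ×ˢ scaleDomain δ) := (contDiffOn_profileD hU hz v _).mul
    (((hf.smooth_sing.mul (contDiffOn_regScaled hg.smooth_reg)).add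
      ((contDiffOn_regScaled hf.smooth_reg).mul hg.smooth_sing)).add
      ((contDiffOn_scale_pow 2).mul ((contDiffOn_regScaled hf.smooth_reg).mul
        (contDiffOn_regScaled hg.smooth_reg))))
  -- The gradient of the even profile is odd, and the product of two odd coefficients is even. The
  -- integrand is therefore odd, its integral is linear in `r` up to `O(r³)`, and the purely
  -- singular product gives `K / r` and no constant. The constant comes from the mixed terms alone.
  obtain ⟨C₁, h10, h1⟩ := exists_integral_annulus_odd hUc hU (half_lt_self hδ) hΦΨ
    (fun p hp q hq => by
      simp only [profileD, hf.parity p hp q hq, hg.parity p hp q hq, Prod.snd_neg,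
        profileSlope_neg]
      ring)
  obtain ⟨C₂, h20, h2⟩ := exists_integral_annulus_lipschitz hUc hU (half_lt_self hδ) hM
  refine ⟨fun p => ∫ w in annulus, scaleD U δ (fun x => profileD U z v x * (Φ x * Ψ x)) (p, 0, w),
    C₁ + C₂, continuousOn_integral_annulus hUc (contDiffOn_scaleD hU hΦΨ).continuousOn
      (by simpa using hδ), fun p hp r hr hr' => ?_⟩
  rw [(hf.integral_profileD_mul hg hU hz v hp hr (by linarith)).2]
  have e1 := h1 p hp r hr.le hr'
  have e2 := h2 p hp r hr.le hr'
  have e3 : ∫ w in annulus, profileD U z v (p, 0, w) * mixedScaled Φ Ψ φ ψ (p, 0, w) =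
      ∫ w in annulus, profileD U z v (p, 0, w) *
          (Φ (p, 0, w) * ψ (p, 0) + φ (p, 0) * Ψ (p, 0, w)) := by
    simp [mixedScaled, regScaled]
  rw [e3] at e2
  set a := ∫ w in annulus, profileD U z v (p, r, w) * (Φ (p, r, w) * Ψ (p, r, w))
  set k := ∫ w in annulus, scaleD U δ (fun x => profileD U z v x * (Φ x * Ψ x)) (p, 0, w)
  set b := ∫ w in annulus, profileD U z v (p, r, w) * mixedScaled Φ Ψ φ ψ (p, r, w)
  set b' := ∫ w in annulus, profileD U z v (p, 0, w) *
          (Φ (p, 0, w) * ψ (p, 0) + φ (p, 0) * Ψ (p, 0, w))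
  have e4 : (r ^ 2)⁻¹ * a + b - (k / r + b') = (r ^ 2)⁻¹ * (a - r * k) + (b - b') := by
    field_simp
    ring
  rw [e4]
  calc _ ≤ |(r ^ 2)⁻¹ * (a - r * k)| + |b - b'| := abs_add_le _ _
    _ ≤ (r ^ 2)⁻¹ * (C₁ * r ^ 3) + C₂ * r := by
        rw [abs_mul, abs_of_pos (by positivity : 0 < (r ^ 2)⁻¹)]
        gcongr
    _ = _ := by field_simp

theorem IsExpansion.continuousOn_integral_profileD_mul {z : P → Space}
    (hf : IsExpansion U z δ 2 f Φ φ) (hg : IsExpansion U z δ 2 g Ψ ψ) (hUc : IsCompact U)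
    (hU : UniqueDiffOn ℝ U) (hz : ContDiffOn ℝ ∞ z U) (v : P × Space) {r : ℝ} (hr : 0 < r)
    (hr' : r < δ) :
    ContinuousOn (fun p => ∫ x, r⁻¹ * profileSlope (relVel U z v p) (r⁻¹ • (x - z p)) *
      (f (p, x) * g (p, x))) U := by
  have hra : |r| < δ := by rwa [abs_of_pos hr]
  have hΦΨ : ContDiffOn ℝ ∞ (fun x => profileD U z v x * (Φ x * Ψ x)) (U ×ˢ scaleDomain δ) :=
    (contDiffOn_profileD hU hz v _).mul (hf.smooth_sing.mul hg.smooth_sing)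
  have hM : ContDiffOn ℝ ∞ (fun x => profileD U z v x * mixedScaled Φ Ψ φ ψ x)
      (U ×ˢ scaleDomain δ) := (contDiffOn_profileD hU hz v _).mul
    (((hf.smooth_sing.mul (contDiffOn_regScaled hg.smooth_reg)).add
      ((contDiffOn_regScaled hf.smooth_reg).mul hg.smooth_sing)).add
      ((contDiffOn_scale_pow 2).mul ((contDiffOn_regScaled hf.smooth_reg).mul
        (contDiffOn_regScaled hg.smooth_reg))))
  refine ((continuousOn_const (c := (r ^ 2)⁻¹).mul (continuousOn_integral_annulus hUc hΦΨ.continuousOn hra)).add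
    (continuousOn_integral_annulus hUc hM.continuousOn hra)).congr fun p hp => ?_
  exact (hf.integral_profileD_mul hg hU hz v hp hr hr').2

theorem IsExpansion.continuousOn_integral_profileD_mixed {z : P → Space}
    (hf : IsExpansion U z δ 2 f Φ φ) (hg : IsExpansion U z δ 2 g Ψ ψ) (hUc : IsCompact U)
    (hU : UniqueDiffOn ℝ U) (hz : ContDiffOn ℝ ∞ z U) (hδ : 0 < δ) (v : P × Space) :
    ContinuousOn (fun p => ∫ w in annulus, profileD U z v (p, 0, w) *
          (Φ (p, 0, w) * ψ (p, 0) + φ (p, 0) * Ψ (p, 0, w))) U := by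
  have hM : ContDiffOn ℝ ∞ (fun x => profileD U z v x * mixedScaled Φ Ψ φ ψ x)
      (U ×ˢ scaleDomain δ) := (contDiffOn_profileD hU hz v _).mul
    (((hf.smooth_sing.mul (contDiffOn_regScaled hg.smooth_reg)).add
      ((contDiffOn_regScaled hf.smooth_reg).mul hg.smooth_sing)).add
      ((contDiffOn_scale_pow 2).mul ((contDiffOn_regScaled hf.smooth_reg).mul
        (contDiffOn_regScaled hg.smooth_reg))))
  refine (continuousOn_integral_annulus (r := 0) hUc hM.continuousOn (by simpa using hδ)).congr
    fun p hp => ?_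
  simp [mixedScaled, regScaled]

/-- For a single factor of order two the powers `r⁻¹ r³ r⁻²` cancel, so these integrals have a
finite limit without any `1 / r` term. -/
theorem IsExpansion.integral_profileD {z : P → Space}
    (hf : IsExpansion U z δ 2 f Φ φ) (hU : UniqueDiffOn ℝ U) (hz : ContDiffOn ℝ ∞ z U)
    (v : P × Space) {p : P} (hp : p ∈ U) {r : ℝ} (hr : 0 < r) (hr' : r < δ) :
    Integrable (fun x => r⁻¹ * profileSlope (relVel U z v p) (r⁻¹ • (x - z p)) * f (p, x)) ∧
    ∫ x, r⁻¹ * profileSlope (relVel U z v p) (r⁻¹ • (x - z p)) * f (p, x) =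
      ∫ w in annulus, profileD U z v (p, r, w) *
        (Φ (p, r, w) + r ^ 2 * regScaled φ (p, r, w)) := by
  have hra : |r| < δ := by rwa [abs_of_pos hr]
  set m : Space → ℝ := profileSlope (relVel U z v p) with hm
  have hM : ContDiffOn ℝ ∞ (fun x => profileD U z v x * (Φ x + x.2.1 ^ 2 * regScaled φ x))
      (U ×ˢ scaleDomain δ) := (contDiffOn_profileD hU hz v _).mul
    (hf.smooth_sing.add ((contDiffOn_scale_pow 2).mul (contDiffOn_regScaled hf.smooth_reg)))
  have i1 := integrableOn_annulus hM.continuousOn hp hra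
  have key : ∀ w, m w * f (p, z p + r • w) = annulus.indicator (fun w => (r ^ 2)⁻¹ *
      (profileD U z v (p, r, w) * (Φ (p, r, w) + r ^ 2 * regScaled φ (p, r, w)))) w := by
    intro w
    by_cases hw : w ∈ annulus
    · rw [indicator_of_mem hw, hf.eq p hp r w hr (mem_scaleDomain_of_annulus hra hw)]
      simp only [hm, profileD, regScaled]
      field_simp
    · rw [indicator_of_notMem hw, hm, profileSlope_eq_zero hw, zero_mul]
  have hI : Integrable fun w => m w * f (p, z p + r • w) := by
    simp only [key]
    rw [integrable_indicator_iff measurableSet_annulus]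
    exact i1.const_mul _
  simp only [mul_assoc]
  constructor
  · exact (integrable_scaled_mul (f := fun x => f (p, x)) (z p) hr hI).const_mul r⁻¹
  · rw [integral_const_mul, integral_scaled_mul m (fun x => f (p, x)) (z p) hr]
    simp only [key]
    rw [integral_indicator measurableSet_annulus, integral_const_mul]
    field_simp

theorem IsExpansion.exists_integral_profileD {z : P → Space}
    (hf : IsExpansion U z δ 2 f Φ φ) (hUc : IsCompact U)
    (hU : UniqueDiffOn ℝ U) (hz : ContDiffOn ℝ ∞ z U) (hδ : 0 < δ) (v : P × Space) :
    ∃ C, ∀ p ∈ U, ∀ r, 0 < r → r ≤ δ / 2 →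
      |(∫ x, r⁻¹ * profileSlope (relVel U z v p) (r⁻¹ • (x - z p)) * f (p, x)) -
        ∫ w in annulus, profileD U z v (p, 0, w) * Φ (p, 0, w)| ≤ C * r := by
  have hM : ContDiffOn ℝ ∞ (fun x => profileD U z v x * (Φ x + x.2.1 ^ 2 * regScaled φ x))
      (U ×ˢ scaleDomain δ) := (contDiffOn_profileD hU hz v _).mul
    (hf.smooth_sing.add ((contDiffOn_scale_pow 2).mul (contDiffOn_regScaled hf.smooth_reg)))
  obtain ⟨C, h0, h⟩ := exists_integral_annulus_lipschitz hUc hU (half_lt_self hδ) hM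
  refine ⟨C, fun p hp r hr hr' => ?_⟩
  rw [(hf.integral_profileD hU hz v hp hr (by linarith)).2]
  simpa using h p hp r hr.le hr'

theorem IsExpansion.continuousOn_integral_profileD {z : P → Space}
    (hf : IsExpansion U z δ 2 f Φ φ) (hUc : IsCompact U)
    (hU : UniqueDiffOn ℝ U) (hz : ContDiffOn ℝ ∞ z U) (v : P × Space) {r : ℝ} (hr : 0 < r)
    (hr' : r < δ) : ContinuousOn
      (fun p => ∫ x, r⁻¹ * profileSlope (relVel U z v p) (r⁻¹ • (x - z p)) * f (p, x)) U := by
  have hM : ContDiffOn ℝ ∞ (fun x => profileD U z v x * (Φ x + x.2.1 ^ 2 * regScaled φ x))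
      (U ×ˢ scaleDomain δ) := (contDiffOn_profileD hU hz v _).mul
    (hf.smooth_sing.add ((contDiffOn_scale_pow 2).mul (contDiffOn_regScaled hf.smooth_reg)))
  exact (continuousOn_integral_annulus hUc hM.continuousOn (by rwa [abs_of_pos hr])).congr
    fun p hp => (hf.integral_profileD hU hz v hp hr hr').2

theorem IsExpansion.continuousOn_integral_profileD_zero {z : P → Space}
    (hf : IsExpansion U z δ 2 f Φ φ) (hUc : IsCompact U)
    (hU : UniqueDiffOn ℝ U) (hz : ContDiffOn ℝ ∞ z U) (hδ : 0 < δ) (v : P × Space) :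
    ContinuousOn (fun p => ∫ w in annulus, profileD U z v (p, 0, w) * Φ (p, 0, w)) U :=
  continuousOn_integral_annulus hUc
    ((contDiffOn_profileD hU hz v _).mul hf.smooth_sing).continuousOn (by simpa using hδ)

end Quadratic

/-! ### Exchange of directions -/

/-- Integration by parts turns both sides into minus the integral of the profile against a second
derivative, and second derivatives commute. This symmetry is what makes the local terms of the
variation cancel. -/
theorem integral_profileSlope_exchange {h : Space → ℝ} (hh : ContDiffOn ℝ ∞ h {0}ᶜ) (a b : Space) :
    ∫ w in annulus, profileSlope a w * fderiv ℝ h w b =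
      ∫ w in annulus, profileSlope b w * fderiv ℝ h w a := by
  -- The singularity of `h` at the origin is removed: `g` vanishes for `‖w‖ ≤ 1/32` and equals `h`
  -- for `‖w‖ ≥ 1/8`, while the gradient of the profile vanishes for `‖w‖ < 1/4`. So the replacement
  -- does not affect the integrals.
  set g : Space → ℝ := fun w => (1 - profile ((8 : ℝ) • w)) * h w with hg
  have hgs : ContDiff ℝ ∞ g := by
    rw [contDiff_iff_contDiffAt]
    intro w
    by_cases hw : w = 0
    · have : g =ᶠ[𝓝 w] fun _ => 0 := by
        have : ∀ᶠ y in 𝓝 w, ‖y‖ < 1 / 32 :=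
          continuous_norm.continuousAt.eventually (gt_mem_nhds (by rw [hw]; norm_num))
        filter_upwards [this] with y hy
        rw [hg]
        dsimp only
        rw [profile_eq_one (by rw [norm_smul]; norm_num; linarith)]
        simp
      exact contDiffAt_const.congr_of_eventuallyEq this
    · refine ContDiffAt.mul ?_ (hh.contDiffAt (isOpen_compl_singleton.mem_nhds hw))
      exact contDiffAt_const.sub (profile_contDiff.comp (contDiff_const_smul _)).contDiffAt
  have heq : ∀ w, 1 / 8 < ‖w‖ → fderiv ℝ g w = fderiv ℝ h w := by
    intro w hw
    refine Filter.EventuallyEq.fderiv_eq ?_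
    filter_upwards [continuous_norm.continuousAt.eventually (lt_mem_nhds hw)] with y hy
    rw [hg]
    dsimp only
    rw [profile_eq_zero (by rw [norm_smul]; norm_num; linarith)]
    ring
  have hzero : ∀ c w, ‖w‖ < 1 / 4 → profileSlope c w = 0 := by
    intro c w hw
    have : profile =ᶠ[𝓝 w] fun _ => 1 := by
      filter_upwards [continuous_norm.continuousAt.eventually (gt_mem_nhds hw)] with y hy
      exact profile_eq_one hy.le
    rw [profileSlope, this.fderiv_eq]
    simp
  have hprod : ∀ c d w, profileSlope c w * fderiv ℝ h w d = profileSlope c w * fderiv ℝ g w d := by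
    intro c d w
    rcases lt_or_ge ‖w‖ (1 / 4) with hw | hw
    · rw [hzero c w hw, zero_mul, zero_mul]
    · rw [heq w (by linarith)]
  have hsupp : HasCompactSupport profile := HasCompactSupport.of_support_subset_isCompact
    (isCompact_closedBall (0 : Space) 1) fun w hw => by
      rw [mem_closedBall_zero_iff]
      by_contra hc
      exact hw (profile_eq_zero (by linarith))
  have hgd : ∀ d, ContDiff ℝ ∞ fun w => fderiv ℝ g w d := fun d =>
    (hgs.fderiv_right (by simp)).clm_apply contDiff_const
  have hkd : ∀ d, Continuous fun w => fderiv ℝ profile w d := fun d =>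
    ((profile_contDiff.continuous_fderiv (by simp)).clm_apply continuous_const)
  have ibp : ∀ c d, ∫ w, fderiv ℝ g w d * fderiv ℝ profile w c =
      -∫ w, fderiv ℝ (fun w => fderiv ℝ g w d) w c * profile w := by
    intro c d
    refine integral_mul_fderiv_eq_neg_fderiv_mul_of_integrable ?_ ?_ ?_
      (fun w _ => (hgd d).differentiable (by simp) w)
      (fun w _ => profile_contDiff.differentiable (by simp) w)
    · exact (((((hgd d).continuous_fderiv (by simp)).clm_apply continuous_const)).mul
        profile_contDiff.continuous).integrable_of_hasCompactSupport hsupp.mul_left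
    · exact ((hgd d).continuous.mul (hkd c)).integrable_of_hasCompactSupport
        (hsupp.fderiv_apply (𝕜 := ℝ) c).mul_left
    · exact ((hgd d).continuous.mul profile_contDiff.continuous).integrable_of_hasCompactSupport
        hsupp.mul_left
  have hfull : ∀ c d, ∫ w in annulus, profileSlope c w * fderiv ℝ h w d =
      -∫ w, fderiv ℝ (fun w => fderiv ℝ g w d) w c * profile w := by
    intro c d
    rw [← ibp c d, ← integral_eq_integral_annulus fun w hw => by
      rw [profileSlope_eq_zero hw, zero_mul]]
    refine integral_congr_ae (Eventually.of_forall fun w => ?_)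
    dsimp only
    rw [hprod, profileSlope, mul_comm]
  rw [hfull, hfull]
  congr 2
  ext w
  have hsym : IsSymmSndFDerivAt ℝ g w := hgs.contDiffAt.isSymmSndFDerivAt (by
    rw [minSmoothness_of_isRCLikeNormedField]
    exact WithTop.coe_le_coe.2 le_top)
  have hd : DifferentiableAt ℝ (fderiv ℝ g) w :=
    ((hgs.fderiv_right (m := ∞) (by simp)).differentiable (by simp)) w
  have e : ∀ c d, fderiv ℝ (fun w => fderiv ℝ g w d) w c = fderiv ℝ (fderiv ℝ g) w c d := by
    intro c d
    rw [fderiv_clm_apply hd (differentiableAt_const _)]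
    simp
  rw [e, e, hsym.eq]

/-! ### Local integrability of the singularities -/

/-- `|y|⁻²` on the ball of radius `ρ`. -/
noncomputable def nearWeight (ρ : ℝ) (y : Space) : ℝ :=
  (Metric.closedBall (0 : Space) ρ).indicator (fun y => (‖y‖ ^ 2)⁻¹) y

theorem nearWeight_nonneg (ρ : ℝ) (y : Space) : 0 ≤ nearWeight ρ y :=
  indicator_nonneg (fun _ _ => by positivity) y

theorem nearWeight_eq {ρ : ℝ} {y : Space} (h : ‖y‖ ≤ ρ) : nearWeight ρ y = (‖y‖ ^ 2)⁻¹ :=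
  indicator_of_mem (mem_closedBall_zero_iff.2 h) _

theorem integrable_nearWeight (ρ : ℝ) : Integrable (nearWeight ρ) := by
  have h : IntegrableOn (fun y : Space => (‖y‖ ^ 2)⁻¹) (Metric.ball 0 (ρ + 1)) := by
    refine integrableOn_ball_of_norm_le_rpow (C := 1) (α := 2) (by simp) (by norm_num) ?_ ?_
    · filter_upwards with y
      rw [Real.rpow_neg (norm_nonneg _), one_mul, Real.norm_of_nonneg (by positivity)]
      norm_num
    · exact (Measurable.aestronglyMeasurable (by fun_prop))
  rw [show nearWeight ρ = (Metric.closedBall (0 : Space) ρ).indicator (fun y => (‖y‖ ^ 2)⁻¹) from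
    rfl, integrable_indicator_iff measurableSet_closedBall]
  exact h.mono_set (Metric.closedBall_subset_ball (by linarith))

theorem integral_nearWeight {ρ : ℝ} (hρ : 0 < ρ) (c : Space) :
    ∫ x, nearWeight ρ (x - c) = ρ * ∫ y, nearWeight 1 y := by
  have h : ∀ x, nearWeight ρ (x - c) = (ρ ^ 2)⁻¹ * nearWeight 1 (ρ⁻¹ • (x - c)) := by
    intro x
    have hn : ‖ρ⁻¹ • (x - c)‖ = ρ⁻¹ * ‖x - c‖ := by
      rw [norm_smul, Real.norm_of_nonneg (inv_nonneg.2 hρ.le)]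
    by_cases hx : ‖x - c‖ ≤ ρ
    · rw [nearWeight_eq hx, nearWeight_eq (by rw [hn, inv_mul_le_iff₀ hρ]; linarith), hn]
      field_simp
    · rw [nearWeight, nearWeight, indicator_of_notMem (by simpa using hx), indicator_of_notMem, mul_zero]
      rw [mem_closedBall_zero_iff, hn, inv_mul_le_iff₀ hρ]
      simpa using hx
  simp only [h]
  rw [integral_const_mul, integral_scaled (nearWeight 1) c hρ]
  field_simp

/-- `f(p, x) = O(|x - z p|⁻²)` near the moving points. -/
def NearBound (U : Set P) (z : Fin N → P → Space) (δ : ℝ) (f : P × Space → ℝ) : Prop :=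
  ∃ C, 0 ≤ C ∧ ∀ p ∈ U, ∀ n, ∀ x : Space, x ≠ z n p → ‖x - z n p‖ ≤ δ / 2 →
    |f (p, x)| ≤ C * (‖x - z n p‖ ^ 2)⁻¹

theorem IsExpansion.exists_near_bound (hUc : IsCompact U) (hδ : 0 < δ) {k : ℕ}
    {z : P → Space} {f : P × Space → ℝ} {Φ : P × (ℝ × Space) → ℝ} {φ : P × Space → ℝ}
    (h : IsExpansion U z δ k f Φ φ) :
    ∃ C, 0 ≤ C ∧ ∀ p ∈ U, ∀ x : Space, x ≠ z p → ‖x - z p‖ ≤ δ / 2 →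
      |f (p, x)| ≤ C * (‖x - z p‖ ^ k)⁻¹ := by
  obtain ⟨C₁, h10, h1⟩ := exists_bound_scale hUc (half_lt_self hδ) h.smooth_sing.continuousOn
  obtain ⟨C₂, h2⟩ := (hUc.prod (isCompact_closedBall (0 : Space) (δ / 2))).exists_bound_of_continuousOn
    (h.smooth_reg.continuousOn.mono (prod_mono_right
      (Metric.closedBall_subset_ball (half_lt_self hδ))))
  refine ⟨C₁ + |C₂| * δ ^ k, by positivity, fun p hp x hx hx' => ?_⟩
  set r := ‖x - z p‖ with hr
  have hr0 : 0 < r := norm_pos_iff.2 (sub_ne_zero.2 hx)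
  set w := r⁻¹ • (x - z p) with hw
  have hwn : ‖w‖ = 1 := by
    rw [hw, norm_smul, norm_inv, Real.norm_of_nonneg hr0.le, ← hr, inv_mul_cancel₀ hr0.ne']
  have hwa : w ∈ annulus := ⟨by rw [hwn]; norm_num, hwn.le⟩
  have hrw : r • w = x - z p := by rw [hw, smul_smul, mul_inv_cancel₀ hr0.ne', one_smul]
  have hra : |r| ≤ δ / 2 := by rwa [abs_of_pos hr0]
  have e := h.eq p hp r w hr0 (mem_scaleDomain_of_annulus (by linarith) hwa)
  rw [hrw, add_sub_cancel] at e
  have e1 := h1 p hp r hra w hwa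
  have e2 : |φ (p, x - z p)| ≤ |C₂| := (h2 (p, x - z p) ⟨hp, by
    rw [mem_closedBall_zero_iff]; exact hx'⟩).trans (le_abs_self _)
  have e4 : 1 ≤ δ ^ k * (r ^ k)⁻¹ := by
    rw [← div_eq_mul_inv, le_div_iff₀ (by positivity), one_mul]
    exact pow_le_pow_left₀ hr0.le (by linarith) k
  rw [e]
  calc _ ≤ |(r ^ k)⁻¹ * Φ (p, r, w)| + |φ (p, x - z p)| := abs_add_le _ _
    _ ≤ (r ^ k)⁻¹ * C₁ + |C₂| * 1 := by
        rw [abs_mul, abs_of_pos (by positivity : 0 < (r ^ k)⁻¹), mul_one]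
        gcongr
    _ ≤ (r ^ k)⁻¹ * C₁ + |C₂| * (δ ^ k * (r ^ k)⁻¹) := by gcongr
    _ = _ := by ring

theorem SingularFunction.exists_near_bound (hs : SeparatedPoints U z δ) {k : ℕ}
    {f : P × Space → ℝ} {Φ : Fin N → P × (ℝ × Space) → ℝ} {φ : Fin N → P × Space → ℝ}
    (h : SingularFunction U z δ k f Φ φ) :
    ∃ C, 0 ≤ C ∧ ∀ p ∈ U, ∀ n, ∀ x : Space, x ≠ z n p → ‖x - z n p‖ ≤ δ / 2 →
      |f (p, x)| ≤ C * (‖x - z n p‖ ^ k)⁻¹ := by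
  have := fun n => (h.expansion n).exists_near_bound hs.compact hs.pos
  choose C hC0 hC using this
  refine ⟨∑ n, C n, Finset.sum_nonneg fun n _ => hC0 n, fun p hp n x hx hx' => ?_⟩
  refine (hC n p hp x hx hx').trans ?_
  gcongr
  exact Finset.single_le_sum (f := C) (fun n _ => hC0 n) (Finset.mem_univ n)

theorem SingularFunction.nearBound (hs : SeparatedPoints U z δ) {k : ℕ} (hk : k = 1 ∨ k = 2)
    {f : P × Space → ℝ} {Φ : Fin N → P × (ℝ × Space) → ℝ} {φ : Fin N → P × Space → ℝ}
    (h : SingularFunction U z δ k f Φ φ) : NearBound U z δ f := by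
  have hδ := hs.pos
  obtain ⟨C, hC0, hC⟩ := h.exists_near_bound hs
  refine ⟨C * (1 + δ), by positivity, fun p hp n x hx hx' => (hC p hp n x hx hx').trans ?_⟩
  have hr0 : 0 < ‖x - z n p‖ := norm_pos_iff.2 (sub_ne_zero.2 hx)
  rw [mul_assoc]
  gcongr
  rcases hk with rfl | rfl
  · rw [← div_eq_mul_inv, le_div_iff₀ (by positivity)]
    field_simp
    linarith
  · exact le_mul_of_one_le_left (by positivity) (by linarith)

/-- A function that dominates the fields of a configuration. -/
noncomputable def dominating (j : ℕ) (ρ : ℝ) (z : Fin N → P → Space) (x : P × Space) : ℝ :=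
  ((1 + ‖x.2‖) ^ j)⁻¹ + ∑ n, nearWeight ρ (x.2 - z n x.1)

theorem dominating_nonneg (j : ℕ) (ρ : ℝ) (z : Fin N → P → Space) (x : P × Space) :
    0 ≤ dominating j ρ z x :=
  add_nonneg (by positivity) (Finset.sum_nonneg fun n _ => nearWeight_nonneg _ _)

/-- Close to some particle the singular bound applies; elsewhere the cutoff of radius `δ / 2` is
`1`, and the cut off function is continuous and decays. -/
theorem NearBound.exists_global_bound (hs : SeparatedPoints U z δ) {f : P × Space → ℝ}
    (hf : ContDiffOn ℝ ∞ f (offLines U z)) (hn : NearBound U z δ f) {j : ℕ}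
    (hd : DecaysLike U j f) :
    ∃ C, 0 ≤ C ∧ ∀ x ∈ offLines U z, |f x| ≤ C * dominating j (δ / 2) z x := by
  have hδ := hs.pos
  obtain ⟨C₁, h10, h1⟩ := hn
  obtain ⟨C₂, h20, h2⟩ := (hs.decays_cut_mul (half_pos hδ) (by linarith) hd).exists_bound hs.compact
    (hs.contDiffOn_cut_mul (half_pos hδ) (by linarith) hf).continuousOn
  refine ⟨C₁ + C₂, by positivity, fun x hx => ?_⟩
  have hA : 0 ≤ ((1 + ‖x.2‖) ^ j)⁻¹ := by positivity
  by_cases h : ∃ n, ‖x.2 - z n x.1‖ ≤ δ / 2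
  · obtain ⟨n, hxn⟩ := h
    have e1 := h1 x.1 hx.1 n x.2 (hx.2 n) hxn
    rw [← nearWeight_eq hxn] at e1
    have e2 : nearWeight (δ / 2) (x.2 - z n x.1) ≤ ∑ n, nearWeight (δ / 2) (x.2 - z n x.1) :=
      Finset.single_le_sum (f := fun n => nearWeight (δ / 2) (x.2 - z n x.1))
        (fun n _ => nearWeight_nonneg _ _) (Finset.mem_univ n)
    calc |f x| ≤ C₁ * nearWeight (δ / 2) (x.2 - z n x.1) := e1
      _ ≤ (C₁ + C₂) * dominating j (δ / 2) z x := by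
        have := nearWeight_nonneg (δ / 2) (x.2 - z n x.1)
        rw [dominating]
        gcongr <;> linarith
  · push Not at h
    have e1 := h2 x.1 hx.1 x.2
    rw [cut_eq_one (half_pos hδ) fun n => (h n).le, one_mul] at e1
    refine e1.trans ?_
    rw [dominating]
    have : 0 ≤ ∑ n, nearWeight (δ / 2) (x.2 - z n x.1) :=
      Finset.sum_nonneg fun n _ => nearWeight_nonneg _ _
    gcongr <;> linarith

/-- The integral of a singular function over a small ball is small. -/
theorem NearBound.exists_integral_bound {f : P × Space → ℝ} (hn : NearBound U z δ f) :
    ∃ C, 0 ≤ C ∧ ∀ p ∈ U, ∀ n, ∀ r, 0 < r → r ≤ δ / 2 → ∀ (h : Space → ℝ) (M : ℝ),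
      (∀ x, |h x| ≤ M) → (∀ x, r < ‖x - z n p‖ → h x = 0) →
      |∫ x, f (p, x) * h x| ≤ C * M * r := by
  obtain ⟨C, hC0, hC⟩ := hn
  have hI : 0 ≤ ∫ y, nearWeight 1 y := integral_nonneg fun y => nearWeight_nonneg 1 y
  refine ⟨C * ∫ y, nearWeight 1 y, by positivity, fun p hp n r hr hr' h M hM h0 => ?_⟩
  have hM0 : 0 ≤ M := (abs_nonneg _).trans (hM 0)
  have := norm_integral_le_of_norm_le (f := fun x => f (p, x) * h x)
    (g := fun x => C * M * nearWeight r (x - z n p))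
    (((integrable_nearWeight r).comp_sub_right (z n p)).const_mul _) (by
      have hne : ∀ᵐ x : Space, x ≠ z n p := by
        simp [ae_iff, measure_singleton]
      filter_upwards [hne] with x hx
      rw [Real.norm_eq_abs, abs_mul]
      rcases le_or_gt ‖x - z n p‖ r with hxr | hxr
      · rw [nearWeight_eq hxr]
        have := hC p hp n x hx (hxr.trans hr')
        calc _ ≤ C * (‖x - z n p‖ ^ 2)⁻¹ * M := by gcongr; exact hM x
          _ = _ := by ring
      · rw [h0 x hxr, abs_zero, mul_zero]
        exact mul_nonneg (by positivity) (nearWeight_nonneg _ _))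
  rw [integral_const_mul, integral_nearWeight hr] at this
  rw [Real.norm_eq_abs] at this
  exact this.trans (le_of_eq (by ring))

/-! ### Integrals over space-time -/

/-- The measure on the slab `ta < t < tb` of space-time. -/
noncomputable def slabMeasure (ta tb : ℝ) : Measure Spacetime :=
  (volume.restrict (Ioo ta tb)).prod volume

theorem slabMeasure_eq (ta tb : ℝ) :
    slabMeasure ta tb = volume.restrict (Ioo ta tb ×ˢ (univ : Set Space)) := by
  rw [slabMeasure, ← Measure.restrict_univ (μ := (volume : Measure Space)), Measure.prod_restrict]
  rfl

theorem integral_slab_eq {ta tb : ℝ} {g : Spacetime → ℝ}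
    (h : ∀ p : Spacetime, p.1 ∉ Ioo ta tb → g p = 0) : ∫ p, g p ∂slabMeasure ta tb = ∫ p, g p := by
  rw [slabMeasure_eq, setIntegral_eq_integral_of_forall_compl_eq_zero]
  exact fun p hp => h p fun h' => hp ⟨h', mem_univ _⟩

theorem integral_slab_prod {ta tb : ℝ} (ht : ta ≤ tb) {g : Spacetime → ℝ}
    (hg : Integrable g (slabMeasure ta tb)) :
    ∫ p, g p ∂slabMeasure ta tb = ∫ t in ta..tb, ∫ x, g (t, x) := by
  rw [slabMeasure, integral_prod _ hg, intervalIntegral.integral_of_le ht,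
    ← restrict_Ioo_eq_restrict_Ioc]

theorem intervalIntegrable_slab {ta tb : ℝ} (ht : ta ≤ tb) {g : Spacetime → ℝ}
    (hg : Integrable g (slabMeasure ta tb)) :
    IntervalIntegrable (fun t => ∫ x, g (t, x)) volume ta tb := by
  rw [intervalIntegrable_iff_integrableOn_Ioo_of_le ht]
  exact hg.integral_prod_left

section Lines

variable {ta tb : ℝ} {y : Fin N → ℝ → Space}

/-- The open slab without the world-lines. -/
def slabOff (ta tb : ℝ) (y : Fin N → ℝ → Space) : Set Spacetime :=
  {p | p.1 ∈ Ioo ta tb ∧ ∀ n, p.2 ≠ y n p.1}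

theorem isOpen_slabOff (hy : ∀ n, ContinuousOn (y n) (Icc ta tb)) : IsOpen (slabOff ta tb y) := by
  have h : ∀ n, ContinuousOn (fun p : Spacetime => p.2 - y n p.1) (Ioo ta tb ×ˢ univ) := fun n =>
    continuousOn_snd.sub ((hy n).comp continuousOn_fst fun p hp => Ioo_subset_Icc_self hp.1)
  have h2 : ∀ n, IsOpen ((Ioo ta tb ×ˢ univ) ∩ (fun p : Spacetime => p.2 - y n p.1) ⁻¹' {0}ᶜ) :=
    fun n => (h n).isOpen_inter_preimage (isOpen_Ioo.prod isOpen_univ) isOpen_compl_singleton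
  have h3 : slabOff ta tb y = (Ioo ta tb ×ˢ univ) ∩
      ⋂ n, ((Ioo ta tb ×ˢ univ) ∩ (fun p : Spacetime => p.2 - y n p.1) ⁻¹' {0}ᶜ) := by
    ext p
    simp only [slabOff, Set.mem_ofPred_eq, mem_inter_iff, mem_prod, mem_univ, and_true, mem_iInter,
      mem_preimage, mem_compl_iff, mem_singleton_iff, sub_eq_zero]
    constructor
    · exact fun h => ⟨h.1, fun n => ⟨h.1, h.2 n⟩⟩
    · exact fun h => ⟨h.1, fun n => (h.2 n).2⟩
  rw [h3]
  exact (isOpen_Ioo.prod isOpen_univ).inter (isOpen_iInter_of_finite h2)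

/-- Each world-line meets every time slice in one point, so it is null by Fubini. The trajectories
are extended constantly beyond the interval in order to obtain closed, hence measurable, graphs. -/
theorem ae_slabOff (ht : ta ≤ tb) (hy : ∀ n, ContinuousOn (y n) (Icc ta tb)) :
    ∀ᵐ p ∂slabMeasure ta tb, p ∈ slabOff ta tb y := by
  have h1 : ∀ᵐ p ∂slabMeasure ta tb, p.1 ∈ Ioo ta tb := by
    rw [slabMeasure_eq]
    filter_upwards [ae_restrict_mem (measurableSet_Ioo.prod MeasurableSet.univ)] with p hp using hp.1
  have h2 : ∀ n, ∀ᵐ p ∂slabMeasure ta tb, p.2 ≠ IccExtend ht ((Icc ta tb).domRestrict (y n)) p.1 := by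
    intro n
    have hc : Continuous (IccExtend ht ((Icc ta tb).domRestrict (y n))) :=
      (continuousOn_iff_continuous_domRestrict.1 (hy n)).Icc_extend'
    rw [ae_iff, slabMeasure, Measure.measure_prod_null]
    · filter_upwards with t
      have : (Prod.mk t ⁻¹' {a : Spacetime | ¬ a.2 ≠ IccExtend ht ((Icc ta tb).domRestrict (y n)) a.1}) =
          {IccExtend ht ((Icc ta tb).domRestrict (y n)) t} := by
        ext x; simp
      rw [this, measure_singleton]
      rfl
    · simp only [ne_eq, not_not]
      exact (isClosed_eq continuous_snd (hc.comp continuous_fst)).measurableSet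
  filter_upwards [h1, ae_all_iff.2 h2] with p hp hp'
  refine ⟨hp, fun n => ?_⟩
  have := hp' n
  rwa [IccExtend_of_mem ht _ (Ioo_subset_Icc_self hp)] at this

theorem integrable_dominating (ht : ta ≤ tb) (hy : ∀ n, ContinuousOn (y n) (Icc ta tb)) {j : ℕ}
    (hj : 3 < j) (ρ : ℝ) : Integrable (dominating j ρ y) (slabMeasure ta tb) := by
  have h1 : ∀ {k : Space → ℝ}, Integrable k → Integrable (fun p : Spacetime => k p.2)
      (slabMeasure ta tb) := by
    intro k hk
    have := Integrable.mul_prod (f := fun _ : ℝ => (1 : ℝ)) (μ := volume.restrict (Ioo ta tb))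
      (integrable_const 1) hk
    simpa [slabMeasure] using this
  refine (h1 (integrable_decay hj)).add (integrable_finsetSum _ fun n _ => ?_)
  have hc : Continuous (IccExtend ht ((Icc ta tb).domRestrict (y n))) :=
    (continuousOn_iff_continuous_domRestrict.1 (hy n)).Icc_extend'
  -- The shear that puts the particle at rest at the origin preserves the measure, so the moving
  -- singularity is as integrable as the fixed one.
  have hmp : MeasurePreserving (fun p : Spacetime =>
      (p.1, p.2 - IccExtend ht ((Icc ta tb).domRestrict (y n)) p.1)) (slabMeasure ta tb)
      (slabMeasure ta tb) := by
    refine (MeasurePreserving.id (volume.restrict (Ioo ta tb))).skew_product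
      (g := fun t x => x - IccExtend ht ((Icc ta tb).domRestrict (y n)) t) ?_ ?_
    · exact (continuous_snd.sub (hc.comp continuous_fst)).measurable
    · exact Eventually.of_forall fun t => (measurePreserving_sub_right volume _).map_eq
  have h2 := hmp.integrable_comp_of_integrable (h1 (integrable_nearWeight ρ))
  refine h2.congr ?_
  have h3 : ∀ᵐ p ∂slabMeasure ta tb, p.1 ∈ Ioo ta tb := (ae_slabOff ht hy).mono fun p hp => hp.1
  filter_upwards [h3] with p hp
  simp [IccExtend_of_mem ht _ (Ioo_subset_Icc_self hp), domRestrict]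

theorem aestronglyMeasurable_slab (ht : ta ≤ tb) (hy : ∀ n, ContinuousOn (y n) (Icc ta tb))
    {g : Spacetime → ℝ} (hg : ContinuousOn g (slabOff ta tb y)) :
    AEStronglyMeasurable g (slabMeasure ta tb) := by
  have h1 : (slabMeasure ta tb).restrict (slabOff ta tb y) = slabMeasure ta tb :=
    Measure.restrict_eq_self_of_ae_mem (ae_slabOff ht hy)
  rw [← h1]
  exact hg.aestronglyMeasurable (isOpen_slabOff hy).measurableSet

theorem integrable_slab_of_bound (ht : ta ≤ tb) (hy : ∀ n, ContinuousOn (y n) (Icc ta tb))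
    {g : Spacetime → ℝ} (hg : ContinuousOn g (slabOff ta tb y)) {j : ℕ} (hj : 3 < j) {C ρ : ℝ}
    (hb : ∀ p ∈ slabOff ta tb y, |g p| ≤ C * dominating j ρ y p) :
    Integrable g (slabMeasure ta tb) :=
  ((integrable_dominating ht hy hj ρ).const_mul C).mono' (aestronglyMeasurable_slab ht hy hg)
    ((ae_slabOff ht hy).mono hb)

end Lines

end

section

/-! ### Expansions that depend on time -/

/-- `f r t = K(t) / r + b(t) + O(r)` uniformly in `t`, with integrable coefficients. -/
structure TimeExpansion (ta tb ρ : ℝ) (f : ℝ → ℝ → ℝ) (b : ℝ → ℝ) : Prop where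
  integrable : ∀ r, 0 < r → r ≤ ρ → IntervalIntegrable (f r) volume ta tb
  integrable_limit : IntervalIntegrable b volume ta tb
  expansion : ∃ (K : ℝ → ℝ) (C : ℝ), IntervalIntegrable K volume ta tb ∧
    ∀ t ∈ Ioo ta tb, ∀ r, 0 < r → r ≤ ρ → |f r t - (K t / r + b t)| ≤ C * r

namespace TimeExpansion

variable {ta tb ρ : ℝ} {f g : ℝ → ℝ → ℝ} {b c : ℝ → ℝ}

theorem add (hf : TimeExpansion ta tb ρ f b) (hg : TimeExpansion ta tb ρ g c) :
    TimeExpansion ta tb ρ (fun r t => f r t + g r t) (fun t => b t + c t) where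
  integrable r hr hr' := (hf.integrable r hr hr').add (hg.integrable r hr hr')
  integrable_limit := hf.integrable_limit.add hg.integrable_limit
  expansion := by
    obtain ⟨K, C, hK, h⟩ := hf.expansion
    obtain ⟨K', C', hK', h'⟩ := hg.expansion
    refine ⟨fun t => K t + K' t, C + C', hK.add hK', fun t ht r hr hr' => ?_⟩
    have e : f r t + g r t - ((K t + K' t) / r + (b t + c t)) =
      (f r t - (K t / r + b t)) + (g r t - (K' t / r + c t)) := by ring
    rw [e, add_mul]
    exact (abs_add_le _ _).trans (add_le_add (h t ht r hr hr') (h' t ht r hr hr'))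

theorem mul_continuousOn (ht : ta ≤ tb) (hf : TimeExpansion ta tb ρ f b) {k : ℝ → ℝ}
    (hk : ContinuousOn k (Icc ta tb)) :
    TimeExpansion ta tb ρ (fun r t => k t * f r t) (fun t => k t * b t) where
  integrable r hr hr' := (hf.integrable r hr hr').continuousOn_mul (by rwa [uIcc_of_le ht])
  integrable_limit := hf.integrable_limit.continuousOn_mul (by rwa [uIcc_of_le ht])
  expansion := by
    obtain ⟨K, C, hK, h⟩ := hf.expansion
    obtain ⟨M, hM⟩ := isCompact_Icc.exists_bound_of_continuousOn hk
    refine ⟨fun t => k t * K t, |M| * C, hK.continuousOn_mul (by rwa [uIcc_of_le ht]),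
      fun t ht r hr hr' => ?_⟩
    have e : k t * f r t - (k t * K t / r + k t * b t) = k t * (f r t - (K t / r + b t)) := by ring
    rw [e, abs_mul, mul_assoc]
    exact mul_le_mul ((hM t (Ioo_subset_Icc_self ht)).trans (le_abs_self M)) (h t ht r hr hr')
      (abs_nonneg _) (abs_nonneg _)

theorem const_mul (ht : ta ≤ tb) (hf : TimeExpansion ta tb ρ f b) (k : ℝ) :
    TimeExpansion ta tb ρ (fun r t => k * f r t) (fun t => k * b t) :=
  hf.mul_continuousOn ht continuousOn_const

theorem zero : TimeExpansion ta tb ρ (fun _ _ => 0) (fun _ => 0) where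
  integrable _ _ _ := IntervalIntegrable.zero
  integrable_limit := IntervalIntegrable.zero
  expansion := ⟨fun _ => 0, 0, IntervalIntegrable.zero, fun t _ r _ _ => by simp⟩

theorem sum {ι : Type*} {S : Finset ι} {f : ι → ℝ → ℝ → ℝ} {b : ι → ℝ → ℝ}
    (h : ∀ i ∈ S, TimeExpansion ta tb ρ (f i) (b i)) :
    TimeExpansion ta tb ρ (fun r t => ∑ i ∈ S, f i r t) (fun t => ∑ i ∈ S, b i t) := by
  classical
  induction S using Finset.induction_on with
  | empty => simpa using zero
  | insert i S hi ih =>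
    simp only [Finset.sum_insert hi]
    exact (h i (Finset.mem_insert_self i S)).add
      (ih fun j hj => h j (Finset.mem_insert_of_mem hj))

/-- Uniformity in time allows integration of the expansion term by term; the coefficient of `1 / r`
becomes the integral of `K` and is discarded. -/
theorem hasRLim (ht : ta ≤ tb) (hρ : 0 < ρ) (hf : TimeExpansion ta tb ρ f b) :
    HasRLim (fun r => ∫ t in ta..tb, f r t) (∫ t in ta..tb, b t) := by
  obtain ⟨K, C, hK, h⟩ := hf.expansion
  refine hasRLim_of_bound (a := ∫ t in ta..tb, K t) (C := C * (tb - ta)) hρ fun r hr hr' => ?_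
  have hi := hf.integrable r hr hr'.le
  have e : (∫ t in ta..tb, f r t) - ((∫ t in ta..tb, K t) / r + ∫ t in ta..tb, b t) =
      ∫ t in ta..tb, (f r t - (K t / r + b t)) := by
    rw [intervalIntegral.integral_sub hi ((hK.div_const r).add hf.integrable_limit),
      intervalIntegral.integral_add (hK.div_const r) hf.integrable_limit,
      intervalIntegral.integral_div]
  rw [e]
  have := intervalIntegral.norm_integral_le_of_norm_le_const_ae (a := ta) (b := tb) (C := C * r)
    (f := fun t => f r t - (K t / r + b t)) (by
      have hne : ∀ᵐ t : ℝ, t ≠ tb := by simp [ae_iff, measure_singleton]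
      filter_upwards [hne] with t hne htI
      rw [uIoc_of_le ht] at htI
      exact h t ⟨htI.1, lt_of_le_of_ne htI.2 hne⟩ r hr hr'.le)
  rw [abs_of_nonneg (sub_nonneg.2 ht)] at this
  exact this.trans (le_of_eq (by ring))

end TimeExpansion

/-! ### The variation of the field -/

variable {N : ℕ} {η ta tb : ℝ} {Z : ℝ → Fin N → ℝ → Space} {B : ℝ → Spacetime → Fin 4 → ℝ} {δ : ℝ}
  {H : Fin 4 → Fin N → (ℝ × ℝ) × (ℝ × Space) → ℝ} {s : Fin 4 → Fin N → (ℝ × ℝ) × Space → ℝ}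

/-- The direction of the variation parameter. -/
def epsDir : (ℝ × ℝ) × Space := ((1, 0), 0)

/-- The variation `∂_ε A^ν` of the potential. -/
noncomputable def varB (η ta tb : ℝ) (Z : ℝ → Fin N → ℝ → Space)
    (B : ℝ → Spacetime → Fin 4 → ℝ) (ν : Fin 4) : (ℝ × ℝ) × Space → ℝ :=
  epsD η ta tb (famZ Z) (fun x => famB B x ν)

/-- The derivative `∂_μ ∂_ε A^ν`. -/
noncomputable def varD (η ta tb : ℝ) (Z : ℝ → Fin N → ℝ → Space)
    (B : ℝ → Spacetime → Fin 4 → ℝ) (μ ν : Fin 4) (x : (ℝ × ℝ) × Space) : ℝ :=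
  fderivWithin ℝ (varB η ta tb Z B ν) (offLines (slab η ta tb) (famZ Z)) x (jointDir μ)

namespace FamBase

theorem singular_varB (F : FamBase η ta tb Z B δ H s) (ν : Fin 4) :
    SingularFunction (slab η ta tb) (famZ Z) δ 2 (varB η ta tb Z B ν)
      (fun n => singD (slab η ta tb) (famZ Z n) δ epsDir (H ν n))
      (fun n => regD (slab η ta tb) (famZ Z n) δ epsDir (s ν n)) :=
  (F.potential ν).fderiv F.sep epsDir

theorem offLines_mem_nhds (F : FamBase η ta tb Z B δ H s) {x : (ℝ × ℝ) × Space}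
    (hx : x ∈ offLines (slab η ta tb) (famZ Z)) (hε : x.1.1 ∈ Ioo (-η) η)
    (ht : x.1.2 ∈ Ioo ta tb) : offLines (slab η ta tb) (famZ Z) ∈ 𝓝 x := by
  have h := offLines_mem_nhdsWithin F.sep.continuousOn hx
  have h2 : slab η ta tb ×ˢ (univ : Set Space) ∈ 𝓝 x :=
    prod_mem_nhds (prod_mem_nhds (Icc_mem_nhds hε.1 hε.2) (Icc_mem_nhds ht.1 ht.2)) univ_mem
  rwa [nhdsWithin_eq_nhds.2 h2] at h

theorem fderivWithin_fderivWithin_comm {f : (ℝ × ℝ) × Space → ℝ} {S : Set ((ℝ × ℝ) × Space)}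
    (hf : ContDiffOn ℝ ∞ f S) (hS : UniqueDiffOn ℝ S) {x : (ℝ × ℝ) × Space} (hx : S ∈ 𝓝 x)
    (v w : (ℝ × ℝ) × Space) :
    fderivWithin ℝ (fun x => fderivWithin ℝ f S x v) S x w =
      fderivWithin ℝ (fun x => fderivWithin ℝ f S x w) S x v := by
  have hxS := mem_of_mem_nhds hx
  have hsym : IsSymmSndFDerivWithinAt ℝ f S x :=
    (hf x hxS).isSymmSndFDerivWithinAt (by
      rw [minSmoothness_of_isRCLikeNormedField]
      exact WithTop.coe_le_coe.2 le_top) hS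
      (subset_closure (mem_interior_iff_mem_nhds.2 hx)) hxS
  have hd : DifferentiableWithinAt ℝ (fderivWithin ℝ f S) S x :=
    ((hf.fderivWithin (m := ∞) hS (by simp)).differentiableOn (by simp)) x hxS
  have e : ∀ c d, fderivWithin ℝ (fun x => fderivWithin ℝ f S x d) S x c =
      fderivWithin ℝ (fderivWithin ℝ f S) S x c d := by
    intro c d
    rw [fderivWithin_clm_apply (hS x hxS) hd (differentiableWithinAt_const _)]
    simp
  rw [e, e, hsym.eq]

/-- Second derivatives commute at interior parameters, where the domain of differentiation is a
neighbourhood of the point. -/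
theorem epsD_jointD (F : FamBase η ta tb Z B δ H s) {x : (ℝ × ℝ) × Space}
    (hx : x ∈ offLines (slab η ta tb) (famZ Z)) (hε : x.1.1 ∈ Ioo (-η) η)
    (ht : x.1.2 ∈ Ioo ta tb) (μ ν : Fin 4) :
    epsD η ta tb (famZ Z) (jointD η ta tb Z B μ ν) x = varD η ta tb Z B μ ν x :=
  fderivWithin_fderivWithin_comm (F.potential ν).smooth_off F.sep.uniqueDiffOn_offLines
    (F.offLines_mem_nhds hx hε ht) _ _

theorem epsD_jointField (F : FamBase η ta tb Z B δ H s) {x : (ℝ × ℝ) × Space}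
    (hx : x ∈ offLines (slab η ta tb) (famZ Z)) (hε : x.1.1 ∈ Ioo (-η) η)
    (ht : x.1.2 ∈ Ioo ta tb) (μ ν : Fin 4) :
    epsD η ta tb (famZ Z) (jointField η ta tb Z B μ ν) x =
      metric μ * varD η ta tb Z B μ ν x - metric ν * varD η ta tb Z B ν μ x := by
  have h1 := (((F.singular_jointD μ ν).smooth_off.differentiableOn (by simp)) _ hx).hasFDerivWithinAt
  have h2 := (((F.singular_jointD ν μ).smooth_off.differentiableOn (by simp)) _ hx).hasFDerivWithinAt
  have h3 : HasFDerivWithinAt (jointField η ta tb Z B μ ν) _ _ _ :=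
    (h1.const_mul (metric μ)).fun_sub (h2.const_mul (metric ν))
  rw [epsD, h3.fderivWithin (F.sep.uniqueDiffOn_offLines _ hx), ← F.epsD_jointD hx hε ht,
    ← F.epsD_jointD hx hε ht]
  simp [epsD]

/-- The density of the variation of the electromagnetic action, with a cutoff, up to
a total derivative. -/
theorem sum_cutSqD (F : FamBase η ta tb Z B δ H s) {x : (ℝ × ℝ) × Space}
    (hx : x ∈ offLines (slab η ta tb) (famZ Z)) (hε : x.1.1 ∈ Ioo (-η) η)
    (ht : x.1.2 ∈ Ioo ta tb) (r : ℝ) :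
    -(1 / 4) * ∑ μ, ∑ ν, metric μ * metric ν *
        cutSqD η ta tb (famZ Z) (jointField η ta tb Z B μ ν) r x =
      -(1 / 4) * (∑ μ, ∑ ν, metric μ * metric ν *
        (fderivWithin ℝ (cut (famZ Z) r) (slab η ta tb ×ˢ univ) x epsDir *
          (jointField η ta tb Z B μ ν x * jointField η ta tb Z B μ ν x))) +
      (∑ μ, ∑ ν, metric ν * (fderivWithin ℝ (cut (famZ Z) r) (slab η ta tb ×ˢ univ) x (jointDir μ) *
        (jointField η ta tb Z B μ ν x * varB η ta tb Z B ν x))) -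
      ∑ μ, ∑ ν, metric ν * (jointField η ta tb Z B μ ν x *
        fderivWithin ℝ (fun x => cut (famZ Z) r x * varB η ta tb Z B ν x)
          (slab η ta tb ×ˢ univ) x (jointDir μ)) := by
  have h1 : ∀ μ ν, cutSqD η ta tb (famZ Z) (jointField η ta tb Z B μ ν) r x =
      cut (famZ Z) r x * (2 * jointField η ta tb Z B μ ν x * (metric μ * varD η ta tb Z B μ ν x -
        metric ν * varD η ta tb Z B ν μ x)) +
      fderivWithin ℝ (cut (famZ Z) r) (slab η ta tb ×ˢ univ) x epsDir *
        jointField η ta tb Z B μ ν x ^ 2 := by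
    intro μ ν
    have hF := (F.singular_field μ ν).smooth_off
    rw [cutSqD, F.sep.fderivWithin_cut_mul r (hF.pow 2) hx, F.sep.fderivWithin_sq hF hx,
      ← F.epsD_jointField hx hε ht]
    rfl
  have h2 : ∀ μ ν, fderivWithin ℝ (fun x => cut (famZ Z) r x * varB η ta tb Z B ν x)
      (slab η ta tb ×ˢ univ) x (jointDir μ) = cut (famZ Z) r x * varD η ta tb Z B μ ν x +
        fderivWithin ℝ (cut (famZ Z) r) (slab η ta tb ×ˢ univ) x (jointDir μ) *
          varB η ta tb Z B ν x := fun μ ν =>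
    F.sep.fderivWithin_cut_mul r (F.singular_varB ν).smooth_off hx _
  simp only [h1, h2, jointField]
  -- What remains is a polynomial identity in the components: the antisymmetry of the field merges
  -- the two terms of its variation, and the product rule for the cut off variation supplies the
  -- term with the gradient of the cutoff.
  generalize cut (famZ Z) r x = k
  generalize fderivWithin ℝ (cut (famZ Z) r) (slab η ta tb ×ˢ univ) x = L
  generalize jointD η ta tb Z B = J
  generalize varD η ta tb Z B = V
  generalize varB η ta tb Z B = a
  have m0 : metric 0 = -1 := rfl
  have m1 : metric 1 = 1 := rfl
  have m2 : metric 2 = 1 := rfl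
  have m3 : metric 3 = 1 := rfl
  simp only [Fin.sum_univ_four, m0, m1, m2, m3]
  ring

end FamBase

end

/-! ### The variation of the potential, filled in at the particles -/

section

variable {N : ℕ} {η ta tb : ℝ} {Z : ℝ → Fin N → ℝ → Space} {B : ℝ → Spacetime → Fin 4 → ℝ} {δ : ℝ}
  {H : Fin 4 → Fin N → (ℝ × ℝ) × (ℝ × Space) → ℝ} {s : Fin 4 → Fin N → (ℝ × ℝ) × Space → ℝ}

/-- The variation of the potential at the position of a particle. -/
noncomputable def varAt (η ta tb : ℝ) (Z : ℝ → Fin N → ℝ → Space) (δ : ℝ)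
    (s : Fin 4 → Fin N → (ℝ × ℝ) × Space → ℝ) (ν : Fin 4) (n : Fin N) (p : ℝ × ℝ) : ℝ :=
  regD (slab η ta tb) (famZ Z n) δ epsDir (s ν n) (p, 0)

/-- The variation of the potential, with the balls of radius `r` around the particles filled in. -/
noncomputable def filledVar (η ta tb : ℝ) (Z : ℝ → Fin N → ℝ → Space)
    (B : ℝ → Spacetime → Fin 4 → ℝ) (δ : ℝ) (s : Fin 4 → Fin N → (ℝ × ℝ) × Space → ℝ) (r : ℝ)
    (ν : Fin 4) (x : (ℝ × ℝ) × Space) : ℝ :=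
  cut (famZ Z) r x * varB η ta tb Z B ν x +
    ∑ n, profile (r⁻¹ • (x.2 - famZ Z n x.1)) * varAt η ta tb Z δ s ν n x.1

section ProfileAt
variable {P : Type} [NormedAddCommGroup P] [NormedSpace ℝ P] {U : Set P} {z : Fin N → P → Space}

theorem hasFDerivWithinAt_profileAt {z : P → Space} (hz : ContDiffOn ℝ ∞ z U) (r : ℝ) {x : P × Space}
    (hx : x.1 ∈ U) :
    HasFDerivWithinAt (fun x : P × Space => profile (r⁻¹ • (x.2 - z x.1)))
      ((fderiv ℝ profile (r⁻¹ • (x.2 - z x.1))).comp (r⁻¹ • (ContinuousLinearMap.snd ℝ P Space -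
          (fderivWithin ℝ z U x.1).comp (ContinuousLinearMap.fst ℝ P Space)))) (U ×ˢ univ) x := by
  have h2 : HasFDerivWithinAt (fun x : P × Space => z x.1)
      ((fderivWithin ℝ z U x.1).comp (ContinuousLinearMap.fst ℝ P Space)) (U ×ˢ univ) x :=
    ((hz.differentiableOn (by simp)) x.1 hx).hasFDerivWithinAt.comp x
      hasFDerivWithinAt_fst fun y hy => hy.1
  exact (profile_contDiff.differentiable (by simp) _).hasFDerivAt.comp_hasFDerivWithinAt x
    ((hasFDerivWithinAt_snd.fun_sub h2).fun_const_smul r⁻¹)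

theorem contDiffOn_profileAt {z : P → Space} (hz : ContDiffOn ℝ ∞ z U) (r : ℝ) :
    ContDiffOn ℝ ∞ (fun x : P × Space => profile (r⁻¹ • (x.2 - z x.1))) (U ×ˢ univ) :=
  profile_contDiff.comp_contDiffOn ((contDiffOn_snd.sub (hz.comp contDiffOn_fst
    fun _ hx => hx.1)).const_smul r⁻¹)

theorem SeparatedPoints.exists_profileAt_far (hs : SeparatedPoints U z δ) :
    ∃ R, 0 < R ∧ ∀ r, 0 < r → r ≤ δ → ∀ p ∈ U, ∀ n, ∀ x : Space, R ≤ ‖x‖ →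
      profile (r⁻¹ • (x - z n p)) = 0 ∧ ∀ c, profileSlope c (r⁻¹ • (x - z n p)) = 0 := by
  obtain ⟨R, hR, h⟩ := hs.exists_far
  have hδ := hs.pos
  refine ⟨R, hR, fun r hr hr' p hp n x hx => ?_⟩
  have h1 := h p hp n x hx
  refine ⟨profile_scaled_eq_zero hr (by linarith), fun c => profileSlope_eq_zero fun hw => ?_⟩
  have := hw.2
  rw [norm_smul, Real.norm_of_nonneg (inv_nonneg.2 hr.le), inv_mul_le_iff₀ hr] at this
  linarith

theorem DecaysLike.of_far {f : P × Space → ℝ} {R : ℝ}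
    (h : ∀ p ∈ U, ∀ x : Space, R ≤ ‖x‖ → f (p, x) = 0) (j : ℕ) : DecaysLike U j f := by
  refine ⟨0, max R 1, by positivity, fun p hp x hx => ?_⟩
  rw [h p hp x ((le_max_left _ _).trans hx)]
  simp

end ProfileAt

namespace FamBase

theorem contDiffOn_varAt (F : FamBase η ta tb Z B δ H s) (ν : Fin 4) (n : Fin N) :
    ContDiffOn ℝ ∞ (varAt η ta tb Z δ s ν n) (slab η ta tb) :=
  contDiffOn_reg_zero F.sep.pos ((F.singular_varB ν).expansion n).smooth_reg

theorem contDiffOn_filledVar (F : FamBase η ta tb Z B δ H s) {r : ℝ} (hr : 0 < r) (hr' : r ≤ δ)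
    (ν : Fin 4) : ContDiffOn ℝ ∞ (filledVar η ta tb Z B δ s r ν) (slab η ta tb ×ˢ univ) :=
  (F.sep.contDiffOn_cut_mul hr hr' (F.singular_varB ν).smooth_off).add
    (ContDiffOn.sum fun n _ => (contDiffOn_profileAt (F.sep.smooth n) r).mul
      ((F.contDiffOn_varAt ν n).comp contDiffOn_fst fun _ hx => hx.1))

theorem uniqueDiffOn_prod (F : FamBase η ta tb Z B δ H s) :
    UniqueDiffOn ℝ (slab η ta tb ×ˢ (univ : Set Space)) := F.sep.unique.prod uniqueDiffOn_univ

theorem fderivWithin_filledVar (F : FamBase η ta tb Z B δ H s) {r : ℝ} (hr : 0 < r) (hr' : r ≤ δ)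
    (ν : Fin 4) {x : (ℝ × ℝ) × Space} (hx : x.1 ∈ slab η ta tb) (v : (ℝ × ℝ) × Space) :
    fderivWithin ℝ (filledVar η ta tb Z B δ s r ν) (slab η ta tb ×ˢ univ) x v =
      fderivWithin ℝ (fun x => cut (famZ Z) r x * varB η ta tb Z B ν x) (slab η ta tb ×ˢ univ) x v +
      ∑ n, (varAt η ta tb Z δ s ν n x.1 * (r⁻¹ * profileSlope
          (relVel (slab η ta tb) (famZ Z n) v x.1) (r⁻¹ • (x.2 - famZ Z n x.1))) +
        fderivWithin ℝ (varAt η ta tb Z δ s ν n) (slab η ta tb) x.1 v.1 *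
          profile (r⁻¹ • (x.2 - famZ Z n x.1))) := by
  have hxU : x ∈ slab η ta tb ×ˢ (univ : Set Space) := ⟨hx, mem_univ _⟩
  have h1 := (((F.sep.contDiffOn_cut_mul hr hr' (F.singular_varB ν).smooth_off).differentiableOn
    (by simp)) x hxU).hasFDerivWithinAt
  have h2 : ∀ n, HasFDerivWithinAt (fun x : (ℝ × ℝ) × Space => varAt η ta tb Z δ s ν n x.1)
      ((fderivWithin ℝ (varAt η ta tb Z δ s ν n) (slab η ta tb) x.1).comp
        (ContinuousLinearMap.fst ℝ (ℝ × ℝ) Space)) (slab η ta tb ×ˢ univ) x := fun n =>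
    (((F.contDiffOn_varAt ν n).differentiableOn (by simp)) x.1 hx).hasFDerivWithinAt.comp x
      hasFDerivWithinAt_fst fun y hy => hy.1
  have h3 : HasFDerivWithinAt (filledVar η ta tb Z B δ s r ν) _ _ _ :=
    h1.fun_add (HasFDerivWithinAt.fun_sum fun n (_ : n ∈ Finset.univ) =>
      (hasFDerivWithinAt_profileAt (F.sep.smooth n) r hx).fun_mul (h2 n))
  rw [h3.fderivWithin (F.uniqueDiffOn_prod x hxU)]
  simp only [_root_.add_apply, _root_.sum_apply]
  congr 1
  refine Finset.sum_congr rfl fun n _ => ?_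
  simp [profileSlope, relVel]
  ring

end FamBase

namespace Fam
open FamBase

/-- The decay is given for `∂_ε ∂_μ A`. It is transferred to `∂_μ ∂_ε A` in the open slab, where the
two agree, and then extended to the closure by continuity. -/
theorem decays_varD (F : Fam η ta tb Z B δ H s) (μ ν : Fin 4) :
    DecaysLike (slab η ta tb) 2 (varD η ta tb Z B μ ν) := by
  obtain ⟨C, R, hR, h⟩ := F.decay_eps μ ν
  obtain ⟨R', hR', hfar⟩ := F.sep.fderivWithin_cut_far
  refine F.decaysLike_of_interior (((F.singular_varB ν).smooth_off.fderivWithin_apply_vec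
    F.sep.uniqueDiffOn_offLines contDiffOn_const).continuousOn)
    ⟨C, max R R', fun ε hε t ht x hx => ?_⟩
  have hp := mem_slab (Ioo_subset_Icc_self hε) (Ioo_subset_Icc_self ht)
  rw [← varD, ← F.epsD_jointD (hfar δ F.sep.pos le_rfl _ hp x ((le_max_right _ _).trans hx)).2.1 hε ht]
  exact h _ hp x ((le_max_left _ _).trans hx)

theorem decays_filledVar (F : Fam η ta tb Z B δ H s) {r : ℝ} (hr : 0 < r) (hr' : r ≤ δ)
    (μ ν : Fin 4) : DecaysLike (slab η ta tb) 2 (fun x =>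
      fderivWithin ℝ (filledVar η ta tb Z B δ s r ν) (slab η ta tb ×ˢ univ) x (jointDir μ)) := by
  obtain ⟨R, hR, h⟩ := F.sep.exists_profileAt_far
  refine (F.sep.decays_fderivWithin_cut_mul hr hr' (F.singular_varB ν).smooth_off
    (F.decays_varD μ ν)).congr ⟨R, fun p hp x hx => ?_⟩
  rw [F.fderivWithin_filledVar hr hr' ν hp]
  simp [fun n => (h r hr hr' p hp n x hx).1, fun n => (h r hr hr' p hp n x hx).2]

/-- The restriction to the slab, at the parameter `0`. -/
def atZero (f : (ℝ × ℝ) × Space → ℝ) (p : Spacetime) : ℝ := f ((0, p.1), p.2)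

theorem zero_mem (F : Fam η ta tb Z B δ H s) : (0 : ℝ) ∈ Icc (-η) η := by
  have := F.eta_pos
  constructor <;> linarith

theorem continuousOn_traj (F : Fam η ta tb Z B δ H s) (n : Fin N) :
    ContinuousOn (Z 0 n) (Icc ta tb) := fun _ ht =>
  (F.hasDerivWithinAt_traj F.zero_mem ht n).continuousWithinAt

theorem slabOff_mem (F : Fam η ta tb Z B δ H s) {p : Spacetime}
    (hp : p ∈ slabOff ta tb (Z 0)) :
    (((0, p.1), p.2) : (ℝ × ℝ) × Space) ∈ offLines (slab η ta tb) (famZ Z) :=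
  ⟨⟨F.zero_mem, Ioo_subset_Icc_self hp.1⟩, hp.2⟩

/-- Near a particle the bound of `h` is at most a constant, so the integrable singularity of `f` is
preserved; far away the two quadratic decays combine to `|x|⁻⁴`, which is integrable in space. -/
theorem exists_mul_bound (F : Fam η ta tb Z B δ H s) {f h : (ℝ × ℝ) × Space → ℝ}
    (hf : ContDiffOn ℝ ∞ f (offLines (slab η ta tb) (famZ Z)))
    (hn : NearBound (slab η ta tb) (famZ Z) δ f) (hd : DecaysLike (slab η ta tb) 2 f) {C : ℝ}
    (hC : ∀ p ∈ slab η ta tb, ∀ x, |h (p, x)| ≤ C * ((1 + ‖x‖) ^ 2)⁻¹) :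
    ∃ C', 0 ≤ C' ∧ ∀ p ∈ slabOff ta tb (Z 0),
      |atZero f p * atZero h p| ≤ C' * dominating 4 (δ / 2) (Z 0) p := by
  obtain ⟨C₁, h10, h1⟩ := hn.exists_global_bound F.sep hf hd
  refine ⟨C₁ * |C|, by positivity, fun p hp => ?_⟩
  have hoff := F.slabOff_mem hp
  have e1 := h1 _ hoff
  have e2 := hC _ hoff.1 p.2
  have e3 : C * ((1 + ‖p.2‖) ^ 2)⁻¹ ≤ |C| * ((1 + ‖p.2‖) ^ 2)⁻¹ := by gcongr; exact le_abs_self C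
  have hS : 0 ≤ ∑ n, nearWeight (δ / 2) (p.2 - Z 0 n p.1) :=
    Finset.sum_nonneg fun n _ => nearWeight_nonneg _ _
  have e4 : ((1 + ‖p.2‖) ^ 2)⁻¹ ≤ 1 := inv_le_one_of_one_le₀ (one_le_pow₀ (by
    linarith [norm_nonneg p.2]))
  have e5 : dominating 2 (δ / 2) (famZ Z) ((0, p.1), p.2) * ((1 + ‖p.2‖) ^ 2)⁻¹ ≤
      dominating 4 (δ / 2) (Z 0) p := by
    simp only [dominating, famZ, add_mul]
    refine add_le_add (le_of_eq ?_) (mul_le_of_le_one_right hS e4)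
    rw [← mul_inv, ← pow_add]
  rw [abs_mul]
  calc |atZero f p| * |atZero h p| ≤ (C₁ * dominating 2 (δ / 2) (famZ Z) ((0, p.1), p.2)) *
        (|C| * ((1 + ‖p.2‖) ^ 2)⁻¹) := by
        refine mul_le_mul e1 (e2.trans e3) (abs_nonneg _) ?_
        exact mul_nonneg h10 (dominating_nonneg _ _ _ _)
    _ = C₁ * |C| * (dominating 2 (δ / 2) (famZ Z) ((0, p.1), p.2) * ((1 + ‖p.2‖) ^ 2)⁻¹) := by ring
    _ ≤ _ := by gcongr

theorem continuousOn_atZero (F : Fam η ta tb Z B δ H s) {f : (ℝ × ℝ) × Space → ℝ}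
    (hf : ContinuousOn f (offLines (slab η ta tb) (famZ Z))) :
    ContinuousOn (atZero f) (slabOff ta tb (Z 0)) :=
  hf.comp (by fun_prop) fun _ hp => F.slabOff_mem hp

theorem integrable_mul_slab (F : Fam η ta tb Z B δ H s) {f h : (ℝ × ℝ) × Space → ℝ}
    (hf : ContDiffOn ℝ ∞ f (offLines (slab η ta tb) (famZ Z)))
    (hn : NearBound (slab η ta tb) (famZ Z) δ f) (hd : DecaysLike (slab η ta tb) 2 f)
    (hh : ContinuousOn h (slab η ta tb ×ˢ univ)) (hdh : DecaysLike (slab η ta tb) 2 h) :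
    Integrable (fun p => atZero f p * atZero h p) (slabMeasure ta tb) := by
  obtain ⟨C, hC0, hC⟩ := hdh.exists_bound F.sep.compact hh
  obtain ⟨C', hC0', hC'⟩ := F.exists_mul_bound hf hn hd hC
  exact integrable_slab_of_bound F.time_lt.le F.continuousOn_traj
    ((F.continuousOn_atZero hf.continuousOn).mul (F.continuousOn_atZero (hh.mono offLines_subset)))
    (by norm_num) hC'

theorem nearBound_field (F : Fam η ta tb Z B δ H s) (μ ν : Fin 4) :
    NearBound (slab η ta tb) (famZ Z) δ (jointField η ta tb Z B μ ν) :=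
  (F.singular_field μ ν).nearBound F.sep (Or.inr rfl)

theorem integrable_field_mul (F : Fam η ta tb Z B δ H s) (μ ν : Fin 4) {h : (ℝ × ℝ) × Space → ℝ}
    (hh : ContinuousOn h (slab η ta tb ×ˢ univ)) (hdh : DecaysLike (slab η ta tb) 2 h) :
    Integrable (fun p => atZero (jointField η ta tb Z B μ ν) p * atZero h p) (slabMeasure ta tb) :=
  F.integrable_mul_slab (F.singular_field μ ν).smooth_off (F.nearBound_field μ ν) (F.decay μ ν)
    hh hdh

/-! ### Time expansions of the localized integrals -/

theorem timeSlice (F : Fam η ta tb Z B δ H s) {g : ℝ × ℝ → ℝ} (hg : ContinuousOn g (slab η ta tb)) :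
    ContinuousOn (fun t => g (0, t)) (Icc ta tb) :=
  hg.comp (by fun_prop) fun _ ht => mem_slab F.zero_mem ht

theorem timeExpansion_quadratic (F : Fam η ta tb Z B δ H s) (n : Fin N) (v : (ℝ × ℝ) × Space)
    {f g : (ℝ × ℝ) × Space → ℝ} {Φ Ψ : (ℝ × ℝ) × (ℝ × Space) → ℝ} {φ ψ : (ℝ × ℝ) × Space → ℝ}
    (hf : IsExpansion (slab η ta tb) (famZ Z n) δ 2 f Φ φ)
    (hg : IsExpansion (slab η ta tb) (famZ Z n) δ 2 g Ψ ψ) :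
    TimeExpansion ta tb (δ / 2) (fun r t => ∫ x, r⁻¹ * profileSlope
        (relVel (slab η ta tb) (famZ Z n) v (0, t)) (r⁻¹ • (x - famZ Z n (0, t))) *
        (f ((0, t), x) * g ((0, t), x)))
      (fun t => ∫ w in annulus, profileD (slab η ta tb) (famZ Z n) v ((0, t), 0, w) *
          (Φ ((0, t), 0, w) * ψ ((0, t), 0) + φ ((0, t), 0) * Ψ ((0, t), 0, w))) := by
  have hδ := F.sep.pos
  obtain ⟨K, C, hK, h⟩ := hf.exists_integral_profileD_mul hg F.sep.compact F.sep.unique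
    (F.sep.smooth n) hδ v
  refine ⟨fun r hr hr' => F.intervalIntegrable_slice (g := fun p => ∫ x, r⁻¹ * profileSlope
        (relVel (slab η ta tb) (famZ Z n) v p) (r⁻¹ • (x - famZ Z n p)) *
        (f (p, x) * g (p, x))) (hf.continuousOn_integral_profileD_mul hg F.sep.compact F.sep.unique
        (F.sep.smooth n) v hr (by linarith)) F.zero_mem,
    F.intervalIntegrable_slice (g := fun p => ∫ w in annulus,
      profileD (slab η ta tb) (famZ Z n) v (p, 0, w) *
          (Φ (p, 0, w) * ψ (p, 0) + φ (p, 0) * Ψ (p, 0, w)))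
      (hf.continuousOn_integral_profileD_mixed hg F.sep.compact F.sep.unique (F.sep.smooth n) hδ v)
      F.zero_mem, fun t => K (0, t), C, F.intervalIntegrable_slice hK F.zero_mem,
    fun t ht r hr hr' => h (0, t) (mem_slab F.zero_mem (Ioo_subset_Icc_self ht)) r hr hr'⟩

theorem timeExpansion_linear (F : Fam η ta tb Z B δ H s) (n : Fin N) (v : (ℝ × ℝ) × Space)
    {f : (ℝ × ℝ) × Space → ℝ} {Φ : (ℝ × ℝ) × (ℝ × Space) → ℝ} {φ : (ℝ × ℝ) × Space → ℝ}
    (hf : IsExpansion (slab η ta tb) (famZ Z n) δ 2 f Φ φ) :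
    TimeExpansion ta tb (δ / 2) (fun r t => ∫ x, r⁻¹ * profileSlope
        (relVel (slab η ta tb) (famZ Z n) v (0, t)) (r⁻¹ • (x - famZ Z n (0, t))) * f ((0, t), x))
      (fun t => ∫ w in annulus, profileD (slab η ta tb) (famZ Z n) v ((0, t), 0, w) *
          Φ ((0, t), 0, w)) := by
  have hδ := F.sep.pos
  obtain ⟨C, h⟩ := hf.exists_integral_profileD F.sep.compact F.sep.unique (F.sep.smooth n) hδ v
  refine ⟨fun r hr hr' => F.intervalIntegrable_slice (g := fun p => ∫ x, r⁻¹ * profileSlope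
        (relVel (slab η ta tb) (famZ Z n) v p) (r⁻¹ • (x - famZ Z n p)) * f (p, x))
        (hf.continuousOn_integral_profileD F.sep.compact F.sep.unique
        (F.sep.smooth n) v hr (by linarith)) F.zero_mem,
    F.intervalIntegrable_slice (g := fun p => ∫ w in annulus,
      profileD (slab η ta tb) (famZ Z n) v (p, 0, w) * Φ (p, 0, w))
      (hf.continuousOn_integral_profileD_zero F.sep.compact F.sep.unique (F.sep.smooth n) hδ v)
      F.zero_mem, fun _ => 0, C, IntervalIntegrable.zero, fun t ht r hr hr' => ?_⟩
  have := h (0, t) (mem_slab F.zero_mem (Ioo_subset_Icc_self ht)) r hr hr'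
  simpa using this

theorem integrable_field_profile (F : Fam η ta tb Z B δ H s) (μ ν : Fin 4) (n : Fin N) {r : ℝ}
    (hr : 0 < r) (hr' : r ≤ δ) : Integrable (fun p : Spacetime =>
      jointField η ta tb Z B μ ν ((0, p.1), p.2) * profile (r⁻¹ • (p.2 - famZ Z n (0, p.1))))
      (slabMeasure ta tb) := by
  obtain ⟨R, hR, h⟩ := F.sep.exists_profileAt_far
  exact F.integrable_field_mul μ ν (h := fun x => profile (r⁻¹ • (x.2 - famZ Z n x.1)))
    (contDiffOn_profileAt (F.sep.smooth n) r).continuousOn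
    (DecaysLike.of_far (fun p hp x hx => (h r hr hr' p hp n x hx).1) 2)

/-- A singularity `|x - z|⁻²`, integrated over a ball of radius `r`, is `O(r)`: both the `1 / r`
term and the constant are zero. -/
theorem timeExpansion_profile (F : Fam η ta tb Z B δ H s) (μ ν : Fin 4) (n : Fin N) :
    TimeExpansion ta tb (δ / 2) (fun r t => ∫ x, jointField η ta tb Z B μ ν ((0, t), x) *
      profile (r⁻¹ • (x - famZ Z n (0, t)))) (fun _ => 0) := by
  have hδ := F.sep.pos
  obtain ⟨C, hC0, hC⟩ := (F.nearBound_field μ ν).exists_integral_bound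
  refine ⟨fun r hr hr' => intervalIntegrable_slab F.time_lt.le
    (F.integrable_field_profile μ ν n hr (by linarith)), IntervalIntegrable.zero, fun _ => 0, C * 2,
    IntervalIntegrable.zero, fun t ht r hr hr' => ?_⟩
  have := hC (0, t) (mem_slab F.zero_mem (Ioo_subset_Icc_self ht)) n r hr hr'
    (fun x => profile (r⁻¹ • (x - famZ Z n (0, t)))) 2 (fun x => abs_profile_le _)
    (fun x hx => profile_scaled_eq_zero hr hx.le)
  simpa using this

end Fam

/-! ### The localized terms of the electromagnetic variation and their cancellation -/

namespace Fam
open FamBase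

theorem ae_mem_offLines {p : ℝ × ℝ} (hp : p ∈ slab η ta tb) :
    ∀ᵐ x : Space, (p, x) ∈ offLines (slab η ta tb) (famZ Z) := by
  have h : ∀ n, ∀ᵐ x : Space, x ≠ famZ Z n p := fun n => by simp [ae_iff, measure_singleton]
  filter_upwards [ae_all_iff.2 h] with x hx using ⟨hp, hx⟩

/-- The localized terms in the variation of the electromagnetic action. -/
noncomputable def localTerm (η ta tb : ℝ) (Z : ℝ → Fin N → ℝ → Space)
    (B : ℝ → Spacetime → Fin 4 → ℝ) (δ : ℝ) (s : Fin 4 → Fin N → (ℝ × ℝ) × Space → ℝ)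
    (μ ν : Fin 4) (n : Fin N) (r t : ℝ) : ℝ :=
  1 / 4 * (metric μ * metric ν) * (∫ x, r⁻¹ * profileSlope
        (relVel (slab η ta tb) (famZ Z n) epsDir (0, t)) (r⁻¹ • (x - famZ Z n (0, t))) *
        (jointField η ta tb Z B μ ν ((0, t), x) * jointField η ta tb Z B μ ν ((0, t), x))) +
    metric ν * (-1 * (∫ x, r⁻¹ * profileSlope
        (relVel (slab η ta tb) (famZ Z n) (jointDir μ) (0, t)) (r⁻¹ • (x - famZ Z n (0, t))) *
        (jointField η ta tb Z B μ ν ((0, t), x) * varB η ta tb Z B ν ((0, t), x))) +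
      (varAt η ta tb Z δ s ν n (0, t) * (∫ x, r⁻¹ * profileSlope
        (relVel (slab η ta tb) (famZ Z n) (jointDir μ) (0, t)) (r⁻¹ • (x - famZ Z n (0, t))) *
        jointField η ta tb Z B μ ν ((0, t), x)) +
      fderivWithin ℝ (varAt η ta tb Z δ s ν n) (slab η ta tb) (0, t) (jointDir μ).1 *
        ∫ x, jointField η ta tb Z B μ ν ((0, t), x) *
          profile (r⁻¹ • (x - famZ Z n (0, t)))))

/-- The contraction of the field with the derivative of the filled in variation. -/
noncomputable def fieldPairing (η ta tb : ℝ) (Z : ℝ → Fin N → ℝ → Space)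
    (B : ℝ → Spacetime → Fin 4 → ℝ) (μ ν : Fin 4) (Y : (ℝ × ℝ) × Space → ℝ)
    (x : (ℝ × ℝ) × Space) : ℝ :=
  jointField η ta tb Z B μ ν x * fderivWithin ℝ Y (slab η ta tb ×ˢ univ) x (jointDir μ)

theorem integrable_fieldPairing (F : Fam η ta tb Z B δ H s) (μ ν : Fin 4)
    {Y : (ℝ × ℝ) × Space → ℝ} (hY : ContDiffOn ℝ ∞ Y (slab η ta tb ×ˢ univ))
    (hd : DecaysLike (slab η ta tb) 2
      fun x => fderivWithin ℝ Y (slab η ta tb ×ˢ univ) x (jointDir μ)) :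
    Integrable (fun p : Spacetime => fieldPairing η ta tb Z B μ ν Y ((0, p.1), p.2))
      (slabMeasure ta tb) :=
  F.integrable_field_mul μ ν
    ((hY.fderivWithin_apply_vec F.uniqueDiffOn_prod contDiffOn_const).continuousOn) hd

theorem ae_slice {g : Spacetime → ℝ} (hg : Integrable g (slabMeasure ta tb)) :
    ∀ᵐ t ∂(volume.restrict (Ioo ta tb)), Integrable fun x => g (t, x) :=
  hg.prod_right_ae

/-- This is the density identity integrated over space. The terms of the cutoff gradient split into
one contribution for each particle, and the gradient of the filling, added to the pairing, is
subtracted again in `localTerm`. The restriction to almost every time comes from Fubini, which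
provides the integrability of the slices of the singular products. -/
theorem slice_identity (F : Fam η ta tb Z B δ H s) {r : ℝ} (hr : 0 < r) (hr' : r ≤ δ / 2) :
    ∀ᵐ t ∂(volume.restrict (Ioo ta tb)),
      -(1 / 4) * (∑ μ, ∑ ν, metric μ * metric ν *
        ∫ x, cutSqD η ta tb (famZ Z) (jointField η ta tb Z B μ ν) r ((0, t), x)) =
      (∑ μ, ∑ ν, ∑ n, localTerm η ta tb Z B δ s μ ν n r t) -
        ∑ μ, ∑ ν, metric ν * ∫ x, fieldPairing η ta tb Z B μ ν
          (filledVar η ta tb Z B δ s r ν) ((0, t), x) := by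
  have hδ := F.sep.pos
  have hrδ : r < δ := by linarith
  have heta := F.eta_pos
  have hz : (0 : ℝ) ∈ Ioo (-η) η := ⟨by linarith, heta⟩
  have a1 : ∀ᵐ t ∂(volume.restrict (Ioo ta tb)), ∀ μ ν, Integrable fun x =>
      fieldPairing η ta tb Z B μ ν (filledVar η ta tb Z B δ s r ν) ((0, t), x) :=
    ae_all_iff.2 fun μ => ae_all_iff.2 fun ν => ae_slice (F.integrable_fieldPairing μ ν
      (F.contDiffOn_filledVar hr hrδ.le ν) (F.decays_filledVar hr hrδ.le μ ν))
  have a2 : ∀ᵐ t ∂(volume.restrict (Ioo ta tb)), ∀ μ ν n, Integrable fun x =>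
      jointField η ta tb Z B μ ν ((0, t), x) * profile (r⁻¹ • (x - famZ Z n (0, t))) :=
    ae_all_iff.2 fun μ => ae_all_iff.2 fun ν => ae_all_iff.2 fun n =>
      ae_slice (F.integrable_field_profile μ ν n hr hrδ.le)
  filter_upwards [a1, a2, ae_restrict_mem measurableSet_Ioo] with t i5 i4 ht
  have hp : ((0 : ℝ), t) ∈ slab η ta tb := mem_slab F.zero_mem (Ioo_subset_Icc_self ht)
  have i0 : ∀ μ ν, Integrable fun x =>
      cutSqD η ta tb (famZ Z) (jointField η ta tb Z B μ ν) r ((0, t), x) := by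
    intro μ ν
    obtain ⟨hc, hdec⟩ := (F.singular_field μ ν).cutSqD_facts heta F.time_lt F.sep (F.decay μ ν)
      (F.decay_eps_field μ ν) hr hrδ.le
    exact hdec.integrable F.sep.compact (by norm_num) hc hp
  have i1 := fun μ ν n => (((F.singular_field μ ν).expansion n).integral_profileD_mul
    ((F.singular_field μ ν).expansion n) F.sep.unique (F.sep.smooth n) epsDir hp hr hrδ).1
  have i2 := fun μ ν n => (((F.singular_field μ ν).expansion n).integral_profileD_mul
    ((F.singular_varB ν).expansion n) F.sep.unique (F.sep.smooth n) (jointDir μ) hp hr hrδ).1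
  have i3 := fun μ ν n => (((F.singular_field μ ν).expansion n).integral_profileD
    F.sep.unique (F.sep.smooth n) (jointDir μ) hp hr hrδ).1
  have iL := fun μ ν n => ((i1 μ ν n).const_mul (1 / 4 * (metric μ * metric ν))).fun_add
    ((((i2 μ ν n).const_mul (-1)).fun_add
      (((i3 μ ν n).const_mul (varAt η ta tb Z δ s ν n (0, t))).fun_add
      ((i4 μ ν n).const_mul (fderivWithin ℝ (varAt η ta tb Z δ s ν n) (slab η ta tb) (0, t)
        (jointDir μ).1)))).const_mul (metric ν))
  have eL : ∀ μ ν n, localTerm η ta tb Z B δ s μ ν n r t = ∫ x, _ := fun μ ν n => by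
    refine Eq.trans ?_ (integral_add ((i1 μ ν n).const_mul (1 / 4 * (metric μ * metric ν)))
      ((((i2 μ ν n).const_mul (-1)).fun_add
      (((i3 μ ν n).const_mul (varAt η ta tb Z δ s ν n (0, t))).fun_add
      ((i4 μ ν n).const_mul (fderivWithin ℝ (varAt η ta tb Z δ s ν n) (slab η ta tb) (0, t)
        (jointDir μ).1)))).const_mul (metric ν))).symm
    rw [integral_const_mul, integral_const_mul, integral_add ((i2 μ ν n).const_mul (-1))
      (((i3 μ ν n).const_mul (varAt η ta tb Z δ s ν n (0, t))).fun_add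
      ((i4 μ ν n).const_mul (fderivWithin ℝ (varAt η ta tb Z δ s ν n) (slab η ta tb) (0, t)
        (jointDir μ).1))), integral_const_mul, integral_add
      ((i3 μ ν n).const_mul (varAt η ta tb Z δ s ν n (0, t)))
      ((i4 μ ν n).const_mul (fderivWithin ℝ (varAt η ta tb Z δ s ν n) (slab η ta tb) (0, t)
        (jointDir μ).1)), integral_const_mul, integral_const_mul, localTerm]
  simp only [eL, ← integral_const_mul]
  have s1 : ∀ {g : Fin 4 → Fin 4 → Space → ℝ}, (∀ μ ν, Integrable (g μ ν)) →
      ∑ μ, ∑ ν, ∫ x, g μ ν x = ∫ x, ∑ μ, ∑ ν, g μ ν x := by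
    intro g hg
    rw [integral_finsetSum _ fun μ _ => integrable_finsetSum _ fun ν _ => hg μ ν]
    exact Finset.sum_congr rfl fun μ _ => (integral_finsetSum _ fun ν _ => hg μ ν).symm
  rw [s1 fun μ ν => (i0 μ ν).const_mul _, s1 fun μ ν => (i5 μ ν).const_mul _]
  have s2 : ∀ μ ν, _ := fun μ ν => (integral_finsetSum Finset.univ fun n _ => iL μ ν n).symm
  simp only [s2]
  rw [s1 fun μ ν => integrable_finsetSum _ fun n _ => iL μ ν n, ← integral_const_mul,
    ← integral_sub (integrable_finsetSum _ fun μ _ => integrable_finsetSum _ fun ν _ =>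
      integrable_finsetSum _ fun n _ => iL μ ν n)
      (integrable_finsetSum _ fun μ _ => integrable_finsetSum _ fun ν _ => (i5 μ ν).const_mul _)]
  refine integral_congr_ae ?_
  filter_upwards [ae_mem_offLines hp] with x hx
  rw [F.sum_cutSqD hx hz ht]
  have hcut : ∀ v, fderivWithin ℝ (cut (famZ Z) r) (slab η ta tb ×ˢ univ) ((0, t), x) v =
      -∑ n, r⁻¹ * profileSlope (relVel (slab η ta tb) (famZ Z n) v (0, t))
        (r⁻¹ • (x - famZ Z n (0, t))) := fun v =>
    fderivWithin_cut F.sep.unique F.sep.smooth r hp v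
  have hfill := fun ν v => F.fderivWithin_filledVar hr hrδ.le ν (x := ((0, t), x)) hp v
  simp only [fieldPairing, hfill, hcut]
  rw [← sub_eq_zero, Finset.mul_sum, ← Finset.sum_add_distrib, ← Finset.sum_sub_distrib,
    ← Finset.sum_sub_distrib, ← Finset.sum_sub_distrib]
  refine Finset.sum_eq_zero fun μ _ => ?_
  rw [Finset.mul_sum, ← Finset.sum_add_distrib, ← Finset.sum_sub_distrib,
    ← Finset.sum_sub_distrib, ← Finset.sum_sub_distrib]
  refine Finset.sum_eq_zero fun ν _ => ?_
  have hs : ∀ (k J b : ℝ) (e p a f g : Fin N → ℝ), ∑ n, (k * (e n * (J * J)) + metric ν *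
      (-1 * (p n * (J * b)) + (a n * (p n * J) + f n * (J * g n)))) =
      k * ((∑ n, e n) * (J * J)) + metric ν * (-((∑ n, p n) * (J * b)) +
        J * ∑ n, (a n * p n + f n * g n)) := by
    intro k J b e p a f g
    simp only [Finset.mul_sum, Finset.sum_mul, ← Finset.sum_neg_distrib, ← Finset.sum_add_distrib]
    exact Finset.sum_congr rfl fun n _ => by ring
  rw [hs]
  ring

/-- At scale zero the parameter component of the direction carries the factor `r = 0`. So at leading
order every derivative, in time or in `ε` too, is a spatial derivative along the relative velocity.
-/
theorem singD_zero {P : Type} [NormedAddCommGroup P] [NormedSpace ℝ P] {U : Set P} {z : P → Space}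
    {Φ : P × (ℝ × Space) → ℝ}
    (hΦ : ContDiffOn ℝ ∞ Φ (U ×ˢ scaleDomain δ)) (hδ : 0 < δ) {p : P} (hp : p ∈ U) {w : Space}
    (hw : w ≠ 0) (v : P × Space) :
    singD U z δ v Φ (p, 0, w) = fderiv ℝ (fun w => Φ (p, 0, w)) w (relVel U z v p) := by
  have hmem : ∀ w : Space, w ≠ 0 → (p, (0 : ℝ), w) ∈ U ×ˢ scaleDomain δ := fun w hw =>
    ⟨hp, hw, by simpa using hδ⟩
  have h1 := ((hΦ.differentiableOn (by simp)) _ (hmem w hw)).hasFDerivWithinAt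
  have h2 : HasFDerivAt (fun w : Space => ((p, (0 : ℝ), w) : P × (ℝ × Space)))
      ((0 : Space →L[ℝ] P).prod ((0 : Space →L[ℝ] ℝ).prod (ContinuousLinearMap.id ℝ Space))) w :=
    (hasFDerivAt_const p w).prodMk ((hasFDerivAt_const 0 w).prodMk (hasFDerivAt_id w))
  have h3 := (HasFDerivWithinAt.comp w h1 (s := {0}ᶜ) h2.hasFDerivWithinAt
    fun w hw => hmem w hw).hasFDerivAt (isOpen_compl_singleton.mem_nhds hw)
  have h4 : fderiv ℝ (fun w => Φ (p, 0, w)) w = _ := h3.fderiv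
  rw [singD, h4]
  simp [relVel]

/-- The integrals that the limits of the localized terms are made of. -/
noncomputable def slopeIntegral (a b : Space) (h : Space → ℝ) : ℝ :=
  ∫ w in annulus, profileSlope a w * fderiv ℝ h w b

theorem integrableOn_slope {h : Space → ℝ} (hh : ContDiffOn ℝ ∞ h {0}ᶜ) (a b : Space) :
    IntegrableOn (fun w => profileSlope a w * fderiv ℝ h w b) annulus := by
  refine ContinuousOn.integrableOn_compact isCompact_annulus (ContinuousOn.mul ?_ ?_)
  · exact (((profile_contDiff.continuous_fderiv (by simp)).clm_apply continuous_const)).continuousOn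
  · exact ((hh.continuousOn_fderiv_of_isOpen isOpen_compl_singleton (by simp)).mono
      fun w hw => ne_zero_of_mem_annulus hw).clm_apply continuousOn_const

theorem contDiffOn_sing_zero {P : Type} [NormedAddCommGroup P] [NormedSpace ℝ P] {U : Set P}
    {Φ : P × (ℝ × Space) → ℝ} (hΦ : ContDiffOn ℝ ∞ Φ (U ×ˢ scaleDomain δ)) (hδ : 0 < δ) {p : P}
    (hp : p ∈ U) : ContDiffOn ℝ ∞ (fun w => Φ (p, 0, w)) {0}ᶜ :=
  hΦ.comp (ContDiff.contDiffOn (by fun_prop)) fun w hw => ⟨hp, hw, by simpa using hδ⟩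

section Limits

variable (η ta tb Z B δ H s)

/-- The limit of `localTerm`. -/
noncomputable def localLimit (μ ν : Fin 4) (n : Fin N) (t : ℝ) : ℝ :=
  1 / 4 * (metric μ * metric ν) * (∫ w in annulus,
        profileD (slab η ta tb) (famZ Z n) epsDir ((0, t), 0, w) *
          (fieldSing η ta tb Z δ H μ ν n ((0, t), 0, w) * fieldReg η ta tb Z δ s μ ν n ((0, t), 0) +
          fieldReg η ta tb Z δ s μ ν n ((0, t), 0) * fieldSing η ta tb Z δ H μ ν n ((0, t), 0, w))) +
    metric ν * (-1 * (∫ w in annulus,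
        profileD (slab η ta tb) (famZ Z n) (jointDir μ) ((0, t), 0, w) *
          (fieldSing η ta tb Z δ H μ ν n ((0, t), 0, w) * varAt η ta tb Z δ s ν n (0, t) +
          fieldReg η ta tb Z δ s μ ν n ((0, t), 0) *
            singD (slab η ta tb) (famZ Z n) δ epsDir (H ν n) ((0, t), 0, w))) +
      (varAt η ta tb Z δ s ν n (0, t) * (∫ w in annulus,
        profileD (slab η ta tb) (famZ Z n) (jointDir μ) ((0, t), 0, w) *
          fieldSing η ta tb Z δ H μ ν n ((0, t), 0, w)) +
      fderivWithin ℝ (varAt η ta tb Z δ s ν n) (slab η ta tb) (0, t) (jointDir μ).1 * 0))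

end Limits

theorem timeExpansion_localTerm (F : Fam η ta tb Z B δ H s) (μ ν : Fin 4) (n : Fin N) :
    TimeExpansion ta tb (δ / 2) (localTerm η ta tb Z B δ s μ ν n)
      (localLimit η ta tb Z δ H s μ ν n) := by
  have ht := F.time_lt.le
  have c1 := F.timeSlice (F.contDiffOn_varAt ν n).continuousOn
  have c2 := F.timeSlice (g := fun p => fderivWithin ℝ (varAt η ta tb Z δ s ν n)
    (slab η ta tb) p (jointDir μ).1)
    ((F.contDiffOn_varAt ν n).fderivWithin_apply_vec F.sep.unique contDiffOn_const).continuousOn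
  have hJ := (F.singular_field μ ν).expansion n
  exact ((F.timeExpansion_quadratic n epsDir hJ hJ).const_mul ht _).add
    ((((F.timeExpansion_quadratic n (jointDir μ) hJ ((F.singular_varB ν).expansion n)).const_mul
      ht (-1)).add (((F.timeExpansion_linear n (jointDir μ) hJ).mul_continuousOn ht c1).add
      ((F.timeExpansion_profile μ ν n).mul_continuousOn ht c2))).const_mul ht _)

/-- At leading order all singular quantities are directional derivatives of the coefficients `h ν`,
so every integral is a `slopeIntegral`. The terms with `varAt` cancel between the cut off variation
and the filling. The others pair the regular field with slope integrals whose two directions belong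
to `ε` and to a coordinate. By the exchange symmetry the order of these directions is immaterial,
and by the antisymmetry of the field the term from the moving cutoff, with its factor `1/4`, then
cancels the one from the variation of the potential. -/
theorem sum_localLimit (F : Fam η ta tb Z B δ H s) {t : ℝ} (ht : t ∈ Icc ta tb) (n : Fin N) :
    ∑ μ, ∑ ν, localLimit η ta tb Z δ H s μ ν n t = 0 := by
  have hδ := F.sep.pos
  have hp : ((0 : ℝ), t) ∈ slab η ta tb := mem_slab F.zero_mem ht
  set c : (ℝ × ℝ) × Space → Space := fun v => relVel (slab η ta tb) (famZ Z n) v (0, t) with hc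
  set h : Fin 4 → Space → ℝ := fun ν w => H ν n ((0, t), 0, w) with hh
  have hsm : ∀ ν, ContDiffOn ℝ ∞ (h ν) {0}ᶜ := fun ν =>
    contDiffOn_sing_zero ((F.potential ν).expansion n).smooth_sing hδ hp
  have hsing : ∀ v ν, ∀ w ∈ annulus,
      singD (slab η ta tb) (famZ Z n) δ v (H ν n) ((0, t), 0, w) = fderiv ℝ (h ν) w (c v) :=
    fun v ν w hw => singD_zero ((F.potential ν).expansion n).smooth_sing hδ hp
      (ne_zero_of_mem_annulus hw) v
  have hint := fun v v' ν => integrableOn_slope (hsm ν) (c v) (c v')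
  have hex : ∀ v v' ν, slopeIntegral (c v) (c v') (h ν) = slopeIntegral (c v') (c v) (h ν) :=
    fun v v' ν => integral_profileSlope_exchange (hsm ν) _ _
  have hF : ∀ v μ ν (k : ℝ), ∫ w in annulus, profileD (slab η ta tb) (famZ Z n) v ((0, t), 0, w) *
      (k * fieldSing η ta tb Z δ H μ ν n ((0, t), 0, w)) =
      k * (metric μ * slopeIntegral (c v) (c (jointDir μ)) (h ν) -
        metric ν * slopeIntegral (c v) (c (jointDir ν)) (h μ)) := by
    intro v μ ν k
    rw [slopeIntegral, slopeIntegral, ← integral_const_mul, ← integral_const_mul,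
      ← integral_sub ((hint _ _ _).const_mul _) ((hint _ _ _).const_mul _), ← integral_const_mul]
    refine setIntegral_congr_fun measurableSet_annulus fun w hw => ?_
    simp only [profileD, fieldSing, hsing _ _ w hw]
    ring
  have hF' : ∀ v μ ν (k : ℝ), IntegrableOn (fun w => profileD (slab η ta tb) (famZ Z n) v ((0, t), 0, w) *
      (k * fieldSing η ta tb Z δ H μ ν n ((0, t), 0, w))) annulus := by
    intro v μ ν k
    refine IntegrableOn.congr_fun ((((hint v (jointDir μ) ν).const_mul (metric μ)).sub
      ((hint v (jointDir ν) μ).const_mul (metric ν))).const_mul k) (fun w hw => ?_)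
      measurableSet_annulus
    simp only [profileD, fieldSing, hsing _ _ w hw, Pi.sub_apply]
    ring
  have e1 : ∀ μ ν, (∫ w in annulus, profileD (slab η ta tb) (famZ Z n) epsDir ((0, t), 0, w) *
          (fieldSing η ta tb Z δ H μ ν n ((0, t), 0, w) * fieldReg η ta tb Z δ s μ ν n ((0, t), 0) +
          fieldReg η ta tb Z δ s μ ν n ((0, t), 0) * fieldSing η ta tb Z δ H μ ν n ((0, t), 0, w))) =
      2 * fieldReg η ta tb Z δ s μ ν n ((0, t), 0) *
        (metric μ * slopeIntegral (c epsDir) (c (jointDir μ)) (h ν) -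
        metric ν * slopeIntegral (c epsDir) (c (jointDir ν)) (h μ)) := by
    intro μ ν
    rw [← hF]
    refine setIntegral_congr_fun measurableSet_annulus fun w hw => ?_
    ring
  have e3 : ∀ μ ν, (∫ w in annulus, profileD (slab η ta tb) (famZ Z n) (jointDir μ) ((0, t), 0, w) *
          fieldSing η ta tb Z δ H μ ν n ((0, t), 0, w)) =
        metric μ * slopeIntegral (c (jointDir μ)) (c (jointDir μ)) (h ν) -
        metric ν * slopeIntegral (c (jointDir μ)) (c (jointDir ν)) (h μ) := by
    intro μ ν
    simpa using hF (jointDir μ) μ ν 1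
  have e2 : ∀ μ ν, (∫ w in annulus, profileD (slab η ta tb) (famZ Z n) (jointDir μ) ((0, t), 0, w) *
          (fieldSing η ta tb Z δ H μ ν n ((0, t), 0, w) * varAt η ta tb Z δ s ν n (0, t) +
          fieldReg η ta tb Z δ s μ ν n ((0, t), 0) *
            singD (slab η ta tb) (famZ Z n) δ epsDir (H ν n) ((0, t), 0, w))) =
      varAt η ta tb Z δ s ν n (0, t) *
        (metric μ * slopeIntegral (c (jointDir μ)) (c (jointDir μ)) (h ν) -
        metric ν * slopeIntegral (c (jointDir μ)) (c (jointDir ν)) (h μ)) +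
      fieldReg η ta tb Z δ s μ ν n ((0, t), 0) *
        slopeIntegral (c (jointDir μ)) (c epsDir) (h ν) := by
    intro μ ν
    rw [← hF, slopeIntegral, ← integral_const_mul, ← integral_add (hF' _ _ _ _)
      ((hint _ _ _).const_mul _)]
    refine setIntegral_congr_fun measurableSet_annulus fun w hw => ?_
    simp only [profileD, hsing _ _ w hw]
    ring
  simp only [localLimit, e1, e2, e3]
  simp only [hex _ epsDir, fieldReg, mul_zero, add_zero]
  generalize (fun μ ν => slopeIntegral (c epsDir) (c (jointDir μ)) (h ν)) = I
  have m0 : metric 0 = -1 := rfl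
  have m1 : metric 1 = 1 := rfl
  have m2 : metric 2 = 1 := rfl
  have m3 : metric 3 = 1 := rfl
  simp only [Fin.sum_univ_four, m0, m1, m2, m3]
  ring

/-- The variation of the electromagnetic action. -/
noncomputable def emVariation (D : Fin 4 → Fin 4 → ℝ) : ℝ :=
  -(1 / 4) * ∑ μ, ∑ ν, metric μ * metric ν * D μ ν

/-- The cut off derivative and minus the pairing differ by the local terms, whose time integral has
renormalized limit zero. They may diverge like `1 / r`, which is why the statement concerns a
renormalized and not an ordinary limit. -/
theorem hasRLim_emVariation (F : Fam η ta tb Z B δ H s) {D : Fin 4 → Fin 4 → ℝ}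
    (hD : ∀ μ ν, HasRLim (fun r => ∫ t in ta..tb, ∫ x,
      cutSqD η ta tb (famZ Z) (jointField η ta tb Z B μ ν) r ((0, t), x)) (D μ ν)) :
    HasRLim (fun r => -∑ μ, ∑ ν, metric ν * ∫ t in ta..tb, ∫ x, fieldPairing η ta tb Z B μ ν
          (filledVar η ta tb Z B δ s r ν) ((0, t), x)) (emVariation D) := by
  have hδ := F.sep.pos
  have ht := F.time_lt.le
  have h1 : HasRLim (fun r => -(1 / 4) * ∑ μ, ∑ ν, metric μ * metric ν * ∫ t in ta..tb, ∫ x,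
      cutSqD η ta tb (famZ Z) (jointField η ta tb Z B μ ν) r ((0, t), x)) (emVariation D) :=
    HasRLim.const_mul (HasRLim.sum fun μ _ => HasRLim.sum fun ν _ => (hD μ ν).const_mul _) _
  have hT : TimeExpansion ta tb (δ / 2) (fun r t => ∑ μ, ∑ ν, ∑ n,
      localTerm η ta tb Z B δ s μ ν n r t) _ :=
    TimeExpansion.sum fun μ _ => TimeExpansion.sum fun ν _ => TimeExpansion.sum fun n _ =>
      F.timeExpansion_localTerm μ ν n
  have h2 := hT.hasRLim ht (half_pos hδ)
  have h3 : ∫ t in ta..tb, ∑ μ, ∑ ν, ∑ n, localLimit η ta tb Z δ H s μ ν n t = 0 := by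
    rw [intervalIntegral.integral_congr (g := fun _ => 0), intervalIntegral.integral_zero]
    intro t hti
    rw [uIcc_of_le ht] at hti
    dsimp only
    have : ∑ μ, ∑ ν, ∑ n, localLimit η ta tb Z δ H s μ ν n t =
        ∑ n, ∑ μ, ∑ ν, localLimit η ta tb Z δ H s μ ν n t :=
      (Finset.sum_congr rfl fun μ _ => Finset.sum_comm).trans Finset.sum_comm
    rw [this]
    exact Finset.sum_eq_zero fun n _ => F.sum_localLimit hti n
  rw [h3] at h2
  have h4 := h1.add (h2.const_mul (-1))
  rw [mul_zero, add_zero] at h4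
  refine h4.congr' ?_
  filter_upwards [Ioo_mem_nhdsGT (half_pos hδ)] with r hr
  have hrδ : r ≤ δ := by linarith [hr.2]
  have iP : ∀ μ ν, IntervalIntegrable (fun t => ∫ x, fieldPairing η ta tb Z B μ ν
          (filledVar η ta tb Z B δ s r ν) ((0, t), x)) volume ta tb := fun μ ν =>
    intervalIntegrable_slab ht (F.integrable_fieldPairing μ ν (F.contDiffOn_filledVar hr.1 hrδ ν)
      (F.decays_filledVar hr.1 hrδ μ ν))
  have iC : ∀ μ ν, IntervalIntegrable (fun t => ∫ x,
      cutSqD η ta tb (famZ Z) (jointField η ta tb Z B μ ν) r ((0, t), x)) volume ta tb := by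
    intro μ ν
    obtain ⟨hc, hdec⟩ := (F.singular_field μ ν).cutSqD_facts F.eta_pos F.time_lt F.sep (F.decay μ ν)
      (F.decay_eps_field μ ν) hr.1 hrδ
    exact F.intervalIntegrable_slice (hdec.continuousOn_integral F.sep.compact (by norm_num) hc)
      F.zero_mem
  have key : ∫ t in ta..tb, (-(1 / 4) * (∑ μ, ∑ ν, metric μ * metric ν *
        ∫ x, cutSqD η ta tb (famZ Z) (jointField η ta tb Z B μ ν) r ((0, t), x))) =
      ∫ t in ta..tb, ((∑ μ, ∑ ν, ∑ n, localTerm η ta tb Z B δ s μ ν n r t) -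
        ∑ μ, ∑ ν, metric ν * ∫ x, fieldPairing η ta tb Z B μ ν
          (filledVar η ta tb Z B δ s r ν) ((0, t), x)) := by
    rw [intervalIntegral.integral_of_le ht, intervalIntegral.integral_of_le ht,
      ← restrict_Ioo_eq_restrict_Ioc]
    exact integral_congr_ae (F.slice_identity hr.1 hr.2.le)
  have s1 : ∀ {g : Fin 4 → Fin 4 → ℝ → ℝ}, (∀ μ ν, IntervalIntegrable (g μ ν) volume ta tb) →
      (IntervalIntegrable (fun t => ∑ μ, ∑ ν, g μ ν t) volume ta tb ∧
      ∫ t in ta..tb, ∑ μ, ∑ ν, g μ ν t = ∑ μ, ∑ ν, ∫ t in ta..tb, g μ ν t) := by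
    intro g hg
    simp only [intervalIntegrable_iff_integrableOn_Ioc_of_le ht] at hg ⊢
    refine ⟨integrable_finsetSum _ fun μ _ => integrable_finsetSum _ fun ν _ => hg μ ν, ?_⟩
    simp only [intervalIntegral.integral_of_le ht]
    rw [integral_finsetSum _ fun μ _ => integrable_finsetSum _ fun ν _ => hg μ ν]
    exact Finset.sum_congr rfl fun μ _ => integral_finsetSum _ fun ν _ => hg μ ν
  rw [intervalIntegral.integral_sub (hT.integrable r hr.1 hr.2.le)
    (s1 fun μ ν => (iP μ ν).const_mul _).1, intervalIntegral.integral_const_mul,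
    (s1 fun μ ν => (iC μ ν).const_mul _).2, (s1 fun μ ν => (iP μ ν).const_mul _).2] at key
  simp only [intervalIntegral.integral_const_mul] at key
  linarith

end Fam

/-! ### Test functions -/

namespace IsTest

variable {φ : Spacetime → ℝ}

theorem eq_zero (h : IsTest ta tb φ) {p : Spacetime} (hp : p.1 ∉ Ioo ta tb) : φ p = 0 :=
  image_eq_zero_of_notMem_tsupport fun hp' => hp (h.support hp').1

theorem isTest_partialD (h : IsTest ta tb φ) (μ : Fin 4) : IsTest ta tb (partialD μ φ) where
  smooth := (h.smooth.fderiv_right (by simp)).clm_apply contDiff_const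
  compact := h.compact.fderiv_apply (𝕜 := ℝ) (direction μ)
  support := (tsupport_fderiv_apply_subset ℝ (direction μ)).trans h.support

theorem exists_bound (h : IsTest ta tb φ) : ∃ C R : ℝ, 0 ≤ C ∧ 0 < R ∧ (∀ p, |φ p| ≤ C) ∧
    ∀ p : Spacetime, R ≤ ‖p.2‖ → φ p = 0 := by
  obtain ⟨C, hC⟩ := h.smooth.continuous.bounded_above_of_compact_support h.compact
  obtain ⟨R, hR⟩ := h.compact.isBounded.subset_closedBall 0
  refine ⟨C, |R| + 1, (norm_nonneg _).trans (hC 0), by positivity, hC, fun p hp => ?_⟩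
  refine image_eq_zero_of_notMem_tsupport fun hp' => ?_
  have h1 := hR hp'
  rw [mem_closedBall_zero_iff] at h1
  have h2 := norm_snd_le p
  have h3 := le_abs_self R
  linarith

/-- `D` is controlled only on the open slab, but the support of the test function is a compact
subset of it, so the product is continuous everywhere. -/
theorem integrable_mul (h : IsTest ta tb φ) {D : Spacetime → ℝ}
    (hD : ContinuousOn D (Ioo ta tb ×ˢ univ)) : Integrable fun p => D p * φ p := by
  refine Continuous.integrable_of_hasCompactSupport (continuous_of_tsupport fun p hp => ?_)
    h.compact.mul_left
  have hp' := h.support (tsupport_mul_subset_right hp)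
  exact (hD.continuousAt ((isOpen_Ioo.prod isOpen_univ).mem_nhds hp')).mul
    h.smooth.continuous.continuousAt

theorem partialD_comm (h : IsTest ta tb φ) (μ ν : Fin 4) :
    partialD μ (partialD ν φ) = partialD ν (partialD μ φ) := by
  funext p
  have hs : IsSymmSndFDerivAt ℝ φ p := (h.smooth.contDiffAt (x := p)).isSymmSndFDerivAt
    (by rw [minSmoothness_of_isRCLikeNormedField]; exact WithTop.coe_le_coe.2 le_top)
  have hd : DifferentiableAt ℝ (fderiv ℝ φ) p :=
    ((h.smooth.fderiv_right (m := ∞) (by simp)).differentiable (by simp)) p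
  have e : ∀ v w, fderiv ℝ (fun p => fderiv ℝ φ p v) p w = fderiv ℝ (fderiv ℝ φ) p w v := by
    intro v w
    rw [fderiv_clm_apply hd (differentiableAt_const _)]
    simp
  change fderiv ℝ (fun p => fderiv ℝ φ p (direction ν)) p (direction μ) =
    fderiv ℝ (fun p => fderiv ℝ φ p (direction μ)) p (direction ν)
  rw [e, e]
  exact hs _ _

end IsTest

/-! ### Integration by parts in the slab -/

open Fam

theorem hasFDerivAt_atZero (hη : 0 < η) {g : (ℝ × ℝ) × Space → ℝ}
    (hg : ContDiffOn ℝ ∞ g (slab η ta tb ×ˢ univ)) {p : Spacetime} (hp : p.1 ∈ Ioo ta tb) :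
    HasFDerivAt (atZero g) ((fderivWithin ℝ g (slab η ta tb ×ˢ univ) ((0, p.1), p.2)).comp
        ((ContinuousLinearMap.inr ℝ ℝ ℝ).prodMap (ContinuousLinearMap.id ℝ Space))) p := by
  have h0 : (0 : ℝ) ∈ Icc (-η) η := ⟨by linarith, hη.le⟩
  have h1 := ((hg.differentiableOn (by simp)) ((0, p.1), p.2)
    ⟨⟨h0, Ioo_subset_Icc_self hp⟩, mem_univ _⟩).hasFDerivWithinAt
  have h2 : HasFDerivAt (fun q : Spacetime => (((0, q.1), q.2) : (ℝ × ℝ) × Space))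
      ((ContinuousLinearMap.inr ℝ ℝ ℝ).prodMap (ContinuousLinearMap.id ℝ Space)) p :=
    ((ContinuousLinearMap.inr ℝ ℝ ℝ).prodMap (ContinuousLinearMap.id ℝ Space)).hasFDerivAt
  have h3 : (fun q : Spacetime => (((0, q.1), q.2) : (ℝ × ℝ) × Space)) ⁻¹'
      (slab η ta tb ×ˢ univ) ∈ 𝓝 p := by
    filter_upwards [(isOpen_Ioo.preimage continuous_fst).mem_nhds hp] with q hq
    exact ⟨⟨h0, Ioo_subset_Icc_self hq⟩, mem_univ _⟩
  exact (HasFDerivWithinAt.comp p h1 h2.hasFDerivWithinAt (mapsTo_preimage _ _)).hasFDerivAt h3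

theorem partialD_atZero (hη : 0 < η) {g : (ℝ × ℝ) × Space → ℝ}
    (hg : ContDiffOn ℝ ∞ g (slab η ta tb ×ˢ univ)) {p : Spacetime} (hp : p.1 ∈ Ioo ta tb)
    (μ : Fin 4) : partialD μ (atZero g) p =
      fderivWithin ℝ g (slab η ta tb ×ˢ univ) ((0, p.1), p.2) (jointDir μ) := by
  rw [partialD, (hasFDerivAt_atZero hη hg hp).fderiv]
  rfl

theorem continuousOn_atZero_slab (hη : 0 < η) {g : (ℝ × ℝ) × Space → ℝ}
    (hg : ContinuousOn g (slab η ta tb ×ˢ univ)) :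
    ContinuousOn (atZero g) (Ioo ta tb ×ˢ univ) :=
  hg.comp (by fun_prop) fun _ hp =>
    ⟨⟨⟨by linarith, hη.le⟩, Ioo_subset_Icc_self hp.1⟩, mem_univ _⟩

theorem integral_mul_partialD (hη : 0 < η) (ht : ta < tb) {g : (ℝ × ℝ) × Space → ℝ}
    (hg : ContDiffOn ℝ ∞ g (slab η ta tb ×ˢ univ)) {φ : Spacetime → ℝ} (hφ : IsTest ta tb φ)
    (μ : Fin 4) : ∫ p, atZero g p * partialD μ φ p ∂slabMeasure ta tb =
      -∫ p, atZero (fun x => fderivWithin ℝ g (slab η ta tb ×ˢ univ) x (jointDir μ)) p * φ p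
        ∂slabMeasure ta tb := by
  have hU : UniqueDiffOn ℝ (slab η ta tb ×ˢ (univ : Set Space)) :=
    (uniqueDiffOn_slab hη ht).prod uniqueDiffOn_univ
  rw [integral_slab_eq fun p hp => by rw [(hφ.isTest_partialD μ).eq_zero hp, mul_zero],
    integral_slab_eq fun p hp => by rw [hφ.eq_zero hp, mul_zero]]
  have c0 := continuousOn_atZero_slab hη hg.continuousOn
  have c1 := continuousOn_atZero_slab hη
    (hg.fderivWithin_apply_vec hU (v := fun _ => jointDir μ) contDiffOn_const).continuousOn
  have e : ∀ p, fderiv ℝ (atZero g) p (direction μ) * φ p =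
      atZero (fun x => fderivWithin ℝ g (slab η ta tb ×ˢ univ) x (jointDir μ)) p * φ p := by
    intro p
    by_cases hp : p.1 ∈ Ioo ta tb
    · rw [← partialD, partialD_atZero hη hg hp]
      rfl
    · rw [hφ.eq_zero hp, mul_zero, mul_zero]
  have : (volume : Measure Spacetime).IsAddHaarMeasure :=
    inferInstanceAs ((volume : Measure ℝ).prod (volume : Measure Space)).IsAddHaarMeasure
  have h := integral_mul_fderiv_eq_neg_fderiv_mul_of_integrable (μ := volume) (f := atZero g) (g := φ)
    (v := direction μ)
    ((hφ.integrable_mul c1).congr (Eventually.of_forall fun p => (e p).symm))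
    ((hφ.isTest_partialD μ).integrable_mul c0) (hφ.integrable_mul c0)
    (fun p hp => (hasFDerivAt_atZero hη hg (hφ.support hp).1).differentiableAt)
    (fun p _ => hφ.smooth.differentiable (by simp) p)
  simp only [e] at h
  exact h

section Cut

variable {P : Type} [NormedAddCommGroup P] [NormedSpace ℝ P] {U : Set P} {z : Fin N → P → Space}

theorem abs_cut_le (z : Fin N → P → Space) (r : ℝ) (x : P × Space) : |cut z r x| ≤ 1 + 2 * N := by
  rw [cut]
  refine (abs_sub _ _).trans (add_le_add (by simp) ?_)
  refine (Finset.abs_sum_le_sum_abs _ _).trans ((Finset.sum_le_sum fun n _ => abs_profile_le _).trans ?_)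
  simp [mul_comm]

theorem eventually_cut (hs : SeparatedPoints U z δ) {x : P × Space} (hx : x ∈ offLines U z) :
    ∀ᶠ r in 𝓝[>] (0 : ℝ), cut z r x = 1 ∧ ∀ v, fderivWithin ℝ (cut z r) (U ×ˢ univ) x v = 0 := by
  have h1 : ∀ᶠ r in 𝓝[>] (0 : ℝ), ∀ n, r < ‖x.2 - z n x.1‖ := by
    refine eventually_all.2 fun n => ?_
    exact nhdsWithin_le_nhds (Iio_mem_nhds (norm_pos_iff.2 (sub_ne_zero.2 (hx.2 n))))
  filter_upwards [h1, self_mem_nhdsWithin] with r hr hr0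
  refine ⟨cut_eq_one hr0 fun n => (hr n).le, fun v => ?_⟩
  rw [fderivWithin_cut hs.unique hs.smooth r hx.1, neg_eq_zero]
  refine Finset.sum_eq_zero fun n _ => ?_
  rw [fderiv_profile_eq_zero, zero_apply, mul_zero]
  intro h
  have := h.2
  rw [norm_smul, norm_inv, Real.norm_of_nonneg (le_of_lt hr0), inv_mul_le_iff₀ hr0] at this
  linarith [hr n]

/-- Where the gradient of the cutoff lives one has `|x - z| ≤ r`, so its size `r⁻¹` is at most a
multiple of `|x - z|⁻¹`. Times a singularity of order one this is bounded by `|x - z|⁻²`, which is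
integrable and independent of `r`. -/
theorem SingularFunction.exists_cut_slope_bound (hs : SeparatedPoints U z δ) {f : P × Space → ℝ}
    {Φ : Fin N → P × (ℝ × Space) → ℝ} {φ : Fin N → P × Space → ℝ}
    (hf : SingularFunction U z δ 1 f Φ φ) (v : P × Space) :
    ∃ C, 0 ≤ C ∧ ∀ r, 0 < r → r ≤ δ / 2 → ∀ x ∈ offLines U z,
      |fderivWithin ℝ (cut z r) (U ×ˢ univ) x v * f x| ≤
        C * ∑ n, nearWeight (δ / 2) (x.2 - z n x.1) := by
  have hδ := hs.pos
  obtain ⟨C₁, h10, h1⟩ := hf.exists_near_bound hs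
  have := fun n => exists_bound_scale hs.compact (half_lt_self hδ)
    (contDiffOn_profileD hs.unique (hs.smooth n) v (scaleDomain δ)).continuousOn
  choose K hK0 hK using this
  have hKs : ∀ n, K n ≤ ∑ n, K n := fun n =>
    Finset.single_le_sum (f := K) (fun n _ => hK0 n) (Finset.mem_univ n)
  have hK0' : 0 ≤ ∑ n, K n := Finset.sum_nonneg fun n _ => hK0 n
  refine ⟨(∑ n, K n) * C₁, by positivity, fun r hr hr' x hx => ?_⟩
  rw [fderivWithin_cut hs.unique hs.smooth r hx.1, neg_mul, abs_neg, Finset.sum_mul, Finset.mul_sum]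
  refine (Finset.abs_sum_le_sum_abs _ _).trans (Finset.sum_le_sum fun n _ => ?_)
  by_cases hw : r⁻¹ • (x.2 - z n x.1) ∈ annulus
  · have hy0 : 0 < ‖x.2 - z n x.1‖ := norm_pos_iff.2 (sub_ne_zero.2 (hx.2 n))
    have hyr : ‖x.2 - z n x.1‖ ≤ r := by
      have := hw.2
      rwa [norm_smul, norm_inv, Real.norm_of_nonneg hr.le, inv_mul_le_iff₀ hr, mul_one] at this
    rw [nearWeight_eq (hyr.trans hr')]
    have e1 := h1 x.1 hx.1 n x.2 (hx.2 n) (hyr.trans hr')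
    have e2 := hK n x.1 hx.1 0 (by rw [abs_zero]; positivity) _ hw
    have e3 : r⁻¹ ≤ ‖x.2 - z n x.1‖⁻¹ := inv_anti₀ hy0 hyr
    rw [profileD, profileSlope] at e2
    rw [abs_mul, abs_mul, abs_of_pos (inv_pos.2 hr)]
    calc _ ≤ ‖x.2 - z n x.1‖⁻¹ * (∑ n, K n) * (C₁ * (‖x.2 - z n x.1‖ ^ 1)⁻¹) := by
          gcongr
          exact e2.trans (hKs n)
      _ = _ := by
          field_simp
  · rw [fderiv_profile_eq_zero hw, zero_apply, mul_zero, zero_mul, abs_zero]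
    exact mul_nonneg (by positivity) (nearWeight_nonneg _ _)

end Cut

/-! ### Integration by parts across the world-lines and the homogeneous Maxwell equations -/

namespace Fam
open FamBase

theorem exists_local_bound (F : Fam η ta tb Z B δ H s) {f : (ℝ × ℝ) × Space → ℝ}
    (hf : ContDiffOn ℝ ∞ f (offLines (slab η ta tb) (famZ Z)))
    (hn : NearBound (slab η ta tb) (famZ Z) δ f) (R : ℝ) :
    ∃ C, 0 ≤ C ∧ ∀ p ∈ slabOff ta tb (Z 0), ‖p.2‖ ≤ R →
      |atZero f p| ≤ C * dominating 4 (δ / 2) (Z 0) p := by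
  -- The factor `4` makes the spatial cutoff equal to `1` on the ball of radius `|R|`, since the
  -- profile is `1` up to a quarter of its scale. The cut off function decays trivially, so the
  -- global bound applies.
  set ρ : ℝ := 4 * (|R| + 1) with hρ
  have hρ0 : 0 < ρ := by positivity
  set χ : (ℝ × ℝ) × Space → ℝ := fun x => profile (ρ⁻¹ • x.2) with hχ
  have hχs : ContDiff ℝ ∞ χ := profile_contDiff.comp (by fun_prop)
  have h1 : ContDiffOn ℝ ∞ (fun x => f x * χ x) (offLines (slab η ta tb) (famZ Z)) :=
    hf.mul hχs.contDiffOn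
  have h2 : NearBound (slab η ta tb) (famZ Z) δ (fun x => f x * χ x) := by
    obtain ⟨C, hC0, hC⟩ := hn
    refine ⟨C * 2, by positivity, fun p hp n x hx hx' => ?_⟩
    rw [abs_mul]
    calc _ ≤ C * (‖x - famZ Z n p‖ ^ 2)⁻¹ * 2 := by
          gcongr
          · exact hC p hp n x hx hx'
          · exact abs_profile_le _
      _ = _ := by ring
  have h3 : DecaysLike (slab η ta tb) 2 (fun x => f x * χ x) :=
    DecaysLike.of_far (R := ρ) (fun p hp x hx => by
      simp only [hχ, profile_scaled_eq_zero hρ0 hx, mul_zero]) 2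
  obtain ⟨C, hC0, hC⟩ := F.exists_mul_bound h1 h2 h3 (C := 1)
    (h := fun x => ((1 + ‖x.2‖) ^ 2)⁻¹) (fun p _ x => by
      rw [one_mul, abs_of_nonneg (by positivity)])
  refine ⟨C * (1 + |R|) ^ 2, by positivity, fun p hp hpR => ?_⟩
  have h4 := hC p hp
  have hp2 : ‖p.2‖ ≤ |R| := hpR.trans (le_abs_self R)
  have h5 : χ ((0, p.1), p.2) = 1 := profile_scaled_eq_one hρ0 (by rw [hρ]; linarith)
  simp only [atZero, h5, mul_one, abs_mul, abs_inv, abs_pow] at h4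
  rw [abs_of_pos (by positivity : 0 < 1 + ‖p.2‖), ← div_eq_mul_inv, div_le_iff₀ (by positivity)] at h4
  have h6 : 0 ≤ dominating 4 (δ / 2) (Z 0) p := dominating_nonneg _ _ _ _
  calc _ ≤ C * dominating 4 (δ / 2) (Z 0) p * (1 + ‖p.2‖) ^ 2 := h4
    _ ≤ C * dominating 4 (δ / 2) (Z 0) p * (1 + |R|) ^ 2 := by gcongr
    _ = _ := by ring

theorem integrable_mul_test (F : Fam η ta tb Z B δ H s) {f : (ℝ × ℝ) × Space → ℝ}
    (hf : ContDiffOn ℝ ∞ f (offLines (slab η ta tb) (famZ Z)))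
    (hn : NearBound (slab η ta tb) (famZ Z) δ f) {φ : Spacetime → ℝ} (hφ : IsTest ta tb φ) :
    Integrable (fun p => atZero f p * φ p) (slabMeasure ta tb) := by
  obtain ⟨M, R, hM0, hR, hM, h0⟩ := hφ.exists_bound
  obtain ⟨C, hC0, hC⟩ := F.exists_local_bound hf hn R
  refine integrable_slab_of_bound F.time_lt.le F.continuousOn_traj
    ((F.continuousOn_atZero hf.continuousOn).mul hφ.smooth.continuous.continuousOn)
    (j := 4) (by norm_num) (C := C * M) (ρ := δ / 2) fun p hp => ?_
  have h6 : 0 ≤ dominating 4 (δ / 2) (Z 0) p := dominating_nonneg _ _ _ _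
  rw [abs_mul]
  rcases le_or_gt ‖p.2‖ R with h | h
  · calc _ ≤ C * dominating 4 (δ / 2) (Z 0) p * M := by
          gcongr
          · exact hC p hp h
          · exact hM p
      _ = _ := by ring
  · rw [h0 p h.le, abs_zero, mul_zero]
    positivity

/-- Integration by parts for functions with singularities of order one. -/
theorem integral_mul_partialD_of_singular (F : Fam η ta tb Z B δ H s) {f : (ℝ × ℝ) × Space → ℝ}
    {Φ : Fin N → (ℝ × ℝ) × (ℝ × Space) → ℝ} {ψ : Fin N → (ℝ × ℝ) × Space → ℝ}
    (hf : SingularFunction (slab η ta tb) (famZ Z) δ 1 f Φ ψ) {φ : Spacetime → ℝ}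
    (hφ : IsTest ta tb φ) (μ : Fin 4) :
    ∫ p, atZero f p * partialD μ φ p ∂slabMeasure ta tb =
      -∫ p, atZero (fun x => fderivWithin ℝ f (offLines (slab η ta tb) (famZ Z)) x (jointDir μ)) p *
        φ p ∂slabMeasure ta tb := by
  have hδ := F.sep.pos
  have ht := F.time_lt.le
  set f' : (ℝ × ℝ) × Space → ℝ :=
    fun x => fderivWithin ℝ f (offLines (slab η ta tb) (famZ Z)) x (jointDir μ) with hf'
  have hs' := hf.fderiv F.sep (jointDir μ)
  have hφ' := hφ.isTest_partialD μ
  have hnf := hf.nearBound F.sep (Or.inl rfl)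
  have hnf' := hs'.nearBound F.sep (Or.inr rfl)
  have i1 := F.integrable_mul_test hf.smooth_off hnf hφ'
  have i2 := F.integrable_mul_test hs'.smooth_off hnf' hφ
  obtain ⟨M, R, hM0, hR, hM, h0⟩ := hφ.exists_bound
  obtain ⟨K, hK0, hK⟩ := hf.exists_cut_slope_bound F.sep (jointDir μ)
  have hoff := ae_slabOff ht F.continuousOn_traj
  have hrpos : ∀ᶠ r in 𝓝[>] (0 : ℝ), r ∈ Ioo 0 (δ / 2) := Ioo_mem_nhdsGT (half_pos hδ)
  have hcutc : ∀ r, ContinuousOn (atZero (cut (famZ Z) r)) (slabOff ta tb (Z 0)) := fun r =>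
    F.continuousOn_atZero ((contDiffOn_cut F.sep.smooth r).continuousOn.mono offLines_subset)
  have hcutc' : ∀ r, ContinuousOn (atZero fun x => fderivWithin ℝ (cut (famZ Z) r)
      (slab η ta tb ×ˢ univ) x (jointDir μ)) (slabOff ta tb (Z 0)) := fun r =>
    F.continuousOn_atZero (((contDiffOn_cut F.sep.smooth r).fderivWithin_apply_vec F.uniqueDiffOn_prod
      contDiffOn_const).continuousOn.mono offLines_subset)
  have cf := F.continuousOn_atZero hf.smooth_off.continuousOn
  have cf' := F.continuousOn_atZero hs'.smooth_off.continuousOn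
  have L1 : Tendsto (fun r => ∫ p, atZero (cut (famZ Z) r) p * (atZero f p * partialD μ φ p)
      ∂slabMeasure ta tb) (𝓝[>] 0) (𝓝 (∫ p, atZero f p * partialD μ φ p ∂slabMeasure ta tb)) := by
    refine tendsto_integral_filter_of_dominated_convergence
      (fun p => (1 + 2 * N) * ‖atZero f p * partialD μ φ p‖) ?_ ?_ (i1.norm.const_mul _) ?_
    · exact Eventually.of_forall fun r => (aestronglyMeasurable_slab ht F.continuousOn_traj (hcutc r)).mul i1.1
    · refine Eventually.of_forall fun r => Eventually.of_forall fun p => ?_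
      rw [norm_mul]
      gcongr
      exact abs_cut_le _ _ _
    · filter_upwards [hoff] with p hp
      refine tendsto_const_nhds.congr' ?_
      filter_upwards [eventually_cut F.sep (F.slabOff_mem hp)] with r hr
      rw [atZero, atZero, hr.1, one_mul]
  -- The term with the gradient of the cutoff tends to zero off the world-lines and has a dominating
  -- function independent of `r`. Hence a singularity of order one leaves no contribution on the
  -- world-lines.
  have L2 : Tendsto (fun r => ∫ p, (atZero (cut (famZ Z) r) p * (atZero f' p * φ p) +
      atZero (fun x => fderivWithin ℝ (cut (famZ Z) r) (slab η ta tb ×ˢ univ) x (jointDir μ)) p *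
        atZero f p * φ p) ∂slabMeasure ta tb) (𝓝[>] 0)
      (𝓝 (∫ p, atZero f' p * φ p ∂slabMeasure ta tb)) := by
    refine tendsto_integral_filter_of_dominated_convergence
      (fun p => (1 + 2 * N) * ‖atZero f' p * φ p‖ + K * M * dominating 4 (δ / 2) (Z 0) p) ?_ ?_
      ((i2.norm.const_mul _).add ((integrable_dominating ht F.continuousOn_traj (by norm_num) _).const_mul _)) ?_
    · refine Eventually.of_forall fun r =>
        ((aestronglyMeasurable_slab ht F.continuousOn_traj (hcutc r)).mul i2.1).add ?_
      exact (aestronglyMeasurable_slab ht F.continuousOn_traj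
        (((hcutc' r).mul cf).mul hφ.smooth.continuous.continuousOn))
    · filter_upwards [hrpos] with r hr
      filter_upwards [hoff] with p hp
      refine (norm_add_le _ _).trans (add_le_add ?_ ?_)
      · rw [norm_mul]
        gcongr
        exact abs_cut_le _ _ _
      · have h1 := hK r hr.1 hr.2.le _ (F.slabOff_mem hp)
        have h2 : ∑ n, nearWeight (δ / 2) (p.2 - famZ Z n (0, p.1)) ≤ dominating 4 (δ / 2) (Z 0) p :=
          le_add_of_nonneg_left (by positivity)
        have h6 : 0 ≤ dominating 4 (δ / 2) (Z 0) p := dominating_nonneg _ _ _ _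
        rw [norm_mul, Real.norm_eq_abs, Real.norm_eq_abs]
        calc _ ≤ K * (∑ n, nearWeight (δ / 2) (p.2 - famZ Z n (0, p.1))) * M := by
              gcongr
              · exact mul_nonneg hK0 (Finset.sum_nonneg fun n _ => nearWeight_nonneg _ _)
              · exact h1
              · exact hM p
          _ ≤ K * dominating 4 (δ / 2) (Z 0) p * M := by gcongr
          _ = _ := by ring
    · filter_upwards [hoff] with p hp
      refine tendsto_const_nhds.congr' ?_
      filter_upwards [eventually_cut F.sep (F.slabOff_mem hp)] with r hr
      simp only [atZero, hr.1, hr.2]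
      ring
  refine tendsto_nhds_unique L1 (L2.neg.congr' ?_)
  filter_upwards [hrpos] with r hr
  have h := integral_mul_partialD F.eta_pos F.time_lt
    (F.sep.contDiffOn_cut_mul hr.1 (by linarith [hr.2]) hf.smooth_off) hφ μ
  have e1 : ∀ p, atZero (cut (famZ Z) r) p * (atZero f p * partialD μ φ p) =
      atZero (fun x => cut (famZ Z) r x * f x) p * partialD μ φ p := fun p =>
    (mul_assoc _ _ _).symm
  simp only [e1]
  refine Eq.symm ?_
  rw [h, neg_inj]
  refine integral_congr_ae ?_
  filter_upwards [hoff] with p hp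
  have := F.sep.fderivWithin_cut_mul r hf.smooth_off (F.slabOff_mem hp) (jointDir μ)
  simp only [atZero, hf', this]
  ring

/-- Each side is the potential integrated against a second derivative of the test function, up to
the same sign, and those derivatives commute. The potential is integrated by parts only once, so its
order-one singularity is mild enough. -/
theorem integral_jointD_swap (F : Fam η ta tb Z B δ H s) {φ : Spacetime → ℝ}
    (hφ : IsTest ta tb φ) (μ ν l : Fin 4) :
    ∫ p, atZero (jointD η ta tb Z B μ ν) p * partialD l φ p ∂slabMeasure ta tb =
      ∫ p, atZero (jointD η ta tb Z B l ν) p * partialD μ φ p ∂slabMeasure ta tb := by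
  have h1 := F.integral_mul_partialD_of_singular (F.potential ν) (hφ.isTest_partialD l) μ
  have h2 := F.integral_mul_partialD_of_singular (F.potential ν) (hφ.isTest_partialD μ) l
  rw [hφ.partialD_comm] at h1
  exact neg_inj.1 (h1.symm.trans h2)

theorem integrable_jointD_test (F : Fam η ta tb Z B δ H s) {φ : Spacetime → ℝ}
    (hφ : IsTest ta tb φ) (μ ν : Fin 4) :
    Integrable (fun p => atZero (jointD η ta tb Z B μ ν) p * φ p) (slabMeasure ta tb) :=
  F.integrable_mul_test (F.singular_jointD μ ν).smooth_off
    ((F.singular_jointD μ ν).nearBound F.sep (Or.inr rfl)) hφ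

theorem integral_field_test (F : Fam η ta tb Z B δ H s) {φ : Spacetime → ℝ}
    (hφ : IsTest ta tb φ) (μ ν : Fin 4) :
    ∫ p, field (B 0) μ ν p * φ p =
      ∫ p, atZero (jointField η ta tb Z B μ ν) p * φ p ∂slabMeasure ta tb := by
  rw [← integral_slab_eq (ta := ta) (tb := tb) fun p hp => by rw [hφ.eq_zero hp, mul_zero]]
  refine integral_congr_ae ?_
  filter_upwards [ae_slabOff F.time_lt.le F.continuousOn_traj] with p hp
  rw [show p = (p.1, p.2) from rfl, F.field_eq F.zero_mem hp.1 hp.2]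
  rfl

theorem integral_field_test_eq (F : Fam η ta tb Z B δ H s) {φ : Spacetime → ℝ}
    (hφ : IsTest ta tb φ) (μ ν : Fin 4) :
    ∫ p, field (B 0) μ ν p * φ p =
      metric μ * (∫ p, atZero (jointD η ta tb Z B μ ν) p * φ p ∂slabMeasure ta tb) -
      metric ν * ∫ p, atZero (jointD η ta tb Z B ν μ) p * φ p ∂slabMeasure ta tb := by
  rw [F.integral_field_test hφ, ← integral_const_mul, ← integral_const_mul,
    ← integral_sub ((F.integrable_jointD_test hφ μ ν).const_mul _)
      ((F.integrable_jointD_test hφ ν μ).const_mul _)]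
  refine integral_congr_ae (Eventually.of_forall fun p => ?_)
  simp only [atZero, jointField]
  ring

/-- The field is a curl, and its second derivatives cancel in pairs in the weak sense; no equation
of motion is involved. -/
theorem faraday (F : Fam η ta tb Z B δ H s) {φ : Spacetime → ℝ} (hφ : IsTest ta tb φ) (i : Fin 3) :
    distD 0 (magnetic (B 0) i) φ + (distD (i + 1).succ (electric (B 0) (i + 2)) φ
      - distD (i + 2).succ (electric (B 0) (i + 1)) φ) = 0 := by
  simp only [distD, magnetic, electric,
    fun l μ ν => F.integral_field_test_eq (hφ.isTest_partialD l) μ ν]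
  have m0 : metric 0 = -1 := rfl
  have ms : ∀ i : Fin 3, metric i.succ = 1 := fun i => by fin_cases i <;> rfl
  rw [m0, ms, ms, F.integral_jointD_swap hφ 0 (i + 2).succ (i + 1).succ,
    F.integral_jointD_swap hφ 0 (i + 1).succ (i + 2).succ,
    F.integral_jointD_swap hφ (i + 2).succ 0 (i + 1).succ]
  ring

theorem gauss_magnetic (F : Fam η ta tb Z B δ H s) {φ : Spacetime → ℝ} (hφ : IsTest ta tb φ) :
    ∑ i : Fin 3, distD i.succ (magnetic (B 0) i) φ = 0 := by
  simp only [distD, magnetic,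
    fun l μ ν => F.integral_field_test_eq (hφ.isTest_partialD l) μ ν]
  have ms : ∀ i : Fin 3, metric i.succ = 1 := fun i => by fin_cases i <;> rfl
  simp only [ms, Fin.sum_univ_three]
  have e1 : (0 : Fin 3) + 1 = 1 := rfl
  have e2 : (0 : Fin 3) + 2 = 2 := rfl
  have e3 : (1 : Fin 3) + 1 = 2 := rfl
  have e4 : (1 : Fin 3) + 2 = 0 := rfl
  have e5 : (2 : Fin 3) + 1 = 0 := rfl
  have e6 : (2 : Fin 3) + 2 = 1 := rfl
  rw [e1, e2, e3, e4, e5, e6, F.integral_jointD_swap hφ (Fin.succ 1) (Fin.succ 2) (Fin.succ 0),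
    F.integral_jointD_swap hφ (Fin.succ 2) (Fin.succ 1) (Fin.succ 0),
    F.integral_jointD_swap hφ (Fin.succ 2) (Fin.succ 0) (Fin.succ 1)]
  ring

end Fam

/-! ### The inhomogeneous Maxwell equations -/

/-- The velocity `(1, v)`. -/
noncomputable def velocity (z : ℝ → Space) (t : ℝ) : Fin 4 → ℝ :=
  Fin.cons 1 fun i => deriv z t i

/-- The weak form of `∂_μ F^{μν} = -j^ν`. -/
def WeakMaxwell (q : Fin N → ℝ) (ta tb : ℝ) (z : Fin N → ℝ → Space)
    (A : Spacetime → Fin 4 → ℝ) : Prop :=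
  ∀ φ, IsTest ta tb φ → ∀ ν, ∑ μ, ∫ p, field A μ ν p * partialD μ φ p =
    ∑ n, q n * ∫ t in ta..tb, velocity (z n) t ν * φ (t, z n t)

theorem field_self (A : Spacetime → Fin 4 → ℝ) (μ : Fin 4) (p : Spacetime) : field A μ μ p = 0 := by
  simp [field]

theorem field_swap (A : Spacetime → Fin 4 → ℝ) (μ ν : Fin 4) (p : Spacetime) :
    field A μ ν p = -field A ν μ p := by
  simp [field]

/-- The component `ν = 0` is the Gauss law and the spatial components are the Ampère law, up to the
sign from moving derivatives to the test function. Indices of magnetic components are cyclic modulo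
`3`. -/
theorem weakMaxwell_iff (q : Fin N → ℝ) (ta tb : ℝ) (z : Fin N → ℝ → Space)
    (A : Spacetime → Fin 4 → ℝ) : WeakMaxwell q ta tb z A ↔
      (∀ φ, IsTest ta tb φ → ∀ i : Fin 3,
        distD 0 (electric A i) φ - (distD (i + 1).succ (magnetic A (i + 2)) φ
          - distD (i + 2).succ (magnetic A (i + 1)) φ)
          = -∑ n, q n * ∫ t in ta..tb, deriv (z n) t i * φ (t, z n t)) ∧
      ∀ φ, IsTest ta tb φ →
        ∑ i : Fin 3, distD i.succ (electric A i) φ = ∑ n, q n * ∫ t in ta..tb, φ (t, z n t) := by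
  have h0 : ∀ φ, ∑ μ, ∫ p, field A μ 0 p * partialD μ φ p =
      ∑ i : Fin 3, distD i.succ (electric A i) φ := by
    intro φ
    rw [Fin.sum_univ_succ]
    simp only [field_self, zero_mul, integral_zero, zero_add, distD, electric]
    refine Finset.sum_congr rfl fun i _ => ?_
    rw [← integral_neg]
    refine integral_congr_ae (Eventually.of_forall fun p => ?_)
    simp only [field_swap A i.succ 0 p]
    ring
  have hi : ∀ φ, ∀ i : Fin 3, ∑ μ, ∫ p, field A μ i.succ p * partialD μ φ p =
      -(distD 0 (electric A i) φ - (distD (i + 1).succ (magnetic A (i + 2)) φ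
          - distD (i + 2).succ (magnetic A (i + 1)) φ)) := by
    intro φ i
    have e1 : i + 2 + 1 = i := by fin_cases i <;> rfl
    have e2 : i + 2 + 2 = i + 1 := by fin_cases i <;> rfl
    have e3 : i + 1 + 1 = i + 2 := by fin_cases i <;> rfl
    have e4 : i + 1 + 2 = i := by fin_cases i <;> rfl
    simp only [distD, electric, magnetic, e1, e2, e3, e4]
    have e5 : ∀ g : Fin 3 → ℝ, ∑ j, g j = g i + g (i + 1) + g (i + 2) := by
      intro g
      rw [Fin.sum_univ_three]
      fin_cases i
      · rfl
      · change _ = g 1 + g 2 + g 0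
        ring
      · change _ = g 2 + g 0 + g 1
        ring
    have e6 : ∫ p, field A (i + 1).succ i.succ p * partialD (i + 1).succ φ p =
        -∫ p, field A i.succ (i + 1).succ p * partialD (i + 1).succ φ p := by
      rw [← integral_neg]
      refine integral_congr_ae (Eventually.of_forall fun p => ?_)
      simp only [field_swap A (i + 1).succ i.succ p]
      ring
    rw [Fin.sum_univ_succ, e5, e6]
    simp only [field_self, zero_mul, integral_zero]
    ring
  constructor
  · intro h
    refine ⟨fun φ hφ i => ?_, fun φ hφ => ?_⟩
    · have := h φ hφ i.succ
      rw [hi, neg_eq_iff_eq_neg] at this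
      exact this
    · have := h φ hφ 0
      rw [h0] at this
      simpa [velocity] using this
  · rintro ⟨ha, hg⟩ φ hφ ν
    refine Fin.cases ?_ (fun i => ?_) ν
    · rw [h0, hg φ hφ]
      simp [velocity]
    · rw [hi, ha φ hφ, neg_neg]
      rfl

theorem Fam.maxwell_iff (F : Fam η ta tb Z B δ H s) (q : Fin N → ℝ) :
    Maxwell q ta tb (Z 0) (B 0) ↔ WeakMaxwell q ta tb (Z 0) (B 0) := by
  rw [weakMaxwell_iff]
  exact ⟨fun h => ⟨h.ampere, h.gauss⟩, fun h => ⟨fun φ hφ => F.faraday hφ, h.1, h.2,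
    fun φ hφ => F.gauss_magnetic hφ⟩⟩

/-! ### Exhausting the slab by test functions -/

theorem IsTest.mul_contDiffOn {c : Spacetime → ℝ} (hc : IsTest ta tb c) {D : Spacetime → ℝ}
    (hD : ContDiffOn ℝ ∞ D (Ioo ta tb ×ˢ univ)) : IsTest ta tb fun p => c p * D p where
  smooth := contDiff_iff_contDiffAt.2 fun p => by
    by_cases hp : p ∈ tsupport c
    · exact hc.smooth.contDiffAt.mul
        (hD.contDiffAt ((isOpen_Ioo.prod isOpen_univ).mem_nhds (hc.support hp)))
    · refine (contDiffAt_const (c := (0 : ℝ))).congr_of_eventuallyEq ?_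
      filter_upwards [notMem_tsupport_iff_eventuallyEq.1 hp] with x hx
      rw [hx, Pi.zero_apply, zero_mul]
  compact := hc.compact.mul_right
  support := tsupport_mul_subset_left.trans hc.support

theorem deriv_smoothTransition_eq_zero {u : ℝ} (hu : u ∉ Icc (0 : ℝ) 1) :
    deriv Real.smoothTransition u = 0 := by
  rw [mem_Icc, not_and_or, not_le, not_le] at hu
  rcases hu with hu | hu
  · have : Real.smoothTransition =ᶠ[𝓝 u] fun _ => 0 := by
      filter_upwards [Iio_mem_nhds hu] with x hx
      exact Real.smoothTransition.zero_of_nonpos (le_of_lt hx)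
    rw [this.deriv_eq, deriv_const]
  · have : Real.smoothTransition =ᶠ[𝓝 u] fun _ => 1 := by
      filter_upwards [Ioi_mem_nhds hu] with x hx
      exact Real.smoothTransition.one_of_one_le (le_of_lt hx)
    rw [this.deriv_eq, deriv_const]

/-- For `u = κ (t - ta) - 1` the weight `|u + 1|` is `κ (t - ta)` inside the interval. The bound
therefore controls `(t - ta)` times the time derivative of the cutoff, uniformly in `κ`. -/
theorem exists_smoothTransition_bound :
    ∃ L, 0 ≤ L ∧ ∀ u : ℝ, |u + 1| * |deriv Real.smoothTransition u| ≤ L := by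
  have hS : ContDiff ℝ ∞ Real.smoothTransition := Real.smoothTransition.contDiff
  have hc : Continuous fun u : ℝ => |u + 1| * |deriv Real.smoothTransition u| :=
    (continuous_abs.comp (continuous_id.add continuous_const)).mul
      (continuous_abs.comp (hS.continuous_deriv (by simp)))
  obtain ⟨L, hL⟩ := (isCompact_Icc (a := (0 : ℝ)) (b := 1)).exists_bound_of_continuousOn hc.continuousOn
  refine ⟨|L|, abs_nonneg _, fun u => ?_⟩
  by_cases hu : u ∈ Icc (0 : ℝ) 1
  · exact (le_abs_self _).trans ((hL u hu).trans (le_abs_self L))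
  · rw [deriv_smoothTransition_eq_zero hu, abs_zero, mul_zero]
    exact abs_nonneg _

/-- A smooth function of time that vanishes near the ends of an interval. -/
noncomputable def timeCut (κ ta tb t : ℝ) : ℝ :=
  Real.smoothTransition (κ * (t - ta) - 1) * Real.smoothTransition (κ * (tb - t) - 1)

theorem contDiff_timeCut (κ ta tb : ℝ) : ContDiff ℝ ∞ (timeCut κ ta tb) :=
  (Real.smoothTransition.contDiff.comp (by fun_prop)).mul
    (Real.smoothTransition.contDiff.comp (by fun_prop))

theorem hasDerivAt_timeCut (κ ta tb t : ℝ) : HasDerivAt (timeCut κ ta tb)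
    (κ * deriv Real.smoothTransition (κ * (t - ta) - 1) * Real.smoothTransition (κ * (tb - t) - 1) -
      κ * deriv Real.smoothTransition (κ * (tb - t) - 1) *
        Real.smoothTransition (κ * (t - ta) - 1)) t := by
  have hS : ContDiff ℝ ∞ Real.smoothTransition := Real.smoothTransition.contDiff
  have hd := fun u => (hS.differentiable (by simp) u).hasDerivAt
  have h1 : HasDerivAt (fun t => κ * (t - ta) - 1) (κ * 1) t :=
    (((hasDerivAt_id t).sub_const ta).const_mul κ).sub_const 1
  have h2 : HasDerivAt (fun t => κ * (tb - t) - 1) (κ * -1) t :=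
    (((hasDerivAt_id t).const_sub tb).const_mul κ).sub_const 1
  refine ((hd (κ * (t - ta) - 1)).comp t h1 |>.mul ((hd (κ * (tb - t) - 1)).comp t h2)).congr_deriv ?_
  simp only [Function.comp]
  ring

/-- Test functions that exhaust the slab. -/
noncomputable def cutoffTest (κ ta tb : ℝ) (p : Spacetime) : ℝ :=
  timeCut κ ta tb p.1 * profile (κ⁻¹ • p.2)

theorem isTest_cutoffTest {κ : ℝ} (hκ : 0 < κ) : IsTest ta tb (cutoffTest κ ta tb) := by
  have hsub : tsupport (cutoffTest κ ta tb) ⊆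
      Icc (ta + κ⁻¹) (tb - κ⁻¹) ×ˢ Metric.closedBall (0 : Space) κ := by
    refine closure_minimal (fun p hp => ?_) (isClosed_Icc.prod Metric.isClosed_closedBall)
    rw [Function.mem_support, cutoffTest, timeCut] at hp
    by_contra hcon
    apply hp
    rw [mem_prod, mem_Icc, mem_closedBall_zero_iff, not_and_or, not_and_or, not_le, not_le, not_le] at hcon
    have e : κ * κ⁻¹ = 1 := mul_inv_cancel₀ hκ.ne'
    rcases hcon with (h | h) | h
    · rw [Real.smoothTransition.zero_of_nonpos (by nlinarith), zero_mul, zero_mul]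
    · rw [Real.smoothTransition.zero_of_nonpos (x := κ * (tb - p.1) - 1) (by nlinarith), mul_zero,
        zero_mul]
    · rw [profile_scaled_eq_zero hκ h.le, mul_zero]
  refine ⟨?_, ?_, hsub.trans ?_⟩
  · exact ((contDiff_timeCut κ ta tb).comp contDiff_fst).mul (profile_contDiff.comp (by fun_prop))
  · exact HasCompactSupport.of_support_subset_isCompact
      (isCompact_Icc.prod (isCompact_closedBall (0 : Space) κ)) ((subset_tsupport _).trans hsub)
  · refine prod_mono (fun t ht => ?_) (subset_univ _)
    have := inv_pos.2 hκ
    exact ⟨by linarith [ht.1], by linarith [ht.2]⟩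

theorem abs_timeCut_le (κ ta tb t : ℝ) : |timeCut κ ta tb t| ≤ 1 := by
  rw [timeCut, abs_mul, abs_of_nonneg (Real.smoothTransition.nonneg _),
    abs_of_nonneg (Real.smoothTransition.nonneg _)]
  exact mul_le_one₀ (Real.smoothTransition.le_one _) (Real.smoothTransition.nonneg _)
    (Real.smoothTransition.le_one _)

theorem abs_cutoffTest_le (κ ta tb : ℝ) (p : Spacetime) : |cutoffTest κ ta tb p| ≤ 2 := by
  rw [cutoffTest, abs_mul]
  calc _ ≤ (1 : ℝ) * 2 := mul_le_mul (abs_timeCut_le _ _ _ _) (abs_profile_le _) (abs_nonneg _) zero_le_one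
    _ = 2 := one_mul _

theorem partialD_cutoffTest (κ ta tb : ℝ) (p : Spacetime) (μ : Fin 4) :
    partialD μ (cutoffTest κ ta tb) p =
      (direction μ).1 * deriv (timeCut κ ta tb) p.1 * profile (κ⁻¹ • p.2) +
      timeCut κ ta tb p.1 * (κ⁻¹ * fderiv ℝ profile (κ⁻¹ • p.2) (direction μ).2) := by
  have h1 : HasFDerivAt (fun p : Spacetime => timeCut κ ta tb p.1) _ p :=
    ((hasDerivAt_timeCut κ ta tb p.1).differentiableAt.hasDerivAt).comp_hasFDerivAt p
      (hasFDerivAt_fst (𝕜 := ℝ) (p := p))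
  have h2 : HasFDerivAt (fun p : Spacetime => profile (κ⁻¹ • p.2))
      ((fderiv ℝ profile (κ⁻¹ • p.2)).comp (κ⁻¹ • ContinuousLinearMap.snd ℝ ℝ Space)) p :=
    HasFDerivAt.comp (g := profile) (f := fun p : Spacetime => κ⁻¹ • p.2) p
      ((profile_contDiff.differentiable (by simp)) (κ⁻¹ • p.2)).hasFDerivAt
      (κ⁻¹ • ContinuousLinearMap.snd ℝ ℝ Space).hasFDerivAt
  have h3 : fderiv ℝ (cutoffTest κ ta tb) p = _ := (h1.mul h2).fderiv
  rw [partialD, h3]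
  simp
  ring

theorem abs_direction_fst_le (μ : Fin 4) : |(direction μ).1| ≤ 1 := by
  refine Fin.cases ?_ (fun i => ?_) μ <;> simp [direction]

theorem norm_direction_snd_le (μ : Fin 4) : ‖(direction μ).2‖ ≤ 1 := by
  refine Fin.cases ?_ (fun i => ?_) μ <;> simp [direction]

/-- The time derivative of the cutoff grows like `κ`, but only at distances of order `κ⁻¹` from the
ends, where `y` is small in proportion to the distance. The product stays bounded as `κ` grows. -/
theorem exists_cutoffTest_bound (ta tb : ℝ) : ∃ L, 0 ≤ L ∧ ∀ κ, 1 ≤ κ → ∀ p : Spacetime,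
    p.1 ∈ Ioo ta tb → ∀ (μ : Fin 4) (y M : ℝ), 0 ≤ M → |y| ≤ M * (p.1 - ta) → |y| ≤ M * (tb - p.1) →
      |partialD μ (cutoffTest κ ta tb) p * y| ≤ L * M := by
  obtain ⟨L, hL0, hL⟩ := exists_smoothTransition_bound
  have hcont : Continuous (fderiv ℝ profile) := profile_contDiff.continuous_fderiv (by simp)
  obtain ⟨K, hK⟩ := isCompact_annulus.exists_bound_of_continuousOn hcont.continuousOn
  have hK' : ∀ w, ‖fderiv ℝ profile w‖ ≤ |K| := fun w => by
    by_cases hw : w ∈ annulus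
    · exact (hK w hw).trans (le_abs_self K)
    · rw [fderiv_profile_eq_zero hw, norm_zero]
      exact abs_nonneg K
  -- The factor `4` counts the two ends of the interval and the bound `2` of the profile; the second
  -- summand comes from the spatial gradient.
  refine ⟨4 * L + |K| * |tb - ta|, by positivity, fun κ hκ p hp μ y M hM h1 h2 => ?_⟩
  have hκ0 : 0 < κ := by linarith
  have d1 : |κ * deriv Real.smoothTransition (κ * (p.1 - ta) - 1)| * |y| ≤ L * M := by
    calc _ ≤ |κ * deriv Real.smoothTransition (κ * (p.1 - ta) - 1)| * (M * (p.1 - ta)) := by gcongr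
      _ = |κ * (p.1 - ta) - 1 + 1| * |deriv Real.smoothTransition (κ * (p.1 - ta) - 1)| * M := by
          rw [abs_mul, sub_add_cancel, abs_mul κ (p.1 - ta), abs_of_pos (sub_pos.2 hp.1)]
          ring
      _ ≤ L * M := by gcongr; exact hL _
  have d2 : |κ * deriv Real.smoothTransition (κ * (tb - p.1) - 1)| * |y| ≤ L * M := by
    calc _ ≤ |κ * deriv Real.smoothTransition (κ * (tb - p.1) - 1)| * (M * (tb - p.1)) := by gcongr
      _ = |κ * (tb - p.1) - 1 + 1| * |deriv Real.smoothTransition (κ * (tb - p.1) - 1)| * M := by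
          rw [abs_mul, sub_add_cancel, abs_mul κ (tb - p.1), abs_of_pos (sub_pos.2 hp.2)]
          ring
      _ ≤ L * M := by gcongr; exact hL _
  have s1 : ∀ u, |Real.smoothTransition u| ≤ 1 := fun u => by
    rw [abs_of_nonneg (Real.smoothTransition.nonneg _)]
    exact Real.smoothTransition.le_one _
  have d3 : |deriv (timeCut κ ta tb) p.1| * |y| ≤ 2 * (L * M) := by
    rw [(hasDerivAt_timeCut κ ta tb p.1).deriv]
    refine (mul_le_mul_of_nonneg_right (abs_sub _ _) (abs_nonneg y)).trans ?_
    rw [abs_mul (κ * _), abs_mul (κ * _), add_mul, two_mul]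
    refine add_le_add (le_trans ?_ d1) (le_trans ?_ d2)
    · gcongr
      exact mul_le_of_le_one_right (abs_nonneg _) (s1 _)
    · gcongr
      exact mul_le_of_le_one_right (abs_nonneg _) (s1 _)
  have d4 : |κ⁻¹ * fderiv ℝ profile (κ⁻¹ • p.2) (direction μ).2| ≤ |K| := by
    rw [abs_mul, abs_of_pos (inv_pos.2 hκ0)]
    have e1 : κ⁻¹ ≤ 1 := inv_le_one_of_one_le₀ hκ
    have e2 : |fderiv ℝ profile (κ⁻¹ • p.2) (direction μ).2| ≤ |K| := by
      refine ((fderiv ℝ profile (κ⁻¹ • p.2)).le_opNorm _).trans ?_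
      calc _ ≤ |K| * 1 := mul_le_mul (hK' _) (norm_direction_snd_le μ) (norm_nonneg _) (abs_nonneg _)
        _ = |K| := mul_one _
    calc _ ≤ 1 * |K| := mul_le_mul e1 e2 (abs_nonneg _) zero_le_one
      _ = |K| := one_mul _
  have d5 : |y| ≤ |tb - ta| * M := by
    refine h1.trans ?_
    rw [mul_comm]
    gcongr
    exact le_trans (by linarith [hp.2]) (le_abs_self _)
  rw [partialD_cutoffTest, add_mul]
  refine (abs_add_le _ _).trans ?_
  have f1 : |(direction μ).1 * deriv (timeCut κ ta tb) p.1 * profile (κ⁻¹ • p.2) * y| ≤ 4 * (L * M) := by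
    rw [abs_mul, abs_mul, abs_mul]
    have h3 := abs_direction_fst_le μ
    have h4 := abs_profile_le (κ⁻¹ • p.2)
    calc _ = |(direction μ).1| * (|deriv (timeCut κ ta tb) p.1| * |y|) * |profile (κ⁻¹ • p.2)| := by ring
      _ ≤ 1 * (2 * (L * M)) * 2 := by gcongr
      _ = _ := by ring
  have f2 : |timeCut κ ta tb p.1 * (κ⁻¹ * fderiv ℝ profile (κ⁻¹ • p.2) (direction μ).2) * y| ≤
      1 * |K| * (|tb - ta| * M) := by
    rw [abs_mul, abs_mul]
    gcongr
    exact abs_timeCut_le _ _ _ _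
  calc _ ≤ 4 * (L * M) + 1 * |K| * (|tb - ta| * M) := add_le_add f1 f2
    _ = _ := by ring

theorem eventually_cutoffTest {p : Spacetime} (hp : p.1 ∈ Ioo ta tb) :
    ∀ᶠ κ : ℝ in atTop, cutoffTest κ ta tb p = 1 ∧ ∀ μ, partialD μ (cutoffTest κ ta tb) p = 0 := by
  have h1 : 0 < p.1 - ta := sub_pos.2 hp.1
  have h2 : 0 < tb - p.1 := sub_pos.2 hp.2
  filter_upwards [eventually_gt_atTop (2 / (p.1 - ta)), eventually_gt_atTop (2 / (tb - p.1)),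
    eventually_gt_atTop (8 * ‖p.2‖), eventually_gt_atTop 0] with κ k1 k2 k3 hκ
  rw [div_lt_iff₀ h1] at k1
  rw [div_lt_iff₀ h2] at k2
  have e1 : deriv (timeCut κ ta tb) p.1 = 0 := by
    rw [(hasDerivAt_timeCut κ ta tb p.1).deriv, deriv_smoothTransition_eq_zero,
      deriv_smoothTransition_eq_zero]
    · ring
    · exact fun h => by linarith [h.2]
    · exact fun h => by linarith [h.2]
  have e2 : timeCut κ ta tb p.1 = 1 := by
    rw [timeCut, Real.smoothTransition.one_of_one_le (by linarith),
      Real.smoothTransition.one_of_one_le (by linarith), one_mul]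
  have e3 : profile (κ⁻¹ • p.2) = 1 := profile_scaled_eq_one hκ (by linarith [norm_nonneg p.2])
  have e4 : fderiv ℝ profile (κ⁻¹ • p.2) = 0 := by
    refine fderiv_profile_eq_zero fun h => ?_
    have := h.1
    rw [norm_smul, norm_inv, Real.norm_of_nonneg hκ.le, le_inv_mul_iff₀ hκ] at this
    linarith
  refine ⟨by rw [cutoffTest, e2, e3, one_mul], fun μ => ?_⟩
  rw [partialD_cutoffTest, e1, e4]
  simp

/-! ### Extending the Maxwell equations to more general test functions -/

namespace Fam
open FamBase

/-- `Y` vanishes at both ends and its time derivative decays, so the mean value inequality gives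
decay in space together with linear vanishing at each end. This is the form that the bound on the
derivative of the cutoff requires. -/
theorem exists_time_bound (F : Fam η ta tb Z B δ H s) {Y : (ℝ × ℝ) × Space → ℝ}
    (hY : ContDiffOn ℝ ∞ Y (slab η ta tb ×ˢ univ))
    (h1 : ∀ x, Y ((0, ta), x) = 0) (h2 : ∀ x, Y ((0, tb), x) = 0)
    (hd : DecaysLike (slab η ta tb) 2
      fun x => fderivWithin ℝ Y (slab η ta tb ×ˢ univ) x (jointDir 0)) :
    ∃ C, 0 ≤ C ∧ ∀ t ∈ Icc ta tb, ∀ x : Space,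
      |Y ((0, t), x)| ≤ C * ((1 + ‖x‖) ^ 2)⁻¹ * (t - ta) ∧
      |Y ((0, t), x)| ≤ C * ((1 + ‖x‖) ^ 2)⁻¹ * (tb - t) := by
  obtain ⟨C, hC0, hC⟩ := hd.exists_bound F.sep.compact
    ((hY.fderivWithin_apply_vec F.uniqueDiffOn_prod contDiffOn_const).continuousOn)
  have ht := F.time_lt.le
  have key : ∀ x : Space, ∀ t ∈ Icc ta tb, ∀ t' ∈ Icc ta tb,
      |Y ((0, t'), x) - Y ((0, t), x)| ≤ C * ((1 + ‖x‖) ^ 2)⁻¹ * |t' - t| := by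
    intro x t htI t' htI'
    refine Convex.norm_image_sub_le_of_norm_hasDerivWithin_le (f := fun t => Y ((0, t), x))
      (f' := fun t => fderivWithin ℝ Y (slab η ta tb ×ˢ univ) ((0, t), x) (jointDir 0))
      (s := Icc ta tb) (fun τ hτ => ?_) (fun τ hτ => hC _ (mem_slab F.zero_mem hτ) x)
      (convex_Icc _ _) htI htI'
    have hc : HasDerivWithinAt (fun τ : ℝ => (((0, τ), x) : (ℝ × ℝ) × Space)) (jointDir 0)
        (Icc ta tb) τ :=
      ((hasDerivAt_const τ (0 : ℝ)).prodMk (hasDerivAt_id τ)).prodMk (hasDerivAt_const τ x) |>.hasDerivWithinAt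
    exact hY.hasDerivWithinAt_comp_curve hc (fun τ hτ => ⟨mem_slab F.zero_mem hτ, mem_univ _⟩)
      ⟨mem_slab F.zero_mem hτ, mem_univ _⟩
  refine ⟨C, hC0, fun t htI x => ⟨?_, ?_⟩⟩
  · have := key x ta (left_mem_Icc.2 ht) t htI
    rwa [h1, sub_zero, abs_of_nonneg (sub_nonneg.2 htI.1)] at this
  · have := key x tb (right_mem_Icc.2 ht) t htI
    rwa [h2, sub_zero, abs_sub_comm, abs_of_nonneg (sub_nonneg.2 htI.2)] at this

theorem velocity_eq (F : Fam η ta tb Z B δ H s) {t : ℝ} (ht : t ∈ Ioo ta tb) (n : Fin N) (ν : Fin 4) :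
    velocity (Z 0 n) t ν = (Fin.cons 1 fun i => famVel η ta tb Z n (0, t) i : Fin 4 → ℝ) ν := by
  rw [velocity, F.deriv_traj F.zero_mem ht]

theorem contDiffOn_vel (F : Fam η ta tb Z B δ H s) (n : Fin N) (ν : Fin 4) :
    ContDiffOn ℝ ∞ (fun p => (Fin.cons 1 fun i => famVel η ta tb Z n p i : Fin 4 → ℝ) ν)
      (slab η ta tb) := by
  refine Fin.cases ?_ (fun i => ?_) ν
  · exact contDiffOn_const
  · exact (contDiff_piLp_apply (𝕜 := ℝ) (p := 2) (i := i)).comp_contDiffOn (F.contDiffOn_famVel n)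

theorem intervalIntegrable_velocity_mul (F : Fam η ta tb Z B δ H s) (n : Fin N) (ν : Fin 4)
    {g : ℝ → ℝ} (hg : ContinuousOn g (Icc ta tb)) :
    IntervalIntegrable (fun t => velocity (Z 0 n) t ν * g t) volume ta tb := by
  have ht := F.time_lt.le
  have h1 := (F.timeSlice (F.contDiffOn_vel n ν).continuousOn).mul hg
  have h2 : IntervalIntegrable _ volume ta tb :=
    ContinuousOn.intervalIntegrable (u := _) (by rwa [uIcc_of_le ht])
  rw [intervalIntegrable_iff_integrableOn_Ioo_of_le ht] at h2 ⊢
  exact h2.congr_fun (fun t ht => by rw [F.velocity_eq ht]; rfl) measurableSet_Ioo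

theorem tendsto_velocity_integral (F : Fam η ta tb Z B δ H s) (n : Fin N) (ν : Fin 4)
    {g : ℝ → ℝ} (hg : ContinuousOn g (Icc ta tb)) :
    Tendsto (fun κ => ∫ t in ta..tb, velocity (Z 0 n) t ν * (cutoffTest κ ta tb (t, Z 0 n t) * g t))
      atTop (𝓝 (∫ t in ta..tb, velocity (Z 0 n) t ν * g t)) := by
  have ht := F.time_lt.le
  have h1 := F.intervalIntegrable_velocity_mul n ν hg
  rw [intervalIntegrable_iff_integrableOn_Ioo_of_le ht] at h1
  simp only [intervalIntegral.integral_of_le ht, ← restrict_Ioo_eq_restrict_Ioc]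
  refine tendsto_integral_filter_of_dominated_convergence
    (fun t => 2 * ‖velocity (Z 0 n) t ν * g t‖) ?_ ?_ (h1.norm.const_mul _) ?_
  · filter_upwards [eventually_gt_atTop 0] with κ hκ
    have h2 := F.intervalIntegrable_velocity_mul n ν (g := fun t => cutoffTest κ ta tb (t, Z 0 n t) * g t)
      ((((isTest_cutoffTest hκ).smooth.continuous.comp_continuousOn
        (continuousOn_id.prodMk (F.continuousOn_traj n)))).mul hg)
    rw [intervalIntegrable_iff_integrableOn_Ioo_of_le ht] at h2
    exact h2.1
  · refine Eventually.of_forall fun κ => Eventually.of_forall fun t => ?_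
    rw [mul_left_comm, norm_mul]
    gcongr
    exact abs_cutoffTest_le _ _ _ _
  · filter_upwards [ae_restrict_mem measurableSet_Ioo] with t ht
    refine tendsto_const_nhds.congr' ?_
    filter_upwards [eventually_cutoffTest (p := (t, Z 0 n t)) ht] with κ hκ
    rw [hκ.1, one_mul]

/-- `Y` has compact support neither in space nor in the open time interval. It is multiplied by
`cutoffTest`, and `κ → ∞` is taken by dominated convergence. The dominating function is integrable
because field and test derivative decay quadratically each, and because the linear vanishing of `Y`
at the ends compensates the growing derivative of the cutoff. -/
theorem weakMaxwell_extended (F : Fam η ta tb Z B δ H s) {q : Fin N → ℝ}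
    (hw : WeakMaxwell q ta tb (Z 0) (B 0)) (ν : Fin 4) {Y : (ℝ × ℝ) × Space → ℝ}
    (hY : ContDiffOn ℝ ∞ Y (slab η ta tb ×ˢ univ))
    (h1 : ∀ x, Y ((0, ta), x) = 0) (h2 : ∀ x, Y ((0, tb), x) = 0)
    (hd : ∀ μ, DecaysLike (slab η ta tb) 2
      fun x => fderivWithin ℝ Y (slab η ta tb ×ˢ univ) x (jointDir μ)) :
    ∑ μ, ∫ t in ta..tb, ∫ x, fieldPairing η ta tb Z B μ ν Y ((0, t), x) =
      ∑ n, q n * ∫ t in ta..tb, velocity (Z 0 n) t ν * Y ((0, t), Z 0 n t) := by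
  have ht := F.time_lt.le
  have heta := F.eta_pos
  have hYc : ∀ n, ContinuousOn (fun t => Y ((0, t), Z 0 n t)) (Icc ta tb) := fun n =>
    hY.continuousOn.comp ((continuousOn_const.prodMk continuousOn_id).prodMk (F.continuousOn_traj n))
      fun t ht => ⟨mem_slab F.zero_mem ht, mem_univ _⟩
  have hY0 : ContDiffOn ℝ ∞ (atZero Y) (Ioo ta tb ×ˢ univ) :=
    hY.comp (ContDiff.contDiffOn (by fun_prop)) fun p hp =>
      ⟨mem_slab F.zero_mem (Ioo_subset_Icc_self hp.1), mem_univ _⟩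
  have hR : Tendsto (fun κ => ∑ n, q n * ∫ t in ta..tb, velocity (Z 0 n) t ν *
      (cutoffTest κ ta tb (t, Z 0 n t) * Y ((0, t), Z 0 n t))) atTop
      (𝓝 (∑ n, q n * ∫ t in ta..tb, velocity (Z 0 n) t ν * Y ((0, t), Z 0 n t))) :=
    tendsto_finsetSum _ fun n _ => (F.tendsto_velocity_integral n ν (hYc n)).const_mul _
  obtain ⟨C, hC0, hC⟩ := F.exists_time_bound hY h1 h2 (hd 0)
  obtain ⟨L, hL0, hL⟩ := exists_cutoffTest_bound ta tb
  have hoff := ae_slabOff ht F.continuousOn_traj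
  have hL : ∀ μ, Tendsto (fun κ => ∫ p, atZero (jointField η ta tb Z B μ ν) p *
      partialD μ (fun p => cutoffTest κ ta tb p * atZero Y p) p ∂slabMeasure ta tb) atTop
      (𝓝 (∫ p, fieldPairing η ta tb Z B μ ν Y ((0, p.1), p.2) ∂slabMeasure ta tb)) := by
    intro μ
    have hYμ := hY.fderivWithin_apply_vec F.uniqueDiffOn_prod
      (contDiffOn_const (c := jointDir μ))
    obtain ⟨K, hK0, hK⟩ := (hd μ).exists_bound F.sep.compact hYμ.continuousOn
    obtain ⟨M, hM0, hM⟩ := F.exists_mul_bound (F.singular_field μ ν).smooth_off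
      (F.nearBound_field μ ν) (F.decay μ ν) (C := 1) (h := fun x => ((1 + ‖x.2‖) ^ 2)⁻¹)
      (fun p _ x => by rw [one_mul, abs_of_nonneg (by positivity)])
    have hprod : ∀ κ, 0 < κ → ∀ p : Spacetime, p.1 ∈ Ioo ta tb →
        partialD μ (fun p => cutoffTest κ ta tb p * atZero Y p) p = cutoffTest κ ta tb p *
          fderivWithin ℝ Y (slab η ta tb ×ˢ univ) ((0, p.1), p.2) (jointDir μ) +
          partialD μ (cutoffTest κ ta tb) p * atZero Y p := by
      intro κ hκ p hp
      have d1 := ((isTest_cutoffTest (ta := ta) (tb := tb) hκ).smooth.differentiable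
        (by simp) p).hasFDerivAt
      have d2 := hasFDerivAt_atZero heta hY hp
      rw [← partialD_atZero heta hY hp, partialD, partialD, partialD, (d1.fun_mul d2).fderiv, d2.fderiv]
      simp [mul_comm]
    refine tendsto_integral_filter_of_dominated_convergence
      (fun p => (2 * K + L * C) * (M * dominating 4 (δ / 2) (Z 0) p)) ?_ ?_
      (((integrable_dominating ht F.continuousOn_traj (by norm_num) _).const_mul _).const_mul _) ?_
    · filter_upwards [eventually_gt_atTop 0] with κ hκ
      exact (aestronglyMeasurable_slab ht F.continuousOn_traj
        (F.continuousOn_atZero (F.singular_field μ ν).smooth_off.continuousOn)).mul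
        ((((isTest_cutoffTest hκ).mul_contDiffOn hY0).isTest_partialD μ).smooth.continuous.aestronglyMeasurable)
    · filter_upwards [eventually_ge_atTop 1] with κ hκ
      filter_upwards [hoff] with p hp
      have hpI := Ioo_subset_Icc_self hp.1
      have hw0 : 0 ≤ ((1 + ‖p.2‖) ^ 2)⁻¹ := by positivity
      have b1 : |cutoffTest κ ta tb p * fderivWithin ℝ Y (slab η ta tb ×ˢ univ) ((0, p.1), p.2)
          (jointDir μ)| ≤ 2 * (K * ((1 + ‖p.2‖) ^ 2)⁻¹) := by
        rw [abs_mul]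
        exact mul_le_mul (abs_cutoffTest_le _ _ _ _) (hK _ (mem_slab F.zero_mem hpI) _)
          (abs_nonneg _) zero_le_two
      have b2 := hL κ hκ p hp.1 μ (atZero Y p) (C * ((1 + ‖p.2‖) ^ 2)⁻¹) (by positivity)
        (hC _ hpI _).1 (hC _ hpI _).2
      have b3 := hM p hp
      rw [hprod κ (by linarith) p hp.1, Real.norm_eq_abs, abs_mul]
      rw [abs_mul] at b3
      have b4 : |atZero (fun x : (ℝ × ℝ) × Space => ((1 + ‖x.2‖) ^ 2)⁻¹) p| = ((1 + ‖p.2‖) ^ 2)⁻¹ :=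
        abs_of_nonneg hw0
      rw [b4] at b3
      calc _ ≤ |atZero (jointField η ta tb Z B μ ν) p| *
            (2 * (K * ((1 + ‖p.2‖) ^ 2)⁻¹) + L * (C * ((1 + ‖p.2‖) ^ 2)⁻¹)) := by
            gcongr
            exact (abs_add_le _ _).trans (add_le_add b1 b2)
        _ = (2 * K + L * C) * (|atZero (jointField η ta tb Z B μ ν) p| * ((1 + ‖p.2‖) ^ 2)⁻¹) := by ring
        _ ≤ _ := by gcongr
    · filter_upwards [hoff] with p hp
      refine tendsto_const_nhds.congr' ?_
      filter_upwards [eventually_cutoffTest hp.1, eventually_gt_atTop 0] with κ hκ hκ0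
      rw [hprod κ hκ0 p hp.1, hκ.1, hκ.2, one_mul, zero_mul, add_zero]
      rfl
  have hS := tendsto_finsetSum Finset.univ fun μ (_ : μ ∈ Finset.univ) => hL μ
  have e : ∀ μ, ∫ p, fieldPairing η ta tb Z B μ ν Y ((0, p.1), p.2) ∂slabMeasure ta tb =
      ∫ t in ta..tb, ∫ x, fieldPairing η ta tb Z B μ ν Y ((0, t), x) := fun μ =>
    integral_slab_prod ht (F.integrable_fieldPairing μ ν hY (hd μ))
  simp only [e] at hS
  refine tendsto_nhds_unique hS (hR.congr' ?_)
  filter_upwards [eventually_gt_atTop 0] with κ hκ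
  have hT := (isTest_cutoffTest (ta := ta) (tb := tb) hκ).mul_contDiffOn hY0
  have h := hw _ hT ν
  simp only [F.integral_field_test (hT.isTest_partialD _)] at h
  exact h.symm

end Fam

/-! ### The electromagnetic part of the first variation -/

/-- The family does not vary at the ends of the time interval. -/
def FixedEnds (η ta tb : ℝ) (Z : ℝ → Fin N → ℝ → Space) (B : ℝ → Spacetime → Fin 4 → ℝ) : Prop :=
  ∀ ε ∈ Icc (-η) η, ∀ t, t = ta ∨ t = tb → (∀ n, Z ε n t = Z 0 n t) ∧
    ∀ x, (∀ n, x ≠ Z 0 n t) → B ε (t, x) = B 0 (t, x)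

/-- The variation `∂_ε z_n` of the trajectories. -/
noncomputable def trajVar (η ta tb : ℝ) (Z : ℝ → Fin N → ℝ → Space) (n : Fin N) (p : ℝ × ℝ) : Space :=
  fderivWithin ℝ (famZ Z n) (slab η ta tb) p (1, 0)

theorem sphereAverage_eq_zero {f : Space → ℝ} {c : Space} {r : ℝ}
    (h : ∀ θ : Metric.sphere (0 : Space) 1, f (c + r • (θ : Space)) = 0) :
    sphereAverage f c r = 0 := by
  simp [sphereAverage, h]

namespace FamBase

theorem ends_mem (F : FamBase η ta tb Z B δ H s) {t : ℝ} (ht : t = ta ∨ t = tb) : t ∈ Icc ta tb := by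
  rcases ht with rfl | rfl
  · exact left_mem_Icc.2 F.time_lt.le
  · exact right_mem_Icc.2 F.time_lt.le

theorem zero_mem_Ioo (F : FamBase η ta tb Z B δ H s) : (0 : ℝ) ∈ Ioo (-η) η :=
  ⟨neg_lt_zero.2 F.eta_pos, F.eta_pos⟩

theorem zero_slab (F : FamBase η ta tb Z B δ H s) {t : ℝ} (ht : t ∈ Icc ta tb) :
    ((0 : ℝ), t) ∈ slab η ta tb :=
  mem_slab (Ioo_subset_Icc_self F.zero_mem_Ioo) ht

theorem hasDerivAt_eps_traj (F : FamBase η ta tb Z B δ H s) {t : ℝ} (ht : t ∈ Icc ta tb) (n : Fin N) :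
    HasDerivAt (fun ε => Z ε n t) (trajVar η ta tb Z n (0, t)) 0 := by
  have h := (((F.sep.smooth n).differentiableOn (by simp)) _ (F.zero_slab ht)).hasFDerivWithinAt
  have hc : HasDerivWithinAt (fun ε : ℝ => (ε, t)) ((1 : ℝ), (0 : ℝ)) (Icc (-η) η) 0 :=
    (hasDerivWithinAt_id _ _).prodMk (hasDerivWithinAt_const _ _ _)
  exact (h.comp_hasDerivWithinAt (0 : ℝ) hc fun ε hε => mem_slab hε ht).hasDerivAt
    (Icc_mem_nhds F.zero_mem_Ioo.1 F.zero_mem_Ioo.2)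

theorem trajVar_end (F : FamBase η ta tb Z B δ H s) (hE : FixedEnds η ta tb Z B) {t : ℝ}
    (ht : t = ta ∨ t = tb) (n : Fin N) : trajVar η ta tb Z n (0, t) = 0 := by
  refine (F.hasDerivAt_eps_traj (F.ends_mem ht) n).unique ?_
  refine (hasDerivAt_const (0 : ℝ) (Z 0 n t)).congr_of_eventuallyEq ?_
  filter_upwards [Icc_mem_nhds F.zero_mem_Ioo.1 F.zero_mem_Ioo.2] with ε hε
  exact (hE ε hε t ht).1 n

theorem varB_end (F : FamBase η ta tb Z B δ H s) (hE : FixedEnds η ta tb Z B) {t : ℝ}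
    (ht : t = ta ∨ t = tb) {x : Space} (hx : ∀ n, x ≠ Z 0 n t) (ν : Fin 4) :
    varB η ta tb Z B ν ((0, t), x) = 0 := by
  refine (F.hasDerivAt_eps_off (F.potential ν).smooth_off F.zero_mem_Ioo (F.ends_mem ht) hx).unique ?_
  refine (hasDerivAt_const (0 : ℝ) (B 0 (t, x) ν)).congr_of_eventuallyEq ?_
  filter_upwards [Icc_mem_nhds F.zero_mem_Ioo.1 F.zero_mem_Ioo.2] with ε hε
  exact congrFun ((hE ε hε t ht).2 x hx) ν

/-- The expansion is merely chosen, so its regular part is not directly tied to the end conditions.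
But `varAt` is the renormalized limit of the sphere means of the variation, which vanish at the
ends, and such limits are unique. -/
theorem varAt_end (F : FamBase η ta tb Z B δ H s) (hE : FixedEnds η ta tb Z B) {t : ℝ}
    (ht : t = ta ∨ t = tb) (ν : Fin 4) (n : Fin N) : varAt η ta tb Z δ s ν n (0, t) = 0 := by
  have hp := F.zero_slab (F.ends_mem ht)
  refine HasRLim.unique (((F.singular_varB ν).expansion n).hasRLim_sphereAverage F.sep.compact
    F.sep.unique F.sep.pos (Or.inr rfl) hp) ((hasRLim_const 0).congr' ?_)
  filter_upwards [Ioo_mem_nhdsGT F.sep.pos] with r hr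
  refine (sphereAverage_eq_zero fun θ => ?_).symm
  have hθ : ‖(θ : Space)‖ = 1 := by simp
  refine F.varB_end hE ht (F.sep.add_mem_offLines hp n (y := r • (θ : Space)) ?_ ?_).2 ν
  · rw [← norm_pos_iff, norm_smul, hθ, Real.norm_of_nonneg hr.1.le]
    linarith [hr.1]
  · rw [norm_smul, hθ, Real.norm_of_nonneg hr.1.le]
    linarith [hr.2]

theorem filledVar_end (F : FamBase η ta tb Z B δ H s) (hE : FixedEnds η ta tb Z B) {t : ℝ}
    (ht : t = ta ∨ t = tb) {r : ℝ} (hr : 0 < r) (hr' : r ≤ δ) (ν : Fin 4) (x : Space) :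
    filledVar η ta tb Z B δ s r ν ((0, t), x) = 0 := by
  have hp := F.zero_slab (F.ends_mem ht)
  have h1 : cut (famZ Z) r ((0, t), x) * varB η ta tb Z B ν ((0, t), x) = 0 := by
    by_cases hx : ∀ n, x ≠ Z 0 n t
    · rw [F.varB_end hE ht hx, mul_zero]
    · push Not at hx
      obtain ⟨n, hn⟩ := hx
      rw [(F.sep.cut_eventually_zero hr hr' (x := ((0, t), x)) hp (n := n) hn).self_of_nhdsWithin
        ⟨hp, mem_univ _⟩, zero_mul]
  simp [filledVar, h1, F.varAt_end hE ht]

theorem filledVar_particle (F : FamBase η ta tb Z B δ H s) {t : ℝ} (ht : t ∈ Icc ta tb) {r : ℝ}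
    (hr : 0 < r) (hr' : r ≤ δ) (ν : Fin 4) (n : Fin N) :
    filledVar η ta tb Z B δ s r ν ((0, t), Z 0 n t) = varAt η ta tb Z δ s ν n (0, t) := by
  have hp := F.zero_slab ht
  have h0 : ‖((0, t), Z 0 n t).2 - famZ Z n (((0 : ℝ), t), Z 0 n t).1‖ = 0 := by simp [famZ]
  have h1 := (F.sep.cut_eventually_zero hr hr' (x := ((0, t), Z 0 n t)) hp
    (n := n) rfl).self_of_nhdsWithin ⟨hp, mem_univ _⟩
  rw [filledVar, h1, zero_mul, zero_add, Finset.sum_eq_single n]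
  · rw [profile_scaled_eq_one hr (by rw [h0]; positivity), one_mul]
  · intro m _ hm
    rw [profile_scaled_eq_zero hr (F.sep.le_norm_sub hr' (x := ((0, t), Z 0 n t)) hp
      (by rw [h0]; exact hr) hm), zero_mul]
  · simp

end FamBase

namespace Fam

open FamBase

/-- The filled variation vanishes at the ends and equals `varAt` at the particles. The Maxwell
equations therefore make its pairing with the field independent of `r`, and the renormalized limit
is that of a constant. -/
theorem emVariation_eq (F : Fam η ta tb Z B δ H s) {q : Fin N → ℝ}
    (hw : WeakMaxwell q ta tb (Z 0) (B 0)) (hE : FixedEnds η ta tb Z B) {D : Fin 4 → Fin 4 → ℝ}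
    (hD : ∀ μ ν, HasRLim (fun r => ∫ t in ta..tb, ∫ x,
      cutSqD η ta tb (famZ Z) (jointField η ta tb Z B μ ν) r ((0, t), x)) (D μ ν)) :
    emVariation D = -∑ ν, metric ν * ∑ n, q n *
      ∫ t in ta..tb, velocity (Z 0 n) t ν * varAt η ta tb Z δ s ν n (0, t) := by
  refine HasRLim.unique (F.hasRLim_emVariation hD) ((hasRLim_const _).congr' ?_)
  filter_upwards [Ioo_mem_nhdsGT F.sep.pos] with r hr
  rw [Finset.sum_comm]
  simp only [← Finset.mul_sum]
  congr 1
  refine Finset.sum_congr rfl fun ν _ => ?_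
  rw [F.weakMaxwell_extended hw ν (F.contDiffOn_filledVar hr.1 hr.2.le ν)
    (F.filledVar_end hE (Or.inl rfl) hr.1 hr.2.le ν)
    (F.filledVar_end hE (Or.inr rfl) hr.1 hr.2.le ν)
    fun μ => F.decays_filledVar hr.1 hr.2.le μ ν]
  congr 1
  refine Finset.sum_congr rfl fun n _ => ?_
  congr 1
  refine intervalIntegral.integral_congr fun t ht => ?_
  rw [uIcc_of_le F.time_lt.le] at ht
  simp only [F.filledVar_particle ht hr.1 hr.2.le ν n]

end Fam

/-! ### The particle part of the first variation -/

theorem hasDerivAt_eps_slab {g : ℝ × ℝ → ℝ} (hg : ContDiffOn ℝ ∞ g (slab η ta tb)) {ε t : ℝ}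
    (hε : ε ∈ Ioo (-η) η) (ht : t ∈ Icc ta tb) :
    HasDerivAt (fun e => g (e, t)) (fderivWithin ℝ g (slab η ta tb) (ε, t) (1, 0)) ε :=
  (hg.hasDerivWithinAt_comp_curve (c := fun e : ℝ => (e, t)) (v := (1, 0)) (T := Icc (-η) η)
    ((hasDerivWithinAt_id _ _).prodMk (hasDerivWithinAt_const _ _ _)) (fun _ he => ⟨he, ht⟩)
    ⟨Ioo_subset_Icc_self hε, ht⟩).hasDerivAt (Icc_mem_nhds hε.1 hε.2)

theorem hasDerivAt_time_slab {g : ℝ × ℝ → ℝ} (hg : ContDiffOn ℝ ∞ g (slab η ta tb)) {ε t : ℝ}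
    (hε : ε ∈ Icc (-η) η) (ht : t ∈ Ioo ta tb) :
    HasDerivAt (fun τ => g (ε, τ)) (fderivWithin ℝ g (slab η ta tb) (ε, t) (0, 1)) t :=
  (hg.hasDerivWithinAt_comp_curve (c := fun τ : ℝ => (ε, τ)) (v := (0, 1)) (T := Icc ta tb)
    ((hasDerivWithinAt_const _ _ _).prodMk (hasDerivWithinAt_id _ _)) (fun _ hτ => ⟨hε, hτ⟩)
    ⟨hε, Ioo_subset_Icc_self ht⟩).hasDerivAt (Icc_mem_nhds ht.1 ht.2)

theorem continuousOn_fderivWithin_slab (hη : 0 < η) (ht : ta < tb) {g : ℝ × ℝ → ℝ}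
    (hg : ContDiffOn ℝ ∞ g (slab η ta tb)) (v : ℝ × ℝ) :
    ContinuousOn (fun p => fderivWithin ℝ g (slab η ta tb) p v) (slab η ta tb) :=
  (hg.fderivWithin_apply_vec (uniqueDiffOn_slab hη ht) contDiffOn_const).continuousOn

theorem intervalIntegrable_slab_slice (ht : ta < tb) {g : ℝ × ℝ → ℝ}
    (hg : ContinuousOn g (slab η ta tb)) {ε : ℝ} (hε : ε ∈ Icc (-η) η) :
    IntervalIntegrable (fun t => g (ε, t)) volume ta tb := by
  refine ContinuousOn.intervalIntegrable ?_
  rw [uIcc_of_le ht.le]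
  exact hg.comp (by fun_prop) fun t ht => ⟨hε, ht⟩

theorem hasDerivAt_integral_slab (hη : 0 < η) (ht : ta < tb) {g : ℝ × ℝ → ℝ}
    (hg : ContDiffOn ℝ ∞ g (slab η ta tb)) :
    HasDerivAt (fun ε => ∫ t in ta..tb, g (ε, t))
      (∫ t in ta..tb, fderivWithin ℝ g (slab η ta tb) (0, t) (1, 0)) 0 := by
  have h0 : (0 : ℝ) ∈ Ioo (-η) η := ⟨neg_lt_zero.2 hη, hη⟩
  have hc := continuousOn_fderivWithin_slab hη ht hg (1, 0)
  obtain ⟨K, hK⟩ := isCompact_slab.exists_bound_of_continuousOn hc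
  refine (intervalIntegral.hasDerivAt_integral_of_dominated_loc_of_deriv_le (s := Ioo (-η) η)
    (a := ta) (b := tb) (μ := volume) (F := fun e t => g (e, t))
    (F' := fun e t => fderivWithin ℝ g (slab η ta tb) (e, t) (1, 0)) (bound := fun _ => K)
    (isOpen_Ioo.mem_nhds h0) ?_ ?_ ?_ ?_ ?_ ?_).2
  · filter_upwards [isOpen_Ioo.mem_nhds h0] with e he
    exact (intervalIntegrable_slab_slice ht hg.continuousOn
      (Ioo_subset_Icc_self he)).aestronglyMeasurable_restrict_uIoc
  · exact intervalIntegrable_slab_slice ht hg.continuousOn (Ioo_subset_Icc_self h0)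
  · exact (intervalIntegrable_slab_slice ht hc
      (Ioo_subset_Icc_self h0)).aestronglyMeasurable_restrict_uIoc
  · refine Eventually.of_forall fun t htI e he => ?_
    rw [uIoc_of_le ht.le] at htI
    exact hK (e, t) ⟨Ioo_subset_Icc_self he, Ioc_subset_Icc_self htI⟩
  · simp
  · refine Eventually.of_forall fun t htI e he => ?_
    rw [uIoc_of_le ht.le] at htI
    exact hasDerivAt_eps_slab hg he (Ioc_subset_Icc_self htI)

theorem integral_time_deriv_slab (hη : 0 < η) (ht : ta < tb) {g : ℝ × ℝ → ℝ}
    (hg : ContDiffOn ℝ ∞ g (slab η ta tb)) :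
    ∫ t in ta..tb, fderivWithin ℝ g (slab η ta tb) (0, t) (0, 1) = g (0, tb) - g (0, ta) := by
  have h0 : (0 : ℝ) ∈ Icc (-η) η := ⟨by linarith, hη.le⟩
  exact intervalIntegral.integral_eq_sub_of_hasDerivAt_of_le ht.le
    (hg.continuousOn.comp (by fun_prop) fun t ht => ⟨h0, ht⟩)
    (fun t ht' => hasDerivAt_time_slab hg h0 ht')
    (intervalIntegrable_slab_slice ht (continuousOn_fderivWithin_slab hη ht hg (0, 1)) h0)

/-- The spatial part of the four-velocities of a family. -/
noncomputable def famMomentum (η ta tb : ℝ) (Z : ℝ → Fin N → ℝ → Space) (n : Fin N) (j : Fin 3)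
    (p : ℝ × ℝ) : ℝ :=
  1 / √(1 - ‖famVel η ta tb Z n p‖ ^ 2) * famVel η ta tb Z n p j

/-- The amount by which the spatial part of the Lorentz-Dirac equation fails. -/
noncomputable def forceDefect (η ta tb : ℝ) (Z : ℝ → Fin N → ℝ → Space) (δ : ℝ)
    (s : Fin 4 → Fin N → (ℝ × ℝ) × Space → ℝ) (m q : Fin N → ℝ) (n : Fin N) (j : Fin 3)
    (p : ℝ × ℝ) : ℝ :=
  -(m n * fderivWithin ℝ (famMomentum η ta tb Z n j) (slab η ta tb) p (0, 1)) +
    q n * ∑ ν, metric ν * (Fin.cons 1 fun i => famVel η ta tb Z n p i : Fin 4 → ℝ) ν *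
      fieldReg η ta tb Z δ s j.succ ν n (p, 0)

theorem one_sub_norm_sq_pos {v : Space} (hv : ‖v‖ < 1) : 0 < 1 - ‖v‖ ^ 2 := by
  nlinarith [norm_nonneg v]

namespace FamBase

theorem contDiffOn_trajVar (F : FamBase η ta tb Z B δ H s) (n : Fin N) (j : Fin 3) :
    ContDiffOn ℝ ∞ (fun p => trajVar η ta tb Z n p j) (slab η ta tb) := by
  have h : ContDiffOn ℝ ∞ (trajVar η ta tb Z n) (slab η ta tb) :=
    ((F.sep.smooth n).fderivWithin F.sep.unique (by simp)).clm_apply contDiffOn_const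
  exact (contDiff_piLp_apply (p := 2)).comp_contDiffOn h

theorem contDiffOn_famVel_apply (F : FamBase η ta tb Z B δ H s) (n : Fin N) (j : Fin 3) :
    ContDiffOn ℝ ∞ (fun p => famVel η ta tb Z n p j) (slab η ta tb) :=
  (contDiff_piLp_apply (p := 2)).comp_contDiffOn (F.contDiffOn_famVel n)

theorem contDiffOn_one_sub (F : FamBase η ta tb Z B δ H s) (n : Fin N) :
    ContDiffOn ℝ ∞ (fun p => 1 - ‖famVel η ta tb Z n p‖ ^ 2) (slab η ta tb) :=
  contDiffOn_const.sub ((F.contDiffOn_famVel n).norm_sq ℝ)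

theorem contDiffOn_sqrt (F : FamBase η ta tb Z B δ H s) {n : Fin N}
    (hv : ∀ p ∈ slab η ta tb, ‖famVel η ta tb Z n p‖ < 1) :
    ContDiffOn ℝ ∞ (fun p => √(1 - ‖famVel η ta tb Z n p‖ ^ 2)) (slab η ta tb) :=
  (F.contDiffOn_one_sub n).sqrt fun p hp => (one_sub_norm_sq_pos (hv p hp)).ne'

theorem contDiffOn_famMomentum (F : FamBase η ta tb Z B δ H s) {n : Fin N}
    (hv : ∀ p ∈ slab η ta tb, ‖famVel η ta tb Z n p‖ < 1) (j : Fin 3) :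
    ContDiffOn ℝ ∞ (famMomentum η ta tb Z n j) (slab η ta tb) :=
  (contDiffOn_const.div (F.contDiffOn_sqrt hv) fun p hp =>
    (Real.sqrt_pos.2 (one_sub_norm_sq_pos (hv p hp))).ne').mul (F.contDiffOn_famVel_apply n j)

theorem contDiffOn_particleLagrangian (F : FamBase η ta tb Z B δ H s) (m q : Fin N → ℝ) {n : Fin N}
    (hv : ∀ p ∈ slab η ta tb, ‖famVel η ta tb Z n p‖ < 1) :
    ContDiffOn ℝ ∞ (Fam.particleLagrangian η ta tb Z s m q n) (slab η ta tb) :=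
  (contDiffOn_const.mul (F.contDiffOn_sqrt hv)).neg.add (contDiffOn_const.mul
    ((ContDiffOn.sum fun i _ => (F.contDiffOn_famVel_apply n i).mul
      (F.contDiffOn_potential_zero i.succ n)).sub (F.contDiffOn_potential_zero 0 n)))

theorem slab_mem_nhds_zero (F : FamBase η ta tb Z B δ H s) {t : ℝ} (ht : t ∈ Ioo ta tb) :
    slab η ta tb ∈ 𝓝 ((0 : ℝ), t) :=
  prod_mem_nhds (Icc_mem_nhds F.zero_mem_Ioo.1 F.zero_mem_Ioo.2) (Icc_mem_nhds ht.1 ht.2)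

theorem eps_famVel (F : FamBase η ta tb Z B δ H s) {t : ℝ} (ht : t ∈ Ioo ta tb) (n : Fin N)
    (j : Fin 3) :
    fderivWithin ℝ (fun p => famVel η ta tb Z n p j) (slab η ta tb) (0, t) (1, 0) =
      fderivWithin ℝ (fun p => trajVar η ta tb Z n p j) (slab η ta tb) (0, t) (0, 1) := by
  have hx := F.slab_mem_nhds_zero ht
  have hp := F.zero_slab (Ioo_subset_Icc_self ht)
  have hs : ContDiffOn ℝ ∞ (fun p => famZ Z n p j) (slab η ta tb) :=
    (contDiff_piLp_apply (p := 2)).comp_contDiffOn (F.sep.smooth n)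
  have hd := hs.differentiableOn (by simp)
  have key : ∀ v p, p ∈ slab η ta tb → fderivWithin ℝ (famZ Z n) (slab η ta tb) p v j =
      fderivWithin ℝ (fun p => famZ Z n p j) (slab η ta tb) p v := by
    intro v p hp
    have h := (((F.sep.smooth n).differentiableOn (by simp)) p hp).hasFDerivWithinAt
    have := ((EuclideanSpace.proj (𝕜 := ℝ) j).hasFDerivAt.comp_hasFDerivWithinAt p h).fderivWithin
      (F.sep.unique p hp)
    exact (congrArg (fun L : ℝ × ℝ →L[ℝ] ℝ => L v) this).symm
  have e1 : ∀ v w, fderivWithin ℝ (fun p => fderivWithin ℝ (famZ Z n) (slab η ta tb) p v j)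
      (slab η ta tb) (0, t) w = fderivWithin ℝ (fderivWithin ℝ (fun p => famZ Z n p j)
        (slab η ta tb)) (slab η ta tb) (0, t) w v := by
    intro v w
    rw [fderivWithin_congr (f₁ := fun p => fderivWithin ℝ (famZ Z n) (slab η ta tb) p v j)
      (key v) (key v _ hp), fderivWithin_clm_apply (F.sep.unique _ hp)
        ((hs.fderivWithin F.sep.unique (m := ∞) (by simp)).differentiableOn (by simp) _ hp)
        (differentiableWithinAt_const _)]
    simp
  have hsym : IsSymmSndFDerivWithinAt ℝ (fun p => famZ Z n p j) (slab η ta tb) (0, t) :=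
    (hs _ hp).isSymmSndFDerivWithinAt
      (by rw [minSmoothness_of_isRCLikeNormedField]; exact WithTop.coe_le_coe.2 le_top)
      F.sep.unique (subset_closure (mem_interior_iff_mem_nhds.2 hx)) hp
  unfold famVel trajVar
  rw [e1, e1, hsym.eq]

/-- The spatial derivatives at the particle of the regular part of the potential. -/
theorem regular_fderiv (F : FamBase η ta tb Z B δ H s) {t : ℝ} (ht : t ∈ Icc ta tb) (n : Fin N)
    (ν : Fin 4) (a : ℝ × ℝ) (w : Space) :
    fderivWithin ℝ (s ν n) (slab η ta tb ×ˢ Metric.ball 0 δ) ((0, t), 0) (a, w) =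
      fderivWithin ℝ (fun p => s ν n (p, 0)) (slab η ta tb) (0, t) a +
      ∑ j : Fin 3, w j *
        regD (slab η ta tb) (famZ Z n) δ (jointDir j.succ) (s ν n) ((0, t), 0) := by
  have hp := F.zero_slab ht
  have hd := ((F.potential ν).expansion n).smooth_reg.differentiableOn (by simp) ((0, t), 0)
    ⟨hp, Metric.mem_ball_self F.sep.pos⟩
  have h1 : fderivWithin ℝ (fun p => s ν n (p, 0)) (slab η ta tb) (0, t) a =
      fderivWithin ℝ (s ν n) (slab η ta tb ×ˢ Metric.ball 0 δ) ((0, t), 0) (a, 0) := by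
    have hc : HasFDerivWithinAt (fun p : ℝ × ℝ => (p, (0 : Space)))
        (ContinuousLinearMap.inl ℝ (ℝ × ℝ) Space) (slab η ta tb) (0, t) :=
      (hasFDerivAt_prodMk_left _ _).hasFDerivWithinAt
    have hm : MapsTo (fun p : ℝ × ℝ => (p, (0 : Space))) (slab η ta tb)
        (slab η ta tb ×ˢ Metric.ball 0 δ) := fun p hp => ⟨hp, Metric.mem_ball_self F.sep.pos⟩
    have := (HasFDerivWithinAt.comp (0, t) hd.hasFDerivWithinAt hc hm).fderivWithin
      (F.sep.unique _ hp)
    exact (congrArg (fun L : ℝ × ℝ →L[ℝ] ℝ => L a) this)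
  have hw : w = ∑ j : Fin 3, w j • EuclideanSpace.single j (1 : ℝ) := by
    ext i
    fin_cases i <;> simp [Fin.sum_univ_three]
  have h2 : ((a, w) : (ℝ × ℝ) × Space) = (a, 0) + ∑ j : Fin 3, w j • ((0 : ℝ × ℝ),
      EuclideanSpace.single j (1 : ℝ)) := by
    refine Prod.ext ?_ ?_
    · simp [Prod.fst_sum]
    · simpa [Prod.snd_sum] using hw
  rw [h1, h2, map_add, map_sum]
  simp only [map_smul, smul_eq_mul]
  congr 1
  refine Finset.sum_congr rfl fun j _ => ?_
  congr 2
  simp only [jointDir, direction, Fin.cons_succ]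
  rw [show (((0 : ℝ), (0 : ℝ)) : ℝ × ℝ) = 0 from rfl, map_zero, sub_zero]

/-- This is the Euler-Lagrange computation with the regular part of the potential. The variation of
the potential seen by the particle is `varAt` plus the transport by the displacement. The derivative
of the velocity variation is moved onto the canonical momentum, at the price of a total time
derivative, and the terms with the displacement combine to the force defect. -/
theorem eps_particleLagrangian (F : FamBase η ta tb Z B δ H s) (m q : Fin N → ℝ) {n : Fin N}
    (hv : ∀ p ∈ slab η ta tb, ‖famVel η ta tb Z n p‖ < 1) {t : ℝ} (ht : t ∈ Ioo ta tb) :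
    fderivWithin ℝ (Fam.particleLagrangian η ta tb Z s m q n) (slab η ta tb) (0, t) (1, 0) =
      q n * (∑ ν, metric ν * ((Fin.cons 1 fun i => famVel η ta tb Z n (0, t) i : Fin 4 → ℝ) ν *
        varAt η ta tb Z δ s ν n (0, t))) +
      (∑ j, trajVar η ta tb Z n (0, t) j * forceDefect η ta tb Z δ s m q n j (0, t)) +
      fderivWithin ℝ (fun p => ∑ j, trajVar η ta tb Z n p j *
        (m n * famMomentum η ta tb Z n j p + q n * s j.succ n (p, 0))) (slab η ta tb) (0, t)
        (0, 1) := by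
  have ht' := Ioo_subset_Icc_self ht
  have h0 := F.zero_mem_Ioo
  have hp := F.zero_slab ht'
  have hpos := one_sub_norm_sq_pos (hv _ hp)
  have hS := fun ν => F.contDiffOn_potential_zero ν n
  have dV := fun j => hasDerivAt_eps_slab (F.contDiffOn_famVel_apply n j) h0 ht'
  have dS := fun ν => hasDerivAt_eps_slab (hS ν) h0 ht'
  have hn : ∀ v : Space, ‖v‖ ^ 2 = ∑ j, v j * v j := fun v => by
    rw [EuclideanSpace.real_norm_sq_eq]; simp [sq]
  have e1 := (hasDerivAt_eps_slab (F.contDiffOn_particleLagrangian m q hv) h0 ht').unique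
    (((((HasDerivAt.fun_sum (u := Finset.univ) fun j _ => (dV j).fun_mul (dV j)).const_sub 1).sqrt
      (by rw [← hn]; exact hpos.ne')).const_mul (m n)).fun_neg.fun_add (((HasDerivAt.fun_sum (u := Finset.univ) fun i _ =>
        (dV i).fun_mul (dS i.succ)).fun_sub (dS 0)).const_mul (q n)) |>.congr_of_eventuallyEq
      (Eventually.of_forall fun e => by simp only [Fam.particleLagrangian, hn]))
  have hI := Ioo_subset_Icc_self h0
  have hT : ContDiffOn ℝ ∞ (fun p => ∑ j, trajVar η ta tb Z n p j *
      (m n * famMomentum η ta tb Z n j p + q n * s j.succ n (p, 0))) (slab η ta tb) :=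
    ContDiffOn.sum fun j _ => (F.contDiffOn_trajVar n j).mul ((contDiffOn_const.mul
      (F.contDiffOn_famMomentum hv j)).add (contDiffOn_const.mul (hS j.succ)))
  have e2 := (hasDerivAt_time_slab hT hI ht).unique (HasDerivAt.fun_sum fun j _ =>
    (hasDerivAt_time_slab (F.contDiffOn_trajVar n j) hI ht).fun_mul
      (((hasDerivAt_time_slab (F.contDiffOn_famMomentum hv j) hI ht).const_mul (m n)).fun_add
        ((hasDerivAt_time_slab (hS j.succ) hI ht).const_mul (q n))))
  -- The regular part is written in coordinates centred at the particle. A derivative at a fixed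
  -- point of space, in `ε` here and in time next, is thus the derivative along the particle minus
  -- the transport by the displacement or the velocity.
  have e3 : ∀ ν, varAt η ta tb Z δ s ν n (0, t) = _ := fun ν =>
    F.regular_fderiv ht' n ν (1, 0) (0 - trajVar η ta tb Z n (0, t))
  have e4 : ∀ ν, regD (slab η ta tb) (famZ Z n) δ (jointDir 0) (s ν n) ((0, t), 0) = _ := fun ν =>
    F.regular_fderiv ht' n ν (0, 1) (0 - famVel η ta tb Z n (0, t))
  rw [e1, e2]
  simp only [e3, forceDefect, fieldReg, F.eps_famVel ht]
  simp only [Fin.sum_univ_succ, Fin.cons_zero, Fin.cons_succ, e4, ← hn]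
  simp [metric, famMomentum]
  have hsq : √(1 - ‖famVel η ta tb Z n (0, t)‖ ^ 2) ≠ 0 := (Real.sqrt_pos.2 hpos).ne'
  field_simp
  ring

end FamBase

theorem intervalIntegrable_fun_sum {ι : Type*} {S : Finset ι} {f : ι → ℝ → ℝ}
    (h : ∀ i ∈ S, IntervalIntegrable (f i) volume ta tb) :
    IntervalIntegrable (fun t => ∑ i ∈ S, f i t) volume ta tb := by
  simpa [Finset.sum_fn] using IntervalIntegrable.sum S h

namespace Fam

open FamBase

theorem continuousOn_forceDefect (F : Fam η ta tb Z B δ H s) (m q : Fin N → ℝ) {n : Fin N}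
    (hv : ∀ p ∈ slab η ta tb, ‖famVel η ta tb Z n p‖ < 1) (j : Fin 3) :
    ContinuousOn (forceDefect η ta tb Z δ s m q n j) (slab η ta tb) :=
  (continuousOn_const.mul (continuousOn_fderivWithin_slab F.eta_pos F.time_lt
    (F.contDiffOn_famMomentum hv j) _)).neg.add (continuousOn_const.mul
      (continuousOn_finsetSum _ fun ν _ => (continuousOn_const.mul
        (F.contDiffOn_vel n ν).continuousOn).mul (contDiffOn_reg_zero F.sep.pos
          ((F.singular_field j.succ ν).expansion n).smooth_reg).continuousOn))

theorem integral_eps_particleLagrangian (F : Fam η ta tb Z B δ H s) (m q : Fin N → ℝ) {n : Fin N}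
    (hv : ∀ p ∈ slab η ta tb, ‖famVel η ta tb Z n p‖ < 1)
    (hz : ∀ t, t = ta ∨ t = tb → trajVar η ta tb Z n (0, t) = 0) :
    ∫ t in ta..tb, fderivWithin ℝ (particleLagrangian η ta tb Z s m q n) (slab η ta tb) (0, t) (1, 0) =
      (∑ ν, metric ν * (q n *
        ∫ t in ta..tb, velocity (Z 0 n) t ν * varAt η ta tb Z δ s ν n (0, t))) +
      ∫ t in ta..tb, ∑ j, trajVar η ta tb Z n (0, t) j * forceDefect η ta tb Z δ s m q n j (0, t) := by
  have h0 := F.zero_mem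
  have hA := fun ν => F.contDiffOn_varAt ν n
  have i1 : ∀ ν, IntervalIntegrable (fun t => velocity (Z 0 n) t ν * varAt η ta tb Z δ s ν n (0, t))
      volume ta tb := fun ν =>
    F.intervalIntegrable_velocity_mul n ν (F.timeSlice (hA ν).continuousOn)
  have i2 : IntervalIntegrable (fun t => ∑ j, trajVar η ta tb Z n (0, t) j *
      forceDefect η ta tb Z δ s m q n j (0, t)) volume ta tb :=
    intervalIntegrable_slab_slice F.time_lt (continuousOn_finsetSum _ fun j _ =>
      (F.contDiffOn_trajVar n j).continuousOn.mul (F.continuousOn_forceDefect m q hv j)) h0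
  have hT : ContDiffOn ℝ ∞ (fun p => ∑ j, trajVar η ta tb Z n p j *
      (m n * famMomentum η ta tb Z n j p + q n * s j.succ n (p, 0))) (slab η ta tb) :=
    ContDiffOn.sum fun j _ => (F.contDiffOn_trajVar n j).mul ((contDiffOn_const.mul
      (F.contDiffOn_famMomentum hv j)).add
        (contDiffOn_const.mul (F.contDiffOn_potential_zero j.succ n)))
  have i3 := intervalIntegrable_slab_slice F.time_lt
    (continuousOn_fderivWithin_slab F.eta_pos F.time_lt hT (0, 1)) h0
  have i0 : IntervalIntegrable (fun t => ∑ ν, metric ν * (q n * (velocity (Z 0 n) t ν *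
      varAt η ta tb Z δ s ν n (0, t)))) volume ta tb :=
    intervalIntegrable_fun_sum fun ν _ => ((i1 ν).const_mul (q n)).const_mul (metric ν)
  rw [intervalIntegral.integral_congr_Ioo_of_le F.time_lt.le (g := fun t => (∑ ν, metric ν * (q n * (velocity (Z 0 n) t ν *
      varAt η ta tb Z δ s ν n (0, t)))) + (∑ j, trajVar η ta tb Z n (0, t) j *
      forceDefect η ta tb Z δ s m q n j (0, t)) + fderivWithin ℝ (fun p => ∑ j,
      trajVar η ta tb Z n p j * (m n * famMomentum η ta tb Z n j p + q n * s j.succ n (p, 0)))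
      (slab η ta tb) (0, t) (0, 1)) fun t ht => ?_]
  · rw [intervalIntegral.integral_add (i0.add i2) i3, intervalIntegral.integral_add i0 i2,
      integral_time_deriv_slab F.eta_pos F.time_lt hT, hz ta (Or.inl rfl), hz tb (Or.inr rfl),
      intervalIntegral.integral_finsetSum fun ν _ => ((i1 ν).const_mul (q n)).const_mul (metric ν)]
    simp only [intervalIntegral.integral_const_mul]
    simp
  · rw [F.eps_particleLagrangian m q hv ht, Finset.mul_sum]
    congr 2
    refine Finset.sum_congr rfl fun ν _ => ?_
    rw [F.velocity_eq ht]
    ring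

/-- No field equation is used, so the formula also serves to extract the Maxwell equations from
stationarity. -/
theorem exists_hasDerivAt_action (F : Fam η ta tb Z B δ H s) (m q : Fin N → ℝ)
    (hv : ∀ n, ∀ p ∈ slab η ta tb, ‖famVel η ta tb Z n p‖ < 1) :
    ∃ D : Fin 4 → Fin 4 → ℝ, (∀ μ ν, HasRLim (fun r => ∫ t in ta..tb, ∫ x,
        cutSqD η ta tb (famZ Z) (jointField η ta tb Z B μ ν) r ((0, t), x)) (D μ ν)) ∧
      HasDerivAt (fun ε => action m q ta tb (Z ε) (B ε)) (emVariation D + ∑ n, ∫ t in ta..tb,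
        fderivWithin ℝ (particleLagrangian η ta tb Z s m q n) (slab η ta tb) (0, t) (1, 0)) 0 := by
  obtain ⟨b, C, hb⟩ := F.exists_fieldLimit
  have h := fun μ ν => (F.singular_field μ ν).hasDerivAt_integral_limit F.eta_pos F.time_lt F.sep
    (F.decay μ ν) (F.decay_eps_field μ ν) (hb μ ν)
  choose D hD hR using h
  refine ⟨D, hR, ?_⟩
  refine HasDerivAt.congr_of_eventuallyEq (HasDerivAt.fun_add (HasDerivAt.const_mul (-(1 / 4))
    (HasDerivAt.fun_sum (u := Finset.univ) fun μ _ => HasDerivAt.fun_sum (u := Finset.univ) fun ν _ =>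
      (hD μ ν).const_mul (metric μ * metric ν))) (HasDerivAt.fun_sum (u := Finset.univ) fun n _ =>
        hasDerivAt_integral_slab F.eta_pos F.time_lt
          (F.contDiffOn_particleLagrangian m q (hv n)))) ?_
  filter_upwards [Icc_mem_nhds F.zero_mem_Ioo.1 F.zero_mem_Ioo.2] with ε hε
  have ib := fun μ ν => (F.intervalIntegrable_slice (F.continuousOn_fieldLimit hb μ ν)
    hε).const_mul (metric μ * metric ν)
  have il := fun n => F.intervalIntegrable_slice (F.continuousOn_particleLagrangian m q n) hε
  rw [action, intervalIntegral.integral_congr_Ioo_of_le F.time_lt.le fun t ht => F.lagrangian_eq hb m q hε ht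
      fun n => hv n _ (mem_slab hε (Ioo_subset_Icc_self ht)),
    intervalIntegral.integral_add ((intervalIntegrable_fun_sum fun μ _ =>
      intervalIntegrable_fun_sum fun ν _ => ib μ ν).const_mul _)
        (intervalIntegrable_fun_sum fun n _ => il n),
    intervalIntegral.integral_const_mul, intervalIntegral.integral_finsetSum fun n _ => il n,
    intervalIntegral.integral_finsetSum fun μ _ => intervalIntegrable_fun_sum fun ν _ => ib μ ν]
  congr 2
  refine Finset.sum_congr rfl fun μ _ => ?_
  rw [intervalIntegral.integral_finsetSum fun ν _ => ib μ ν]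
  simp only [intervalIntegral.integral_const_mul]

/-- The first variation of the action about a solution of the Maxwell equations. -/
theorem hasDerivAt_action (F : Fam η ta tb Z B δ H s) (m : Fin N → ℝ) {q : Fin N → ℝ}
    (hv : ∀ n, ∀ p ∈ slab η ta tb, ‖famVel η ta tb Z n p‖ < 1)
    (hw : WeakMaxwell q ta tb (Z 0) (B 0)) (hE : FixedEnds η ta tb Z B) :
    HasDerivAt (fun ε => action m q ta tb (Z ε) (B ε)) (∑ n, ∫ t in ta..tb, ∑ j,
      trajVar η ta tb Z n (0, t) j * forceDefect η ta tb Z δ s m q n j (0, t)) 0 := by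
  obtain ⟨D, hD, h⟩ := F.exists_hasDerivAt_action m q hv
  convert h using 1
  rw [F.emVariation_eq hw hE hD]
  simp only [fun n => F.integral_eps_particleLagrangian m q (hv n) fun t ht => F.trajVar_end hE ht n]
  rw [Finset.sum_add_distrib, Finset.sum_comm]
  simp only [← Finset.mul_sum]
  ring

end Fam

/-! ### The Lorentz-Dirac equation as the vanishing of the force defect -/

namespace FamBase

theorem gamma_eq (F : FamBase η ta tb Z B δ H s) {t : ℝ} (ht : t ∈ Ioo ta tb) (n : Fin N) :
    gamma (Z 0 n) t = 1 / √(1 - ‖famVel η ta tb Z n (0, t)‖ ^ 2) := by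
  rw [gamma, F.deriv_traj (Ioo_subset_Icc_self F.zero_mem_Ioo) ht]

theorem hasDerivAt_fourVelocity_succ (F : FamBase η ta tb Z B δ H s) {n : Fin N}
    (hv : ∀ p ∈ slab η ta tb, ‖famVel η ta tb Z n p‖ < 1) {t : ℝ} (ht : t ∈ Ioo ta tb) (j : Fin 3) :
    HasDerivAt (fun τ => fourVelocity (Z 0 n) τ j.succ)
      (fderivWithin ℝ (famMomentum η ta tb Z n j) (slab η ta tb) (0, t) (0, 1)) t := by
  have h0 := Ioo_subset_Icc_self F.zero_mem_Ioo
  refine (hasDerivAt_time_slab (F.contDiffOn_famMomentum hv j) h0 ht).congr_of_eventuallyEq ?_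
  filter_upwards [isOpen_Ioo.mem_nhds ht] with τ hτ
  simp only [fourVelocity, Fin.cons_succ, F.gamma_eq hτ, F.deriv_traj h0 hτ, famMomentum]

/-- The normalization of the four-velocity gives `u⁰ = √(1 + |𝐮|²)`, whose derivative is `𝐮 · 𝐮' /
u⁰`, and `𝐮 / u⁰` is the velocity. -/
theorem hasDerivAt_fourVelocity_zero (F : FamBase η ta tb Z B δ H s) {n : Fin N}
    (hv : ∀ p ∈ slab η ta tb, ‖famVel η ta tb Z n p‖ < 1) {t : ℝ} (ht : t ∈ Ioo ta tb) :
    HasDerivAt (fun τ => fourVelocity (Z 0 n) τ 0) (∑ j, famVel η ta tb Z n (0, t) j *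
      fderivWithin ℝ (famMomentum η ta tb Z n j) (slab η ta tb) (0, t) (0, 1)) t := by
  have h0 := Ioo_subset_Icc_self F.zero_mem_Ioo
  have key : ∀ τ ∈ Ioo ta tb, fourVelocity (Z 0 n) τ 0 =
      √(1 + ∑ j : Fin 3, fourVelocity (Z 0 n) τ j.succ * fourVelocity (Z 0 n) τ j.succ) := by
    intro τ hτ
    have hpos := one_sub_norm_sq_pos (hv _ (F.zero_slab (Ioo_subset_Icc_self hτ)))
    simp only [fourVelocity, Fin.cons_zero, Fin.cons_succ, F.gamma_eq hτ, F.deriv_traj h0 hτ]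
    have hn : ‖famVel η ta tb Z n (0, τ)‖ ^ 2 =
        ∑ j, famVel η ta tb Z n (0, τ) j * famVel η ta tb Z n (0, τ) j := by
      rw [EuclideanSpace.real_norm_sq_eq]; simp [sq]
    rw [eq_comm, Real.sqrt_eq_iff_mul_self_eq
      (add_nonneg zero_le_one (Finset.sum_nonneg fun j _ => mul_self_nonneg _)) (by positivity)]
    set g := √(1 - ‖famVel η ta tb Z n (0, τ)‖ ^ 2) with hg
    have hgg : g * g = 1 - ‖famVel η ta tb Z n (0, τ)‖ ^ 2 := Real.mul_self_sqrt hpos.le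
    have hg0 : g ≠ 0 := (Real.sqrt_pos.2 hpos).ne'
    rw [hn] at hgg
    simp only [Fin.sum_univ_three] at hgg ⊢
    field_simp
    linarith
  have hd := fun j => F.hasDerivAt_fourVelocity_succ hv ht j
  have hsum : 0 < 1 + ∑ j : Fin 3, fourVelocity (Z 0 n) t j.succ * fourVelocity (Z 0 n) t j.succ :=
    add_pos_of_pos_of_nonneg one_pos (Finset.sum_nonneg fun j _ => mul_self_nonneg _)
  have h := ((HasDerivAt.fun_sum (u := Finset.univ) fun j _ =>
    (hd j).fun_mul (hd j)).const_add 1).sqrt hsum.ne'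
  rw [← key t ht] at h
  refine (h.congr_of_eventuallyEq ?_).congr_deriv ?_
  · filter_upwards [isOpen_Ioo.mem_nhds ht] with τ hτ using key τ hτ
  · have hpos := one_sub_norm_sq_pos (hv _ (F.zero_slab (Ioo_subset_Icc_self ht)))
    have hg0 := (Real.sqrt_pos.2 hpos).ne'
    simp only [fourVelocity, Fin.cons_zero, Fin.cons_succ, F.gamma_eq ht, F.deriv_traj h0 ht,
      Fin.sum_univ_three]
    field_simp
    ring

end FamBase

namespace Fam

open FamBase

/-- The renormalized field at the particle exists and is the regular part of the expansion. The
spatial equations are the defect equations times `γ`. The time equation is the contraction of the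
spatial ones with the velocity: by antisymmetry the magnetic terms drop out, and the left side is `v
· 𝐮'`. -/
theorem lorentzDirac_iff (F : Fam η ta tb Z B δ H s) (m q : Fin N → ℝ)
    (hv : ∀ n, ∀ p ∈ slab η ta tb, ‖famVel η ta tb Z n p‖ < 1) :
    LorentzDirac m q ta tb (Z 0) (B 0) ↔
      ∀ n, ∀ t ∈ Ioo ta tb, ∀ j, forceDefect η ta tb Z δ s m q n j (0, t) = 0 := by
  refine forall_congr' fun n => forall₂_congr fun t ht => ?_
  have h0 := F.zero_mem
  have hlim := F.hasRLim_field h0 ht n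
  have hpos := one_sub_norm_sq_pos (hv n _ (F.zero_slab (Ioo_subset_Icc_self ht)))
  have hg0 : gamma (Z 0 n) t ≠ 0 := by
    rw [F.gamma_eq ht]
    exact one_div_ne_zero (Real.sqrt_pos.2 hpos).ne'
  have d1 := fun j => (F.hasDerivAt_fourVelocity_succ (hv n) ht j).deriv
  have d0 := (F.hasDerivAt_fourVelocity_zero (hv n) ht).deriv
  have hU : ∀ ν, fourVelocity (Z 0 n) t ν = gamma (Z 0 n) t *
      (Fin.cons 1 fun i => famVel η ta tb Z n (0, t) i : Fin 4 → ℝ) ν := by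
    intro ν
    refine Fin.cases ?_ (fun i => ?_) ν
    · simp [fourVelocity]
    · simp [fourVelocity, F.deriv_traj h0 ht]
  have hG : ∀ j, forceDefect η ta tb Z δ s m q n j (0, t) = 0 ↔
      m n * gamma (Z 0 n) t * deriv (fun τ => fourVelocity (Z 0 n) τ j.succ) t =
        q n * ∑ ν, metric ν * fourVelocity (Z 0 n) t ν *
          fieldReg η ta tb Z δ s j.succ ν n ((0, t), 0) := by
    intro j
    rw [d1, forceDefect, neg_add_eq_zero, ← mul_right_inj' hg0]
    simp only [hU, Fin.sum_univ_succ]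
    constructor <;> intro h <;> linear_combination h
  constructor
  · rintro ⟨Ft, hF, hLD⟩ j
    rw [hG]
    simpa only [fun ν => (hF j.succ ν).unique (hlim j.succ ν)] using hLD j.succ
  · intro h
    refine ⟨_, hlim, fun μ => ?_⟩
    refine Fin.cases ?_ (fun j => (hG j).1 (h j)) μ
    have hanti : ∀ μ ν, fieldReg η ta tb Z δ s μ ν n ((0, t), 0) =
        -fieldReg η ta tb Z δ s ν μ n ((0, t), 0) := fun μ ν => by
      simp only [fieldReg]; ring
    have hself : ∀ μ, fieldReg η ta tb Z δ s μ μ n ((0, t), 0) = 0 := fun μ => by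
      simp only [fieldReg]; ring
    have a0 := h 0
    have a1 := h 1
    have a2 := h 2
    rw [d0]
    simp only [hU]
    simp only [forceDefect, Fin.sum_univ_four, Fin.sum_univ_three, hself, Fin.succ_zero_eq_one,
      Fin.succ_one_eq_two, show (2 : Fin 3).succ = 3 from rfl, hanti 1 0, hanti 2 0, hanti 3 0,
      hanti 2 1, hanti 3 1, hanti 3 2] at a0 a1 a2 ⊢
    have c0 : ∀ f : Fin 3 → ℝ, (Fin.cons 1 f : Fin 4 → ℝ) 0 = 1 := fun f => rfl
    have c1 : ∀ f : Fin 3 → ℝ, (Fin.cons 1 f : Fin 4 → ℝ) 1 = f 0 := fun f => rfl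
    have c2 : ∀ f : Fin 3 → ℝ, (Fin.cons 1 f : Fin 4 → ℝ) 2 = f 1 := fun f => rfl
    have c3 : ∀ f : Fin 3 → ℝ, (Fin.cons 1 f : Fin 4 → ℝ) 3 = f 2 := fun f => rfl
    simp only [c0, c1, c2, c3, metric, Fin.isValue, Matrix.cons_val] at a0 a1 a2 ⊢
    -- The coefficients are the components of the velocity: the power equation is the force equation
    -- contracted with `v`.
    linear_combination -gamma (Z 0 n) t * (famVel η ta tb Z n (0, t) 0 * a0 +
      famVel η ta tb Z n (0, t) 1 * a1 + famVel η ta tb Z n (0, t) 2 * a2)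

end Fam

theorem IsAdmissibleVariation.exists_fam_subluminal {m q : Fin N → ℝ} (ht : ta < tb)
    {z : Fin N → ℝ → Space} {A : Spacetime → Fin 4 → ℝ}
    (hV : IsAdmissibleVariation m q ta tb z A η Z B) :
    ∃ δ H s, Fam (η / 2) ta tb Z B δ H s ∧ FixedEnds (η / 2) ta tb Z B ∧
      ∀ n, ∀ p ∈ slab (η / 2) ta tb, ‖famVel (η / 2) ta tb Z n p‖ < 1 := by
  obtain ⟨δ, H, s, F⟩ := hV.exists_fam ht
  have hη := hV.pos
  have hsub : ∀ ε ∈ Icc (-(η / 2)) (η / 2), ε ∈ Ioo (-η) η := fun ε hε =>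
    ⟨by linarith [hε.1], by linarith [hε.2]⟩
  refine ⟨δ, H, s, F, fun ε hε t htt => ?_, fun n p hp => ?_⟩
  · simp only [hV.trajectory_zero, hV.potential_zero]
    exact ⟨hV.trajectory_endpoint ε (hsub ε hε) t htt, hV.potential_endpoint ε (hsub ε hε) t htt⟩
  · rw [← Prod.mk.eta (p := p), ← F.derivWithin_traj hp.1 hp.2]
    exact (hV.inDomain p.1 (hsub _ hp.1)).subluminal n p.2 hp.2

theorem EquationsOfMotion.isStationary {m q : Fin N → ℝ} (ht : ta < tb) {z : Fin N → ℝ → Space}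
    {A : Spacetime → Fin 4 → ℝ} (h : EquationsOfMotion m q ta tb z A) :
    IsStationary m q ta tb z A := by
  intro η Z B hV
  obtain ⟨δ, H, s, F, hE, hv⟩ := hV.exists_fam_subluminal ht
  obtain ⟨hM, hL⟩ := h
  rw [← hV.trajectory_zero, ← hV.potential_zero] at hM hL
  have hd := F.hasDerivAt_action m hv ((F.maxwell_iff q).1 hM) hE
  rw [F.lorentzDirac_iff m q hv] at hL
  convert hd using 1
  refine (Finset.sum_eq_zero fun n _ => ?_).symm
  rw [intervalIntegral.integral_congr_Ioo_of_le (g := fun _ => 0) ht.le fun t ht' => ?_]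
  · simp
  · exact Finset.sum_eq_zero fun j _ => by rw [hL n t ht' j, mul_zero]

/-! ### A criterion for admissible variations -/

theorem PointSingular.mono {P : Type} [NormedAddCommGroup P] [NormedSpace ℝ P] {U V : Set P}
    {z : Fin N → P → Space} {A : P × Space → Fin 4 → ℝ} (h : PointSingular U z A) (hV : V ⊆ U) :
    PointSingular V z A :=
  h.comp (g := id) contDiff_id hV

theorem PointSingular.add {P : Type} [NormedAddCommGroup P] [NormedSpace ℝ P] {U : Set P}
    {z : Fin N → P → Space} {A g : P × Space → Fin 4 → ℝ} (h : PointSingular U z A)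
    (hg : ContDiffOn ℝ ∞ g (U ×ˢ univ)) : PointSingular U z (fun x => A x + g x) where
  smooth_trajectory := h.smooth_trajectory
  distinct := h.distinct
  smooth_off := h.smooth_off.add (hg.mono fun x hx => ⟨hx.1, mem_univ _⟩)
  near n := by
    obtain ⟨δ, hδ, k, s, hk, hs, hp, he⟩ := h.near n
    refine ⟨δ, hδ, k, fun x => s x + g (x.1, z n x.1 + x.2), hk, hs.add (hg.comp
      (contDiffOn_fst.prodMk (((h.smooth_trajectory n).comp contDiffOn_fst fun x hx => hx.1).add
        contDiffOn_snd)) fun x hx => ⟨hx.1, mem_univ _⟩), hp, fun p hp' ρ hρ θ hθ => ?_⟩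
    simp only [he p hp' ρ hρ θ hθ, add_assoc]

/-- A smooth family that differs from a configuration only in a bounded region, and not at the ends
of the time interval, is an admissible variation. -/
theorem isAdmissibleVariation_of_local {m q : Fin N → ℝ} (ht : ta < tb) {z : Fin N → ℝ → Space}
    {A : Spacetime → Fin 4 → ℝ} (hdom : InDomain m q ta tb z A) (hη : 0 < η) (hZ : Z 0 = z)
    (hB : B 0 = A) (hsm : PointSingular (Ioo (-η) η ×ˢ Icc ta tb) (famZ Z) (famB B))
    (hfar : ∃ R, ∀ ε ∈ Ioo (-η) η, ∀ t ∈ Icc ta tb, ∀ x : Space, R ≤ ‖x‖ → B ε (t, x) = A (t, x))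
    (hz : ∀ ε ∈ Ioo (-η) η, ∀ t, t = ta ∨ t = tb → ∀ n, Z ε n t = z n t)
    (hA : ∀ ε ∈ Ioo (-η) η, ∀ t, t = ta ∨ t = tb → ∀ x, B ε (t, x) = A (t, x))
    (hv : ∀ ε ∈ Ioo (-η) η, ∀ n, ∀ t ∈ Icc ta tb, ‖derivWithin (Z ε n) (Icc ta tb) t‖ < 1) :
    IsAdmissibleVariation m q ta tb z A η Z B := by
  obtain ⟨R, hR⟩ := hfar
  have hconst : ∀ ε ∈ Ioo (-η) η, ∀ t ∈ Ioo ta tb, ∀ x : Space, R + 1 ≤ ‖x‖ → ∀ μ ν,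
      deriv (fun e => partialD μ (fun p => B e p ν) (t, x)) ε = 0 := by
    intro ε hε t ht' x hx μ ν
    have : (fun e => partialD μ (fun p => B e p ν) (t, x)) =ᶠ[𝓝 ε]
        fun _ => partialD μ (fun p => A p ν) (t, x) := by
      filter_upwards [isOpen_Ioo.mem_nhds hε] with e he
      unfold partialD
      rw [Filter.EventuallyEq.fderiv_eq]
      filter_upwards [(isOpen_Ioo.prod (isOpen_lt continuous_const continuous_norm)).mem_nhds
        (show ((t, x) : Spacetime) ∈ Ioo ta tb ×ˢ {x : Space | R < ‖x‖} from
          ⟨ht', show R < ‖x‖ by linarith⟩)] with p hp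
      rw [show p = (p.1, p.2) from rfl, hR e he p.1 (Ioo_subset_Icc_self hp.1) p.2 (le_of_lt hp.2)]
    rw [this.deriv_eq, deriv_const]
  refine ⟨hη, hZ, hB, fun ε hε => ?_, hsm, hz, fun ε hε t ht' x _ => hA ε hε t ht' x, 0, |R| + 1,
    by positivity, fun ε hε t ht' x hx μ ν => ?_⟩
  -- The given `ε` lies in the closed range of half-width `η'`, which is contained in the open
  -- range, so the theory of families over compact parameters applies around it.
  · set η' := (|ε| + η) / 2 with hη'
    have habs : |ε| < η := abs_lt.2 hε
    have h1 : |ε| < η' := by linarith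
    have hsub : ∀ e ∈ Icc (-η') η', e ∈ Ioo (-η) η := fun e he =>
      ⟨by linarith [he.1], by linarith [he.2]⟩
    have hε' : ε ∈ Icc (-η') η' := ⟨(abs_lt.1 h1).1.le, (abs_lt.1 h1).2.le⟩
    obtain ⟨δ, H, s, F⟩ := exists_famBase (ta := ta) (tb := tb) ((abs_nonneg ε).trans_lt h1) ht
      (hsm.mono fun p hp => ⟨hsub _ hp.1, hp.2⟩)
    obtain ⟨C, R', -, hC⟩ := hdom.decay
    have F' := F.toFam ⟨C, R', by rwa [hB]⟩ ⟨0, R + 1, fun e he t ht' x hx μ ν => by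
      rw [hconst e (hsub e (Ioo_subset_Icc_self he)) t ht' x hx]; simp⟩
    exact F'.inDomain m q hε' (hsm.comp (g := fun t : ℝ => (ε, t)) (by fun_prop) fun t ht' =>
      ⟨hε, ht'⟩) (hv ε hε)
  · rw [hconst ε hε t ht' x (by linarith [le_abs_self R])]
    simp

/-! ### Variation of the potential -/

/-- Multiplication by `r` shows that convergence forces the coefficient of `1 / r` to vanish. -/
theorem HasRLim.eq_of_tendsto {f : ℝ → ℝ} {b c : ℝ} (h : HasRLim f b)
    (hc : Tendsto f (𝓝[>] 0) (𝓝 c)) : b = c := by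
  obtain ⟨a, ha⟩ := h
  have hid : Tendsto (fun r : ℝ => r) (𝓝[>] (0 : ℝ)) (𝓝 0) := tendsto_id.mono_left nhdsWithin_le_nhds
  have h1 : Tendsto (fun r => a / r + b) (𝓝[>] 0) (𝓝 c) := by
    simpa using hc.sub (ha.trans_tendsto hid)
  have h2 : Tendsto (fun r => r * (a / r + b) - r * b) (𝓝[>] 0) (𝓝 (0 * c - 0 * b)) :=
    (hid.mul h1).sub (hid.mul_const b)
  have ha0 : a = 0 := by
    refine tendsto_nhds_unique (tendsto_const_nhds (f := 𝓝[>] (0 : ℝ))) ?_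
    refine Tendsto.congr' ?_ (by simpa using h2)
    filter_upwards [self_mem_nhdsWithin] with r (hr : 0 < r)
    field_simp
    ring
  subst ha0
  exact tendsto_nhds_unique (by simp) h1

/-- The potential `A` with `ε ψ` added to its component `ν`. -/
noncomputable def shiftPotential (A : Spacetime → Fin 4 → ℝ) (ψ : Spacetime → ℝ) (ν : Fin 4) (ε : ℝ)
    (p : Spacetime) : Fin 4 → ℝ :=
  A p + (ε * ψ p) • Pi.single ν 1

theorem isAdmissibleVariation_shiftPotential {m q : Fin N → ℝ} (ht : ta < tb)
    {z : Fin N → ℝ → Space} {A : Spacetime → Fin 4 → ℝ} (hdom : InDomain m q ta tb z A)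
    {ψ : Spacetime → ℝ} (hψ : IsTest ta tb ψ) (ν : Fin 4) :
    IsAdmissibleVariation m q ta tb z A 1 (fun _ => z) (shiftPotential A ψ ν) := by
  refine isAdmissibleVariation_of_local ht hdom one_pos rfl ?_ ?_ ?_ (fun _ _ _ _ _ => rfl) ?_
    fun _ _ => hdom.subluminal
  · funext p
    simp [shiftPotential]
  · have hs := hψ.smooth
    exact (hdom.singular.comp (g := Prod.snd) contDiff_snd fun p hp => hp.2).add
      (ContDiff.contDiffOn (by fun_prop))
  · obtain ⟨C, R, -, -, -, hR⟩ := hψ.exists_bound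
    exact ⟨R, fun ε _ t _ x hx => by simp [shiftPotential, hR (t, x) hx]⟩
  · rintro ε - t (rfl | rfl) x <;> simp [shiftPotential, hψ.eq_zero]

end

/-! ### The Maxwell equations from stationarity -/

section

variable {N : ℕ} {η ta tb : ℝ} {δ : ℝ}
  {H : Fin 4 → Fin N → (ℝ × ℝ) × (ℝ × Space) → ℝ} {s : Fin 4 → Fin N → (ℝ × ℝ) × Space → ℝ}
  {z : Fin N → ℝ → Space} {A : Spacetime → Fin 4 → ℝ} {φ : Spacetime → ℝ} {ν : Fin 4}

theorem shiftPotential_zero (A : Spacetime → Fin 4 → ℝ) (φ : Spacetime → ℝ) (ν : Fin 4) :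
    shiftPotential A φ ν 0 = A := by
  funext p
  simp [shiftPotential]

theorem shiftPotential_apply (A : Spacetime → Fin 4 → ℝ) (φ : Spacetime → ℝ) (ν : Fin 4) (ε : ℝ)
    (p : Spacetime) (k : Fin 4) :
    shiftPotential A φ ν ε p k = A p k + ε * ((Pi.single ν 1 : Fin 4 → ℝ) k * φ p) := by
  simp only [shiftPotential, Pi.add_apply, Pi.smul_apply, smul_eq_mul]
  ring

/-- The field of the potential that has `φ` as its component `ν` and no other components. -/
noncomputable def testField (φ : Spacetime → ℝ) (ν μ k : Fin 4) (p : Spacetime) : ℝ :=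
  metric μ * (Pi.single ν 1 : Fin 4 → ℝ) k * partialD μ φ p -
    metric k * (Pi.single ν 1 : Fin 4 → ℝ) μ * partialD k φ p

namespace Fam

open FamBase

theorem trajVar_const (F : Fam η ta tb (fun _ => z) (shiftPotential A φ ν) δ H s) {t : ℝ}
    (ht : t ∈ Icc ta tb) (n : Fin N) : trajVar η ta tb (fun _ => z) n (0, t) = 0 :=
  (F.hasDerivAt_eps_traj ht n).unique (hasDerivAt_const _ _)

theorem varB_shift (F : Fam η ta tb (fun _ => z) (shiftPotential A φ ν) δ H s) {t : ℝ}
    (ht : t ∈ Icc ta tb) {x : Space} (hx : ∀ n, x ≠ z n t) (k : Fin 4) :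
    varB η ta tb (fun _ => z) (shiftPotential A φ ν) k ((0, t), x) =
      (Pi.single ν 1 : Fin 4 → ℝ) k * φ (t, x) := by
  refine (F.hasDerivAt_eps_off (F.potential k).smooth_off F.zero_mem_Ioo ht hx).unique ?_
  simp only [famB, shiftPotential_apply]
  simpa using ((hasDerivAt_id (0 : ℝ)).mul_const
    ((Pi.single ν 1 : Fin 4 → ℝ) k * φ (t, x))).const_add (A (t, x) k)

theorem varAt_shift (F : Fam η ta tb (fun _ => z) (shiftPotential A φ ν) δ H s)
    (hφ : IsTest ta tb φ) {t : ℝ} (ht : t ∈ Icc ta tb) (k : Fin 4) (n : Fin N) :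
    varAt η ta tb (fun _ => z) δ s k n (0, t) = (Pi.single ν 1 : Fin 4 → ℝ) k * φ (t, z n t) := by
  have hp := F.zero_slab ht
  have hsm := hφ.smooth
  have hz := F.sep.smooth n
  -- The variation is the restriction of a smooth function, so it has an expansion with zero
  -- singular part. Uniqueness of renormalized limits identifies the regular value with that of the
  -- chosen expansion.
  have hexp : IsExpansion (slab η ta tb) (famZ (fun _ => z) n) δ 2
      (fun x => (Pi.single ν 1 : Fin 4 → ℝ) k * φ (x.1.2, x.2)) (fun _ => 0)
      (fun x => (Pi.single ν 1 : Fin 4 → ℝ) k * φ (x.1.2, famZ (fun _ => z) n x.1 + x.2)) :=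
    { smooth_sing := contDiffOn_const
      smooth_reg := contDiffOn_const.mul (hsm.comp_contDiffOn
        ((contDiff_snd.comp contDiff_fst).contDiffOn.prodMk
          ((hz.comp contDiffOn_fst fun x hx => hx.1).add contDiffOn_snd)))
      parity := by simp
      eq := by simp }
  have h2 := hexp.hasRLim_sphereAverage F.sep.compact F.sep.unique F.sep.pos (Or.inr rfl) hp
  simp only [famZ, add_zero] at h2
  refine HasRLim.unique (((F.singular_varB k).expansion n).hasRLim_sphereAverage F.sep.compact
    F.sep.unique F.sep.pos (Or.inr rfl) hp) (h2.congr' ?_)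
  filter_upwards [Ioo_mem_nhdsGT F.sep.pos] with r hr
  unfold sphereAverage
  congr 1
  funext θ
  have hθ : ‖(θ : Space)‖ = 1 := by simp
  refine (F.varB_shift ht (F.sep.add_mem_offLines hp n (y := r • (θ : Space)) ?_ ?_).2 k).symm
  · rw [← norm_pos_iff, norm_smul, hθ, Real.norm_of_nonneg hr.1.le]
    linarith [hr.1]
  · rw [norm_smul, hθ, Real.norm_of_nonneg hr.1.le]
    linarith [hr.2]

theorem epsD_field_shift (F : Fam η ta tb (fun _ => z) (shiftPotential A φ ν) δ H s)
    (hφ : IsTest ta tb φ) {t : ℝ} (ht : t ∈ Ioo ta tb) {x : Space} (hx : ∀ n, x ≠ z n t)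
    (μ k : Fin 4) :
    epsD η ta tb (famZ fun _ => z) (jointField η ta tb (fun _ => z) (shiftPotential A φ ν) μ k)
      ((0, t), x) = testField φ ν μ k (t, x) := by
  have hφd : DifferentiableAt ℝ φ (t, x) := hφ.smooth.differentiable (by simp) _
  have hAd : ∀ k, DifferentiableAt ℝ (fun p => A p k) (t, x) := fun k => by
    have := (F.hasFDerivAt_slice (F.potential k).smooth_off F.zero_mem
      ht hx).differentiableAt
    simpa only [famB, Prod.mk.eta, shiftPotential_zero] using this
  have hpart : ∀ e l k, partialD l (fun p => shiftPotential A φ ν e p k) (t, x) =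
      partialD l (fun p => A p k) (t, x) + e * ((Pi.single ν 1 : Fin 4 → ℝ) k * partialD l φ (t, x)) := by
    intro e l k
    simp only [partialD, shiftPotential_apply]
    rw [fderiv_fun_add (hAd k) ((hφd.const_mul _).const_mul _), fderiv_const_mul (hφd.const_mul _),
      fderiv_const_mul hφd]
    simp
  have hfield : ∀ e, field (shiftPotential A φ ν e) μ k (t, x) =
      field A μ k (t, x) + e * testField φ ν μ k (t, x) := by
    intro e
    simp only [field, hpart, testField]
    ring
  refine (F.hasDerivAt_eps_off (F.singular_field μ k).smooth_off F.zero_mem_Ioo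
    (Ioo_subset_Icc_self ht) hx).unique ?_
  have h := ((hasDerivAt_id (0 : ℝ)).mul_const (testField φ ν μ k (t, x))).const_add
    (field A μ k (t, x))
  rw [one_mul] at h
  refine h.congr_of_eventuallyEq ?_
  filter_upwards [Icc_mem_nhds F.zero_mem_Ioo.1 F.zero_mem_Ioo.2] with e he
  rw [← F.field_eq he ht hx, hfield]
  rfl

/-- The trajectories do not depend on `ε`, so the cutoff is not differentiated. -/
theorem cutSqD_shift (F : Fam η ta tb (fun _ => z) (shiftPotential A φ ν) δ H s)
    (hφ : IsTest ta tb φ) {t : ℝ} (ht : t ∈ Ioo ta tb) {x : Space} (hx : ∀ n, x ≠ z n t)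
    (μ k : Fin 4) (r : ℝ) :
    cutSqD η ta tb (famZ fun _ => z) (jointField η ta tb (fun _ => z) (shiftPotential A φ ν) μ k) r
      ((0, t), x) = cut (famZ fun _ => z) r ((0, t), x) *
        (2 * (jointField η ta tb (fun _ => z) (shiftPotential A φ ν) μ k ((0, t), x) *
          testField φ ν μ k (t, x))) := by
  have ht' := Ioo_subset_Icc_self ht
  have hx' := mem_off (Z := fun _ => z) F.zero_mem ht' hx
  have hf := (F.singular_field μ k).smooth_off
  have hz : ∀ n, fderivWithin ℝ (famZ (fun _ => z) n) (slab η ta tb) (0, t) (1, 0) = 0 :=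
    fun n => F.trajVar_const ht' n
  rw [cutSqD, F.sep.fderivWithin_cut_mul r (hf.pow 2) hx',
    F.sep.fderivWithin_sq hf hx', fderivWithin_cut F.sep.unique F.sep.smooth r hx'.1,
    ← F.epsD_field_shift hφ ht hx μ k]
  simp only [hz, sub_zero, map_zero, mul_zero, Finset.sum_const_zero, neg_zero, zero_mul, add_zero]
  simp only [epsD]
  ring

theorem integrable_field_partialD (F : Fam η ta tb (fun _ => z) (shiftPotential A φ ν) δ H s)
    (hφ : IsTest ta tb φ) (μ k l : Fin 4) : Integrable (fun p => atZero (jointField η ta tb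
      (fun _ => z) (shiftPotential A φ ν) μ k) p * partialD l φ p) (slabMeasure ta tb) :=
  F.integrable_mul_test (F.singular_field μ k).smooth_off (F.nearBound_field μ k)
    (hφ.isTest_partialD l)

/-- The field is locally integrable and the test function is smooth, so the cut off derivatives
converge by dominated convergence. The renormalized limit is then the ordinary one. -/
theorem fieldVariation_shift (F : Fam η ta tb (fun _ => z) (shiftPotential A φ ν) δ H s)
    (hφ : IsTest ta tb φ) (μ k : Fin 4) {D : ℝ}
    (hD : HasRLim (fun r => ∫ t in ta..tb, ∫ x, cutSqD η ta tb (famZ fun _ => z)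
      (jointField η ta tb (fun _ => z) (shiftPotential A φ ν) μ k) r ((0, t), x)) D) :
    D = 2 * (metric μ * (Pi.single ν 1 : Fin 4 → ℝ) k * (∫ p, field A μ k p * partialD μ φ p) -
      metric k * (Pi.single ν 1 : Fin 4 → ℝ) μ * ∫ p, field A μ k p * partialD k φ p) := by
  set Fz := jointField η ta tb (fun _ => z) (shiftPotential A φ ν) μ k with hFz
  have hT := F.integrable_field_partialD hφ μ k
  have hg : Integrable (fun p => 2 * (atZero Fz p * testField φ ν μ k p)) (slabMeasure ta tb) := by
    refine ((((hT μ).const_mul (metric μ * (Pi.single ν 1 : Fin 4 → ℝ) k)).sub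
      ((hT k).const_mul (metric k * (Pi.single ν 1 : Fin 4 → ℝ) μ))).const_mul 2).congr
        (Eventually.of_forall fun p => ?_)
    simp only [testField, Pi.sub_apply, hFz]
    ring
  have htt := F.time_lt.le
  have hm : ∀ r, AEStronglyMeasurable (atZero (cut (famZ fun _ => z) r)) (slabMeasure ta tb) :=
    fun r => aestronglyMeasurable_slab htt F.continuousOn_traj (F.continuousOn_atZero
      ((contDiffOn_cut F.sep.smooth r).continuousOn.mono offLines_subset))
  have hle : ∀ r p, ‖atZero (cut (famZ fun _ => z) r) p * (2 * (atZero Fz p * testField φ ν μ k p))‖ ≤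
      (1 + 2 * N) * ‖2 * (atZero Fz p * testField φ ν μ k p)‖ := by
    intro r p
    rw [norm_mul]
    gcongr
    exact abs_cut_le _ _ _
  have hlim : Tendsto (fun r => ∫ p, atZero (cut (famZ fun _ => z) r) p *
      (2 * (atZero Fz p * testField φ ν μ k p)) ∂slabMeasure ta tb) (𝓝[>] 0)
      (𝓝 (∫ p, 2 * (atZero Fz p * testField φ ν μ k p) ∂slabMeasure ta tb)) := by
    refine tendsto_integral_filter_of_dominated_convergence _
      (Eventually.of_forall fun r => (hm r).mul hg.1)
      (Eventually.of_forall fun r => Eventually.of_forall (hle r)) (hg.norm.const_mul _) ?_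
    filter_upwards [ae_slabOff htt F.continuousOn_traj] with p hp
    refine tendsto_const_nhds.congr' ?_
    filter_upwards [eventually_cut F.sep (F.slabOff_mem hp)] with r hr
    rw [atZero, atZero, hr.1, one_mul]
  rw [hD.eq_of_tendsto (hlim.congr' (Eventually.of_forall fun r => ?_))]
  · simp only [integral_const_mul, testField]
    congr 1
    have hF : ∀ l, ∫ p, field A μ k p * partialD l φ p =
        ∫ p, atZero Fz p * partialD l φ p ∂slabMeasure ta tb := fun l => by
      have := F.integral_field_test (hφ.isTest_partialD l) μ k
      rwa [shiftPotential_zero] at this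
    rw [hF, hF, ← integral_const_mul, ← integral_const_mul, ← integral_sub ((hT μ).const_mul _)
      ((hT k).const_mul _)]
    refine integral_congr_ae (Eventually.of_forall fun p => ?_)
    simp only
    ring
  · have hi : Integrable (fun p => atZero (cut (famZ fun _ => z) r) p *
        (2 * (atZero Fz p * testField φ ν μ k p))) (slabMeasure ta tb) :=
      (hg.norm.const_mul _).mono' ((hm r).mul hg.1) (Eventually.of_forall (hle r))
    rw [integral_slab_prod htt hi]
    refine intervalIntegral.integral_congr_Ioo_of_le htt fun t ht => integral_congr_ae ?_
    filter_upwards [ae_mem_offLines (Z := fun _ => z)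
      (F.zero_slab (Ioo_subset_Icc_self ht))] with x hx
    exact (F.cutSqD_shift hφ ht hx.2 μ k r).symm

end Fam

/-- A configuration for which the action is stationary satisfies the Maxwell equations. -/
theorem IsStationary.weakMaxwell {m q : Fin N → ℝ} (ht : ta < tb) (hdom : InDomain m q ta tb z A)
    (hst : IsStationary m q ta tb z A) : WeakMaxwell q ta tb z A := by
  intro φ hφ ν
  have hV := isAdmissibleVariation_shiftPotential ht hdom hφ ν
  obtain ⟨δ, H, s, F, hE, hv⟩ := hV.exists_fam_subluminal ht
  obtain ⟨D, hD, h⟩ := F.exists_hasDerivAt_action m q hv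
  have h0 := h.unique (hst _ _ _ hV)
  have hp : ∀ n, _ := fun n => F.integral_eps_particleLagrangian m q (hv n) fun t ht' =>
    F.trajVar_end hE ht' n
  have hvar : ∀ n k, ∫ t in ta..tb, velocity (z n) t k * varAt (1 / 2) ta tb (fun _ => z) δ s k n (0, t) =
      (Pi.single ν 1 : Fin 4 → ℝ) k * ∫ t in ta..tb, velocity (z n) t k * φ (t, z n t) := by
    intro n k
    rw [← intervalIntegral.integral_const_mul]
    refine intervalIntegral.integral_congr_Ioo_of_le ht.le fun t ht' => ?_
    simp only [F.varAt_shift hφ (Ioo_subset_Icc_self ht')]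
    ring
  -- The particles are not displaced in this family, so the force term drops out and only the field
  -- equation remains.
  have hz : ∀ n, ∫ t in ta..tb, ∑ j, trajVar (1 / 2) ta tb (fun _ => z) n (0, t) j *
      forceDefect (1 / 2) ta tb (fun _ => z) δ s m q n j (0, t) = 0 := by
    intro n
    rw [intervalIntegral.integral_congr_Ioo_of_le (g := fun _ => 0) ht.le fun t ht' => ?_]
    · simp
    · refine Finset.sum_eq_zero fun j _ => ?_
      rw [F.trajVar_const (Ioo_subset_Icc_self ht') n, PiLp.zero_apply, zero_mul]
  simp only [hp, hvar, hz, add_zero, Fam.emVariation, fun μ k => F.fieldVariation_shift hφ μ k (hD μ k)]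
    at h0
  have hsw : ∀ μ k l, ∫ p, field A μ k p * partialD l φ p = -∫ p, field A k μ p * partialD l φ p := by
    intro μ k l
    rw [← integral_neg]
    exact congrArg _ (funext fun p => by rw [field_swap, neg_mul])
  have hms : ∀ μ, metric μ * metric μ = 1 := fun μ => by fin_cases μ <;> simp [metric]
  have hem : -(1 / 4) * ∑ μ, ∑ k, metric μ * metric k * (2 * (metric μ * (Pi.single ν 1 : Fin 4 → ℝ) k *
      (∫ p, field A μ k p * partialD μ φ p) - metric k * (Pi.single ν 1 : Fin 4 → ℝ) μ *
        ∫ p, field A μ k p * partialD k φ p)) =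
      -(metric ν * ∑ μ, ∫ p, field A μ ν p * partialD μ φ p) := by
    have e1 : ∀ μ k, metric μ * metric k * (2 * (metric μ * (Pi.single ν 1 : Fin 4 → ℝ) k *
        (∫ p, field A μ k p * partialD μ φ p) - metric k * (Pi.single ν 1 : Fin 4 → ℝ) μ *
        ∫ p, field A μ k p * partialD k φ p)) =
        2 * ((Pi.single ν 1 : Fin 4 → ℝ) k * (metric k * ∫ p, field A μ k p * partialD μ φ p)) +
        2 * ((Pi.single ν 1 : Fin 4 → ℝ) μ * (metric μ * ∫ p, field A k μ p * partialD k φ p)) := by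
      intro μ k
      rw [hsw k μ k]
      linear_combination (2 * (Pi.single ν 1 : Fin 4 → ℝ) k * metric k *
        ∫ p, field A μ k p * partialD μ φ p) * hms μ - (2 * (Pi.single ν 1 : Fin 4 → ℝ) μ * metric μ *
        ∫ p, field A μ k p * partialD k φ p) * hms k
    simp only [e1, Finset.sum_add_distrib]
    rw [Finset.sum_comm (f := fun μ k => 2 * ((Pi.single ν 1 : Fin 4 → ℝ) μ *
      (metric μ * ∫ p, field A k μ p * partialD k φ p)))]
    simp only [← Finset.mul_sum, Pi.single_apply, ite_mul, one_mul, zero_mul, Finset.sum_ite_eq',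
      Finset.mem_univ, if_true]
    ring
  rw [hem] at h0
  simp only [Pi.single_apply, ite_mul, one_mul, zero_mul, mul_ite, mul_zero, Finset.sum_ite_eq',
    Finset.mem_univ, if_true] at h0
  rw [← Finset.mul_sum] at h0
  linear_combination -metric ν * h0 - ((∑ μ, ∫ p, field A μ ν p * partialD μ φ p) -
    ∑ n, q n * ∫ t in ta..tb, velocity (z n) t ν * φ (t, z n t)) * hms ν

end

/-! ### Displacing one particle together with its potential -/

section

variable {N : ℕ} {η ta tb : ℝ} {δ : ℝ} {z : Fin N → ℝ → Space} {A : Spacetime → Fin 4 → ℝ}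
  {ζ : ℝ → Space} {l : Fin N}

/-- The trajectories `z` with `ε ζ` added to that of particle `l`. -/
noncomputable def shiftTrajectory (z : Fin N → ℝ → Space) (l : Fin N) (ζ : ℝ → Space) (ε : ℝ)
    (n : Fin N) (t : ℝ) : Space :=
  z n t + ((Pi.single l 1 : Fin N → ℝ) n * ε) • ζ t

/-- A map of space that is the translation by `-ε ζ` close to particle `l` and the identity far from
it. -/
noncomputable def localShift (z : Fin N → ℝ → Space) (l : Fin N) (δ : ℝ) (ζ : ℝ → Space) (ε : ℝ)
    (p : Spacetime) : Space :=
  p.2 - profile (δ⁻¹ • (p.2 - z l p.1)) • (ε • ζ p.1)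

/-- The potential `A` carried along by the motion of particle `l`. -/
noncomputable def carriedPotential (A : Spacetime → Fin 4 → ℝ) (z : Fin N → ℝ → Space) (l : Fin N)
    (δ : ℝ) (ζ : ℝ → Space) (ε : ℝ) (p : Spacetime) : Fin 4 → ℝ :=
  A (p.1, localShift z l δ ζ ε p)

theorem shiftTrajectory_self (z : Fin N → ℝ → Space) (l : Fin N) (ζ : ℝ → Space) (ε t : ℝ) :
    shiftTrajectory z l ζ ε l t = z l t + ε • ζ t := by
  simp [shiftTrajectory]

theorem shiftTrajectory_of_ne (z : Fin N → ℝ → Space) {n : Fin N} (h : n ≠ l) (ζ : ℝ → Space)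
    (ε t : ℝ) : shiftTrajectory z l ζ ε n t = z n t := by
  simp [shiftTrajectory, h]

theorem localShift_near (hδ : 0 < δ) {ε t : ℝ} {x : Space} (h : ‖x - z l t‖ ≤ δ / 4) :
    localShift z l δ ζ ε (t, x) = x - ε • ζ t := by
  simp only [localShift]
  rw [profile_scaled_eq_one hδ h, one_smul]

theorem localShift_far (hδ : 0 < δ) {ε t : ℝ} {x : Space} (h : δ ≤ ‖x - z l t‖) :
    localShift z l δ ζ ε (t, x) = x := by
  simp only [localShift]
  rw [profile_scaled_eq_zero hδ h, zero_smul, sub_zero]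

theorem norm_sub_localShift_le {ε t : ℝ} {x : Space} (h : ‖ε • ζ t‖ ≤ δ / 16) :
    ‖x - localShift z l δ ζ ε (t, x)‖ ≤ δ / 8 := by
  simp only [localShift, sub_sub_cancel]
  rw [norm_smul]
  have := abs_profile_le (δ⁻¹ • (x - z l t))
  rw [Real.norm_eq_abs]
  nlinarith [norm_nonneg (ε • ζ t), abs_nonneg (profile (δ⁻¹ • (x - z l t)))]

/-- The map moves points by at most `δ / 8`. A point sent to the old position of particle `l` is
hence in the ball of radius `δ / 4`, where the map is a translation, so it is the new position. For
the other particles, their distance of at least `2 δ` puts the point where the map is the identity.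
-/
theorem localShift_ne (hs : SeparatedPoints (Icc ta tb) z δ) {ε t : ℝ} (ht : t ∈ Icc ta tb)
    (h : ‖ε • ζ t‖ ≤ δ / 16) {x : Space} (hx : ∀ n, x ≠ shiftTrajectory z l ζ ε n t) (n : Fin N) :
    localShift z l δ ζ ε (t, x) ≠ z n t := by
  intro heq
  have hδ := hs.pos
  have hle := norm_sub_localShift_le (z := z) (l := l) (x := x) h
  rw [heq] at hle
  by_cases hn : n = l
  · subst hn
    rw [localShift_near hδ (by linarith), sub_eq_iff_eq_add] at heq
    exact hx n (by rw [shiftTrajectory_self, heq])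
  · by_cases hfar : δ ≤ ‖x - z l t‖
    · rw [localShift_far hδ hfar] at heq
      exact hx n (by rw [shiftTrajectory_of_ne z hn, heq])
    · have h2 := hs.sep t ht n l hn
      have h3 : ‖z n t - z l t‖ ≤ ‖x - z l t‖ + ‖x - z n t‖ := by
        rw [show z n t - z l t = (x - z l t) - (x - z n t) by abel]
        exact norm_sub_le _ _
      linarith

/-- In a small ball around each particle, displaced or not, the map is exactly the translation to
the old position. The carried potential thus has the same expansion functions as the original one.
-/
theorem localShift_add (hs : SeparatedPoints (Icc ta tb) z δ) {ε t : ℝ} (ht : t ∈ Icc ta tb)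
    (h : ‖ε • ζ t‖ ≤ δ / 16) {y : Space} (hy : ‖y‖ ≤ δ / 8) (n : Fin N) :
    localShift z l δ ζ ε (t, shiftTrajectory z l ζ ε n t + y) = z n t + y := by
  have hδ := hs.pos
  by_cases hn : n = l
  · subst hn
    rw [shiftTrajectory_self, localShift_near hδ]
    · abel
    · rw [show z n t + ε • ζ t + y - z n t = ε • ζ t + y by abel]
      exact (norm_add_le _ _).trans (by linarith)
  · rw [shiftTrajectory_of_ne z hn, localShift_far hδ]
    have h2 := hs.sep t ht n l hn
    have h3 : ‖z n t - z l t‖ ≤ ‖z n t + y - z l t‖ + ‖y‖ := by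
      rw [show z n t - z l t = (z n t + y - z l t) - y by abel]
      exact norm_sub_le _ _
    linarith

theorem contDiffOn_localShift (hs : SeparatedPoints (Icc ta tb) z δ) (hζ : ContDiff ℝ ∞ ζ)
    {S : Set ((ℝ × ℝ) × Space)} (hS : ∀ x ∈ S, x.1.2 ∈ Icc ta tb) :
    ContDiffOn ℝ ∞ (fun x : (ℝ × ℝ) × Space => localShift z l δ ζ x.1.1 (x.1.2, x.2)) S := by
  have hzl : ContDiffOn ℝ ∞ (fun x : (ℝ × ℝ) × Space => z l x.1.2) S :=
    (hs.smooth l).comp (contDiff_snd.comp contDiff_fst).contDiffOn hS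
  have h1 : ContDiff ℝ ∞ fun x : (ℝ × ℝ) × Space => x.1.1 • ζ x.1.2 :=
    (contDiff_fst.comp contDiff_fst).smul (hζ.comp (contDiff_snd.comp contDiff_fst))
  have h2 : ContDiffOn ℝ ∞ (fun x : (ℝ × ℝ) × Space => x.2) S := contDiff_snd.contDiffOn
  have h3 : ContDiffOn ℝ ∞ (fun x : (ℝ × ℝ) × Space => δ⁻¹ • (x.2 - z l x.1.2)) S :=
    (h2.sub hzl).const_smul δ⁻¹
  have h4 : ContDiffOn ℝ ∞ (fun x : (ℝ × ℝ) × Space => profile (δ⁻¹ • (x.2 - z l x.1.2))) S :=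
    profile_contDiff.comp_contDiffOn h3
  exact h2.sub (h4.smul h1.contDiffOn)

theorem pointSingular_carried (hA : PointSingular (Icc ta tb) z A)
    (hs : SeparatedPoints (Icc ta tb) z δ) (hζ : ContDiff ℝ ∞ ζ) {V : Set ℝ}
    (hV : ∀ ε ∈ V, ∀ t, ‖ε • ζ t‖ ≤ δ / 16) :
    PointSingular (V ×ˢ Icc ta tb) (famZ (shiftTrajectory z l ζ))
      (famB (carriedPotential A z l δ ζ)) := by
  have hδ := hs.pos
  have hz : ∀ n, ContDiffOn ℝ ∞ (fun p : ℝ × ℝ => z n p.2) (V ×ˢ Icc ta tb) := fun n =>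
    (hs.smooth n).comp contDiffOn_snd fun p hp => hp.2
  refine ⟨fun n => (hz n).add (ContDiff.contDiffOn (by fun_prop)), fun p hp n k hnk => ?_, ?_,
    fun n => ?_⟩
  -- The map sends the new positions to the old ones, so distinct old positions have distinct new
  -- ones.
  · have h0 : ‖(0 : Space)‖ ≤ δ / 8 := by rw [norm_zero]; positivity
    have e := fun n => localShift_add (l := l) hs hp.2 (hV p.1 hp.1 p.2) h0 n
    simp only [add_zero] at e
    exact hA.distinct p.2 hp.2 (show z n p.2 = z k p.2 by
      rw [← e n, ← e k]; exact congrArg (fun w => localShift z l δ ζ p.1 (p.2, w)) hnk)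
  · exact hA.smooth_off.comp ((contDiff_snd.comp contDiff_fst).contDiffOn.prodMk
      (contDiffOn_localShift hs hζ (fun x hx => hx.1.2))) fun x hx =>
        ⟨hx.1.2, localShift_ne hs hx.1.2 (hV _ hx.1.1 _) hx.2⟩
  · obtain ⟨d, hd, h, s, hh, hs', hpar, heq⟩ := hA.near n
    have hsub : Ioo (-(min d (δ / 8))) (min d (δ / 8)) ⊆ Ioo (-d) d := fun ρ hρ =>
      ⟨by linarith [hρ.1, min_le_left d (δ / 8)], hρ.2.trans_le (min_le_left _ _)⟩
    refine ⟨min d (δ / 8), by positivity, fun x => h (x.1.2, x.2), fun x => s (x.1.2, x.2), ?_, ?_,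
      fun p hp ρ hρ => hpar p.2 hp.2 ρ (hsub hρ), fun p hp ρ hρ θ hθ => ?_⟩
    · exact hh.comp (ContDiff.contDiffOn (by fun_prop)) fun x hx =>
        ⟨hx.1.2, hsub hx.2.1, hx.2.2⟩
    · exact hs'.comp (ContDiff.contDiffOn (by fun_prop)) fun x hx =>
        ⟨hx.1.2, Metric.ball_subset_ball (min_le_left _ _) hx.2⟩
    · have hy : ‖ρ • θ‖ ≤ δ / 8 := by
        rw [norm_smul, hθ, mul_one, Real.norm_of_nonneg hρ.1.le]
        exact hρ.2.le.trans (min_le_right _ _)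
      refine Eq.trans ?_ (heq p.2 hp.2 ρ ⟨hρ.1, hρ.2.trans_le (min_le_left _ _)⟩ θ hθ)
      exact congrArg (fun w => A (p.2, w)) (localShift_add hs hp.2 (hV p.1 hp.1 p.2) hy n)

theorem exists_isAdmissibleVariation_carried {m q : Fin N → ℝ} (ht : ta < tb)
    (hdom : InDomain m q ta tb z A) (l : Fin N) (hζ : ContDiff ℝ ∞ ζ) (hc : HasCompactSupport ζ)
    (h0 : ∀ t, t = ta ∨ t = tb → ζ t = 0) :
    ∃ η δ, IsAdmissibleVariation m q ta tb z A η (shiftTrajectory z l ζ)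
      (carriedPotential A z l δ ζ) := by
  obtain ⟨δ, -, -, hs, -⟩ := hdom.singular.exists_expansion isCompact_Icc (uniqueDiffOn_Icc ht)
  obtain ⟨M₁, hM₁⟩ := hζ.continuous.bounded_above_of_compact_support hc
  obtain ⟨M₂, hM₂⟩ := (hζ.continuous_deriv (by simp)).bounded_above_of_compact_support hc.deriv
  have hvc : ContinuousOn (fun t => ‖derivWithin (z l) (Icc ta tb) t‖) (Icc ta tb) :=
    ((hs.smooth l).continuousOn_derivWithin (uniqueDiffOn_Icc ht) (by simp)).norm
  obtain ⟨τ, hτ, hmax⟩ := isCompact_Icc.exists_isMaxOn (nonempty_Icc.2 ht.le) hvc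
  have hκ := hdom.subluminal l τ hτ
  set κ := 1 - ‖derivWithin (z l) (Icc ta tb) τ‖ with hκd
  have hκ0 : 0 < κ := by linarith
  have hδ := hs.pos
  set M := |M₁| + |M₂| + 1 with hM
  have hM0 : 0 < M := by positivity
  -- `M` bounds the displacement profile and its derivative. The value `δ / 16` keeps the
  -- displacement within the region of the previous lemmas, and `κ / 2` is half the smallest gap
  -- between the speed of particle `l` and that of light.
  set η := min (δ / 16) (κ / 2) / M with hη
  have hη0 : 0 < η := by positivity
  have hsmall : ∀ ε ∈ Ioo (-η) η, ∀ w : Space, ‖w‖ ≤ M → ‖ε • w‖ ≤ min (δ / 16) (κ / 2) := by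
    intro ε hε w hw
    rw [norm_smul, Real.norm_eq_abs]
    calc |ε| * ‖w‖ ≤ η * M := mul_le_mul (abs_lt.2 hε).le hw (norm_nonneg _) hη0.le
      _ = _ := div_mul_cancel₀ _ hM0.ne'
  have hsm1 : ∀ ε ∈ Ioo (-η) η, ∀ t, ‖ε • ζ t‖ ≤ δ / 16 := fun ε hε t =>
    (hsmall ε hε _ ((hM₁ t).trans (by linarith [le_abs_self M₁, abs_nonneg M₂]))).trans (min_le_left _ _)
  obtain ⟨R, hR⟩ := isCompact_Icc.exists_bound_of_continuousOn (hs.continuousOn l)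
  refine ⟨η, δ, isAdmissibleVariation_of_local ht hdom hη0 ?_ ?_
    (pointSingular_carried hdom.singular hs hζ hsm1) ⟨R + δ, fun ε _ t htI x hx => ?_⟩ ?_ ?_ ?_⟩
  · funext n t
    simp [shiftTrajectory]
  · funext p
    simp [carriedPotential, localShift]
  · rw [carriedPotential, localShift_far hδ]
    have := norm_sub_norm_le x (z l t)
    linarith [hR t htI]
  · intro ε _ t htt n
    simp [shiftTrajectory, h0 t htt]
  · intro ε _ t htt x
    simp [carriedPotential, localShift, h0 t htt]
  · intro ε hε n t htI
    have hd : HasDerivWithinAt (shiftTrajectory z l ζ ε n) (derivWithin (z n) (Icc ta tb) t +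
        ((Pi.single l 1 : Fin N → ℝ) n * ε) • deriv ζ t) (Icc ta tb) t :=
      (((hs.smooth n).differentiableOn (by simp) t htI).hasDerivWithinAt).fun_add
        (((hζ.differentiable (by simp) t).hasDerivAt.hasDerivWithinAt).fun_const_smul _)
    rw [hd.derivWithin (uniqueDiffOn_Icc ht t htI)]
    by_cases hn : n = l
    · subst hn
      rw [Pi.single_eq_same, one_mul]
      have h1 := hsmall ε hε (deriv ζ t) ((hM₂ t).trans (by linarith [le_abs_self M₂, abs_nonneg M₁]))
      have h2 : ‖derivWithin (z n) (Icc ta tb) t‖ ≤ 1 - κ := by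
        rw [hκd, sub_sub_cancel]; exact hmax htI
      have h3 := norm_add_le (derivWithin (z n) (Icc ta tb) t) (ε • deriv ζ t)
      linarith [min_le_right (δ / 16) (κ / 2)]
    · rw [Pi.single_eq_of_ne hn, zero_mul, zero_smul, add_zero]
      exact hdom.subluminal n t htI

end

/-! ### The Lorentz-Dirac equation from stationarity -/

section

variable {N : ℕ} {η ta tb : ℝ} {Z : ℝ → Fin N → ℝ → Space} {B : ℝ → Spacetime → Fin 4 → ℝ} {δ : ℝ}
  {H : Fin 4 → Fin N → (ℝ × ℝ) × (ℝ × Space) → ℝ} {s : Fin 4 → Fin N → (ℝ × ℝ) × Space → ℝ}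
  {z : Fin N → ℝ → Space} {A : Spacetime → Fin 4 → ℝ} {m q : Fin N → ℝ}

/-- The amount by which the spatial part of the Lorentz-Dirac equation fails for a configuration. -/
noncomputable def lorentzDefect (m q : Fin N → ℝ) (z : Fin N → ℝ → Space) (A : Spacetime → Fin 4 → ℝ)
    (n : Fin N) (j : Fin 3) (t : ℝ) : ℝ :=
  -(m n * deriv (fun τ => fourVelocity (z n) τ j.succ) t) + q n * ∑ ν, metric ν * velocity (z n) t ν *
    rLim (sphereAverage (fun x => field A j.succ ν (t, x)) (z n t))

namespace Fam

open FamBase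

/-- `forceDefect` refers to the expansion chosen for a family, while `lorentzDefect` depends on the
configuration only. This permits a comparison of different families through the same configuration.
-/
theorem forceDefect_eq (F : Fam η ta tb Z B δ H s) {n : Fin N}
    (hv : ∀ p ∈ slab η ta tb, ‖famVel η ta tb Z n p‖ < 1) {t : ℝ} (ht : t ∈ Ioo ta tb) (j : Fin 3) :
    forceDefect η ta tb Z δ s m q n j (0, t) = lorentzDefect m q (Z 0) (B 0) n j t := by
  rw [forceDefect, lorentzDefect, (F.hasDerivAt_fourVelocity_succ hv ht j).deriv]
  simp only [F.velocity_eq ht, (F.hasRLim_field F.zero_mem ht n j.succ _).rLim_eq]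

/-- Fundamental lemma of the calculus of variations: the defect vanishes almost everywhere, and it
is continuous on the open interval. -/
theorem forceDefect_eq_zero (F : Fam η ta tb Z B δ H s) {n : Fin N}
    (hv : ∀ p ∈ slab η ta tb, ‖famVel η ta tb Z n p‖ < 1) {j : Fin 3}
    (h : ∀ g : ℝ → ℝ, ContDiff ℝ ∞ g → HasCompactSupport g → tsupport g ⊆ Ioo ta tb →
      ∫ t in ta..tb, g t * lorentzDefect m q (Z 0) (B 0) n j t = 0) :
    ∀ t ∈ Ioo ta tb, forceDefect η ta tb Z δ s m q n j (0, t) = 0 := by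
  have hc := (F.timeSlice (F.continuousOn_forceDefect m q hv j)).mono Ioo_subset_Icc_self
  refine Measure.eqOn_open_of_ae_eq (μ := volume) ?_ isOpen_Ioo hc continuousOn_const
  rw [Filter.EventuallyEq, ae_restrict_iff' measurableSet_Ioo]
  refine isOpen_Ioo.ae_eq_zero_of_integral_contDiff_smul_eq_zero
    (hc.locallyIntegrableOn measurableSet_Ioo) fun g hg hgc hgs => ?_
  refine Eq.trans ?_ (h g hg hgc hgs)
  rw [intervalIntegral.integral_of_le F.time_lt.le, integral_Ioc_eq_integral_Ioo,
    ← setIntegral_eq_integral_of_forall_compl_eq_zero (s := Ioo ta tb) fun t ht => by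
      rw [image_eq_zero_of_notMem_tsupport fun h => ht (hgs h), zero_smul]]
  refine setIntegral_congr_fun measurableSet_Ioo fun t ht => ?_
  simp only [smul_eq_mul, F.forceDefect_eq hv ht]

end Fam

theorem isTest_zero (ta tb : ℝ) : IsTest ta tb fun _ => 0 where
  smooth := contDiff_const
  compact := HasCompactSupport.zero
  support := by
    rw [show (fun _ : Spacetime => (0 : ℝ)) = 0 from rfl, tsupport_zero]
    exact empty_subset _

/-- Stationarity already implies the weak Maxwell equations, so the formula for the first variation
applies to the carried family. The displacement is `g` in direction `j` for particle `l` and zero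
for the others, which singles out one component of one defect. -/
theorem IsStationary.integral_lorentzDefect (ht : ta < tb) (hdom : InDomain m q ta tb z A)
    (hst : IsStationary m q ta tb z A) (l : Fin N) (j : Fin 3) {g : ℝ → ℝ} (hg : ContDiff ℝ ∞ g)
    (hgc : HasCompactSupport g) (hgs : tsupport g ⊆ Ioo ta tb) :
    ∫ t in ta..tb, g t * lorentzDefect m q z A l j t = 0 := by
  set ζ : ℝ → Space := fun t => g t • EuclideanSpace.single j 1 with hζ
  have hζs : ContDiff ℝ ∞ ζ := hg.smul contDiff_const
  have h0 : ∀ t, t = ta ∨ t = tb → ζ t = 0 := by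
    intro t htt
    have : t ∉ tsupport g := fun h => by
      rcases htt with rfl | rfl
      · exact lt_irrefl _ (hgs h).1
      · exact lt_irrefl _ (hgs h).2
    simp [hζ, image_eq_zero_of_notMem_tsupport this]
  obtain ⟨η, δ', hV⟩ := exists_isAdmissibleVariation_carried ht hdom l hζs hgc.smul_right h0
  obtain ⟨δ, H, s, F, hE, hv⟩ := hV.exists_fam_subluminal ht
  have hw : WeakMaxwell q ta tb (shiftTrajectory z l ζ 0) (carriedPotential A z l δ' ζ 0) := by
    rw [hV.trajectory_zero, hV.potential_zero]
    exact hst.weakMaxwell ht hdom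
  have h := (F.hasDerivAt_action m hv hw hE).unique (hst _ _ _ hV)
  have htraj : ∀ t ∈ Ioo ta tb, ∀ n, trajVar (η / 2) ta tb (shiftTrajectory z l ζ) n (0, t) =
      (Pi.single l 1 : Fin N → ℝ) n • ζ t := by
    intro t ht' n
    refine (F.hasDerivAt_eps_traj (Ioo_subset_Icc_self ht') n).unique ?_
    simpa [shiftTrajectory] using ((((hasDerivAt_id (0 : ℝ)).const_mul
      ((Pi.single l 1 : Fin N → ℝ) n)).smul_const (ζ t)).const_add (z n t))
  rw [Finset.sum_eq_single l (fun n _ hn => ?_) (by simp)] at h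
  · refine Eq.trans ?_ h
    refine intervalIntegral.integral_congr_Ioo_of_le ht.le fun t ht' => ?_
    have hf := fun i => F.forceDefect_eq (m := m) (q := q) (hv l) ht' i
    rw [hV.trajectory_zero, hV.potential_zero] at hf
    beta_reduce
    rw [Finset.sum_congr rfl fun i _ => by rw [htraj t ht', hf], Finset.sum_eq_single j]
    · simp [hζ]
    · intro i _ hi
      simp [hζ, hi]
    · simp
  · rw [intervalIntegral.integral_congr_Ioo_of_le (g := fun _ => 0) ht.le fun t ht' => ?_]
    · simp
    · refine Finset.sum_eq_zero fun i _ => ?_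
      rw [htraj t ht', Pi.single_eq_of_ne hn, zero_smul, PiLp.zero_apply, zero_mul]

theorem IsStationary.equationsOfMotion (ht : ta < tb) (hdom : InDomain m q ta tb z A)
    (hst : IsStationary m q ta tb z A) : EquationsOfMotion m q ta tb z A := by
  -- The zero test function gives the constant family, whose only role is to provide expansions of
  -- the given configuration.
  have hV := isAdmissibleVariation_shiftPotential ht hdom (isTest_zero ta tb) 0
  obtain ⟨δ, H, s, F, -, hv⟩ := hV.exists_fam_subluminal ht
  have hM := F.maxwell_iff q
  have hL := F.lorentzDirac_iff m q hv
  simp only [hV.potential_zero] at hM hL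
  refine ⟨hM.2 (hst.weakMaxwell ht hdom), hL.2 fun n t ht' j =>
    F.forceDefect_eq_zero (hv n) (fun g hg hgc hgs => ?_) t ht'⟩
  simp only [hV.potential_zero]
  exact hst.integral_lorentzDefect ht hdom n j hg hgc hgs

end

end PointCharges

theorem theorem3 {N : ℕ} (m q : Fin N → ℝ) (t₁ t₂ : ℝ) (ht : t₁ < t₂)
    (z : Fin N → ℝ → PointCharges.Space) (A : PointCharges.Spacetime → Fin 4 → ℝ)
    (hdom : PointCharges.InDomain m q t₁ t₂ z A) :
    PointCharges.EquationsOfMotion m q t₁ t₂ z A ↔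
      PointCharges.IsStationary m q t₁ t₂ z A :=
  ⟨fun h => h.isStationary ht, fun h => h.equationsOfMotion ht hdom⟩
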